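/- **Setting.** Let $V$ be a real polynomial of even degree $m\ge 2$ with positive leading coefficient, write $V'(z)=\sum_{k=1}^m v_k z^{k-1}$, and let $a>0$, $\alpha\in(0,1)$. For $\vec n=(n_1,n_2)\in\mathbb{N}^2$ put $|\vec n|=n_1+n_2$, and let $A=\operatorname{diag}(a,\dots,a,-a,\dots,-a)$ with $n_1$ entries $a$ and $n_2$ entries $-a$. For $t>0$ let $$P_{\vec n}^{[t]}(z)=\mathbb{E}\det(zI-M),$$ where $M$ is a random $|\vec n|\times|\vec n|$ Hermitian matrix with density proportional to $e^{-t\operatorname{tr}(V(M)-AM)}$ with respect to Lebesgue measure, and let $\pi_{\vec n}=P_{\vec n}^{[|\vec n|]}$. Let $(\vec n_N)_{N\ge 0}$ be an up-right path with slope $\alpha$: $\vec n_N=(n_{N,1},n_{N,2})\in\mathbb{N}^2$, $|\vec n_N|=N$, each difference $\vec n_{N+1}-\vec n_N$ is $(1,0)$ or $(0,1)$, $n_{N,1}/N\to\alpha$, and for a certain $d\ge2$ one has $n_{N+d,j}\ge n_{N,j}+1$ for all $N$ and $j=1,2$. Put $\kappa=\max\{m-2,d\}$ and $\widetilde\pi_{\vec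 n_N}=P_{\vec n_N}^{[N-\kappa]}$ for $N>\kappa$. *Finite $N$ spectral curve.* Let $\vec n=(n_1,n_2)$ with $n_1,n_2\ge1$ and $N=|\vec n|$. For a multi-index $\vec k$ let $P_{\vec k}^{(N)}$ be the monic polynomial of degree $|\vec k|$ with $\int_{\mathbb R} P_{\vec k}^{(N)}(x)x^l e^{-N(V(x)\mp ax)}dx=0$ for $0\le l<k_1$ (upper sign) and for $0\le l<k_2$ (lower sign). Let $T(z)$, $z\in\mathbb{C}\setminus\mathbb{R}$, be the $3\times3$ matrix whose rows are $$\Big(P(z)e^{-NV(z)},\ e^{-Naz}\int_{\mathbb R}\frac{P(x)e^{-N(V(x)-ax)}}{x-z}dx,\ e^{Naz}\int_{\mathbb R}\frac{P(x)e^{-N(V(x)+ax)}}{x-z}dx\Big)$$ for $P=P^{(N)}_{\vec n},\,P^{(N)}_{\vec n-(1,0)},\,P^{(N)}_{\vec n-(0,1)}$. The matrix $R_{\vec n}$ is the $3\times 3$ matrix with polynomial entries such that $T'(z)=N R_{\vec n}(z)T(z)$ on $\mathbb{C}\setminus\mathbb{R}$, and the finite $N$ spectral curve is $\det(\xi I+R_{\vec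 n}(z))=0$. *Admissible spectral curve.* For a measure $\nu$ let $C^\nu(z)=\lim_{\varepsilon\to0+}\int_{|z-s|>\varepsilon}\frac{d\nu(s)}{s-z}$. An admissible spectral curve associated with $V,a,\alpha$ is an equation $F(\xi,z)=\xi^3+p_2(z)\xi^2+p_1(z)\xi+p_0(z)=0$ with real polynomials $p_0,p_1,p_2$, such that $F$ is irreducible over $\mathbb{C}$, $p_2=-V'$, $\deg p_1\le m-2$, $$p_0(z)=v_ma^2z^{m-1}+\big(v_{m-1}a^2+v_ma(2\alpha-1)\big)z^{m-2}+\text{lower degree terms},$$ and there is a probability measure $\nu$ on $\mathbb{R}$ for which $F(C^\nu(z)+V'(z),z)=0$ for all $z\in\mathbb{C}\setminus\mathbb{R}$. **Theorem E.** Suppose that all zeros of all the polynomials $\widetilde\pi_{\vec n_N}$, $N>\kappa$, lie in one compact subset of $\mathbb{C}$. Then: 1. The zeros of all the polynomials $\pi_{\vec n_N}$ lie in one compact subset of $\mathbb{C}$. 2. For all $N$ with $n_{N,1},n_{N,2}\ge1$ the matrix $R_{\vec n_N}$ exists and is unique. 3. Let $\lambda$ be a weak-* limit, along a subsequence $(\vec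 n_{N_k})$, of the normalized zero counting measures of $\pi_{\vec n_{N_k}}$. Then $\lambda$ is a probability measure on $\mathbb{R}$, and there is an admissible spectral curve $F(\xi,z)=0$ associated with $V,a,\alpha$ such that $F(C^\lambda(z)+V'(z),z)=0$ for all $z\in\mathbb{C}\setminus\operatorname{supp}\lambda$. Moreover, along some further subsequence of $(\vec n_{N_k})$, $\det(\xi I+R_{\vec n_N}(z))$ converges to $F(\xi,z)$ locally uniformly in $(\xi,z)\in\mathbb{C}^2$. -/

import Mathlib

open Polynomial MeasureTheory Filter Topology

noncomputable section

namespace ExternalSource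

/-! ### Up-right paths -/

/-- An up-right path of multi-indices `n 0, n 1, n 2, …` with slope `α`, every `d` consecutive
steps of which contain at least one step in each of the two directions. -/
structure IsUpRightPath (n : ℕ → ℕ × ℕ) (α : ℝ) (d : ℕ) : Prop where
  size : ∀ k, (n k).1 + (n k).2 = k
  step : ∀ k, n (k + 1) = n k + (1, 0) ∨ n (k + 1) = n k + (0, 1)
  slope : Tendsto (fun k : ℕ => ((n k).1 : ℝ) / k) atTop (𝓝 α)
  two_le : 2 ≤ d
  fst_advance : ∀ k, (n k).1 + 1 ≤ (n (k + d)).1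
  snd_advance : ∀ k, (n k).2 + 1 ≤ (n (k + d)).2

/-! ### The Hermitian matrix model with external source -/

/-- The Hermitian matrix with real coordinates `x`: diagonal entries `x i i`, and for `i < j` the
entry in position `(i, j)` has real part `x i j` and imaginary part `x j i`. This identifies
`ℝ^(M²)` with the space of `M × M` Hermitian matrices. -/
def hermitian {M : ℕ} (x : Fin M → Fin M → ℝ) : Matrix (Fin M) (Fin M) ℂ :=
  Matrix.of fun i j =>
    if i = j then (x i i : ℂ)
    else if i < j then (x i j : ℂ) + (x j i : ℂ) * Complex.I
    else (x j i : ℂ) - (x i j : ℂ) * Complex.I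

/-- The external source `diag(a, …, a, -a, …, -a)`, with `k.1` entries `a` and `k.2` entries
`-a`. -/
def source (a : ℝ) (k : ℕ × ℕ) : Matrix (Fin (k.1 + k.2)) (Fin (k.1 + k.2)) ℂ :=
  Matrix.diagonal fun i => if (i : ℕ) < k.1 then (a : ℂ) else -(a : ℂ)

/-- The unnormalized density `exp (-t tr (V(M) - A M))` on Hermitian matrices (the trace is
real). -/
def density (V : ℝ[X]) (a : ℝ) (k : ℕ × ℕ) (t : ℝ)
    (x : Fin (k.1 + k.2) → Fin (k.1 + k.2) → ℝ) : ℝ :=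
  Real.exp (-t * (Matrix.trace (aeval (hermitian x) V - source a k * hermitian x)).re)

/-- Expectation with respect to the probability measure `Z⁻¹ exp (-t tr (V(M) - A M)) dM`. -/
def expectation (V : ℝ[X]) (a : ℝ) (k : ℕ × ℕ) (t : ℝ)
    (f : Matrix (Fin (k.1 + k.2)) (Fin (k.1 + k.2)) ℂ → ℂ) : ℂ :=
  (∫ x, f (hermitian x) * (density V a k t x : ℂ)) / (∫ x, density V a k t x : ℝ)

/-- The average characteristic polynomial `E det (z I - M)`, as a polynomial in `z`. The matrices
have size `k.1 + k.2`; the parameter `t` is the factor in the exponent of the density. -/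
def avgCharPoly (V : ℝ[X]) (a : ℝ) (k : ℕ × ℕ) (t : ℝ) : ℂ[X] :=
  ∑ i ∈ Finset.range (k.1 + k.2 + 1),
    monomial i (expectation V a k t fun M => M.charpoly.coeff i)

/-! ### Measures -/

/-- The normalized zero counting measure of a polynomial. -/
def zeroMeasure (q : ℂ[X]) : Measure ℂ :=
  (q.natDegree : ENNReal)⁻¹ • (q.roots.map Measure.dirac).sum

/-- Weak-* convergence of a sequence of measures on `ℂ`. -/
def WeakStarTendsto (μ : ℕ → Measure ℂ) (ν : Measure ℂ) : Prop :=
  ∀ f : ℂ → ℝ, Continuous f → HasCompactSupport f →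
    Tendsto (fun k => ∫ s, f s ∂(μ k)) atTop (𝓝 (∫ s, f s ∂ν))

/-- The Cauchy transform `C^ν(z) = lim_{ε → 0+} ∫_{|z - s| > ε} dν(s) / (s - z)`. -/
def cauchyTransform (ν : Measure ℂ) (z : ℂ) : ℂ :=
  limUnder (𝓝[>] (0 : ℝ)) fun ε => ∫ s in {s : ℂ | ε < ‖z - s‖}, (s - z)⁻¹ ∂ν

/-! ### Spectral curves -/

/-- The value at `(ξ, z)` of `F(ξ, z) = ξ³ + p₂(z) ξ² + p₁(z) ξ + p₀(z)`. -/
def curveEval (p₂ p₁ p₀ : ℝ[X]) (ξ z : ℂ) : ℂ :=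
  ξ ^ 3 + aeval z p₂ * ξ ^ 2 + aeval z p₁ * ξ + aeval z p₀

/-- The polynomial `F`, as a polynomial in `ξ` whose coefficients are polynomials in `z`. -/
def curvePoly (p₂ p₁ p₀ : ℝ[X]) : ℂ[X][X] :=
  X ^ 3 + C (p₂.map (algebraMap ℝ ℂ)) * X ^ 2 + C (p₁.map (algebraMap ℝ ℂ)) * X
    + C (p₀.map (algebraMap ℝ ℂ))

/-- `ξ(z) = C^ν(z) + V'(z)`. -/
def xi (V : ℝ[X]) (ν : Measure ℂ) (z : ℂ) : ℂ :=
  cauchyTransform ν z + aeval z (derivative V)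

/-- Admissible spectral curves associated with `V`, `a`, `α`. Writing `V' = ∑ v_k z^(k-1)` and
`m = deg V`, we have `v_m = V'.coeff (m - 1)` and `v_{m-1} = V'.coeff (m - 2)`. -/
structure IsAdmissibleCurve (V : ℝ[X]) (a α : ℝ) (p₂ p₁ p₀ : ℝ[X]) : Prop where
  irreducible : Irreducible (curvePoly p₂ p₁ p₀)
  p₂_eq : p₂ = -derivative V
  p₁_deg : p₁.natDegree ≤ V.natDegree - 2
  p₀_deg : p₀.natDegree ≤ V.natDegree - 1
  p₀_lead : p₀.coeff (V.natDegree - 1) = (derivative V).coeff (V.natDegree - 1) * a ^ 2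
  p₀_next : p₀.coeff (V.natDegree - 2) =
    (derivative V).coeff (V.natDegree - 2) * a ^ 2
      + (derivative V).coeff (V.natDegree - 1) * a * (2 * α - 1)
  exists_measure : ∃ ν : Measure ℂ, IsProbabilityMeasure ν ∧ ν {s : ℂ | s.im ≠ 0} = 0 ∧
    ∀ z : ℂ, z.im ≠ 0 → curveEval p₂ p₁ p₀ (xi V ν z) z = 0

/-! ### Multiple orthogonal polynomials and the finite `N` spectral curve -/

/-- The weight `exp (-t (V(x) - b x))`; the two weights of the model have `b = a` and `b = -a`. -/
def weight (V : ℝ[X]) (b t x : ℝ) : ℝ := Real.exp (-t * (V.eval x - b * x))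

/-- `P` is the (monic, type II) multiple orthogonal polynomial with multi-index `k`. -/
structure IsMOP (V : ℝ[X]) (a t : ℝ) (k : ℕ × ℕ) (P : ℝ[X]) : Prop where
  monic : P.Monic
  degree : P.natDegree = k.1 + k.2
  orth_fst : ∀ l < k.1, ∫ x : ℝ, P.eval x * x ^ l * weight V a t x = 0
  orth_snd : ∀ l < k.2, ∫ x : ℝ, P.eval x * x ^ l * weight V (-a) t x = 0

/-- The weighted Cauchy transform `∫ P(x) exp (-t (V(x) - b x)) / (x - z) dx`. -/
def weightedCauchy (V : ℝ[X]) (b t : ℝ) (P : ℝ[X]) (z : ℂ) : ℂ :=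
  ∫ x : ℝ, ((P.eval x * weight V b t x : ℝ) : ℂ) / ((x : ℂ) - z)

/-- The `3 × 3` matrix `T(z)`. For `P = (P_n, P_{n-e₁}, P_{n-e₂})` and `t = |n|` its first column is
the vector of wave functions, and the other two columns are the associated functions of the second
kind. It is the solution `Y` of the Riemann-Hilbert problem of the multiple orthogonal
polynomials, multiplied by `diag (exp (-tV), exp (-taz), exp (taz))` on the right, up to
constant invertible diagonal factors on the left and on the right; these change the
matrix `T' T⁻¹` only by a constant conjugation. -/
def waveMatrix (V : ℝ[X]) (a t : ℝ) (P : Fin 3 → ℝ[X]) (z : ℂ) : Matrix (Fin 3) (Fin 3) ℂ :=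
  Matrix.of fun i =>
    ![aeval z (P i) * Complex.exp (-(t : ℂ) * aeval z V),
      weightedCauchy V a t (P i) z * Complex.exp (-(t : ℂ) * (a : ℂ) * z),
      weightedCauchy V (-a) t (P i) z * Complex.exp ((t : ℂ) * (a : ℂ) * z)]

/-- The value at `z` of a matrix with polynomial entries. -/
def matEval (R : Matrix (Fin 3) (Fin 3) ℂ[X]) (z : ℂ) : Matrix (Fin 3) (Fin 3) ℂ :=
  R.map (eval z)

/-- `R` is the polynomial coefficient matrix `R_n` in the differential equation `T' = N R T` for
the wave functions and functions of the second kind, with `N = |n|`. -/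
def IsCoeffMatrix (V : ℝ[X]) (a : ℝ) (n : ℕ × ℕ) (R : Matrix (Fin 3) (Fin 3) ℂ[X]) : Prop :=
  ∃ P : Fin 3 → ℝ[X],
    IsMOP V a ((n.1 + n.2 : ℕ) : ℝ) n (P 0) ∧
    IsMOP V a ((n.1 + n.2 : ℕ) : ℝ) (n.1 - 1, n.2) (P 1) ∧
    IsMOP V a ((n.1 + n.2 : ℕ) : ℝ) (n.1, n.2 - 1) (P 2) ∧
    ∀ z : ℂ, z.im ≠ 0 → ∀ i j,
      HasDerivAt (fun w => waveMatrix V a ((n.1 + n.2 : ℕ) : ℝ) P w i j)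
        (((n.1 + n.2 : ℕ) : ℂ) *
          (matEval R z * waveMatrix V a ((n.1 + n.2 : ℕ) : ℝ) P z) i j) z

/-- The finite `N` spectral curve `det (ξ I + R(z))`. -/
def finiteCurve (R : Matrix (Fin 3) (Fin 3) ℂ[X]) (ξ z : ℂ) : ℂ :=
  (ξ • (1 : Matrix (Fin 3) (Fin 3) ℂ) + matEval R z).det

end ExternalSource

end

/-!
The average characteristic polynomial with external source is a type II multiple orthogonal
polynomial (`avgCharPoly_eq`). The proof peels off one row and column of the matrix at a time: the
rotation invariance of the border leaves only its radial parameters, which are coordinates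
equivalent to the eigenvalues of the larger matrix, and the eigenvalues of the corner are
integrated out between them. By induction (`exists_radial_system`) the joint eigenvalue density is
a Vandermonde determinant times the determinant of a basis of solutions of `∏ (D - b i) f = 0`,
and the formula of Heine turns averages of `∏ (X - l j)` into determinants of moments.

Exponential polynomials `q₁ + q₂ exp (c x)` form a Chebyshev system. Hence the zeros of the
multiple orthogonal polynomials are real and simple, neighbours interlace, and their quotient is
the Stieltjes transform of a probability measure (`exists_stieltjes`). So for fixed `t` a bound on
the zeros passes to all smaller indices (`rootsIn_mop_of_le`). The hypothesis bounds the zeros for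
the index `n_{N+κ}` with parameter `N`; this gives the compactness of the zeros for the index
`n_N`.

Differentiation of the wave functions acts on the polynomials as `P ↦ P' / t - V' P`, which keeps
the orthogonality conditions and raises the degree by `m - 1`. The image is expanded along the
chain `n - (1, 1)`, `n - (1, 0)`, `n`, `n_{N+1}`, …, `n_{N+m-2}`, with coefficients bounded
uniformly by the maximum principle outside a circle of radius `3 r` (`exists_expansion`); bounded
recurrences (`bddSpan_triple_step`) bring this back to the first three polynomials. The resulting
matrices have polynomial entries of bounded degree and bounded coefficients
(`exists_bddPoly_matrix`) and are conjugate by a constant matrix to the coefficient matrix `R`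
(`exists_isCoeffMatrix`). Since the normalized wave functions have an invertible limit along the
imaginary axis, `R` is unique (`coeffMatrix_unique`), and the leading coefficients of its
characteristic polynomial are explicit (`coeffMatrix_invariants`).

By the first column of the system, `N⁻¹` times the logarithmic derivative of `P e^{-NV}` is an
eigenvalue of `R` up to an error `O(1 / N)` (`det_eq_of_wave`). Compactness of the bounded
polynomial matrices (`exists_polyTendsto`) and weak convergence of the zero counting measures
(`limit_zeroMeasure`) therefore give a limit curve which `C^λ + V'` satisfies
(`exists_limit_curve`). It is irreducible: by Gauss a factor would give a root polynomial in `z`,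
and comparison of degrees (`curve_no_root`) leaves only constant roots `± a`, which occur for
slope `0` or `1` only.
-/

noncomputable section

namespace ExternalSource

/-! ### Exponential polynomials as a Chebyshev system -/

/-- The exponential polynomial `q₁(x) + q₂(x) exp (c x)`. -/
def expPoly (q₁ q₂ : ℝ[X]) (c x : ℝ) : ℝ := q₁.eval x + q₂.eval x * Real.exp (c * x)

theorem hasDerivAt_expPoly (q₁ q₂ : ℝ[X]) (c x : ℝ) :
    HasDerivAt (expPoly q₁ q₂ c) (expPoly (derivative q₁) (derivative q₂ + C c * q₂) c x) x := by
  have h1 : HasDerivAt (fun x : ℝ => Real.exp (c * x)) (Real.exp (c * x) * c) x := by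
    simpa using ((hasDerivAt_id x).const_mul c).exp
  refine ((q₁.hasDerivAt x).add ((q₂.hasDerivAt x).mul h1)).congr_deriv ?_
  simp only [expPoly, eval_add, eval_mul, eval_C]
  ring

theorem deriv_expPoly (q₁ q₂ : ℝ[X]) (c x : ℝ) :
    deriv (expPoly q₁ q₂ c) x = expPoly (derivative q₁) (derivative q₂ + C c * q₂) c x :=
  (hasDerivAt_expPoly q₁ q₂ c x).deriv

theorem continuous_expPoly (q₁ q₂ : ℝ[X]) (c : ℝ) : Continuous (expPoly q₁ q₂ c) :=
  continuous_iff_continuousAt.2 fun x => (hasDerivAt_expPoly q₁ q₂ c x).continuousAt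

theorem degree_derivative_add_C_mul {q : ℝ[X]} {c : ℝ} {k : ℕ} (h : q.degree < k) :
    (derivative q + C c * q).degree < k :=
  lt_of_le_of_lt (degree_add_le _ _) (max_lt (lt_of_le_of_lt (degree_derivative_le) h)
    (lt_of_le_of_lt (by rw [← smul_eq_C_mul]; exact degree_smul_le c q) h))

theorem derivative_add_C_mul_ne_zero {q : ℝ[X]} {c : ℝ} (hc : c ≠ 0) (hq : q ≠ 0) :
    derivative q + C c * q ≠ 0 := by
  intro h
  have h1 : (derivative q).degree < (C c * q).degree := by
    rw [degree_C_mul hc]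
    exact degree_derivative_lt hq
  have h2 := degree_add_eq_right_of_degree_lt h1
  rw [h, degree_zero, degree_C_mul hc, eq_comm, degree_eq_bot] at h2
  exact hq h2

theorem degree_derivative_lt_of_lt_succ {q : ℝ[X]} {k : ℕ} (h : q.degree < (k + 1 : ℕ)) :
    (derivative q).degree < k := by
  by_cases hq : q = 0
  · simp [hq]
  · refine lt_of_lt_of_le (degree_derivative_lt hq) ?_
    rw [degree_eq_natDegree hq] at h ⊢
    exact_mod_cast Nat.lt_succ_iff.1 (by exact_mod_cast h)

/-- By Rolle, between two zeros of an exponential polynomial lies a zero of its derivative. -/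
theorem interleaved_expPoly (q₁ q₂ : ℝ[X]) (c : ℝ) (s t : Finset ℝ)
    (hs : ∀ x ∈ s, expPoly q₁ q₂ c x = 0)
    (ht : ∀ x, expPoly (derivative q₁) (derivative q₂ + C c * q₂) c x = 0 → x ∈ t) :
    s.card ≤ (t \ s).card + 1 := by
  refine Finset.card_le_sdiff_of_interleaved fun x hx y hy hxy _ => ?_
  obtain ⟨z, hz, hz0⟩ := exists_deriv_eq_zero hxy (continuous_expPoly q₁ q₂ c).continuousOn
    ((hs x hx).trans (hs y hy).symm)
  rw [deriv_expPoly] at hz0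
  exact ⟨z, ht z hz0, hz.1, hz.2⟩

theorem exists_zero_finset {f : ℝ → ℝ} {k : ℕ}
    (h : ∀ s : Finset ℝ, (∀ x ∈ s, f x = 0) → s.card < k) :
    ∃ t : Finset ℝ, t.card < k ∧ ∀ x, f x = 0 ↔ x ∈ t := by
  have hfin : {x | f x = 0}.Finite := by
    by_contra hinf
    obtain ⟨t, ht, hc⟩ := Set.Infinite.exists_subset_card_eq hinf k
    exact absurd (h t fun x hx => ht hx) (by omega)
  exact ⟨hfin.toFinset, h _ (by simp), by simp⟩

/-- A nonzero exponential polynomial with coefficients of degrees less than `k₁` and `k₂` has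
fewer than `k₁ + k₂` real zeros. -/
theorem card_zeros_expPoly_lt {c : ℝ} (hc : c ≠ 0) {k₂ : ℕ} (k₁ : ℕ) :
    ∀ {q₁ q₂ : ℝ[X]}, q₁.degree < k₁ → q₂.degree < k₂ → (q₁ ≠ 0 ∨ q₂ ≠ 0) →
      ∀ s : Finset ℝ, (∀ x ∈ s, expPoly q₁ q₂ c x = 0) → s.card < k₁ + k₂ := by
  induction k₁ with
  | zero =>
    intro q₁ q₂ h1 h2 hne s hs
    have hq1 : q₁ = 0 := by
      by_contra h
      rw [degree_eq_natDegree h] at h1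
      exact absurd h1 (by simp)
    subst hq1
    have hq2 : q₂ ≠ 0 := by simpa using hne
    have : s ⊆ q₂.roots.toFinset := by
      intro x hx
      have := hs x hx
      simp [expPoly] at this
      simp [hq2, this]
    have h3 := Finset.card_le_card this
    have h4 := q₂.roots.toFinset_card_le
    have h5 := card_roots' q₂
    rw [degree_eq_natDegree hq2] at h2
    have h6 : q₂.natDegree < k₂ := by exact_mod_cast h2
    omega
  | succ k ih =>
    intro q₁ q₂ h1 h2 hne s hs
    by_cases h0 : derivative q₁ = 0 ∧ q₂ = 0
    · obtain ⟨h0, rfl⟩ := h0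
      have hq1 : q₁ ≠ 0 := by simpa using hne
      have : s = ∅ := by
        by_contra hse
        obtain ⟨x, hx⟩ := Finset.nonempty_iff_ne_empty.2 hse
        have h3 := hs x hx
        rw [Polynomial.eq_C_of_derivative_eq_zero h0] at h3 hq1
        simp [expPoly] at h3
        simp [h3] at hq1
      simp [this]
    · have hne' : derivative q₁ ≠ 0 ∨ derivative q₂ + C c * q₂ ≠ 0 := by
        by_cases h : q₂ = 0
        · exact Or.inl fun h' => h0 ⟨h', h⟩
        · exact Or.inr (derivative_add_C_mul_ne_zero hc h)
      obtain ⟨t, ht, ht'⟩ := exists_zero_finset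
        (ih (degree_derivative_lt_of_lt_succ h1) (degree_derivative_add_C_mul h2) hne')
      have h3 := interleaved_expPoly q₁ q₂ c s t hs fun x hx => (ht' x).1 hx
      have h4 := Finset.card_le_card (Finset.sdiff_subset (s := t) (t := s))
      omega

/-- The zero count of `card_zeros_expPoly_lt`, where double zeros count twice. -/
theorem card_zeros_add_card_double_zeros_lt {c : ℝ} (hc : c ≠ 0) {k₁ k₂ : ℕ} {q₁ q₂ : ℝ[X]}
    (h1 : q₁.degree < k₁) (h2 : q₂.degree < k₂) (hne : q₁ ≠ 0 ∨ q₂ ≠ 0) (s u : Finset ℝ)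
    (hs : ∀ x ∈ s, expPoly q₁ q₂ c x = 0) (hus : u ⊆ s)
    (hu : ∀ x ∈ u, expPoly (derivative q₁) (derivative q₂ + C c * q₂) c x = 0) :
    s.card + u.card < k₁ + k₂ := by
  wlog hk : 0 < k₁ generalizing k₁ k₂ q₁ q₂
  · have hk0 : k₁ = 0 := by omega
    subst hk0
    have hq1 : q₁ = 0 := by
      by_contra h
      rw [degree_eq_natDegree h] at h1
      exact absurd h1 (by simp)
    subst hq1
    have hq2 : q₂ ≠ 0 := by simpa using hne
    have hk2 : 0 < k₂ := by
      by_contra h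
      rw [degree_eq_natDegree hq2, show k₂ = 0 by omega] at h2
      exact absurd h2 (by simp)
    have hs' : ∀ x ∈ s, q₂.eval x = 0 := fun x hx => by simpa [expPoly] using hs x hx
    have := this (k₁ := k₂) (k₂ := 0) (q₁ := q₂) (q₂ := 0) h2 (by simp) (Or.inl hq2)
      (fun x hx => by simpa [expPoly] using hs' x hx)
      (fun x hx => by
        have h := hu x hx
        simp [expPoly, hs' x (hus hx)] at h
        simpa [expPoly] using h) hk2
    omega
  obtain ⟨k, rfl⟩ := Nat.exists_eq_succ_of_ne_zero hk.ne'
  by_cases h0 : derivative q₁ = 0 ∧ q₂ = 0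
  · obtain ⟨h0, rfl⟩ := h0
    have hq1 : q₁ ≠ 0 := by simpa using hne
    have hse : s = ∅ := by
      by_contra hse
      obtain ⟨x, hx⟩ := Finset.nonempty_iff_ne_empty.2 hse
      have h3 := hs x hx
      rw [Polynomial.eq_C_of_derivative_eq_zero h0] at h3 hq1
      simp [expPoly] at h3
      simp [h3] at hq1
    subst hse
    simp [Finset.subset_empty.1 hus]
  · have hne' : derivative q₁ ≠ 0 ∨ derivative q₂ + C c * q₂ ≠ 0 := by
      by_cases h : q₂ = 0
      · exact Or.inl fun h' => h0 ⟨h', h⟩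
      · exact Or.inr (derivative_add_C_mul_ne_zero hc h)
    obtain ⟨t, ht, ht'⟩ := exists_zero_finset
      (card_zeros_expPoly_lt hc k (degree_derivative_lt_of_lt_succ h1)
        (degree_derivative_add_C_mul h2) hne')
    have h3 := interleaved_expPoly q₁ q₂ c s t hs fun x hx => (ht' x).1 hx
    have h4 : u ⊆ t ∩ s := fun x hx => Finset.mem_inter.2 ⟨(ht' x).1 (hu x hx), hus hx⟩
    have h5 := Finset.card_le_card h4
    have h6 := Finset.card_sdiff_add_card_inter t s
    omega

/-- A continuous function whose zeros are simple and form the finite set `s` is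
`∏ (x - y)` over `y ∈ s`, times a continuous function without zeros. -/
theorem exists_eq_prod_mul_of_simple_zeros (s : Finset ℝ) : ∀ (f : ℝ → ℝ) (_ : Continuous f)
    (_ : ∀ x, f x = 0 ↔ x ∈ s) (_ : ∀ x ∈ s, ∃ f', f' ≠ 0 ∧ HasDerivAt f f' x),
    ∃ h : ℝ → ℝ, Continuous h ∧ (∀ x, h x ≠ 0) ∧ ∀ x, f x = (∏ y ∈ s, (x - y)) * h x := by
  induction s using Finset.induction_on with
  | empty =>
    intro f hf hz _
    exact ⟨f, hf, fun x hx => by simpa using (hz x).1 hx, by simp⟩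
  | insert a s ha ih =>
    intro f hf hz hd
    obtain ⟨f', hf'0, hf'⟩ := hd a (Finset.mem_insert_self a s)
    have hfa : f a = 0 := (hz a).2 (Finset.mem_insert_self a s)
    have hmul : ∀ x, f x = (x - a) * dslope f a x := fun x => by
      have := sub_smul_dslope f a x
      rw [smul_eq_mul, hfa, sub_zero] at this
      exact this.symm
    have hcont : Continuous (dslope f a) := by
      rw [← continuousOn_univ, continuousOn_dslope univ_mem]
      exact ⟨hf.continuousOn, hf'.differentiableAt⟩
    have hga : dslope f a a ≠ 0 := by rwa [dslope_same, hf'.deriv]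
    have hzero : ∀ x, dslope f a x = 0 ↔ x ∈ s := by
      intro x
      by_cases hxa : x = a
      · subst hxa
        exact ⟨fun h => absurd h hga, fun h => absurd h ha⟩
      · have h1 := hz x
        rw [hmul x, mul_eq_zero, sub_eq_zero, Finset.mem_insert] at h1
        simpa [hxa] using h1
    obtain ⟨h, hh1, hh2, hh3⟩ := ih (dslope f a) hcont hzero (by
      intro x hx
      have hxa : x ≠ a := fun h => ha (h ▸ hx)
      obtain ⟨g', hg'0, hg'⟩ := hd x (Finset.mem_insert_of_mem hx)
      have hfx : f x = 0 := (hz x).2 (Finset.mem_insert_of_mem hx)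
      have h1 : HasDerivAt (fun y => f y / (y - a)) (g' / (x - a)) x := by
        have := hg'.div ((hasDerivAt_id x).sub_const a) (sub_ne_zero.2 hxa)
        refine this.congr_deriv ?_
        have := sub_ne_zero.2 hxa
        simp [hfx]
        field_simp
      refine ⟨g' / (x - a), div_ne_zero hg'0 (sub_ne_zero.2 hxa), h1.congr_of_eventuallyEq ?_⟩
      filter_upwards [isOpen_ne.mem_nhds hxa] with y hy
      rw [hmul y, mul_div_cancel_left₀ _ (sub_ne_zero.2 hy)])
    refine ⟨h, hh1, hh2, fun x => ?_⟩
    rw [hmul x, hh3 x, Finset.prod_insert ha, mul_assoc]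

theorem pos_or_neg_of_continuous_ne_zero {h : ℝ → ℝ} (hc : Continuous h) (h0 : ∀ x, h x ≠ 0) :
    (∀ x, 0 < h x) ∨ ∀ x, h x < 0 := by
  by_contra! hcon
  obtain ⟨⟨x, hx⟩, y, hy⟩ := hcon
  obtain ⟨z, hz⟩ := mem_range_of_exists_le_of_exists_ge hc ⟨x, hx⟩ ⟨y, hy⟩
  exact h0 z hz

/-- Interpolation in a Chebyshev system: some exponential polynomial changes sign exactly at the
points of a prescribed set of fewer than `k₁ + k₂` points. -/
theorem exists_expPoly_sign {c : ℝ} (hc : c ≠ 0) {k₁ k₂ : ℕ} (s : Finset ℝ)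
    (hs : s.card < k₁ + k₂) :
    ∃ q₁ q₂ : ℝ[X], q₁.degree < k₁ ∧ q₂.degree < k₂ ∧
      ∃ h : ℝ → ℝ, (∀ x, 0 < h x) ∧ ∀ x, expPoly q₁ q₂ c x = (∏ y ∈ s, (x - y)) * h x := by
  obtain ⟨j₁, j₂, hj1, hj2, hj⟩ : ∃ j₁ j₂, j₁ ≤ k₁ ∧ j₂ ≤ k₂ ∧ j₁ + j₂ = s.card + 1 :=
    ⟨min k₁ (s.card + 1), s.card + 1 - min k₁ (s.card + 1), by omega, by omega, by omega⟩
  let L : (degreeLT ℝ j₁ × degreeLT ℝ j₂) →ₗ[ℝ] (s → ℝ) :=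
    { toFun := fun q x => expPoly q.1 q.2 c x
      map_add' := fun p q => by ext x; simp [expPoly]; ring
      map_smul' := fun r q => by ext x; simp [expPoly]; ring }
  have hker : L.ker ≠ ⊥ := by
    apply LinearMap.ker_ne_bot_of_finrank_lt
    rw [Module.finrank_prod, (degreeLTEquiv ℝ j₁).finrank_eq, (degreeLTEquiv ℝ j₂).finrank_eq]
    simp [hj]
  obtain ⟨⟨q₁, q₂⟩, hq, hq0⟩ := Submodule.exists_mem_ne_zero_of_ne_bot hker
  have hd1 : (q₁ : ℝ[X]).degree < j₁ := mem_degreeLT.1 q₁.2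
  have hd2 : (q₂ : ℝ[X]).degree < j₂ := mem_degreeLT.1 q₂.2
  have hne : (q₁ : ℝ[X]) ≠ 0 ∨ (q₂ : ℝ[X]) ≠ 0 := by
    by_contra! h
    exact hq0 (Prod.ext (Subtype.ext h.1) (Subtype.ext h.2))
  have hz : ∀ x ∈ s, expPoly q₁ q₂ c x = 0 := fun x hx => congrFun (LinearMap.mem_ker.1 hq) ⟨x, hx⟩
  obtain ⟨h, hh1, hh2, hh3⟩ := exists_eq_prod_mul_of_simple_zeros s (expPoly q₁ q₂ c)
    (continuous_expPoly _ _ _) (fun x => ⟨fun hx => by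
      by_contra hxs
      have := card_zeros_expPoly_lt hc j₁ hd1 hd2 hne (insert x s) (by
        intro y hy
        rcases Finset.mem_insert.1 hy with rfl | hy
        exacts [hx, hz y hy])
      rw [Finset.card_insert_of_notMem hxs] at this
      omega, hz x⟩) (fun x hx => ⟨_, fun h0 => by
        have := card_zeros_add_card_double_zeros_lt hc hd1 hd2 hne s {x} hz
          (Finset.singleton_subset_iff.2 hx) (by simpa using h0)
        rw [Finset.card_singleton] at this
        omega, hasDerivAt_expPoly _ _ _ x⟩)
  have hj1' : ((j₁ : ℕ) : WithBot ℕ) ≤ k₁ := by exact_mod_cast hj1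
  have hj2' : ((j₂ : ℕ) : WithBot ℕ) ≤ k₂ := by exact_mod_cast hj2
  rcases pos_or_neg_of_continuous_ne_zero hh1 hh2 with hp | hn
  · exact ⟨q₁, q₂, hd1.trans_le hj1', hd2.trans_le hj2', h, hp, hh3⟩
  · refine ⟨-q₁, -q₂, by rw [degree_neg]; exact hd1.trans_le hj1',
      by rw [degree_neg]; exact hd2.trans_le hj2', fun x => -h x, fun x => neg_pos.2 (hn x),
      fun x => ?_⟩
    have := hh3 x
    simp only [expPoly, eval_neg] at this ⊢
    linarith

/-- The sign changes of a real polynomial `Q` occur at distinct roots: there is a finite set `s`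
such that `Q` is divisible by `∏ (X - y)` over `y ∈ s` and times this product has constant sign. -/
theorem exists_sign_finset (n : ℕ) : ∀ Q : ℝ[X], Q ≠ 0 → Q.natDegree ≤ n →
    ∃ s : Finset ℝ, (∏ y ∈ s, (X - C y)) ∣ Q ∧
      ((∀ x, 0 ≤ Q.eval x * ∏ y ∈ s, (x - y)) ∨ ∀ x, Q.eval x * ∏ y ∈ s, (x - y) ≤ 0) := by
  induction n with
  | zero =>
    intro Q hQ hd
    refine ⟨∅, by simp, ?_⟩
    rw [eq_C_of_natDegree_le_zero hd]
    simp only [eval_C, Finset.prod_empty, mul_one, forall_const]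
    exact le_total _ _
  | succ n ih =>
    intro Q hQ hd
    by_cases hroot : ∃ y, Q.IsRoot y
    · obtain ⟨y, hy⟩ := hroot
      obtain ⟨Q₁, rfl⟩ := dvd_iff_isRoot.2 hy
      have hQ1 : Q₁ ≠ 0 := right_ne_zero_of_mul hQ
      obtain ⟨s, hs1, hs2⟩ := ih Q₁ hQ1 (by
        rw [natDegree_mul (X_sub_C_ne_zero y) hQ1, natDegree_X_sub_C] at hd
        omega)
      by_cases hys : y ∈ s
      · refine ⟨s.erase y, ?_, ?_⟩
        · exact (Finset.prod_dvd_prod_of_subset _ _ _ (Finset.erase_subset y s)).trans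
            (hs1.trans (dvd_mul_left _ _))
        · have : ∀ x, ((X - C y) * Q₁).eval x * ∏ z ∈ s.erase y, (x - z)
              = Q₁.eval x * ∏ z ∈ s, (x - z) := fun x => by
            rw [← Finset.mul_prod_erase s _ hys]
            simp
            ring
          simpa only [this] using hs2
      · refine ⟨insert y s, ?_, ?_⟩
        · rw [Finset.prod_insert hys]
          exact mul_dvd_mul_left _ hs1
        · have : ∀ x, ((X - C y) * Q₁).eval x * ∏ z ∈ insert y s, (x - z)
              = (x - y) ^ 2 * (Q₁.eval x * ∏ z ∈ s, (x - z)) := fun x => by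
            rw [Finset.prod_insert hys]
            simp
            ring
          simp only [this]
          rcases hs2 with h | h
          · exact Or.inl fun x => mul_nonneg (sq_nonneg _) (h x)
          · exact Or.inr fun x => mul_nonpos_of_nonneg_of_nonpos (sq_nonneg _) (h x)
    · refine ⟨∅, by simp, ?_⟩
      rcases pos_or_neg_of_continuous_ne_zero Q.continuous (fun x hx => hroot ⟨x, hx⟩) with h | h
      · exact Or.inl fun x => by simpa using (h x).le
      · exact Or.inr fun x => by simpa using (h x).le

/-! ### Integrability against the weights -/

/-- Real polynomials of even degree at least two with positive leading coefficient. -/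
structure IsConfining (V : ℝ[X]) : Prop where
  two_le : 2 ≤ V.natDegree
  even : Even V.natDegree
  pos : 0 < V.leadingCoeff

theorem integrableOn_Ioi_eval_mul_exp_neg {W : ℝ[X]} (h2 : 2 ≤ W.natDegree)
    (hpos : 0 < W.leadingCoeff) (Q : ℝ[X]) (s : ℝ) :
    IntegrableOn (fun x => Q.eval x * Real.exp (-W.eval x)) (Set.Ioi s) := by
  refine integrable_of_isBigO_exp_neg (b := 1) one_pos (by fun_prop) ?_
  have hdeg : (C 2 * X : ℝ[X]).degree < W.degree := by
    refine lt_of_le_of_lt (degree_C_mul_X_le 2) ?_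
    rw [degree_eq_natDegree (leadingCoeff_ne_zero.1 hpos.ne')]
    exact_mod_cast h2
  have h1 : Tendsto (fun x => (W - C 2 * X).eval x) atTop atTop := by
    refine tendsto_atTop_of_leadingCoeff_nonneg _ ?_ ?_
    · rw [degree_sub_eq_left_of_degree_lt hdeg]
      exact natDegree_pos_iff_degree_pos.1 (by omega)
    · rw [leadingCoeff_sub_of_degree_lt hdeg]
      exact hpos.le
  have h3 := (tendsto_div_exp_atTop Q).mul (Real.tendsto_exp_neg_atTop_nhds_zero.comp h1)
  refine Asymptotics.isBigO_of_div_tendsto_nhds (Eventually.of_forall fun x hx => ?_) _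
    (h3.congr fun x => ?_)
  · exact absurd hx (Real.exp_pos _).ne'
  · simp only [Function.comp, Pi.div_apply, eval_sub, eval_mul, eval_C, eval_X]
    rw [div_mul_eq_mul_div, div_eq_div_iff (Real.exp_pos _).ne' (Real.exp_pos _).ne', mul_assoc,
      mul_assoc, ← Real.exp_add, ← Real.exp_add]
    ring_nf

theorem integrable_eval_mul_exp_neg {W : ℝ[X]} (hW : IsConfining W) (Q : ℝ[X]) :
    Integrable (fun x => Q.eval x * Real.exp (-W.eval x)) := by
  rw [← integrableOn_univ, ← Set.Iic_union_Ioi (a := (0 : ℝ))]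
  refine IntegrableOn.union ?_ (integrableOn_Ioi_eval_mul_exp_neg hW.two_le hW.pos Q 0)
  rw [← (Measure.measurePreserving_neg (volume : Measure ℝ)).integrableOn_comp_preimage
    (MeasurableEquiv.neg ℝ).measurableEmbedding]
  have hpre : (Neg.neg : ℝ → ℝ) ⁻¹' Set.Iic 0 = Set.Ici 0 := by ext; simp
  rw [hpre, integrableOn_Ici_iff_integrableOn_Ioi]
  have hX : (-X : ℝ[X]).natDegree = 1 := by simp
  have h := integrableOn_Ioi_eval_mul_exp_neg (W := W.comp (-X))
    (by rw [natDegree_comp, hX, mul_one]; exact hW.two_le)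
    (by rw [leadingCoeff_comp (by simp)]; simpa [hW.even.neg_one_pow] using hW.pos)
    (Q.comp (-X)) 0
  refine h.congr_fun (fun x _ => ?_) measurableSet_Ioi
  simp

theorem IsConfining.scaled {V : ℝ[X]} (hV : IsConfining V) {t : ℝ} (ht : 0 < t) (b : ℝ) :
    IsConfining (C t * (V - C b * X)) := by
  have hdeg : (C b * X : ℝ[X]).degree < V.degree := by
    refine lt_of_le_of_lt (degree_C_mul_X_le b) ?_
    rw [degree_eq_natDegree (leadingCoeff_ne_zero.1 hV.pos.ne')]
    exact_mod_cast hV.two_le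
  have hn : (C t * (V - C b * X)).natDegree = V.natDegree := by
    rw [natDegree_C_mul ht.ne']
    exact natDegree_eq_of_degree_eq (degree_sub_eq_left_of_degree_lt hdeg)
  refine ⟨hn ▸ hV.two_le, hn ▸ hV.even, ?_⟩
  rw [leadingCoeff_mul, leadingCoeff_C, leadingCoeff_sub_of_degree_lt hdeg]
  exact mul_pos ht hV.pos

theorem weight_eq (V : ℝ[X]) (b t x : ℝ) :
    weight V b t x = Real.exp (-(C t * (V - C b * X)).eval x) := by
  simp [weight]

theorem weight_pos (V : ℝ[X]) (b t x : ℝ) : 0 < weight V b t x := Real.exp_pos _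

theorem continuous_weight (V : ℝ[X]) (b t : ℝ) : Continuous (weight V b t) := by
  unfold weight
  fun_prop

theorem integrable_eval_mul_weight {V : ℝ[X]} (hV : IsConfining V) {t : ℝ} (ht : 0 < t) (b : ℝ)
    (Q : ℝ[X]) : Integrable (fun x => Q.eval x * weight V b t x) := by
  simp only [weight_eq]
  exact integrable_eval_mul_exp_neg (hV.scaled ht b) Q

/-! ### Orthogonality -/

/-- `Q` satisfies the orthogonality conditions of multi-index `k` with respect to the two
weights. -/
def IsOrth (V : ℝ[X]) (a t : ℝ) (k : ℕ × ℕ) (Q : ℝ[X]) : Prop :=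
  (∀ l < k.1, ∫ x : ℝ, Q.eval x * x ^ l * weight V a t x = 0) ∧
    ∀ l < k.2, ∫ x : ℝ, Q.eval x * x ^ l * weight V (-a) t x = 0

section

variable {V : ℝ[X]} (hV : IsConfining V) {a t : ℝ} (ht : 0 < t) {k : ℕ × ℕ} {P Q : ℝ[X]}

theorem IsMOP.isOrth (h : IsMOP V a t k P) : IsOrth V a t k P := ⟨h.orth_fst, h.orth_snd⟩

theorem IsOrth.mono {j : ℕ × ℕ} (h : IsOrth V a t k Q) (h1 : j.1 ≤ k.1) (h2 : j.2 ≤ k.2) :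
    IsOrth V a t j Q :=
  ⟨fun l hl => h.1 l (hl.trans_le h1), fun l hl => h.2 l (hl.trans_le h2)⟩

theorem IsOrth.C_mul (h : IsOrth V a t k Q) (c : ℝ) : IsOrth V a t k (C c * Q) := by
  constructor
  · intro l hl
    simpa [mul_assoc, integral_const_mul] using Or.inr (h.1 l hl)
  · intro l hl
    simpa [mul_assoc, integral_const_mul] using Or.inr (h.2 l hl)

include hV ht in
theorem integrable_eval_mul_pow_mul_weight (b : ℝ) (Q : ℝ[X]) (l : ℕ) :
    Integrable (fun x => Q.eval x * x ^ l * weight V b t x) := by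
  refine (integrable_eval_mul_weight hV ht b (Q * X ^ l)).congr (Eventually.of_forall fun x => ?_)
  simp

include hV ht in
theorem IsOrth.add (hP : IsOrth V a t k P) (hQ : IsOrth V a t k Q) : IsOrth V a t k (P + Q) := by
  constructor
  · intro l hl
    simp only [eval_add, add_mul]
    rw [integral_add (integrable_eval_mul_pow_mul_weight hV ht _ _ _)
      (integrable_eval_mul_pow_mul_weight hV ht _ _ _), hP.1 l hl, hQ.1 l hl, add_zero]
  · intro l hl
    simp only [eval_add, add_mul]
    rw [integral_add (integrable_eval_mul_pow_mul_weight hV ht _ _ _)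
      (integrable_eval_mul_pow_mul_weight hV ht _ _ _), hP.2 l hl, hQ.2 l hl, add_zero]

include hV ht in
theorem IsOrth.sub (hP : IsOrth V a t k P) (hQ : IsOrth V a t k Q) : IsOrth V a t k (P - Q) := by
  have := hP.add hV ht (hQ.C_mul (-1))
  simpa [sub_eq_add_neg] using this

theorem IsOrth.X_mul (h : IsOrth V a t k Q) : IsOrth V a t (k.1 - 1, k.2 - 1) (X * Q) := by
  constructor
  · intro l hl
    rw [← h.1 (l + 1) (by simp at hl; omega)]
    refine integral_congr_ae (Eventually.of_forall fun x => ?_)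
    simp only [eval_mul, eval_X, pow_succ]
    ring
  · intro l hl
    rw [← h.2 (l + 1) (by simp at hl; omega)]
    refine integral_congr_ae (Eventually.of_forall fun x => ?_)
    simp only [eval_mul, eval_X, pow_succ]
    ring

include hV ht in
theorem integral_mul_eq_zero_of_degree_lt {b : ℝ} {j : ℕ}
    (h : ∀ l < j, ∫ x : ℝ, Q.eval x * x ^ l * weight V b t x = 0) {q : ℝ[X]} (hq : q.degree < j) :
    ∫ x : ℝ, Q.eval x * q.eval x * weight V b t x = 0 := by
  have hq' : q.natDegree < j ∨ q = 0 := by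
    by_cases h0 : q = 0
    · exact Or.inr h0
    · rw [degree_eq_natDegree h0] at hq
      exact Or.inl (by exact_mod_cast hq)
  rcases hq' with hq' | rfl
  · have : ∀ x, Q.eval x * q.eval x * weight V b t x
        = ∑ i ∈ Finset.range j, q.coeff i * (Q.eval x * x ^ i * weight V b t x) := fun x => by
      rw [eval_eq_sum_range' hq', Finset.mul_sum, Finset.sum_mul]
      exact Finset.sum_congr rfl fun i _ => by ring
    simp only [this]
    rw [integral_finsetSum _ fun i _ =>
      (integrable_eval_mul_pow_mul_weight hV ht b Q i).const_mul _]
    refine Finset.sum_eq_zero fun i hi => ?_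
    rw [integral_const_mul, h i (Finset.mem_range.1 hi), mul_zero]
  · simp

include hV ht in
/-- A polynomial with the orthogonality conditions of index `k` has at least `k₁ + k₂` sign
changes; factors without sign change do not help to reach this number. -/
theorem IsOrth.exists_finset (ha : a ≠ 0) (h : IsOrth V a t k Q) (hQ : Q ≠ 0) {E Q₂ : ℝ[X]}
    (hE : ∀ x, 0 ≤ E.eval x) (hEQ : Q = E * Q₂) :
    ∃ s : Finset ℝ, k.1 + k.2 ≤ s.card ∧ (∏ y ∈ s, (X - C y)) ∣ Q₂ := by
  have hQ2 : Q₂ ≠ 0 := right_ne_zero_of_mul (hEQ ▸ hQ)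
  obtain ⟨s, hs1, hs2⟩ := exists_sign_finset _ Q₂ hQ2 le_rfl
  refine ⟨s, ?_, hs1⟩
  by_contra! hlt
  have hc : -2 * t * a ≠ 0 := by simp [ht.ne', ha]
  -- an exponential polynomial with exactly the sign changes of `Q₂`: its product with `Q` keeps
  -- a sign, but integrates to zero
  obtain ⟨q₁, q₂, hq1, hq2, g, hg, hA⟩ := exists_expPoly_sign hc s hlt
  have hw : ∀ x, weight V (-a) t x = Real.exp (-2 * t * a * x) * weight V a t x := fun x => by
    simp only [weight]
    rw [← Real.exp_add]
    ring_nf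
  have hsum : ∀ x, Q.eval x * expPoly q₁ q₂ (-2 * t * a) x * weight V a t x
      = Q.eval x * q₁.eval x * weight V a t x + Q.eval x * q₂.eval x * weight V (-a) t x := by
    intro x
    rw [hw x, expPoly]
    ring
  have hi1 : Integrable (fun x => Q.eval x * q₁.eval x * weight V a t x) := by
    simpa using integrable_eval_mul_weight hV ht a (Q * q₁)
  have hi2 : Integrable (fun x => Q.eval x * q₂.eval x * weight V (-a) t x) := by
    simpa using integrable_eval_mul_weight hV ht (-a) (Q * q₂)
  have hint : ∫ x, Q.eval x * expPoly q₁ q₂ (-2 * t * a) x * weight V a t x = 0 := by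
    simp only [hsum]
    rw [integral_add hi1 hi2, integral_mul_eq_zero_of_degree_lt hV ht h.1 hq1,
      integral_mul_eq_zero_of_degree_lt hV ht h.2 hq2, add_zero]
  have hintegrable : Integrable
      (fun x => Q.eval x * expPoly q₁ q₂ (-2 * t * a) x * weight V a t x) := by
    simp only [hsum]
    exact hi1.add hi2
  have hcont : Continuous (fun x => Q.eval x * expPoly q₁ q₂ (-2 * t * a) x * weight V a t x) :=
    (Q.continuous.mul (continuous_expPoly _ _ _)).mul (continuous_weight V a t)
  have hform : ∀ x, Q.eval x * expPoly q₁ q₂ (-2 * t * a) x * weight V a t x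
      = (E.eval x * g x * weight V a t x) * (Q₂.eval x * ∏ y ∈ s, (x - y)) := fun x => by
    rw [hA, hEQ, eval_mul]
    ring
  have hpos : ∀ x, 0 ≤ E.eval x * g x * weight V a t x := fun x =>
    mul_nonneg (mul_nonneg (hE x) (hg x).le) (weight_pos V a t x).le
  have hzero : ∀ x, Q.eval x * expPoly q₁ q₂ (-2 * t * a) x * weight V a t x = 0 := by
    rcases hs2 with hs2 | hs2
    · rw [integral_eq_zero_iff_of_nonneg (fun x => by
        rw [Pi.zero_apply, hform]
        exact mul_nonneg (hpos x) (hs2 x)) hintegrable] at hint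
      exact congrFun ((Continuous.ae_eq_iff_eq volume hcont continuous_const).1 hint)
    · have hint' : ∫ x, -(Q.eval x * expPoly q₁ q₂ (-2 * t * a) x * weight V a t x) = 0 := by
        rw [integral_neg, hint, neg_zero]
      rw [integral_eq_zero_iff_of_nonneg (fun x => by
        rw [Pi.zero_apply, hform x, ← mul_neg]
        exact mul_nonneg (hpos x) (neg_nonneg.2 (hs2 x))) (by exact hintegrable.neg)] at hint'
      intro x
      exact neg_eq_zero.1
        (congrFun ((Continuous.ae_eq_iff_eq volume hcont.neg continuous_const).1 hint') x)
  obtain ⟨x, hx⟩ := Infinite.exists_notMem_finset (Q.roots.toFinset ∪ s)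
  rw [Finset.mem_union, not_or] at hx
  have h1 : Q.eval x ≠ 0 := fun h0 => hx.1 (by simp [hQ, h0])
  have h2 := hzero x
  rw [hA] at h2
  have h3 : (∏ y ∈ s, (x - y)) ≠ 0 := Finset.prod_ne_zero_iff.2 fun y hy h0 =>
    hx.2 (sub_eq_zero.1 h0 ▸ hy)
  exact mul_ne_zero (mul_ne_zero h1 (mul_ne_zero h3 (hg x).ne')) (weight_pos V a t x).ne' h2

theorem natDegree_prod_X_sub_C_finset (s : Finset ℝ) :
    (∏ y ∈ s, (X - C y)).natDegree = s.card := by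
  rw [natDegree_prod_of_monic _ _ fun y _ => monic_X_sub_C y, Finset.sum_congr rfl
      fun y _ => natDegree_X_sub_C y, Finset.sum_const, smul_eq_mul, mul_one]

include hV ht in
/-- Removing a factor without sign change from a polynomial with the orthogonality conditions of
index `k` cannot bring its degree below `k₁ + k₂`. -/
theorem IsOrth.le_natDegree (ha : a ≠ 0) (h : IsOrth V a t k Q) (hQ : Q ≠ 0) {E Q₂ : ℝ[X]}
    (hE : ∀ x, 0 ≤ E.eval x) (hEQ : Q = E * Q₂) : k.1 + k.2 ≤ Q₂.natDegree := by
  obtain ⟨s, hs, hs1⟩ := h.exists_finset hV ht ha hQ hE hEQ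
  have := natDegree_le_of_dvd hs1 (right_ne_zero_of_mul (hEQ ▸ hQ))
  rw [natDegree_prod_X_sub_C_finset] at this
  omega

include hV ht in
theorem IsOrth.eq_zero_of_degree_lt (ha : a ≠ 0) (h : IsOrth V a t k Q)
    (hd : Q.degree < (k.1 + k.2 : ℕ)) : Q = 0 := by
  by_contra hQ
  have := h.le_natDegree hV ht ha hQ (E := 1) (by simp) (one_mul Q).symm
  rw [degree_eq_natDegree hQ] at hd
  exact absurd (show Q.natDegree < k.1 + k.2 by exact_mod_cast hd) (by omega)

theorem degree_sub_lt_of_monic {P Q : ℝ[X]} {n : ℕ} (hP : P.Monic) (hQ : Q.Monic)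
    (hp : P.natDegree = n) (hq : Q.natDegree = n) : (P - Q).degree < n := by
  have : P.degree = Q.degree := by
    rw [degree_eq_natDegree hP.ne_zero, degree_eq_natDegree hQ.ne_zero, hp, hq]
  refine (degree_sub_lt_left this hP.ne_zero (by rw [hP, hQ])).trans_eq ?_
  rw [degree_eq_natDegree hP.ne_zero, hp]

include hV ht in
theorem IsMOP.unique (ha : a ≠ 0) (hP : IsMOP V a t k P) (hQ : IsMOP V a t k Q) : P = Q :=
  sub_eq_zero.1 ((hP.isOrth.sub hV ht hQ.isOrth).eq_zero_of_degree_lt hV ht ha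
    (degree_sub_lt_of_monic hP.monic hQ.monic hP.degree hQ.degree))

include hV ht in
theorem exists_isMOP (ha : a ≠ 0) (k : ℕ × ℕ) : ∃ P, IsMOP V a t k P := by
  let L : degreeLT ℝ (k.1 + k.2) →ₗ[ℝ] ((Fin k.1 → ℝ) × (Fin k.2 → ℝ)) :=
    { toFun := fun q => (fun l => ∫ x : ℝ, (q : ℝ[X]).eval x * x ^ (l : ℕ) * weight V a t x,
        fun l => ∫ x : ℝ, (q : ℝ[X]).eval x * x ^ (l : ℕ) * weight V (-a) t x)
      map_add' := fun p q => by
        ext l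
        · simp only [Submodule.coe_add, eval_add, add_mul]
          exact integral_add (integrable_eval_mul_pow_mul_weight hV ht _ _ _)
            (integrable_eval_mul_pow_mul_weight hV ht _ _ _)
        · simp only [Submodule.coe_add, eval_add, add_mul]
          exact integral_add (integrable_eval_mul_pow_mul_weight hV ht _ _ _)
            (integrable_eval_mul_pow_mul_weight hV ht _ _ _)
      map_smul' := fun r q => by
        ext l <;> simp [mul_assoc, integral_const_mul] }
  have hinj : Function.Injective L := by
    rw [← LinearMap.ker_eq_bot, LinearMap.ker_eq_bot']
    intro q hq
    refine Subtype.ext (IsOrth.eq_zero_of_degree_lt hV ht ha (k := k) ⟨fun l hl => ?_,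
      fun l hl => ?_⟩ (mem_degreeLT.1 q.2))
    · exact congrFun (congrArg Prod.fst hq) ⟨l, hl⟩
    · exact congrFun (congrArg Prod.snd hq) ⟨l, hl⟩
  have hsurj : Function.Surjective L := by
    rwa [← LinearMap.injective_iff_surjective_of_finrank_eq_finrank]
    rw [Module.finrank_prod, (degreeLTEquiv ℝ _).finrank_eq]
    simp
  obtain ⟨q, hq⟩ := hsurj (fun l => ∫ x : ℝ, (X ^ (k.1 + k.2) : ℝ[X]).eval x * x ^ (l : ℕ) *
    weight V a t x, fun l => ∫ x : ℝ, (X ^ (k.1 + k.2) : ℝ[X]).eval x * x ^ (l : ℕ) *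
    weight V (-a) t x)
  have hqd : (q : ℝ[X]).degree < (k.1 + k.2 : ℕ) := mem_degreeLT.1 q.2
  refine ⟨X ^ (k.1 + k.2) - (q : ℝ[X]), monic_X_pow_sub hqd, ?_, fun l hl => ?_, fun l hl => ?_⟩
  · rw [natDegree_eq_of_degree_eq (degree_sub_eq_left_of_degree_lt
      (by rwa [degree_X_pow])), natDegree_X_pow]
  · simp only [eval_sub, sub_mul]
    rw [integral_sub (integrable_eval_mul_pow_mul_weight hV ht _ _ _)
      (integrable_eval_mul_pow_mul_weight hV ht _ _ _), sub_eq_zero]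
    exact (congrFun (congrArg Prod.fst hq) ⟨l, hl⟩).symm
  · simp only [eval_sub, sub_mul]
    rw [integral_sub (integrable_eval_mul_pow_mul_weight hV ht _ _ _)
      (integrable_eval_mul_pow_mul_weight hV ht _ _ _), sub_eq_zero]
    exact (congrFun (congrArg Prod.snd hq) ⟨l, hl⟩).symm

end

/-! ### Zeros of neighbouring multiple orthogonal polynomials -/

section

variable {V : ℝ[X]} (hV : IsConfining V) {a t : ℝ} (ht : 0 < t) {k k' : ℕ × ℕ} {P Q : ℝ[X]}

include hV ht in
theorem IsMOP.exists_eq_prod (ha : a ≠ 0) (hP : IsMOP V a t k P) :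
    ∃ s : Finset ℝ, s.card = k.1 + k.2 ∧ P = ∏ y ∈ s, (X - C y) := by
  obtain ⟨s, hs, hdvd⟩ := hP.isOrth.exists_finset hV ht ha hP.monic.ne_zero (E := 1) (by simp)
    (one_mul P).symm
  have h1 := natDegree_le_of_dvd hdvd hP.monic.ne_zero
  rw [natDegree_prod_X_sub_C_finset, hP.degree] at h1
  refine ⟨s, by omega, ?_⟩
  refine eq_of_monic_of_dvd_of_natDegree_le (monic_prod_of_monic _ _ fun y _ => monic_X_sub_C y)
    hP.monic hdvd ?_
  rw [natDegree_prod_X_sub_C_finset, hP.degree]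
  exact hs

/-- `k'` arises from `k` by one step in one of the two directions. -/
def IsStep (k k' : ℕ × ℕ) : Prop := k' = k + (1, 0) ∨ k' = k + (0, 1)

theorem IsStep.le_fst (h : IsStep k k') : k.1 ≤ k'.1 := by
  rcases h with rfl | rfl <;> simp

theorem IsStep.le_snd (h : IsStep k k') : k.2 ≤ k'.2 := by
  rcases h with rfl | rfl <;> simp

theorem IsStep.size (h : IsStep k k') : k'.1 + k'.2 = k.1 + k.2 + 1 := by
  rcases h with rfl | rfl <;> simp <;> omega

theorem sq_dvd_of_double_root {F : ℝ[X]} {y : ℝ} (h0 : F.eval y = 0)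
    (h1 : (derivative F).eval y = 0) : (X - C y) ^ 2 ∣ F := by
  obtain ⟨g, rfl⟩ := dvd_iff_isRoot.2 h0
  simp at h1
  obtain ⟨g', rfl⟩ := dvd_iff_isRoot.2 h1
  exact ⟨g', by ring⟩

include hV ht in
/-- A nonzero polynomial with the orthogonality conditions of index `k` and of degree at most
`k₁ + k₂ + 1` has no double real root. -/
theorem IsOrth.not_double_root (ha : a ≠ 0) (h : IsOrth V a t k Q) (hQ : Q ≠ 0)
    (hd : Q.natDegree ≤ k.1 + k.2 + 1) {y : ℝ} (h0 : Q.eval y = 0)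
    (h1 : (derivative Q).eval y = 0) : False := by
  obtain ⟨g, hg⟩ := sq_dvd_of_double_root h0 h1
  have hg0 : g ≠ 0 := right_ne_zero_of_mul (hg ▸ hQ)
  have h2 := h.le_natDegree hV ht ha hQ (fun x => by simp [sq_nonneg]) hg
  rw [hg, natDegree_mul (pow_ne_zero _ (X_sub_C_ne_zero y)) hg0, natDegree_pow,
    natDegree_X_sub_C] at hd
  omega

include hV ht in
/-- At a zero `y` of the Wronskian of two neighbouring polynomials, a nontrivial combination
`A Q - B P` would have a double root, hence too few sign changes. -/
theorem wronskian_ne_zero (ha : a ≠ 0) (hP : IsMOP V a t k P) (hQ : IsMOP V a t k' Q)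
    (hk : IsStep k k') (y : ℝ) :
    P.eval y * (derivative Q).eval y - (derivative P).eval y * Q.eval y ≠ 0 := by
  intro hW
  have hdP : P.natDegree = k.1 + k.2 := hP.degree
  have hdQ : Q.natDegree = k.1 + k.2 + 1 := by rw [hQ.degree, hk.size]
  have hQo : IsOrth V a t k Q := hQ.isOrth.mono hk.le_fst hk.le_snd
  -- `A Q - B P` is nonzero and has a double root at `y`
  have key : ∀ A B : ℝ, (A ≠ 0 ∨ B ≠ 0) → A * Q.eval y = B * P.eval y →
      A * (derivative Q).eval y = B * (derivative P).eval y → False := by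
    intro A B hAB h0 h1
    have horth := (hQo.C_mul A).sub hV ht (hP.isOrth.C_mul B)
    refine horth.not_double_root hV ht ha (fun hz => ?_) ?_ (y := y) (by simp [h0]) (by simp [h1])
    · have hA : A = 0 := by
        have := congrArg (fun F => F.coeff (k.1 + k.2 + 1)) hz
        have h2 : Q.coeff (k.1 + k.2 + 1) = 1 := by rw [← hdQ]; exact hQ.monic
        have h3 : P.coeff (k.1 + k.2 + 1) = 0 := coeff_eq_zero_of_natDegree_lt (by omega)
        simpa [h2, h3] using this
      have hB : B = 0 := by
        have := congrArg (fun F => F.coeff (k.1 + k.2)) hz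
        have h2 : P.coeff (k.1 + k.2) = 1 := by rw [← hdP]; exact hP.monic
        simpa [h2, hA] using this
      exact hAB.elim (fun h => h hA) (fun h => h hB)
    · refine (natDegree_sub_le _ _).trans (max_le ((natDegree_C_mul_le _ _).trans hdQ.le)
        ((natDegree_C_mul_le _ _).trans ?_))
      omega
  by_cases h0 : P.eval y = 0 ∧ Q.eval y = 0
  · by_cases h1 : (derivative P).eval y = 0
    · exact hP.isOrth.not_double_root hV ht ha hP.monic.ne_zero (by omega) h0.1 h1
    · exact key ((derivative P).eval y) ((derivative Q).eval y) (Or.inl h1)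
        (by rw [h0.1, h0.2, mul_zero, mul_zero]) (mul_comm _ _)
  · exact key (P.eval y) (Q.eval y) (by tauto) (mul_comm _ _) (by linarith)

theorem eval_derivative_prod_X_sub_C {s : Finset ℝ} {x : ℝ} (hx : x ∈ s) :
    (derivative (∏ y ∈ s, (X - C y))).eval x = ∏ y ∈ s.erase x, (x - y) := by
  rw [← Finset.mul_prod_erase s _ hx]
  simp [eval_prod]

include hV ht in
/-- Zeros of neighbouring polynomials interlace, in the form of a partial fraction decomposition of
their quotient with positive coefficients. -/
theorem exists_partialFraction (ha : a ≠ 0) (hP : IsMOP V a t k P) (hQ : IsMOP V a t k' Q)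
    (hk : IsStep k k') :
    ∃ (s : Finset ℝ) (c : ℝ → ℝ), Q = ∏ y ∈ s, (X - C y) ∧ (∀ x ∈ s, 0 < c x) ∧
      ∑ x ∈ s, c x = 1 ∧ P = ∑ x ∈ s, C (c x) * ∏ y ∈ s.erase x, (X - C y) := by
  obtain ⟨s, hcard, hQs⟩ := hQ.exists_eq_prod hV ht ha
  have hR : ∀ x ∈ s, ∏ y ∈ s.erase x, (x - y) ≠ 0 := fun x _ =>
    Finset.prod_ne_zero_iff.2 fun y hy => sub_ne_zero.2 (Finset.ne_of_mem_erase hy).symm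
  have hmonic : ∀ x, (∏ y ∈ s.erase x, (X - C y : ℝ[X])).Monic := fun x =>
    monic_prod_of_monic _ _ fun y _ => monic_X_sub_C y
  have hdeg : ∀ x ∈ s, (∏ y ∈ s.erase x, (X - C y : ℝ[X])).natDegree = k.1 + k.2 := fun x hx => by
    rw [natDegree_prod_X_sub_C_finset, Finset.card_erase_of_mem hx, hcard, hk.size]
    rfl
  set c : ℝ → ℝ := fun x => P.eval x / ∏ y ∈ s.erase x, (x - y) with hc
  -- Lagrange interpolation at the zeros of `Q`
  have hPs : P = ∑ x ∈ s, C (c x) * ∏ y ∈ s.erase x, (X - C y) := by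
    refine eq_of_degrees_lt_of_eval_finset_eq s ?_ ?_ fun x hx => ?_
    · rw [degree_eq_natDegree hP.monic.ne_zero, hP.degree, hcard, hk.size]
      exact_mod_cast Nat.lt_succ_self _
    · refine (degree_sum_le _ _).trans_lt ((Finset.sup_lt_iff
        (WithBot.bot_lt_coe _)).2 fun x hx => ?_)
      refine (degree_le_natDegree).trans_lt ?_
      have := (natDegree_C_mul_le (c x) (∏ y ∈ s.erase x, (X - C y))).trans (hdeg x hx).le
      rw [hcard, hk.size]
      exact_mod_cast Nat.lt_succ_of_le this
    · rw [eval_finsetSum, Finset.sum_eq_single_of_mem x hx]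
      · simp [eval_prod, hc, hR x hx]
      · intro z hz hzx
        have hmem : x ∈ s.erase z := Finset.mem_erase.2 ⟨hzx.symm, hx⟩
        rw [eval_mul, eval_prod, Finset.prod_eq_zero hmem (by simp), mul_zero]
  have hsum : ∑ x ∈ s, c x = 1 := by
    have h1 : P.coeff (k.1 + k.2) = 1 := by rw [← hP.degree]; exact hP.monic
    rw [hPs, finsetSum_coeff] at h1
    rw [← h1]
    refine Finset.sum_congr rfl fun x hx => ?_
    rw [coeff_C_mul, ← hdeg x hx]
    have := hmonic x
    rw [Monic, leadingCoeff] at this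
    rw [this, mul_one]
  -- the coefficients have the sign of the Wronskian, which is constant
  have hcW : ∀ x ∈ s, c x = (P.eval x * (derivative Q).eval x - (derivative P).eval x * Q.eval x)
      / (∏ y ∈ s.erase x, (x - y)) ^ 2 := by
    intro x hx
    have h1 : Q.eval x = 0 := by
      rw [hQs, eval_prod, Finset.prod_eq_zero hx (by simp)]
    rw [h1, hQs, eval_derivative_prod_X_sub_C hx, mul_zero, sub_zero, hc]
    have := hR x hx
    field_simp
  refine ⟨s, c, hQs, ?_, hsum, hPs⟩
  rcases pos_or_neg_of_continuous_ne_zero (h := fun y =>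
      P.eval y * (derivative Q).eval y - (derivative P).eval y * Q.eval y) (by fun_prop)
    (wronskian_ne_zero hV ht ha hP hQ hk) with h | h
  · intro x hx
    rw [hcW x hx]
    exact div_pos (h x) (sq_pos_of_ne_zero (hR x hx))
  · exfalso
    have : ∑ x ∈ s, c x ≤ 0 := Finset.sum_nonpos fun x hx => by
      rw [hcW x hx]
      exact div_nonpos_of_nonpos_of_nonneg (h x).le (sq_nonneg _)
    linarith

/-- All real zeros of `P` lie in `[-r, r]`. -/
def RootsIn (r : ℝ) (P : ℝ[X]) : Prop := ∀ x, P.eval x = 0 → |x| ≤ r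

theorem aeval_prod_X_sub_C (s : Finset ℝ) (z : ℂ) :
    aeval z (∏ y ∈ s, (X - C y : ℝ[X])) = ∏ y ∈ s, (z - (y : ℂ)) := by
  simp [map_prod]

theorem aeval_ofReal (F : ℝ[X]) (y : ℝ) : aeval (y : ℂ) F = ((F.eval y : ℝ) : ℂ) := by
  have := aeval_algebraMap_apply ℂ y F
  rwa [coe_aeval_eq_eval] at this

include hV ht in
/-- The quotient of neighbouring polynomials is the Stieltjes transform of a probability measure
on the zeros of the larger one. -/
theorem exists_stieltjes (ha : a ≠ 0) (hP : IsMOP V a t k P) (hQ : IsMOP V a t k' Q)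
    (hk : IsStep k k') :
    ∃ (s : Finset ℝ) (c : ℝ → ℝ), Q = ∏ y ∈ s, (X - C y) ∧ (∀ x ∈ s, 0 < c x) ∧
      ∑ x ∈ s, c x = 1 ∧ ∀ z : ℂ, aeval z Q ≠ 0 →
        aeval z P = aeval z Q * ∑ x ∈ s, (c x : ℂ) / (z - x) := by
  obtain ⟨s, c, hQs, hpos, hsum, hPs⟩ := exists_partialFraction hV ht ha hP hQ hk
  refine ⟨s, c, hQs, hpos, hsum, fun z hz => ?_⟩
  rw [hQs, aeval_prod_X_sub_C] at hz ⊢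
  rw [hPs, map_sum, Finset.mul_sum]
  refine Finset.sum_congr rfl fun x hx => ?_
  rw [map_mul, aeval_prod_X_sub_C, ← Finset.mul_prod_erase s _ hx]
  have : z - (x : ℂ) ≠ 0 := Finset.prod_ne_zero_iff.1 hz x hx
  simp
  field_simp

theorem rootsIn_prod {r : ℝ} {s : Finset ℝ} :
    RootsIn r (∏ y ∈ s, (X - C y)) ↔ ∀ x ∈ s, |x| ≤ r := by
  refine forall_congr' fun x => ?_
  rw [eval_prod, Finset.prod_eq_zero_iff]
  simp [sub_eq_zero]

include hV ht in
/-- The zeros of the smaller polynomial lie in the same interval: outside it the Stieltjes transform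
of a probability measure has a fixed sign. -/
theorem RootsIn.of_step (ha : a ≠ 0) (hP : IsMOP V a t k P) (hQ : IsMOP V a t k' Q)
    (hk : IsStep k k') {r : ℝ} (hr : RootsIn r Q) : RootsIn r P := by
  obtain ⟨s, c, hQs, hpos, hsum, hPs⟩ := exists_stieltjes hV ht ha hP hQ hk
  have hs : ∀ x ∈ s, |x| ≤ r := rootsIn_prod.1 (hQs ▸ hr)
  have hne : s.Nonempty := by
    by_contra h
    rw [Finset.not_nonempty_iff_eq_empty.1 h] at hsum
    simp at hsum
  intro y hy
  by_contra! hlt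
  have hQy : Q.eval y ≠ 0 := fun h => absurd (hr y h) (not_le.2 hlt)
  have h1 := hPs (y : ℂ) (by rw [aeval_ofReal]; exact_mod_cast hQy)
  rw [aeval_ofReal, aeval_ofReal, hy] at h1
  have h3 : (0 : ℝ) = Q.eval y * ∑ x ∈ s, c x / (y - x) := by exact_mod_cast h1
  have h4 : ∑ x ∈ s, c x / (y - x) = 0 := by
    rcases mul_eq_zero.1 h3.symm with h | h
    exacts [absurd h hQy, h]
  rcases lt_abs.1 hlt with h | h
  · have : 0 < ∑ x ∈ s, c x / (y - x) := Finset.sum_pos (fun x hx => div_pos (hpos x hx) (by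
      have := abs_le.1 (hs x hx); linarith)) hne
    linarith
  · have : ∑ x ∈ s, c x / (y - x) < 0 := Finset.sum_neg (fun x hx => div_neg_of_pos_of_neg
      (hpos x hx) (by have := abs_le.1 (hs x hx); linarith)) hne
    linarith

theorem RootsIn.aeval_ne_zero {s : Finset ℝ} {r : ℝ} (hs : RootsIn r (∏ y ∈ s, (X - C y)))
    {z : ℂ} (hz : r < ‖z‖ ∨ z.im ≠ 0) : aeval z (∏ y ∈ s, (X - C y : ℝ[X])) ≠ 0 := by
  rw [aeval_prod_X_sub_C, Finset.prod_ne_zero_iff]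
  intro y hy h
  have hzy := sub_eq_zero.1 h
  rcases hz with hz | hz
  · rw [hzy, Complex.norm_real, Real.norm_eq_abs] at hz
    exact absurd (rootsIn_prod.1 hs y hy) (not_le.2 hz)
  · exact hz (by simp [hzy])

include hV ht in
theorem IsMOP.aeval_ne_zero (ha : a ≠ 0) (hP : IsMOP V a t k P) {r : ℝ} (hr : RootsIn r P)
    {z : ℂ} (hz : r < ‖z‖ ∨ z.im ≠ 0) : aeval z P ≠ 0 := by
  obtain ⟨s, -, rfl⟩ := hP.exists_eq_prod hV ht ha
  exact hr.aeval_ne_zero hz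

include hV ht in
/-- Far from the zeros, the quotient of neighbouring polynomials is comparable with `z`. -/
theorem norm_aeval_step_bounds (ha : a ≠ 0) (hP : IsMOP V a t k P) (hQ : IsMOP V a t k' Q)
    (hk : IsStep k k') {r : ℝ} (hr0 : 0 < r) (hr : RootsIn r Q) {z : ℂ} (hz : 3 * r ≤ ‖z‖) :
    ‖aeval z Q‖ ≤ 2 * ‖z‖ * ‖aeval z P‖ ∧ ‖z‖ * ‖aeval z P‖ ≤ 2 * ‖aeval z Q‖ := by
  obtain ⟨s, c, hQs, hpos, hsum, hPs⟩ := exists_stieltjes hV ht ha hP hQ hk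
  have hs : ∀ x ∈ s, |x| ≤ r := rootsIn_prod.1 (hQs ▸ hr)
  have hQz : aeval z Q ≠ 0 := hQ.aeval_ne_zero hV ht ha hr (Or.inl (by linarith))
  have h1 := hPs z hQz
  set G := ∑ x ∈ s, (c x : ℂ) / (z - x) with hG
  have hdist : ∀ x ∈ s, 2 * r ≤ ‖z - (x : ℂ)‖ := fun x hx => by
    have h2 := norm_sub_norm_le z (x : ℂ)
    rw [Complex.norm_real, Real.norm_eq_abs] at h2
    have := hs x hx
    linarith
  have h2 : ‖z * G - 1‖ ≤ 1 / 2 := by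
    have h3 : z * G - 1 = ∑ x ∈ s, (c x : ℂ) * (x / (z - x)) := by
      have : (1 : ℂ) = ∑ x ∈ s, (c x : ℂ) := by exact_mod_cast hsum.symm
      rw [this, hG, Finset.mul_sum, ← Finset.sum_sub_distrib]
      refine Finset.sum_congr rfl fun x hx => ?_
      have : z - (x : ℂ) ≠ 0 := norm_pos_iff.1 (by have := hdist x hx; linarith)
      field_simp
      ring
    rw [h3]
    refine (norm_sum_le _ _).trans ?_
    have : (1 / 2 : ℝ) = ∑ x ∈ s, c x * (1 / 2) := by rw [← Finset.sum_mul, hsum, one_mul]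
    rw [this]
    refine Finset.sum_le_sum fun x hx => ?_
    rw [norm_mul, Complex.norm_real, Real.norm_eq_abs, abs_of_pos (hpos x hx), norm_div,
      Complex.norm_real, Real.norm_eq_abs]
    refine mul_le_mul_of_nonneg_left ?_ (hpos x hx).le
    have h4 := hdist x hx
    rw [div_le_div_iff₀ (by linarith) two_pos]
    have := hs x hx
    linarith
  have h3 : ‖z * G‖ ≤ 2 := by
    have := norm_sub_norm_le (z * G) 1
    rw [norm_one] at this
    linarith
  have h4 : 1 / 2 ≤ ‖z * G‖ := by
    have := norm_sub_norm_le 1 (z * G)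
    rw [norm_one, norm_sub_rev] at this
    linarith
  rw [norm_mul] at h3 h4
  rw [h1, norm_mul]
  have hQn := norm_nonneg (aeval z Q)
  constructor
  · nlinarith
  · nlinarith

end

/-! ### Bordered Hermitian matrices and interlacing -/

section

variable {n : ℕ}

/-- The matrix `M` bordered by a first row `(y, v)` and the conjugate first column. -/
def bord (y : ℝ) (v : Fin n → ℂ) (M : Matrix (Fin n) (Fin n) ℂ) :
    Matrix (Fin (n + 1)) (Fin (n + 1)) ℂ :=
  Matrix.of (Fin.cons (Fin.cons (y : ℂ) v) fun i => Fin.cons (star (v i)) (M i))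

@[simp] theorem bord_zero_zero (y : ℝ) (v : Fin n → ℂ) (M : Matrix (Fin n) (Fin n) ℂ) :
    bord y v M 0 0 = y := rfl

@[simp] theorem bord_zero_succ (y : ℝ) (v : Fin n → ℂ) (M : Matrix (Fin n) (Fin n) ℂ) (j : Fin n) :
    bord y v M 0 j.succ = v j := rfl

@[simp] theorem bord_succ_zero (y : ℝ) (v : Fin n → ℂ) (M : Matrix (Fin n) (Fin n) ℂ) (i : Fin n) :
    bord y v M i.succ 0 = star (v i) := rfl

@[simp] theorem bord_succ_succ (y : ℝ) (v : Fin n → ℂ) (M : Matrix (Fin n) (Fin n) ℂ)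
    (i j : Fin n) : bord y v M i.succ j.succ = M i j := rfl

/-- The coordinates of a bordered Hermitian matrix. -/
def bordCoord (y : ℝ) (v : Fin n → ℂ) (x : Fin n → Fin n → ℝ) : Fin (n + 1) → Fin (n + 1) → ℝ :=
  Fin.cons (Fin.cons y fun j => (v j).re) fun i => Fin.cons (v i).im (x i)

theorem hermitian_bordCoord (y : ℝ) (v : Fin n → ℂ) (x : Fin n → Fin n → ℝ) :
    hermitian (bordCoord y v x) = bord y v (hermitian x) := by
  ext i j
  refine Fin.cases ?_ (fun i => ?_) i <;> refine Fin.cases ?_ (fun j => ?_) j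
  · simp [hermitian, bordCoord]
  · simp only [hermitian, bordCoord, Matrix.of_apply, bord_zero_succ]
    rw [if_neg (Fin.succ_ne_zero j).symm, if_pos (Fin.succ_pos j)]
    simp [Complex.re_add_im]
  · simp only [hermitian, bordCoord, Matrix.of_apply, bord_succ_zero]
    rw [if_neg (Fin.succ_ne_zero i), if_neg (by simp)]
    apply Complex.ext <;> simp
  · simp [hermitian, bordCoord]

theorem isHermitian_hermitian (x : Fin n → Fin n → ℝ) : (hermitian x).IsHermitian := by
  ext i j
  simp only [Matrix.conjTranspose_apply, hermitian, Matrix.of_apply]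
  rcases lt_trichotomy i j with h | rfl | h
  · rw [if_neg h.ne', if_neg (not_lt.2 h.le), if_neg h.ne, if_pos h]
    apply Complex.ext <;> simp
  · simp
  · rw [if_neg h.ne, if_pos h, if_neg h.ne', if_neg (not_lt.2 h.le)]
    apply Complex.ext <;> simp

theorem isHermitian_bord (y : ℝ) (v : Fin n → ℂ) {M : Matrix (Fin n) (Fin n) ℂ}
    (hM : M.IsHermitian) : (bord y v M).IsHermitian := by
  ext i j
  refine Fin.cases ?_ (fun i => ?_) i <;> refine Fin.cases ?_ (fun j => ?_) j
  · simp
  · simp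
  · simp
  · simpa using hM.apply i j

/-- Coordinates of a real diagonal matrix. -/
def diagCoord (l : Fin n → ℝ) : Fin n → Fin n → ℝ := fun i j => if i = j then l i else 0

theorem hermitian_diagCoord (l : Fin n → ℝ) :
    hermitian (diagCoord l) = Matrix.diagonal fun i => (l i : ℂ) := by
  ext i j
  by_cases h : i = j
  · subst h; simp [hermitian, diagCoord]
  · simp [hermitian, diagCoord, h, Ne.symm h]

theorem isHermitian_diagonal_ofReal (l : Fin n → ℝ) :
    (Matrix.diagonal fun i => (l i : ℂ)).IsHermitian := by
  rw [← hermitian_diagCoord]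
  exact isHermitian_hermitian _

/-- Conjugating the corner of a bordered matrix amounts to rotating the border. -/
theorem charpoly_bord_conj (y : ℝ) (v : Fin n → ℂ) (M : Matrix (Fin n) (Fin n) ℂ)
    (U : Matrix (Fin n) (Fin n) ℂ) (hU : U * star U = 1) :
    (bord y v (U * M * star U)).charpoly = (bord y (Matrix.vecMul v U) M).charpoly := by
  have hU' : star U * U = 1 := mul_eq_one_comm.1 hU
  let B (W : Matrix (Fin n) (Fin n) ℂ) : Matrix (Fin (n + 1)) (Fin (n + 1)) ℂ := bord 1 0 W
  have hB : ∀ W W' : Matrix (Fin n) (Fin n) ℂ, W * W' = 1 → B W * B W' = 1 := by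
    intro W W' h
    ext i j
    refine Fin.cases ?_ (fun i => ?_) i <;> refine Fin.cases ?_ (fun j => ?_) j
    · simp [B, Matrix.mul_apply, Fin.sum_univ_succ]
    · simp [B, Matrix.mul_apply, Fin.sum_univ_succ]
      exact (Matrix.one_apply_ne (Fin.succ_ne_zero j).symm).symm
    · simp [B, Matrix.mul_apply, Fin.sum_univ_succ]
    · have := congrFun (congrFun h i) j
      simp only [Matrix.mul_apply, Matrix.one_apply] at this
      simp [B, Matrix.mul_apply, Fin.sum_univ_succ, this, Matrix.one_apply]
  have hconj : bord y v (U * M * star U) = B U * bord y (Matrix.vecMul v U) M * B (star U) := by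
    have hv : Matrix.vecMul (Matrix.vecMul v U) (star U) = v := by
      rw [Matrix.vecMul_vecMul, hU, Matrix.vecMul_one]
    ext i j
    refine Fin.cases ?_ (fun i => ?_) i <;> refine Fin.cases ?_ (fun j => ?_) j
    · simp [B, Matrix.mul_apply, Fin.sum_univ_succ]
    · have := congrFun hv j
      simp only [Matrix.vecMul, dotProduct] at this
      simp only [B, Matrix.mul_apply, Fin.sum_univ_succ, bord_zero_zero, bord_zero_succ,
        bord_succ_succ, bord_succ_zero]
      simp [Matrix.vecMul, dotProduct]
      exact this.symm
    · have := congrArg star (congrFun hv i)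
      simp only [Matrix.vecMul, dotProduct, star_sum, star_mul', Matrix.star_apply,
        star_star] at this
      simp only [B, Matrix.mul_apply, Fin.sum_univ_succ, bord_zero_zero, bord_zero_succ,
        bord_succ_succ, bord_succ_zero]
      simp [Matrix.vecMul, dotProduct]
      rw [← Complex.star_def, ← this]
      exact Finset.sum_congr rfl fun k _ => by simp [mul_comm]
    · simp [B, Matrix.mul_apply, Fin.sum_univ_succ]
  rw [hconj, mul_assoc, Matrix.charpoly_mul_comm, mul_assoc, hB _ _ hU', mul_one]

/-! ### The interlacing coordinates -/

/-- The points `l` strictly interlace the points `μ`. -/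
def Interlace (μ : Fin n → ℝ) (l : Fin (n + 1) → ℝ) : Prop :=
  ∀ i, l i.castSucc < μ i ∧ μ i < l i.succ

theorem Interlace.strictMono_right {μ : Fin n → ℝ} {l : Fin (n + 1) → ℝ} (h : Interlace μ l) :
    StrictMono l :=
  Fin.strictMono_iff_lt_succ.2 fun i => (h i).1.trans (h i).2

theorem Interlace.strictMono_left {μ : Fin n → ℝ} {l : Fin (n + 1) → ℝ} (h : Interlace μ l) :
    StrictMono μ := fun i j hij =>
  ((h i).2.trans_le (h.strictMono_right.monotone (by
    rw [Fin.le_iff_val_le_val]; simpa using Nat.succ_le_of_lt hij))).trans (h j).1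

/-- The characteristic polynomial of a diagonal matrix `diag μ` bordered by a corner entry `y` and
a vector whose entries have squared moduli `r`. -/
def arrowPoly (y : ℝ) (r μ : Fin n → ℝ) : ℝ[X] :=
  (X - C y) * ∏ i, (X - C (μ i)) - ∑ i, C (r i) * ∏ j ∈ Finset.univ.erase i, (X - C (μ j))

theorem degree_arrow_sum_lt (r μ : Fin n → ℝ) :
    (∑ i, C (r i) * ∏ j ∈ Finset.univ.erase i, (X - C (μ j)) : ℝ[X]).degree < n := by
  refine (degree_sum_le _ _).trans_lt ((Finset.sup_lt_iff (WithBot.bot_lt_coe _)).2 fun i _ => ?_)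
  refine degree_le_natDegree.trans_lt ?_
  have h1 := natDegree_C_mul_le (r i) (∏ j ∈ Finset.univ.erase i, (X - C (μ j)))
  rw [natDegree_prod_of_monic _ _ fun _ _ => monic_X_sub_C _, Finset.sum_congr rfl
      fun _ _ => natDegree_X_sub_C _, Finset.sum_const, smul_eq_mul, mul_one,
      Finset.card_erase_of_mem (Finset.mem_univ i), Finset.card_univ, Fintype.card_fin] at h1
  have := i.2
  exact_mod_cast (show _ < n by omega)

theorem arrow_prod_eq (y : ℝ) (μ : Fin n → ℝ) :
    (X - C y) * ∏ i, (X - C (μ i)) = ∏ j : Fin (n + 1), (X - C ((Fin.cons y μ : _ → ℝ) j)) := by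
  rw [Fin.prod_univ_succ]
  simp

theorem natDegree_prod_fin {K : Type*} [Field K] (l : Fin n → K) :
    (∏ j, (X - C (l j))).natDegree = n := by
  rw [natDegree_prod_of_monic _ _ fun _ _ => monic_X_sub_C _]
  simp

theorem monic_prod_fin {K : Type*} [Field K] (l : Fin n → K) : (∏ j, (X - C (l j))).Monic :=
  monic_prod_of_monic _ _ fun _ _ => monic_X_sub_C _

theorem coeff_prod_fin (l : Fin (n + 1) → ℝ) : (∏ j, (X - C (l j))).coeff n = -∑ j, l j := by
  have := prod_X_sub_C_nextCoeff (s := Finset.univ) l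
  rwa [nextCoeff_of_natDegree_pos (by rw [natDegree_prod_fin]; omega), natDegree_prod_fin] at this

theorem eval_arrow_sum (r μ : Fin n → ℝ) (i : Fin n) :
    (∑ i, C (r i) * ∏ j ∈ Finset.univ.erase i, (X - C (μ j))).eval (μ i)
      = r i * ∏ j ∈ Finset.univ.erase i, (μ i - μ j) := by
  rw [eval_finsetSum, Finset.sum_eq_single_of_mem i (Finset.mem_univ i)]
  · simp [eval_prod]
  · intro k _ hk
    rw [eval_mul, eval_prod, Finset.prod_eq_zero (Finset.mem_erase.2 ⟨hk.symm, Finset.mem_univ i⟩)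
      (by simp), mul_zero]

theorem eval_arrowPoly (y : ℝ) (r μ : Fin n → ℝ) (i : Fin n) :
    (arrowPoly y r μ).eval (μ i) = -(r i * ∏ j ∈ Finset.univ.erase i, (μ i - μ j)) := by
  rw [arrowPoly, eval_sub, eval_arrow_sum, eval_mul, eval_prod,
    Finset.prod_eq_zero (Finset.mem_univ i) (by simp), mul_zero, zero_sub]

theorem arrow_denom_ne_zero {μ : Fin n → ℝ} (hμ : Function.Injective μ) (i : Fin n) :
    ∏ j ∈ Finset.univ.erase i, (μ i - μ j) ≠ 0 :=
  Finset.prod_ne_zero_iff.2 fun _ hj => sub_ne_zero.2 (hμ.ne (Finset.ne_of_mem_erase hj).symm)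

/-- The corner entry and squared border moduli are determined by the eigenvalues of the bordered
matrix and of its corner. -/
theorem arrowPoly_eq_prod_iff {μ : Fin n → ℝ} (hμ : Function.Injective μ) (l : Fin (n + 1) → ℝ)
    (y : ℝ) (r : Fin n → ℝ) :
    arrowPoly y r μ = ∏ j, (X - C (l j)) ↔ y = ∑ j, l j - ∑ i, μ i ∧
      ∀ i, r i = -(∏ j, (μ i - l j)) / ∏ j ∈ Finset.univ.erase i, (μ i - μ j) := by
  constructor
  · intro h
    constructor
    · have h1 := congrArg (fun F => F.coeff n) h
      simp only [arrowPoly, arrow_prod_eq, coeff_sub, coeff_prod_fin] at h1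
      rw [coeff_eq_zero_of_degree_lt (degree_arrow_sum_lt r μ), Fin.sum_univ_succ] at h1
      simp only [Fin.cons_zero, Fin.cons_succ] at h1
      linarith
    · intro i
      have h1 := congrArg (fun F => F.eval (μ i)) h
      simp only [eval_arrowPoly, eval_prod, eval_sub, eval_X, eval_C] at h1
      rw [eq_div_iff (arrow_denom_ne_zero hμ i)]
      linarith
  · rintro ⟨hy, hr⟩
    have key : (X - C y) * ∏ i, (X - C (μ i)) - ∏ j, (X - C (l j))
        = ∑ i, C (r i) * ∏ j ∈ Finset.univ.erase i, (X - C (μ j)) := by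
      refine eq_of_degrees_lt_of_eval_index_eq (s := Finset.univ) (v := μ) hμ.injOn ?_ ?_ ?_
      · rw [Finset.card_univ, Fintype.card_fin, degree_lt_iff_coeff_zero]
        intro m hm
        rw [arrow_prod_eq, coeff_sub]
        rcases hm.eq_or_lt with rfl | hm
        · rw [coeff_prod_fin, coeff_prod_fin, Fin.sum_univ_succ]
          simp only [Fin.cons_zero, Fin.cons_succ]
          linarith
        rcases (Nat.succ_le_of_lt hm).eq_or_lt with rfl | hm
        · have h1 : ∀ l : Fin (n + 1) → ℝ, (∏ j, (X - C (l j))).coeff n.succ = 1 := fun l => by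
            have := monic_prod_fin l
            rwa [Monic, leadingCoeff, natDegree_prod_fin] at this
          rw [h1, h1, sub_self]
        · rw [coeff_eq_zero_of_natDegree_lt (by rw [natDegree_prod_fin]; exact hm),
            coeff_eq_zero_of_natDegree_lt (by rw [natDegree_prod_fin]; exact hm), sub_self]
      · rw [Finset.card_univ, Fintype.card_fin]
        exact degree_arrow_sum_lt r μ
      · intro i _
        rw [eval_arrow_sum, hr i, div_mul_cancel₀ _ (arrow_denom_ne_zero hμ i), eval_sub, eval_mul,
          eval_prod, Finset.prod_eq_zero (Finset.mem_univ i) (by simp), mul_zero, zero_sub,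
          eval_prod]
        simp
    rw [arrowPoly, ← key]
    ring

/-- The sign is `(-1) ^ (number of larger points)`. -/
theorem prod_erase_sign {μ : Fin n → ℝ} (hμ : StrictMono μ) (i : Fin n) :
    0 < (-1 : ℝ) ^ (n - 1 - (i : ℕ)) * ∏ j ∈ Finset.univ.erase i, (μ i - μ j) := by
  have hsplit : Finset.univ.erase i = Finset.Iio i ∪ Finset.Ioi i := by
    ext j
    simp [lt_or_lt_iff_ne]
  have hdisj : Disjoint (Finset.Iio i) (Finset.Ioi i) := by
    rw [Finset.disjoint_left]
    intro j h1 h2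
    exact absurd (Finset.mem_Iio.1 h1) (not_lt.2 (Finset.mem_Ioi.1 h2).le)
  have hneg : ∏ j ∈ Finset.Ioi i, (μ i - μ j)
      = (-1 : ℝ) ^ (n - 1 - (i : ℕ)) * ∏ j ∈ Finset.Ioi i, (μ j - μ i) := by
    rw [← Fin.card_Ioi i, ← Finset.prod_const, ← Finset.prod_mul_distrib]
    exact Finset.prod_congr rfl fun j _ => by ring
  rw [hsplit, Finset.prod_union hdisj, hneg]
  have h1 : 0 < ∏ j ∈ Finset.Iio i, (μ i - μ j) :=
    Finset.prod_pos fun j hj => sub_pos.2 (hμ (Finset.mem_Iio.1 hj))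
  have h2 : 0 < ∏ j ∈ Finset.Ioi i, (μ j - μ i) :=
    Finset.prod_pos fun j hj => sub_pos.2 (hμ (Finset.mem_Ioi.1 hj))
  have h3 : ((-1 : ℝ) ^ (n - 1 - (i : ℕ))) * (-1 : ℝ) ^ (n - 1 - (i : ℕ)) = 1 := by
    rw [← mul_pow]; simp
  calc (0 : ℝ) < (∏ j ∈ Finset.Iio i, (μ i - μ j)) * ∏ j ∈ Finset.Ioi i, (μ j - μ i) :=
        mul_pos h1 h2
    _ = (((-1 : ℝ) ^ (n - 1 - (i : ℕ))) * (-1 : ℝ) ^ (n - 1 - (i : ℕ))) *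
        ((∏ j ∈ Finset.Iio i, (μ i - μ j)) * ∏ j ∈ Finset.Ioi i, (μ j - μ i)) := by
        rw [h3, one_mul]
    _ = _ := by ring

/-- The sign is `(-1) ^ (number of points of l above μ i)`. -/
theorem Interlace.prod_sign {μ : Fin n → ℝ} {l : Fin (n + 1) → ℝ} (h : Interlace μ l) (i : Fin n) :
    0 < (-1 : ℝ) ^ (n - (i : ℕ)) * ∏ j, (μ i - l j) := by
  have hl := h.strictMono_right
  have hsplit : (Finset.univ : Finset (Fin (n + 1)))
      = Finset.Iic i.castSucc ∪ Finset.Ioi i.castSucc := by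
    ext j
    simp [le_or_gt]
  have hdisj : Disjoint (Finset.Iic i.castSucc) (Finset.Ioi i.castSucc) := by
    rw [Finset.disjoint_left]
    intro j h1 h2
    exact absurd (Finset.mem_Iic.1 h1) (not_le.2 (Finset.mem_Ioi.1 h2))
  have hneg : ∏ j ∈ Finset.Ioi i.castSucc, (μ i - l j)
      = (-1 : ℝ) ^ (n - (i : ℕ)) * ∏ j ∈ Finset.Ioi i.castSucc, (l j - μ i) := by
    have hc : (Finset.Ioi i.castSucc).card = n - (i : ℕ) := by
      rw [Fin.card_Ioi]; simp
    rw [← hc, ← Finset.prod_const, ← Finset.prod_mul_distrib]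
    exact Finset.prod_congr rfl fun j _ => by ring
  rw [hsplit, Finset.prod_union hdisj, hneg]
  have h1 : 0 < ∏ j ∈ Finset.Iic i.castSucc, (μ i - l j) :=
    Finset.prod_pos fun j hj => sub_pos.2
      ((hl.monotone (Finset.mem_Iic.1 hj)).trans_lt (h i).1)
  have h2 : 0 < ∏ j ∈ Finset.Ioi i.castSucc, (l j - μ i) :=
    Finset.prod_pos fun j hj => sub_pos.2
      ((h i).2.trans_le (hl.monotone (Fin.castSucc_lt_iff_succ_le.1 (Finset.mem_Ioi.1 hj))))
  have h3 : ((-1 : ℝ) ^ (n - (i : ℕ))) * (-1 : ℝ) ^ (n - (i : ℕ)) = 1 := by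
    rw [← mul_pow]; simp
  calc (0 : ℝ) < (∏ j ∈ Finset.Iic i.castSucc, (μ i - l j)) *
          ∏ j ∈ Finset.Ioi i.castSucc, (l j - μ i) := mul_pos h1 h2
    _ = (((-1 : ℝ) ^ (n - (i : ℕ))) * (-1 : ℝ) ^ (n - (i : ℕ))) *
        ((∏ j ∈ Finset.Iic i.castSucc, (μ i - l j)) *
          ∏ j ∈ Finset.Ioi i.castSucc, (l j - μ i)) := by rw [h3, one_mul]
    _ = _ := by ring

theorem monic_arrowPoly (y : ℝ) (r μ : Fin n → ℝ) :
    (arrowPoly y r μ).Monic ∧ (arrowPoly y r μ).natDegree = n + 1 := by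
  have h1 : (∑ i, C (r i) * ∏ j ∈ Finset.univ.erase i, (X - C (μ j)) : ℝ[X]).degree
      < ((X - C y) * ∏ i, (X - C (μ i))).degree := by
    rw [arrow_prod_eq, degree_eq_natDegree (monic_prod_fin _).ne_zero, natDegree_prod_fin]
    exact (degree_arrow_sum_lt r μ).trans (by exact_mod_cast n.lt_succ_self)
  rw [arrowPoly]
  constructor
  · rw [Monic, leadingCoeff_sub_of_degree_lt h1, arrow_prod_eq]
    exact monic_prod_fin _
  · rw [natDegree_eq_of_degree_eq (degree_sub_eq_left_of_degree_lt h1), arrow_prod_eq,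
      natDegree_prod_fin]

theorem exists_root_between {f : ℝ[X]} {x y : ℝ} (hxy : x < y) (h : f.eval x * f.eval y < 0) :
    ∃ z, x < z ∧ z < y ∧ f.eval z = 0 := by
  have hc : ContinuousOn (fun z => f.eval z) (Set.Icc x y) := f.continuous.continuousOn
  rcases mul_neg_iff.1 h with ⟨h1, h2⟩ | ⟨h1, h2⟩
  · obtain ⟨z, hz, hz0⟩ := intermediate_value_Ioo' hxy.le hc (show (0 : ℝ) ∈ _ from ⟨h2, h1⟩)
    exact ⟨z, hz.1, hz.2, hz0⟩
  · obtain ⟨z, hz, hz0⟩ := intermediate_value_Ioo hxy.le hc (show (0 : ℝ) ∈ _ from ⟨h1, h2⟩)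
    exact ⟨z, hz.1, hz.2, hz0⟩

theorem Monic.eq_prod_of_roots {K : Type*} [Field K] {f : K[X]} {N : ℕ} (hf : f.Monic)
    (hd : f.natDegree = N) {l : Fin N → K} (hl : Function.Injective l)
    (h0 : ∀ j, f.eval (l j) = 0) :
    f = ∏ j, (X - C (l j)) := by
  have hdvd : ∏ j, (X - C (l j)) ∣ f := by
    refine Finset.prod_dvd_of_coprime (fun i _ j _ hij => ?_) fun j _ => dvd_iff_isRoot.2 (h0 j)
    exact isCoprime_X_sub_C_of_isUnit_sub (sub_ne_zero.2 (hl.ne hij)).isUnit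
  exact (eq_of_monic_of_dvd_of_natDegree_le (monic_prod_fin l) hf hdvd
    (by rw [hd, natDegree_prod_fin])).symm ▸ rfl

/-- A monic polynomial of degree `n + 1` whose values at the points `μ` alternate in sign has
`n + 1` real roots that interlace `μ`. -/
theorem exists_interlace_roots {f : ℝ[X]} (hf : f.Monic) (hd : f.natDegree = n + 1)
    {μ : Fin n → ℝ} (hμ : StrictMono μ)
    (hs : ∀ i : Fin n, 0 < (-1 : ℝ) ^ (n - (i : ℕ)) * f.eval (μ i)) :
    ∃ l, Interlace μ l ∧ f = ∏ j, (X - C (l j)) := by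
  have hdeg : 0 < f.degree := natDegree_pos_iff_degree_pos.1 (by omega)
  have htop : Tendsto (fun x => f.eval x) atTop atTop :=
    tendsto_atTop_of_leadingCoeff_nonneg f hdeg (by rw [hf.leadingCoeff]; exact zero_le_one)
  have hX : (-X : ℝ[X]).natDegree = 1 := by simp
  have hbot : Tendsto (fun x => (-1 : ℝ) ^ (n + 1) * f.eval (-x)) atTop atTop := by
    have := tendsto_atTop_of_leadingCoeff_nonneg (C ((-1 : ℝ) ^ (n + 1)) * f.comp (-X))
      (by
        rw [degree_C_mul (by simp), ← natDegree_pos_iff_degree_pos, natDegree_comp, hX]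
        omega)
      (by
        rw [leadingCoeff_mul, leadingCoeff_C, leadingCoeff_comp (by simp), hf.leadingCoeff, hd]
        simp only [leadingCoeff_neg, leadingCoeff_X, one_mul]
        rw [← mul_pow]
        simp)
    refine this.congr fun x => ?_
    simp
  obtain ⟨m, hm⟩ : ∃ m : ℝ, ∀ i, |μ i| < m := by
    obtain ⟨m, hm⟩ := (Set.finite_range fun i => |μ i|).bddAbove
    exact ⟨m + 1, fun i => lt_of_le_of_lt (hm ⟨i, rfl⟩) (lt_add_one m)⟩
  obtain ⟨R, hR⟩ := ((htop.eventually_gt_atTop 0).and (eventually_gt_atTop (max m 0))).exists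
  obtain ⟨L, hL⟩ := ((hbot.eventually_gt_atTop 0).and (eventually_gt_atTop (max m 0))).exists
  -- the interlacing points together with the two outer points, and the sign pattern there
  let q : Fin (n + 2) → ℝ := Fin.cons (-L) (Fin.snoc μ R : Fin (n + 1) → ℝ)
  have hq0 : q 0 = -L := rfl
  have hqm : ∀ i : Fin n, q i.castSucc.succ = μ i := fun i => by simp [q]
  have hql : q (Fin.last n).succ = R := by simp [q]
  have hsign : ∀ k : Fin (n + 2), 0 < (-1 : ℝ) ^ (n + 1 - (k : ℕ)) * f.eval (q k) := by
    intro k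
    refine Fin.cases ?_ (fun k => ?_) k
    · rw [hq0]; exact hL.1
    · refine Fin.lastCases ?_ (fun i => ?_) k
      · rw [hql]; simpa using hR.1
      · rw [hqm]; simpa using hs i
  have hmono : ∀ k : Fin (n + 1), q k.castSucc < q k.succ := by
    intro k
    refine Fin.lastCases ?_ (fun i => ?_) k
    · rw [hql]
      rcases Nat.eq_zero_or_pos n with rfl | hn
      · have : (Fin.last 0).castSucc = (0 : Fin 2) := rfl
        rw [this, hq0]
        have := (le_max_right m 0).trans_lt hR.2
        have := (le_max_right m 0).trans_lt hL.2
        linarith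
      · obtain ⟨n', rfl⟩ := Nat.exists_eq_succ_of_ne_zero hn.ne'
        have : (Fin.last (n' + 1)).castSucc = ((Fin.last n').castSucc.succ : Fin (n' + 1 + 2)) := by
          ext; simp
        rw [this, hqm]
        exact (le_abs_self _).trans_lt ((hm _).trans ((le_max_left m 0).trans_lt hR.2))
    · rw [hqm]
      obtain ⟨i, hi⟩ := i
      rcases i with _ | i
      · have : (Fin.castSucc (Fin.castSucc ⟨0, hi⟩) : Fin (n + 2)) = 0 := rfl
        rw [this, hq0]
        have := neg_abs_le (μ ⟨0, hi⟩)
        have := (hm ⟨0, hi⟩).trans ((le_max_left m 0).trans_lt hL.2)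
        linarith
      · have : (Fin.castSucc (Fin.castSucc ⟨i + 1, hi⟩) : Fin (n + 2))
            = (Fin.castSucc ⟨i, by omega⟩ : Fin (n + 1)).succ := rfl
        rw [this, hqm]
        exact hμ (by simp)
  have hroot : ∀ k : Fin (n + 1), ∃ z, q k.castSucc < z ∧ z < q k.succ ∧ f.eval z = 0 := by
    intro k
    refine exists_root_between (hmono k) ?_
    have h1 := mul_pos (hsign k.castSucc) (hsign k.succ)
    have h2 : (-1 : ℝ) ^ (n + 1 - (k.castSucc : ℕ)) * (-1 : ℝ) ^ (n + 1 - (k.succ : ℕ)) = -1 := by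
      rw [← pow_add]
      refine Odd.neg_one_pow ⟨n - k, ?_⟩
      simp only [Fin.val_castSucc, Fin.val_succ]
      omega
    nlinarith
  choose l hl1 hl2 hl0 using hroot
  have hint : Interlace μ l := by
    intro i
    constructor
    · have := hl2 i.castSucc
      rwa [hqm] at this
    · have := hl1 i.succ
      have h' : i.succ.castSucc = i.castSucc.succ := rfl
      rwa [h', hqm] at this
  exact ⟨l, hint, Monic.eq_prod_of_roots hf hd hint.strictMono_right.injective hl0⟩

end

section

variable {n : ℕ}

theorem charpoly_bord_diagonal {μ : Fin n → ℝ} {l : Fin (n + 1) → ℝ} (h : Interlace μ l) {y : ℝ}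
    {v : Fin n → ℂ} (hp : arrowPoly y (fun i => Complex.normSq (v i)) μ = ∏ j, (X - C (l j))) :
    (bord y v (Matrix.diagonal fun i => (μ i : ℂ))).charpoly = ∏ j, (X - C (l j : ℂ)) := by
  have hinj : Function.Injective fun j => (l j : ℂ) :=
    Complex.ofReal_injective.comp h.strictMono_right.injective
  refine Monic.eq_prod_of_roots (Matrix.charpoly_monic _)
    (by rw [Matrix.charpoly_natDegree_eq_dim, Fintype.card_fin]) hinj fun j => ?_
  have hne : ∀ i, l j - μ i ≠ 0 := by
    intro i hi
    have hli : l j = μ i := sub_eq_zero.1 hi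
    rcases lt_or_ge i.castSucc j with hij | hij
    · have := h.strictMono_right.monotone (Fin.castSucc_lt_iff_succ_le.1 hij)
      exact absurd (h i).2 (not_lt.2 (hli ▸ this))
    · have := h.strictMono_right.monotone hij
      exact absurd (h i).1 (not_lt.2 (hli ▸ this))
  have hneC : ∀ i, (l j : ℂ) - μ i ≠ 0 := fun i => by exact_mod_cast hne i
  have hroot : (l j - y) - ∑ i, Complex.normSq (v i) / (l j - μ i) = 0 := by
    have h1 := congrArg (fun F => F.eval (l j)) hp
    simp only [arrowPoly, eval_sub, eval_mul, eval_prod, eval_X, eval_C, eval_finsetSum] at h1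
    rw [Finset.prod_eq_zero (Finset.mem_univ j) (sub_self (l j))] at h1
    have h2 : ∏ i, (l j - μ i) ≠ 0 := Finset.prod_ne_zero_iff.2 fun i _ => hne i
    have h3 : ∑ i, Complex.normSq (v i) * ∏ k ∈ Finset.univ.erase i, (l j - μ k)
        = (∑ i, Complex.normSq (v i) / (l j - μ i)) * ∏ i, (l j - μ i) := by
      rw [Finset.sum_mul]
      refine Finset.sum_congr rfl fun i _ => ?_
      rw [← Finset.mul_prod_erase Finset.univ _ (Finset.mem_univ i)]
      have := hne i
      field_simp
    rw [h3, ← sub_mul] at h1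
    exact (mul_eq_zero.1 h1).resolve_right h2
  rw [Matrix.eval_charpoly, ← Matrix.exists_mulVec_eq_zero_iff]
  -- an eigenvector of the arrow matrix
  refine ⟨Fin.cons 1 fun i => star (v i) / ((l j : ℂ) - μ i), fun h0 => ?_, ?_⟩
  · simpa using congrFun h0 0
  · ext i
    refine Fin.cases ?_ (fun i => ?_) i
    · simp only [Matrix.mulVec, dotProduct, Fin.sum_univ_succ, Matrix.sub_apply, Fin.cons_zero,
        Fin.cons_succ, bord_zero_zero, bord_zero_succ, Matrix.scalar_apply, Matrix.diagonal_apply,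
        Pi.zero_apply, if_true, (Fin.succ_ne_zero _).symm, if_false]
      have h4 : ((l j : ℂ) - y) - ∑ i, (Complex.normSq (v i) : ℂ) / ((l j : ℂ) - μ i) = 0 := by
        exact_mod_cast congrArg (fun x : ℝ => (x : ℂ)) hroot
      refine Eq.trans ?_ h4
      rw [mul_one, sub_eq_add_neg _ (∑ i, _), ← Finset.sum_neg_distrib]
      congr 1
      refine Finset.sum_congr rfl fun k _ => ?_
      rw [Complex.normSq_eq_conj_mul_self, Complex.star_def]
      ring
    · simp only [Matrix.mulVec, dotProduct, Fin.sum_univ_succ, Matrix.sub_apply, Fin.cons_zero,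
        Fin.cons_succ, bord_succ_zero, bord_succ_succ, Matrix.scalar_apply, Matrix.diagonal_apply,
        Pi.zero_apply, Fin.succ_ne_zero, if_false, Fin.succ_inj]
      rw [Finset.sum_eq_single i]
      · have := hneC i
        simp
        field_simp
        ring
      · intro k _ hk
        simp [hk.symm]
      · simp

theorem charpoly_diagonal_ofReal (l : Fin n → ℝ) :
    (Matrix.diagonal fun i => (l i : ℂ)).charpoly = ∏ j, (X - C (l j : ℂ)) := by
  rw [Matrix.charpoly_diagonal]

/-- The coordinates `(y, π r)` of a bordered diagonal matrix in terms of its eigenvalues. -/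
def radial (μ : Fin n → ℝ) (l : Fin (n + 1) → ℝ) : Fin (n + 1) → ℝ :=
  Fin.cons (∑ j, l j - ∑ i, μ i) fun i =>
    Real.pi * (-(∏ j, (μ i - l j)) / ∏ j ∈ Finset.univ.erase i, (μ i - μ j))

theorem arrowPoly_radial {μ : Fin n → ℝ} {l : Fin (n + 1) → ℝ} (h : Interlace μ l) :
    arrowPoly (radial μ l 0) (fun i => radial μ l i.succ / Real.pi) μ = ∏ j, (X - C (l j)) := by
  rw [arrowPoly_eq_prod_iff h.strictMono_left.injective]
  refine ⟨rfl, fun i => ?_⟩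
  simp only [radial, Fin.cons_succ]
  field_simp

theorem radial_pos {μ : Fin n → ℝ} {l : Fin (n + 1) → ℝ} (h : Interlace μ l) (i : Fin n) :
    0 < radial μ l i.succ := by
  have h1 := h.prod_sign i
  have h2 := prod_erase_sign h.strictMono_left i
  have h3 : n - (i : ℕ) = (n - 1 - (i : ℕ)) + 1 := by omega
  simp only [radial, Fin.cons_succ]
  refine mul_pos Real.pi_pos ?_
  rw [h3, pow_succ] at h1
  rcases neg_one_pow_eq_or ℝ (n - 1 - (i : ℕ)) with h4 | h4 <;> rw [h4] at h1 h2
  · exact div_pos (by linarith) (by linarith)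
  · exact div_pos_of_neg_of_neg (by linarith) (by linarith)

theorem prod_X_sub_C_injOn {l l' : Fin n → ℝ} (hl : StrictMono l) (hl' : StrictMono l')
    (h : (∏ j, (X - C (l j)) : ℝ[X]) = ∏ j, (X - C (l' j))) : l = l' := by
  refine (hl.range_inj hl').1 ?_
  have key : ∀ l : Fin n → ℝ, Set.range l = {x | (∏ j, (X - C (l j)) : ℝ[X]).eval x = 0} := by
    intro l
    ext x
    rw [Set.mem_ofPred_eq, eval_prod, Finset.prod_eq_zero_iff, Set.mem_range]
    simp [sub_eq_zero, eq_comm]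
  rw [key, key, h]

theorem injOn_radial (μ : Fin n → ℝ) : Set.InjOn (radial μ) {l | Interlace μ l} := by
  intro l hl l' hl' h
  refine prod_X_sub_C_injOn (Interlace.strictMono_right hl) (Interlace.strictMono_right hl') ?_
  rw [← arrowPoly_radial hl, ← arrowPoly_radial hl', h]

/-- Every arrow polynomial with positive weights has `n + 1` real zeros which interlace with `μ`. -/
theorem image_radial {μ : Fin n → ℝ} (hμ : StrictMono μ) :
    radial μ '' {l | Interlace μ l} = {p | ∀ i : Fin n, 0 < p i.succ} := by
  ext p
  constructor
  · rintro ⟨l, hl, rfl⟩ i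
    exact radial_pos hl i
  · intro hp
    obtain ⟨hmon, hdeg⟩ := monic_arrowPoly (p 0) (fun i => p i.succ / Real.pi) μ
    obtain ⟨l, hl, hf⟩ := exists_interlace_roots hmon hdeg hμ (fun i => by
      rw [eval_arrowPoly]
      have h2 := prod_erase_sign hμ i
      have h3 : n - (i : ℕ) = (n - 1 - (i : ℕ)) + 1 := by omega
      have h4 : 0 < p i.succ / Real.pi := div_pos (hp i) Real.pi_pos
      rw [h3, pow_succ]
      calc (0 : ℝ) < (p i.succ / Real.pi) * ((-1 : ℝ) ^ (n - 1 - (i : ℕ)) *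
            ∏ j ∈ Finset.univ.erase i, (μ i - μ j)) := mul_pos h4 h2
        _ = _ := by ring)
    refine ⟨l, hl, ?_⟩
    obtain ⟨h0, h1⟩ := (arrowPoly_eq_prod_iff hμ.injective l _ _).1 hf
    ext j
    refine Fin.cases ?_ (fun i => ?_) j
    · exact h0.symm
    · simp only [radial, Fin.cons_succ, ← h1 i]
      field_simp

/-- The Jacobian matrix of `radial μ`. -/
def radialJac (μ : Fin n → ℝ) (l : Fin (n + 1) → ℝ) : Matrix (Fin (n + 1)) (Fin (n + 1)) ℝ :=
  Matrix.of (Fin.cons (fun _ => 1) fun i j =>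
    (Real.pi / ∏ j ∈ Finset.univ.erase i, (μ i - μ j)) * ∏ k ∈ Finset.univ.erase j, (μ i - l k))

theorem hasFDerivAt_radial (μ : Fin n → ℝ) (l : Fin (n + 1) → ℝ) :
    HasFDerivAt (radial μ) (LinearMap.toContinuousLinearMap (Matrix.toLin' (radialJac μ l))) l := by
  rw [hasFDerivAt_pi']
  intro k
  refine Fin.cases ?_ (fun i => ?_) k
  · have h1 : HasFDerivAt (fun l : Fin (n + 1) → ℝ => ∑ j, l j - ∑ i, μ i)
        (∑ j, ContinuousLinearMap.proj (R := ℝ) (φ := fun _ : Fin (n + 1) => ℝ) j) l :=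
      (HasFDerivAt.fun_sum fun j _ => hasFDerivAt_apply j l).sub_const _
    refine h1.congr_fderiv ?_
    ext w
    simp [radialJac, Matrix.mulVec, dotProduct]
  · have h1 : HasFDerivAt (fun l : Fin (n + 1) → ℝ => ∏ j, (μ i - l j))
        (∑ j, (∏ k ∈ Finset.univ.erase j, (μ i - l k)) •
          -ContinuousLinearMap.proj (R := ℝ) (φ := fun _ : Fin (n + 1) => ℝ) j) l :=
      HasFDerivAt.finsetProd fun j _ => (hasFDerivAt_apply j l).const_sub (μ i)
    have h2 := (h1.const_mul (-(Real.pi / ∏ j ∈ Finset.univ.erase i, (μ i - μ j))))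
    refine (h2.congr_fderiv ?_).congr_of_eventuallyEq (Eventually.of_forall fun l => ?_)
    · ext w
      simp [radialJac, Matrix.mulVec, dotProduct, Finset.mul_sum]
      exact Finset.sum_congr rfl fun j _ => by ring
    · simp only [radial, Fin.cons_succ]
      ring

theorem det_vandermonde_pos {l : Fin n → ℝ} (hl : StrictMono l) :
    0 < (Matrix.vandermonde l).det := by
  rw [Matrix.det_vandermonde]
  exact Finset.prod_pos fun i _ => Finset.prod_pos fun j hj =>
    sub_pos.2 (hl (Finset.mem_Ioi.1 hj))

theorem abs_prod_prod_erase (l : Fin n → ℝ) :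
    |∏ i, ∏ j ∈ Finset.univ.erase i, (l i - l j)| = (Matrix.vandermonde l).det ^ 2 := by
  have h := Finset.prod_prod_Ioi_mul_eq_prod_prod_off_diag (fun j i : Fin n => (l i - l j))
  have h1 : ∀ i : Fin n, Finset.univ.erase i = {i}ᶜ := fun i => by ext; simp
  simp only [h1]
  rw [← h, Finset.abs_prod, Matrix.det_vandermonde, ← Finset.prod_pow]
  refine Finset.prod_congr rfl fun i _ => ?_
  rw [Finset.abs_prod, ← Finset.prod_pow]
  refine Finset.prod_congr rfl fun j _ => ?_
  rw [abs_mul, abs_sub_comm (l i) (l j), ← sq, sq_abs]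

/-- The Jacobian of the passage from the zeros `l` to the radial parameters is
`π ^ n Δ(l) / Δ(μ)`. -/
theorem abs_det_radialJac {μ : Fin n → ℝ} (hμ : StrictMono μ) {l : Fin (n + 1) → ℝ}
    (hl : StrictMono l) :
    |(radialJac μ l).det| * (Matrix.vandermonde μ).det
      = Real.pi ^ n * (Matrix.vandermonde l).det := by
  set den : Fin n → ℝ := fun i => ∏ j ∈ Finset.univ.erase i, (μ i - μ j) with hden
  let g : Fin (n + 1) → ℝ[X] := fun j => ∏ k ∈ Finset.univ.erase j, (X - C (l k))
  have hgm : ∀ j, (g j).Monic := fun j => monic_prod_of_monic _ _ fun _ _ => monic_X_sub_C _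
  have hgd : ∀ j, (g j).natDegree = n := fun j => by
    rw [natDegree_prod_of_monic _ _ fun _ _ => monic_X_sub_C _, Finset.sum_congr rfl
      fun _ _ => natDegree_X_sub_C _, Finset.sum_const, smul_eq_mul, mul_one,
      Finset.card_erase_of_mem (Finset.mem_univ j), Finset.card_univ, Fintype.card_fin]
    rfl
  let L : Matrix (Fin (n + 1)) (Fin (n + 1)) ℝ := Matrix.of fun k j => (g j).coeff k
  let E : Matrix (Fin (n + 1)) (Fin (n + 1)) ℝ :=
    Matrix.projVandermonde (Fin.cons 1 μ) (Fin.cons 0 fun _ => 1)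
  have hev : ∀ (j : Fin (n + 1)) (x : ℝ), ∑ k : Fin (n + 1), x ^ (k : ℕ) * (g j).coeff k
      = (g j).eval x := fun j x => by
    rw [eval_eq_sum_range' (n := n + 1) (by rw [hgd]; exact n.lt_succ_self),
      ← Fin.sum_univ_eq_sum_range (fun k => (g j).coeff k * x ^ k)]
    exact Finset.sum_congr rfl fun k _ => mul_comm _ _
  have hJ : radialJac μ l
      = Matrix.diagonal (Fin.cons 1 fun i => Real.pi / den i) * (E * L) := by
    ext i j
    rw [Matrix.diagonal_mul]
    refine Fin.cases ?_ (fun i => ?_) i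
    · have : (E * L) 0 j = 1 := by
        rw [Matrix.mul_apply, Finset.sum_eq_single (Fin.last n)]
        · have := hgm j
          rw [Monic, leadingCoeff, hgd] at this
          simp [E, L, Matrix.projVandermonde_apply, this]
        · intro k _ hk
          have : n - (k : ℕ) ≠ 0 := by
            have h1 := k.2
            have h2 : (k : ℕ) ≠ n := fun h => hk (Fin.ext h)
            omega
          simp [E, Matrix.projVandermonde_apply, this]
        · simp
      rw [this]
      simp [radialJac]
    · have : (E * L) i.succ j = (g j).eval (μ i) := by
        rw [Matrix.mul_apply, ← hev]
        exact Finset.sum_congr rfl fun k _ => by simp [E, L, Matrix.projVandermonde_apply]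
      rw [this]
      simp [radialJac, g, eval_prod, hden]
  have hE : |E.det| = (Matrix.vandermonde μ).det := by
    rw [Matrix.det_projVandermonde, Fin.prod_univ_succ, Fin.prod_Ioi_zero]
    simp only [Fin.prod_Ioi_succ, Fin.cons_zero, Fin.cons_succ, mul_zero, mul_one, zero_sub]
    rw [← Matrix.det_vandermonde, abs_mul, Finset.abs_prod, abs_of_pos (det_vandermonde_pos hμ)]
    simp
  have hVL : Matrix.vandermonde l * L = Matrix.diagonal fun j => (g j).eval (l j) := by
    ext i j
    rw [Matrix.mul_apply]
    simp only [Matrix.vandermonde_apply, L, Matrix.of_apply]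
    rw [hev, Matrix.diagonal_apply]
    split_ifs with hij
    · rw [hij]
    · rw [eval_prod, Finset.prod_eq_zero (Finset.mem_erase.2 ⟨hij, Finset.mem_univ i⟩) (by simp)]
  have hL : |L.det| = (Matrix.vandermonde l).det := by
    have h1 := congrArg (fun M => |M.det|) hVL
    simp only [Matrix.det_mul, Matrix.det_diagonal, abs_mul] at h1
    have h2 : ∏ j, (g j).eval (l j) = ∏ i, ∏ j ∈ Finset.univ.erase i, (l i - l j) :=
      Finset.prod_congr rfl fun j _ => by simp [g, eval_prod]
    have h3 := det_vandermonde_pos hl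
    rw [h2, abs_prod_prod_erase, abs_of_pos h3, sq] at h1
    exact mul_left_cancel₀ h3.ne' h1
  have hd : |∏ i, Real.pi / den i| = Real.pi ^ n / (Matrix.vandermonde μ).det ^ 2 := by
    rw [Finset.prod_div_distrib, abs_div, hden, abs_prod_prod_erase, Finset.prod_const,
      Finset.card_univ, Fintype.card_fin, abs_of_pos (pow_pos Real.pi_pos n)]
  rw [hJ, Matrix.det_mul, Matrix.det_mul, Matrix.det_diagonal, Fin.prod_univ_succ]
  simp only [Fin.cons_zero, Fin.cons_succ, one_mul]
  rw [abs_mul, abs_mul, hd, hE, hL]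
  have := (det_vandermonde_pos hμ).ne'
  field_simp

end

/-! ### Change of variables for one border -/

theorem measurePreserving_pi_mul_normSq :
    MeasurePreserving (fun z : ℂ => Real.pi * Complex.normSq z) volume
      (volume.restrict (Set.Ioi (0 : ℝ))) := by
  have hmeas : Measurable (fun z : ℂ => Real.pi * Complex.normSq z) :=
    (Complex.continuous_normSq.measurable).const_mul _
  have h1 : ∀ x : ℝ, volume ((fun z : ℂ => Real.pi * Complex.normSq z) ⁻¹' Set.Iic x)
      = ENNReal.ofReal x := by
    intro x
    rcases lt_or_ge x 0 with hx | hx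
    · rw [ENNReal.ofReal_of_nonpos hx.le]
      have : (fun z : ℂ => Real.pi * Complex.normSq z) ⁻¹' Set.Iic x = ∅ := by
        ext z
        simp only [Set.mem_preimage, Set.mem_Iic, Set.mem_empty_iff_false, iff_false, not_le]
        exact hx.trans_le (mul_nonneg Real.pi_pos.le (Complex.normSq_nonneg z))
      rw [this, measure_empty]
    · have : (fun z : ℂ => Real.pi * Complex.normSq z) ⁻¹' Set.Iic x
          = Metric.closedBall 0 (√(x / Real.pi)) := by
        ext z
        simp only [Set.mem_preimage, Set.mem_Iic, Metric.mem_closedBall, dist_zero_right]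
        rw [Real.le_sqrt (norm_nonneg z) (div_nonneg hx Real.pi_pos.le),
          Complex.normSq_eq_norm_sq, le_div_iff₀ Real.pi_pos, mul_comm]
      rw [this, Complex.volume_closedBall, ← ENNReal.ofReal_pow (Real.sqrt_nonneg _),
        Real.sq_sqrt (div_nonneg hx Real.pi_pos.le), ENNReal.ofReal_div_of_pos Real.pi_pos]
      have : ((NNReal.pi : NNReal) : ENNReal) = ENNReal.ofReal Real.pi :=
        (ENNReal.ofReal_coe_nnreal (p := NNReal.pi)).symm
      rw [this, ENNReal.div_mul_cancel (by simp [Real.pi_pos]) ENNReal.ofReal_ne_top]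
  have h2 : ∀ x : ℝ, (volume.restrict (Set.Ioi (0 : ℝ))) (Set.Iic x) = ENNReal.ofReal x := by
    intro x
    rw [Measure.restrict_apply measurableSet_Iic, Set.inter_comm, Set.Ioi_inter_Iic,
      Real.volume_Ioc, sub_zero]
  refine ⟨hmeas, (Measure.ext_of_Ioc _ _ fun a b hab => ?_).symm⟩
  have h3 : Set.Ioc a b = Set.Iic b \ Set.Iic a := by
    ext x; simp [and_comm]
  rw [h3, measure_sdiff (Set.Iic_subset_Iic.2 hab.le)
    measurableSet_Iic.nullMeasurableSet (by rw [h2]; exact ENNReal.ofReal_ne_top),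
    measure_sdiff (Set.Iic_subset_Iic.2 hab.le) measurableSet_Iic.nullMeasurableSet
      (by rw [Measure.map_apply hmeas measurableSet_Iic, h1]; exact ENNReal.ofReal_ne_top),
    Measure.map_apply hmeas measurableSet_Iic, Measure.map_apply hmeas measurableSet_Iic, h1, h1,
    h2, h2]

section

variable {n : ℕ}

theorem measurePreserving_vecMul {U : Matrix (Fin n) (Fin n) ℂ} (hU : U * star U = 1) :
    MeasurePreserving (fun v : Fin n → ℂ => Matrix.vecMul v U) volume volume := by
  let f : (Fin n → ℂ) →ₗ[ℝ] (Fin n → ℂ) := (Matrix.toLin' U.transpose).restrictScalars ℝ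
  have hf : ∀ v, f v = Matrix.vecMul v U := fun v => by
    simp [f, Matrix.mulVec_transpose]
  have hdet : LinearMap.det f = 1 := by
    have h1 : LinearMap.det f = Algebra.norm ℝ (LinearMap.det (Matrix.toLin' U.transpose)) :=
      LinearMap.det_restrictScalars
    have h2 := congrArg Matrix.det hU
    rw [Matrix.det_mul, Matrix.star_eq_conjTranspose, Matrix.det_conjTranspose,
      Matrix.det_one] at h2
    rw [h1, LinearMap.det_toLin', Matrix.det_transpose, Algebra.norm_complex_eq]
    have h3 : ((Complex.normSq U.det : ℝ) : ℂ) = 1 := by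
      rw [Complex.normSq_eq_conj_mul_self, mul_comm]
      exact h2
    exact_mod_cast h3
  have h := Measure.map_linearMap_addHaar_eq_smul_addHaar (volume : Measure (Fin n → ℂ)) (f := f)
    (by rw [hdet]; exact one_ne_zero)
  rw [hdet] at h
  have hfun : (fun v : Fin n → ℂ => Matrix.vecMul v U) = f := funext fun v => (hf v).symm
  rw [hfun]
  exact ⟨(f.continuous_of_finiteDimensional).measurable, by simpa using h⟩

theorem measurePreserving_finCons : MeasurePreserving
    (fun p : ℝ × (Fin n → ℝ) => (Fin.cons p.1 p.2 : Fin (n + 1) → ℝ)) volume volume := by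
  have := (volume_preserving_piFinSuccAbove (fun _ : Fin (n + 1) => ℝ) 0).symm
  have heq : (fun p : ℝ × (Fin n → ℝ) => (Fin.cons p.1 p.2 : Fin (n + 1) → ℝ))
      = (MeasurableEquiv.piFinSuccAbove (fun _ : Fin (n + 1) => ℝ) 0).symm :=
    funext fun p => (Fin.insertNth_zero' p.1 p.2).symm
  rw [heq]
  exact this

theorem measurePreserving_bordCoord : MeasurePreserving
    (fun p : (ℝ × (Fin n → ℂ)) × (Fin n → Fin n → ℝ) => bordCoord p.1.1 p.1.2 p.2)
    volume volume := by
  -- real and imaginary parts of the border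
  have h1 : MeasurePreserving (fun v : Fin n → ℂ => ((fun j => (v j).re), fun j => (v j).im))
      volume volume :=
    (volume_measurePreserving_arrowProdEquivProdArrow ℝ ℝ (Fin n)).comp
      (volume_preserving_pi fun _ => Complex.volume_preserving_equiv_real_prod)
  have h2 : MeasurePreserving (fun p : (Fin n → ℝ) × (Fin n → Fin n → ℝ) =>
      fun i => (Fin.cons (p.1 i) (p.2 i) : Fin (n + 1) → ℝ)) volume volume :=
    (volume_preserving_pi fun _ : Fin n => measurePreserving_finCons (n := n)).comp
      (volume_measurePreserving_arrowProdEquivProdArrow ℝ (Fin n → ℝ) (Fin n)).symm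
  have h3 : MeasurePreserving (fun p : (Fin (n + 1) → ℝ) × (Fin n → Fin (n + 1) → ℝ) =>
      (Fin.cons p.1 p.2 : Fin (n + 1) → Fin (n + 1) → ℝ)) volume volume := by
    have := (volume_preserving_piFinSuccAbove (fun _ : Fin (n + 1) => Fin (n + 1) → ℝ) 0).symm
    have heq : (fun p : (Fin (n + 1) → ℝ) × (Fin n → Fin (n + 1) → ℝ) =>
        (Fin.cons p.1 p.2 : Fin (n + 1) → Fin (n + 1) → ℝ))
        = (MeasurableEquiv.piFinSuccAbove (fun _ : Fin (n + 1) => Fin (n + 1) → ℝ) 0).symm :=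
      funext fun p => (Fin.insertNth_zero' p.1 p.2).symm
    rw [heq]
    exact this
  have h4 : MeasurePreserving (fun p : (ℝ × (Fin n → ℂ)) × (Fin n → Fin n → ℝ) =>
      ((p.1.1, ((fun j => (p.1.2 j).re), fun j => (p.1.2 j).im)), p.2)) volume volume :=
    ((MeasurePreserving.id volume).prod h1).prod (MeasurePreserving.id volume)
  have h5 : MeasurePreserving
      (fun p : (ℝ × ((Fin n → ℝ) × (Fin n → ℝ))) × (Fin n → Fin n → ℝ) =>
        ((p.1.1, p.1.2.1), (p.1.2.2, p.2))) volume volume := by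
    have h6 : MeasurePreserving (fun p : ℝ × ((Fin n → ℝ) × (Fin n → ℝ)) =>
      ((p.1, p.2.1), p.2.2)) volume volume := (volume_preserving_prodAssoc).symm
    exact (volume_preserving_prodAssoc).comp (h6.prod (MeasurePreserving.id volume))
  exact h3.comp ((measurePreserving_finCons.prod h2).comp (h5.comp h4))

theorem lintegral_bordCoord {F : (Fin (n + 1) → Fin (n + 1) → ℝ) → ENNReal} (hF : Measurable F) :
    ∫⁻ x, F x = ∫⁻ x : Fin n → Fin n → ℝ, ∫⁻ y : ℝ, ∫⁻ v : Fin n → ℂ, F (bordCoord y v x) := by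
  have hm : Measurable fun p : (ℝ × (Fin n → ℂ)) × (Fin n → Fin n → ℝ) =>
      F (bordCoord p.1.1 p.1.2 p.2) := hF.comp (measurePreserving_bordCoord (n := n)).measurable
  rw [← (measurePreserving_bordCoord (n := n)).lintegral_comp hF]
  rw [Measure.volume_eq_prod, lintegral_prod_symm _ hm.aemeasurable]
  refine lintegral_congr fun x => ?_
  rw [Measure.volume_eq_prod, lintegral_prod _
    (show Measurable fun p : ℝ × (Fin n → ℂ) => F (bordCoord p.1 p.2 x) from
      hm.comp measurable_prodMk_right).aemeasurable]

/-- `K` depends only on the eigenvalues of a Hermitian matrix. -/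
def IsSpectral (K : Matrix (Fin n) (Fin n) ℂ → ENNReal) : Prop :=
  ∀ A B, A.IsHermitian → B.IsHermitian → A.charpoly = B.charpoly → K A = K B

theorem measurable_comp_bord {K : Matrix (Fin (n + 1)) (Fin (n + 1)) ℂ → ENNReal}
    (hK : Measurable fun x => K (hermitian x)) :
    Measurable fun p : (ℝ × (Fin n → ℂ)) × (Fin n → Fin n → ℝ) =>
      K (bord p.1.1 p.1.2 (hermitian p.2)) := by
  simpa only [Function.comp_def, hermitian_bordCoord] using
    hK.comp (measurePreserving_bordCoord (n := n)).measurable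

/-- A unitary rotation of the border replaces the corner `M` by the diagonal matrix of its
eigenvalues. -/
theorem lintegral_bord_eq {K : Matrix (Fin (n + 1)) (Fin (n + 1)) ℂ → ENNReal}
    (hK : Measurable fun x => K (hermitian x)) (hs : IsSpectral K) (y : ℝ)
    {M : Matrix (Fin n) (Fin n) ℂ} (hM : M.IsHermitian) :
    ∫⁻ v : Fin n → ℂ, K (bord y v M)
      = ∫⁻ v : Fin n → ℂ, K (bord y v (Matrix.diagonal fun i => (hM.eigenvalues i : ℂ))) := by
  have hD := isHermitian_diagonal_ofReal hM.eigenvalues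
  set D := Matrix.diagonal fun i => (hM.eigenvalues i : ℂ) with hDdef
  obtain ⟨U, hU, hMU⟩ : ∃ U : Matrix (Fin n) (Fin n) ℂ, U * star U = 1 ∧ M = U * D * star U := by
    refine ⟨hM.eigenvectorUnitary, Unitary.mul_star_self_of_mem hM.eigenvectorUnitary.2, ?_⟩
    have := hM.spectral_theorem
    rwa [Unitary.conjStarAlgAut_apply] at this
  have h1 : ∀ v, K (bord y v M) = K (bord y (Matrix.vecMul v U) D) := fun v => by
    refine hs _ _ (isHermitian_bord y v hM) (isHermitian_bord y _ hD) ?_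
    rw [hMU]
    exact charpoly_bord_conj y v D U hU
  simp only [h1]
  refine (measurePreserving_vecMul hU).lintegral_comp (f := fun v => K (bord y v D)) ?_
  have h2 := (measurable_comp_bord hK).comp
    ((measurable_prodMk_right (y := diagCoord hM.eigenvalues)).comp
      (measurable_prodMk_left (x := y)))
  simpa only [Function.comp_def, hermitian_diagCoord] using h2

/-- Integrating out the border of a spectral function gives a spectral function of the corner. -/
theorem IsSpectral.lintegral_bord {K : Matrix (Fin (n + 1)) (Fin (n + 1)) ℂ → ENNReal}
    (hK : Measurable fun x => K (hermitian x)) (hs : IsSpectral K) (G : ℝ → ENNReal) :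
    IsSpectral fun M => ∫⁻ y : ℝ, (∫⁻ v : Fin n → ℂ, K (bord y v M)) * G y := by
  intro A B hA hB hAB
  refine lintegral_congr fun y => ?_
  rw [lintegral_bord_eq hK hs y hA, lintegral_bord_eq hK hs y hB,
    (hA.eigenvalues_eq_eigenvalues_iff hB).2 hAB]

/-- Over a diagonal corner, the phases of the border are removed by a diagonal unitary
conjugation. -/
theorem bord_diagonal_abs {K : Matrix (Fin (n + 1)) (Fin (n + 1)) ℂ → ENNReal}
    (hs : IsSpectral K) (y : ℝ) (v : Fin n → ℂ) (μ : Fin n → ℝ) :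
    K (bord y v (Matrix.diagonal fun i => (μ i : ℂ)))
      = K (bord y (fun i => ((‖v i‖ : ℝ) : ℂ)) (Matrix.diagonal fun i => (μ i : ℂ))) := by
  have hph : ∀ w : ℂ, ∃ u : ℂ, u * star u = 1 ∧ w * u = (‖w‖ : ℝ) := by
    intro w
    by_cases hw : w = 0
    · exact ⟨1, by simp, by simp [hw]⟩
    · have hn : ((‖w‖ : ℝ) : ℂ) ≠ 0 := by simpa using hw
      refine ⟨star w / ‖w‖, ?_, ?_⟩
      · have : w * star w = ((‖w‖ : ℝ) : ℂ) ^ 2 := by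
          rw [Complex.star_def, Complex.mul_conj, Complex.normSq_eq_norm_sq]; push_cast; rfl
        rw [star_div₀, star_star, Complex.star_def, Complex.conj_ofReal]
        field_simp
        rw [mul_comm]; exact this
      · have : w * star w = ((‖w‖ : ℝ) : ℂ) ^ 2 := by
          rw [Complex.star_def, Complex.mul_conj, Complex.normSq_eq_norm_sq]; push_cast; rfl
        rw [mul_div_assoc', this]
        field_simp
  choose u hu1 hu2 using fun i => hph (v i)
  have hU : Matrix.diagonal u * star (Matrix.diagonal u) = 1 := by
    rw [Matrix.star_eq_conjTranspose, Matrix.diagonal_conjTranspose, Matrix.diagonal_mul_diagonal,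
      ← Matrix.diagonal_one]
    exact congrArg _ (funext fun i => hu1 i)
  have hM := isHermitian_diagonal_ofReal μ
  refine hs _ _ (isHermitian_bord y v hM) (isHermitian_bord y _ hM) ?_
  have h1 := charpoly_bord_conj y v (Matrix.diagonal fun i => (μ i : ℂ)) (Matrix.diagonal u) hU
  have h2 : Matrix.diagonal u * (Matrix.diagonal fun i => (μ i : ℂ)) * star (Matrix.diagonal u)
      = Matrix.diagonal fun i => (μ i : ℂ) := by
    rw [Matrix.diagonal_mul_diagonal]
    simp only [mul_comm (u _)]
    rw [← Matrix.diagonal_mul_diagonal, mul_assoc, hU, mul_one]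
  have h3 : Matrix.vecMul v (Matrix.diagonal u) = fun i => ((‖v i‖ : ℝ) : ℂ) := by
    ext i
    rw [Matrix.vecMul_diagonal, hu2]
  rw [h2, h3] at h1
  exact h1

theorem measurableSet_interlace_right (μ : Fin n → ℝ) : MeasurableSet {l | Interlace μ l} := by
  have : {l | Interlace μ l} = ⋂ i : Fin n, {l : Fin (n + 1) → ℝ | l i.castSucc < μ i} ∩
      {l | μ i < l i.succ} := by
    ext l; simp [Interlace]
  rw [this]
  exact MeasurableSet.iInter fun i =>
    (measurableSet_lt (measurable_pi_apply _) measurable_const).inter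
      (measurableSet_lt measurable_const (measurable_pi_apply _))

/-- Integration over the border of a fixed diagonal matrix, in terms of the eigenvalues of the
bordered matrix. -/
theorem lintegral_bord_diagonal {K : Matrix (Fin (n + 1)) (Fin (n + 1)) ℂ → ENNReal}
    (hK : Measurable fun x => K (hermitian x)) (hs : IsSpectral K) {G : ℝ → ENNReal}
    (hG : Measurable G) {μ : Fin n → ℝ} (hμ : StrictMono μ) :
    ∫⁻ y : ℝ, (∫⁻ v : Fin n → ℂ, K (bord y v (Matrix.diagonal fun i => (μ i : ℂ)))) * G y
      = ∫⁻ l in {l | Interlace μ l}, ENNReal.ofReal |(radialJac μ l).det| *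
          (K (Matrix.diagonal fun i => (l i : ℂ)) * G (∑ j, l j - ∑ i, μ i)) := by
  set D := Matrix.diagonal fun i => (μ i : ℂ) with hD
  have hmb : Measurable fun p : ℝ × (Fin n → ℂ) => K (bord p.1 p.2 D) := by
    have h2 := (measurable_comp_bord hK).comp (measurable_prodMk_right (y := diagCoord μ))
    simpa only [Function.comp_def, hermitian_diagCoord] using h2
  -- the integrand in the coordinates `(y, π r)`
  let H : (Fin (n + 1) → ℝ) → ENNReal := fun p =>
    K (bord (p 0) (fun i => ((√(p i.succ / Real.pi) : ℝ) : ℂ)) D) * G (p 0)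
  have hH : Measurable H := by
    refine Measurable.mul (hmb.comp (Measurable.prodMk (measurable_pi_apply 0)
      (measurable_pi_lambda _ fun i => ?_))) (hG.comp (measurable_pi_apply 0))
    exact Complex.measurable_ofReal.comp
      (Real.continuous_sqrt.measurable.comp ((measurable_pi_apply _).div_const _))
  have h1 : ∀ y : ℝ, (∫⁻ v : Fin n → ℂ, K (bord y v D)) * G y
      = ∫⁻ r in Set.univ.pi fun _ : Fin n => Set.Ioi (0 : ℝ), H (Fin.cons y r) := by
    intro y
    have hmp : MeasurePreserving (fun (v : Fin n → ℂ) i => Real.pi * Complex.normSq (v i)) volume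
        (volume.restrict (Set.univ.pi fun _ : Fin n => Set.Ioi (0 : ℝ))) := by
      have := measurePreserving_pi (fun _ : Fin n => (volume : Measure ℂ))
        (fun _ => volume.restrict (Set.Ioi (0 : ℝ))) fun _ => measurePreserving_pi_mul_normSq
      rwa [← Measure.restrict_pi_pi] at this
    have hHy : Measurable fun r : Fin n → ℝ => H (Fin.cons y r) :=
      hH.comp ((measurePreserving_finCons (n := n)).measurable.comp measurable_prodMk_left)
    rw [← hmp.lintegral_comp hHy, ← lintegral_mul_const _
      (show Measurable fun v => K (bord y v D) from hmb.comp measurable_prodMk_left)]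
    refine lintegral_congr fun v => ?_
    simp only [H, Fin.cons_zero, Fin.cons_succ]
    rw [bord_diagonal_abs hs]
    congr 5
    ext i
    rw [mul_div_cancel_left₀ _ Real.pi_ne_zero, Complex.normSq_eq_norm_sq,
      Real.sqrt_sq (norm_nonneg _)]
  have h2 : ∫⁻ y : ℝ, ∫⁻ r in Set.univ.pi fun _ : Fin n => Set.Ioi (0 : ℝ), H (Fin.cons y r)
      = ∫⁻ p in {p : Fin (n + 1) → ℝ | ∀ i : Fin n, 0 < p i.succ}, H p := by
    have hset : MeasurableSet {p : Fin (n + 1) → ℝ | ∀ i : Fin n, 0 < p i.succ} := by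
      have : {p : Fin (n + 1) → ℝ | ∀ i : Fin n, 0 < p i.succ}
          = ⋂ i : Fin n, {p | 0 < p i.succ} := by ext p; simp
      rw [this]
      exact MeasurableSet.iInter fun i => measurableSet_lt measurable_const (measurable_pi_apply _)
    have hmp := (measurePreserving_finCons (n := n)).restrict_preimage hset
    rw [← hmp.lintegral_comp hH]
    have hpre : (fun p : ℝ × (Fin n → ℝ) => (Fin.cons p.1 p.2 : Fin (n + 1) → ℝ)) ⁻¹'
        {p : Fin (n + 1) → ℝ | ∀ i : Fin n, 0 < p i.succ}
        = Set.univ ×ˢ (Set.univ.pi fun _ : Fin n => Set.Ioi (0 : ℝ)) := by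
      ext p
      simp
    rw [hpre, Measure.volume_eq_prod, ← Measure.prod_restrict, Measure.restrict_univ,
      lintegral_prod _ (show Measurable fun p : ℝ × (Fin n → ℝ) => H (Fin.cons p.1 p.2) from
        hH.comp (measurePreserving_finCons (n := n)).measurable).aemeasurable]
  simp only [h1]
  rw [h2, ← image_radial hμ, lintegral_image_eq_lintegral_abs_det_fderiv_mul volume
    (measurableSet_interlace_right μ) (fun l _ => (hasFDerivAt_radial μ l).hasFDerivWithinAt)
    (injOn_radial μ)]
  refine setLIntegral_congr_fun (measurableSet_interlace_right μ) fun l hl => ?_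
  have hl' : Interlace μ l := hl
  simp only [ContinuousLinearMap.det, LinearMap.coe_toContinuousLinearMap, LinearMap.det_toLin', H]
  congr 2
  refine hs _ _ (isHermitian_bord _ _ (isHermitian_diagonal_ofReal μ))
    (isHermitian_diagonal_ofReal l) ?_
  rw [charpoly_diagonal_ofReal]
  refine charpoly_bord_diagonal hl' ?_
  rw [← arrowPoly_radial hl']
  congr 1
  ext i
  rw [Complex.normSq_ofReal, Real.mul_self_sqrt (div_nonneg (radial_pos hl' i).le Real.pi_pos.le)]

end

/-! ### The radial part of the matrix integral -/

/-- The solutions of the linear differential equation `(D - b_{n-1}) ⋯ (D - b_0) f = 0`. -/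
def Sol : (n : ℕ) → (Fin n → ℝ) → Set (ℝ → ℝ)
  | 0, _ => {0}
  | n + 1, b => {f | ∃ f' : ℝ → ℝ, (∀ x, HasDerivAt f (f' x) x) ∧
      (fun x => f' x - b 0 * f x) ∈ Sol n (Fin.tail b)}

section

variable {n : ℕ}

theorem interlace_eq_pi (l : Fin (n + 1) → ℝ) :
    {μ | Interlace μ l} = Set.univ.pi fun j : Fin n => Set.Ioo (l j.castSucc) (l j.succ) := by
  ext μ
  simp [Interlace]

/-- The determinant of the integrals over consecutive intervals is an integral over the interlacing
points. -/
theorem det_integral_eq {g : Fin n → ℝ → ℝ} (hg : ∀ i, Continuous (g i)) {l : Fin (n + 1) → ℝ}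
    (hl : StrictMono l) :
    IntegrableOn (fun μ : Fin n → ℝ => (Matrix.of fun i j => g i (μ j)).det) {μ | Interlace μ l} ∧
    (Matrix.of fun i j : Fin n => ∫ s in (l j.castSucc)..(l j.succ), g i s).det
      = ∫ μ in {μ | Interlace μ l}, (Matrix.of fun i j => g i (μ j)).det := by
  rw [interlace_eq_pi, IntegrableOn, volume_pi, Measure.restrict_pi_pi]
  have hint : ∀ i j, Integrable (g i) (volume.restrict (Set.Ioo (l j.castSucc) (l (Fin.succ j)))) :=
    fun i j => ((hg i).integrableOn_Icc (a := l j.castSucc) (b := l j.succ)).mono_set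
      Set.Ioo_subset_Icc_self
  have hprod : ∀ σ : Equiv.Perm (Fin n), Integrable (fun μ : Fin n → ℝ => ∏ j, g (σ j) (μ j))
      (Measure.pi fun j : Fin n => volume.restrict (Set.Ioo (l j.castSucc) (l j.succ))) :=
    fun σ => Integrable.fintype_prod fun j => hint (σ j) j
  simp only [Matrix.det_apply', Matrix.of_apply]
  refine ⟨integrable_finsetSum _ fun σ _ => (hprod σ).const_mul _, ?_⟩
  rw [integral_finsetSum _ fun σ _ => (hprod σ).const_mul _]
  refine Finset.sum_congr rfl fun σ _ => ?_
  rw [integral_const_mul, integral_fintype_prod_eq_prod (fun j => g (σ j))]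
  congr 1
  refine Finset.prod_congr rfl fun j _ => ?_
  rw [intervalIntegral.integral_of_le (hl (Fin.castSucc_lt_succ)).le, integral_Ioc_eq_integral_Ioo]

/-- The determinants of the radial systems of consecutive sizes. -/
theorem det_radial_succ (c β : ℝ) (φ : Fin n → ℝ → ℝ) (hφ : ∀ i, Continuous (φ i))
    (l : Fin (n + 1) → ℝ) :
    (Matrix.of fun i j => (Fin.cons (fun x => c * Real.exp (β * x))
        (fun i x => Real.exp (β * x) * ∫ s in (0 : ℝ)..x, Real.exp (-(β * s)) * φ i s) :
          Fin (n + 1) → ℝ → ℝ) i (l j)).det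
      = c * Real.exp (β * ∑ j, l j) *
        (Matrix.of fun i j : Fin n => ∫ s in (l j.castSucc)..(l j.succ),
          Real.exp (-(β * s)) * φ i s).det := by
  let A : Matrix (Fin (n + 1)) (Fin (n + 1)) ℝ := Matrix.of (Fin.cons (fun _ => c)
    fun i j => ∫ s in (0 : ℝ)..(l j), Real.exp (-(β * s)) * φ i s)
  let B : Matrix (Fin (n + 1)) (Fin (n + 1)) ℝ := Matrix.of fun i j =>
    (Fin.cons (A i 0) fun j => A i j.succ - A i j.castSucc : Fin (n + 1) → ℝ) j
  have h1 : (Matrix.of fun i j => (Fin.cons (fun x => c * Real.exp (β * x))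
        (fun i x => Real.exp (β * x) * ∫ s in (0 : ℝ)..x, Real.exp (-(β * s)) * φ i s) :
          Fin (n + 1) → ℝ → ℝ) i (l j))
      = Matrix.of fun i j => Real.exp (β * l j) * A i j := by
    ext i j
    refine Fin.cases ?_ (fun i => ?_) i
    · simp [A, mul_comm]
    · simp [A]
  have h2 : A.det = B.det := by
    refine Matrix.det_eq_of_forall_col_eq_smul_add_pred (fun _ => 1) (fun i => ?_) (fun i j => ?_)
    · simp [B]
    · simp [B]
  have h3 : B.det = c * (Matrix.of fun i j : Fin n => ∫ s in (l j.castSucc)..(l j.succ),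
          Real.exp (-(β * s)) * φ i s).det := by
    rw [Matrix.det_succ_row_zero, Fin.sum_univ_succ]
    have h4 : ∀ j : Fin n, B 0 j.succ = 0 := fun j => by simp [B, A]
    simp only [h4, mul_zero, zero_mul, Finset.sum_const_zero, add_zero]
    have h5 : B 0 0 = c := by simp [B, A]
    rw [h5]
    simp only [Fin.val_zero, pow_zero, one_mul]
    congr 2
    ext i j
    have hc : Continuous fun s => Real.exp (-(β * s)) * φ i s :=
      (by fun_prop : Continuous fun s => Real.exp (-(β * s))).mul (hφ i)
    simp only [Matrix.submatrix_apply, Fin.succAbove_zero, B, Matrix.of_apply, Fin.cons_succ, A]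
    rw [intervalIntegral.integral_interval_sub_left (hc.intervalIntegrable _ _)
      (hc.intervalIntegrable _ _)]
  rw [h1, Matrix.det_mul_row, h2, h3, ← Real.exp_sum, ← Finset.mul_sum]
  ring

theorem abs_integral_exp_mul_le {φ : ℝ → ℝ} {C β : ℝ}
    (h : ∀ x, |φ x| ≤ C * Real.exp (C * |x|)) (x : ℝ) :
    |Real.exp (β * x) * ∫ s in (0 : ℝ)..x, Real.exp (-(β * s)) * φ s|
      ≤ (C + 2 * |β| + 1) * Real.exp ((C + 2 * |β| + 1) * |x|) := by
  have hC : 0 ≤ C := by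
    have := h 0
    simp at this
    exact (abs_nonneg _).trans this
  have h1 : ‖∫ s in (0 : ℝ)..x, Real.exp (-(β * s)) * φ s‖
      ≤ (Real.exp (|β| * |x|) * (C * Real.exp (C * |x|))) * |x - 0| := by
    refine intervalIntegral.norm_integral_le_of_norm_le_const fun s hs => ?_
    have hsx : |s| ≤ |x| := by
      rcases Set.mem_uIoc.1 hs with h | h
      · rw [abs_of_pos h.1, abs_of_pos (h.1.trans_le h.2)]; exact h.2
      · rw [abs_of_nonpos h.2, abs_of_nonpos (h.1.le.trans h.2)]; linarith [h.1]
    rw [norm_mul, Real.norm_eq_abs, Real.norm_eq_abs, Real.abs_exp]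
    refine mul_le_mul ?_ ((h s).trans ?_) (abs_nonneg _) (Real.exp_pos _).le
    · refine Real.exp_le_exp.2 ?_
      calc -(β * s) ≤ |β * s| := neg_le_abs _
        _ = |β| * |s| := abs_mul _ _
        _ ≤ |β| * |x| := by gcongr
    · gcongr
  rw [abs_mul, Real.abs_exp]
  rw [Real.norm_eq_abs, sub_zero] at h1
  have h2 : Real.exp (β * x) ≤ Real.exp (|β| * |x|) := Real.exp_le_exp.2 (by
    rw [← abs_mul]; exact le_abs_self _)
  have h3 : |x| ≤ Real.exp |x| := by
    have := Real.add_one_le_exp |x|; linarith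
  calc Real.exp (β * x) * |∫ s in (0 : ℝ)..x, Real.exp (-(β * s)) * φ s|
      ≤ Real.exp (|β| * |x|) * ((Real.exp (|β| * |x|) * (C * Real.exp (C * |x|))) *
          Real.exp |x|) := by
        refine mul_le_mul h2 (h1.trans ?_) (abs_nonneg _) (Real.exp_pos _).le
        gcongr
    _ = C * Real.exp ((C + 2 * |β| + 1) * |x|) := by
        rw [show (C + 2 * |β| + 1) * |x| = |β| * |x| + (|β| * |x| + C * |x| + |x|) by ring,
          Real.exp_add, Real.exp_add, Real.exp_add]
        ring
    _ ≤ _ := by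
        have := abs_nonneg β
        gcongr
        linarith

theorem hasDerivAt_exp_mul_integral {φ : ℝ → ℝ} (hφ : Continuous φ) (β x : ℝ) :
    HasDerivAt (fun x => Real.exp (β * x) * ∫ s in (0 : ℝ)..x, Real.exp (-(β * s)) * φ s)
      (β * (Real.exp (β * x) * ∫ s in (0 : ℝ)..x, Real.exp (-(β * s)) * φ s) + φ x) x := by
  have hc : Continuous fun s => Real.exp (-(β * s)) * φ s :=
    (by fun_prop : Continuous fun s => Real.exp (-(β * s))).mul hφ
  have h1 := intervalIntegral.integral_hasDerivAt_right (hc.intervalIntegrable 0 x)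
    (hc.stronglyMeasurableAtFilter _ _) hc.continuousAt
  have h2 : HasDerivAt (fun x : ℝ => Real.exp (β * x)) (Real.exp (β * x) * β) x := by
    simpa using ((hasDerivAt_id x).const_mul β).exp
  refine (h2.mul h1).congr_deriv ?_
  rw [← mul_assoc (Real.exp (β * x)) (Real.exp _), ← Real.exp_add, add_neg_cancel, Real.exp_zero]
  ring

/-- A function is determined up to a multiple of the exponential by `f' - β f`. -/
theorem eq_exp_add_of_deriv_sub {f f' : ℝ → ℝ} {β : ℝ} (hf : ∀ x, HasDerivAt f (f' x) x)
    {φ : Fin n → ℝ → ℝ} (hφ : ∀ i, Continuous (φ i)) {c : Fin n → ℝ}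
    (h : ∀ x, f' x - β * f x = ∑ i, c i * φ i x) (x : ℝ) :
    f x = f 0 * Real.exp (β * x) + ∑ i, c i *
      (Real.exp (β * x) * ∫ s in (0 : ℝ)..x, Real.exp (-(β * s)) * φ i s) := by
  let g : ℝ → ℝ := fun x => ∑ i, c i *
      (Real.exp (β * x) * ∫ s in (0 : ℝ)..x, Real.exp (-(β * s)) * φ i s)
  have hg : ∀ x, HasDerivAt g (β * g x + ∑ i, c i * φ i x) x := fun x => by
    refine (HasDerivAt.fun_sum fun i _ =>
      (hasDerivAt_exp_mul_integral (hφ i) β x).const_mul (c i)).congr_deriv ?_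
    rw [Finset.mul_sum, ← Finset.sum_add_distrib]
    exact Finset.sum_congr rfl fun i _ => by ring
  have h2 : ∀ x, HasDerivAt (fun x : ℝ => Real.exp (-(β * x))) (-(Real.exp (-(β * x)) * β)) x :=
    fun x => by simpa using ((hasDerivAt_id x).const_mul β).neg.exp
  have hconst : ∀ x, HasDerivAt (fun x => Real.exp (-(β * x)) * (f x - g x)) 0 x := fun x => by
    refine ((h2 x).mul ((hf x).sub (hg x))).congr_deriv ?_
    rw [← h x, Pi.sub_apply]
    ring
  have := is_const_of_deriv_eq_zero (fun x => (hconst x).differentiableAt)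
    (fun x => (hconst x).deriv) x 0
  simp only [mul_zero, neg_zero, Real.exp_zero, one_mul] at this
  have hg0 : g 0 = 0 := by simp [g]
  rw [hg0, sub_zero] at this
  have h3 : f x - g x = f 0 * Real.exp (β * x) := by
    rw [← this, mul_comm, ← mul_assoc, ← Real.exp_add, add_neg_cancel, Real.exp_zero, one_mul]
  linarith

end

section

variable {n : ℕ}

theorem measurableSet_strictMono : MeasurableSet {l : Fin n → ℝ | StrictMono l} := by
  have : {l : Fin n → ℝ | StrictMono l} = ⋂ (i) (j) (_ : i < j), {l : Fin n → ℝ | l i < l j} := by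
    ext l
    simp only [Set.mem_ofPred_eq, Set.mem_iInter]
    exact ⟨fun h i j hij => h hij, fun h i j hij => h i j hij⟩
  rw [this]
  exact MeasurableSet.iInter fun i => MeasurableSet.iInter fun j => MeasurableSet.iInter fun _ =>
    measurableSet_lt (measurable_pi_apply _) (measurable_pi_apply _)

theorem measurableSet_interlace :
    MeasurableSet {p : (Fin n → ℝ) × (Fin (n + 1) → ℝ) | Interlace p.1 p.2} := by
  have : {p : (Fin n → ℝ) × (Fin (n + 1) → ℝ) | Interlace p.1 p.2}
      = ⋂ i : Fin n, {p | p.2 i.castSucc < p.1 i} ∩ {p | p.1 i < p.2 i.succ} := by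
    ext l; simp [Interlace]
  rw [this]
  exact MeasurableSet.iInter fun i => (measurableSet_lt (by fun_prop) (by fun_prop)).inter
    (measurableSet_lt (by fun_prop) (by fun_prop))

theorem measurable_comp_diagonal {K : Matrix (Fin n) (Fin n) ℂ → ENNReal}
    (hK : Measurable fun x => K (hermitian x)) :
    Measurable fun l : Fin n → ℝ => K (Matrix.diagonal fun i => (l i : ℂ)) := by
  have h : Measurable (diagCoord : (Fin n → ℝ) → _) :=
    measurable_pi_lambda _ fun i => measurable_pi_lambda _ fun j => by
      by_cases hij : i = j
      · simpa [diagCoord, hij] using measurable_pi_apply j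
      · simp [diagCoord, hij]
  simpa only [Function.comp_def, hermitian_diagCoord] using hK.comp h

theorem continuous_det_of {φ : Fin n → ℝ → ℝ} (hφ : ∀ i, Continuous (φ i)) :
    Continuous fun l : Fin n → ℝ => (Matrix.of fun i j => φ i (l j)).det :=
  Continuous.matrix_det (continuous_matrix fun i j => (hφ i).comp (continuous_apply j))

theorem continuous_det_vandermonde :
    Continuous fun l : Fin n → ℝ => (Matrix.vandermonde l).det :=
  Continuous.matrix_det (continuous_matrix fun i _ => (continuous_apply i).pow _)

/-- Integrating the determinant of a system of `n` functions over the points between consecutive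
`l j` gives a determinant of `n + 1` functions: the exponential `exp (β x)` and primitives. -/
theorem lintegral_interlace_det {φ : Fin n → ℝ → ℝ} (hφ : ∀ i, Continuous (φ i)) (c β : ℝ)
    (hc : 0 ≤ c) (hpos : ∀ l, StrictMono l → 0 ≤ (Matrix.of fun i j => φ i (l j)).det)
    {l : Fin (n + 1) → ℝ} (hl : StrictMono l) :
    (0 ≤ (Matrix.of fun i j => (Fin.cons (fun x => c * Real.exp (β * x))
        (fun i x => Real.exp (β * x) * ∫ s in (0 : ℝ)..x, Real.exp (-(β * s)) * φ i s) :
          Fin (n + 1) → ℝ → ℝ) i (l j)).det) ∧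
    ∫⁻ μ in {μ | Interlace μ l}, ENNReal.ofReal c *
        (ENNReal.ofReal (Real.exp (β * (∑ j, l j - ∑ i, μ i))) *
          ENNReal.ofReal (Matrix.of fun i j => φ i (μ j)).det)
      = ENNReal.ofReal (Matrix.of fun i j => (Fin.cons (fun x => c * Real.exp (β * x))
        (fun i x => Real.exp (β * x) * ∫ s in (0 : ℝ)..x, Real.exp (-(β * s)) * φ i s) :
          Fin (n + 1) → ℝ → ℝ) i (l j)).det := by
  have hms : MeasurableSet {μ : Fin n → ℝ | Interlace μ l} := by
    rw [interlace_eq_pi]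
    exact MeasurableSet.univ_pi fun _ => measurableSet_Ioo
  have hcont : ∀ i, Continuous fun s => Real.exp (-(β * s)) * φ i s := fun i =>
    (by fun_prop : Continuous fun s => Real.exp (-(β * s))).mul (hφ i)
  obtain ⟨hint, heq⟩ := det_integral_eq hcont hl
  have hdet : ∀ μ : Fin n → ℝ, (Matrix.of fun i j => Real.exp (-(β * μ j)) * φ i (μ j)).det
      = Real.exp (-(β * ∑ j, μ j)) * (Matrix.of fun i j => φ i (μ j)).det := fun μ => by
    have := Matrix.det_mul_row (fun j => Real.exp (-(β * μ j)))
      (Matrix.of fun i j => φ i (μ j))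
    rw [← Real.exp_sum, Finset.sum_neg_distrib, ← Finset.mul_sum] at this
    exact this
  have hnn : ∀ μ ∈ {μ | Interlace μ l},
      0 ≤ (Matrix.of fun i j => Real.exp (-(β * μ j)) * φ i (μ j)).det := fun μ hμ => by
    rw [hdet]
    exact mul_nonneg (Real.exp_pos _).le (hpos μ (Interlace.strictMono_left hμ))
  rw [det_radial_succ c β φ hφ, heq]
  refine ⟨mul_nonneg (mul_nonneg hc (Real.exp_pos _).le) (setIntegral_nonneg hms hnn), ?_⟩
  rw [ENNReal.ofReal_mul (mul_nonneg hc (Real.exp_pos _).le),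
    ofReal_integral_eq_lintegral_ofReal hint ((ae_restrict_iff' hms).2 (ae_of_all _ hnn)),
    ← lintegral_const_mul' _ _ ENNReal.ofReal_ne_top]
  refine setLIntegral_congr_fun hms fun μ hμ => ?_
  have h0 := hpos μ (Interlace.strictMono_left hμ)
  simp only [hdet]
  rw [← ENNReal.ofReal_mul (Real.exp_pos _).le, ← ENNReal.ofReal_mul hc,
    ← ENNReal.ofReal_mul (mul_nonneg hc (Real.exp_pos _).le), mul_sub, sub_eq_add_neg, Real.exp_add]
  congr 1
  ring

/-- The integral of a spectral function against `exp (∑ b_i M_ii)` over Hermitian matrices reduces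
to the eigenvalues: the density is the product of the Vandermonde determinant and of the
determinant of a system of solutions of `∏ (D - b_i) f = 0`. The proof peels off one row and
column at a time, and thus merges Weyl's integration formula with the
Harish-Chandra-Itzykson-Zuber integral, without division by differences of the `b_i`. -/
theorem exists_radial_system : ∀ (n : ℕ) (b : Fin n → ℝ), ∃ φ : Fin n → ℝ → ℝ,
    (∀ i, Continuous (φ i)) ∧ (∃ C : ℝ, ∀ i x, |φ i x| ≤ C * Real.exp (C * |x|)) ∧
    (∀ f ∈ Sol n b, ∃ c : Fin n → ℝ, ∀ x, f x = ∑ i, c i * φ i x) ∧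
    (∀ l, StrictMono l → 0 ≤ (Matrix.of fun i j => φ i (l j)).det) ∧
    ∀ K : Matrix (Fin n) (Fin n) ℂ → ENNReal, (Measurable fun x => K (hermitian x)) →
      IsSpectral K →
      ∫⁻ x, K (hermitian x) * ENNReal.ofReal (Real.exp (∑ i, b i * x i i))
        = ∫⁻ l in {l : Fin n → ℝ | StrictMono l}, K (Matrix.diagonal fun i => (l i : ℂ)) *
          ENNReal.ofReal ((Matrix.vandermonde l).det * (Matrix.of fun i j => φ i (l j)).det) := by
  intro n
  induction n with
  | zero =>
    intro b
    refine ⟨0, fun i => i.elim0, ⟨0, fun i => i.elim0⟩, fun f hf => ⟨0, fun x => ?_⟩,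
      fun l _ => ?_, fun K _ _ => ?_⟩
    · rw [show f = 0 from hf]; simp
    · simp
    · have h : {l : Fin 0 → ℝ | StrictMono l} = Set.univ := by
        ext l; simp [Subsingleton.strictMono]
      rw [h, Measure.restrict_univ, volume_pi, volume_pi, Measure.pi_of_empty,
        Measure.pi_of_empty, lintegral_dirac, lintegral_dirac]
      simp only [Finset.univ_eq_empty, Finset.sum_empty, Matrix.det_isEmpty, mul_one, Real.exp_zero]
      congr 2
      exact Subsingleton.elim _ _
  | succ n ih =>
    intro b
    obtain ⟨φ, hφ, ⟨C, hC⟩, hsol, hpos, hint⟩ := ih (Fin.tail b)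
    -- the new functions solve `f' - b₀ f = φ i`; the first one solves the homogeneous equation
    set φ' : Fin (n + 1) → ℝ → ℝ := Fin.cons (fun x => Real.pi ^ n * Real.exp (b 0 * x))
        (fun i x => Real.exp (b 0 * x) * ∫ s in (0 : ℝ)..x, Real.exp (-(b 0 * s)) * φ i s) with hφ'
    have hπ : 0 < Real.pi ^ n := pow_pos Real.pi_pos n
    have hkey : ∀ l : Fin (n + 1) → ℝ, StrictMono l → _ := fun l hl =>
      lintegral_interlace_det hφ (Real.pi ^ n) (b 0) hπ.le hpos hl
    refine ⟨φ', ?_, ?_, ?_, fun l hl => (hkey l hl).1, ?_⟩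
    · refine fun i => Fin.cases ?_ (fun i => ?_) i
      · simp only [hφ', Fin.cons_zero]
        fun_prop
      · simp only [hφ', Fin.cons_succ]
        exact continuous_iff_continuousAt.2 fun x =>
          (hasDerivAt_exp_mul_integral (hφ i) (b 0) x).continuousAt
    · refine ⟨max (Real.pi ^ n + |b 0|) (|C| + 2 * |b 0| + 1), fun i x => ?_⟩
      refine Fin.cases ?_ (fun i => ?_) i
      · simp only [hφ', Fin.cons_zero]
        rw [abs_mul, abs_of_pos hπ, Real.abs_exp]
        have h1 : b 0 * x ≤ |b 0| * |x| := by rw [← abs_mul]; exact le_abs_self _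
        have h2 := le_max_left (Real.pi ^ n + |b 0|) (|C| + 2 * |b 0| + 1)
        have h3 := abs_nonneg (b 0)
        refine mul_le_mul (by linarith) (Real.exp_le_exp.2 (h1.trans ?_)) (Real.exp_pos _).le
          (by linarith)
        exact mul_le_mul_of_nonneg_right (by linarith) (abs_nonneg x)
      · simp only [hφ', Fin.cons_succ]
        have h4 : ∀ x, |φ i x| ≤ |C| * Real.exp (|C| * |x|) := fun x => by
          refine (hC i x).trans (mul_le_mul (le_abs_self C) (Real.exp_le_exp.2 ?_)
            (Real.exp_pos _).le (abs_nonneg C))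
          exact mul_le_mul_of_nonneg_right (le_abs_self C) (abs_nonneg x)
        refine (abs_integral_exp_mul_le h4 x).trans ?_
        have h2 := le_max_right (Real.pi ^ n + |b 0|) (|C| + 2 * |b 0| + 1)
        have h3 := abs_nonneg (b 0)
        have h5 := abs_nonneg C
        refine mul_le_mul h2 (Real.exp_le_exp.2 ?_) (Real.exp_pos _).le (by linarith)
        exact mul_le_mul_of_nonneg_right h2 (abs_nonneg x)
    · rintro f ⟨f', hf', hf⟩
      obtain ⟨c, hc⟩ := hsol _ hf
      refine ⟨Fin.cons (f 0 / Real.pi ^ n) c, fun x => ?_⟩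
      rw [eq_exp_add_of_deriv_sub hf' hφ hc x, Fin.sum_univ_succ]
      simp only [hφ', Fin.cons_zero, Fin.cons_succ]
      field_simp
    · intro K hK hs
      set G : ℝ → ENNReal := fun y => ENNReal.ofReal (Real.exp (b 0 * y)) with hG
      have hGm : Measurable G := by fun_prop
      -- the border integrated out: a spectral function of the corner
      set K' : Matrix (Fin n) (Fin n) ℂ → ENNReal :=
        fun M => ∫⁻ y : ℝ, (∫⁻ v : Fin n → ℂ, K (bord y v M)) * G y with hK'
      have hmb := measurable_comp_bord hK
      have hK'm : Measurable fun x => K' (hermitian x) := by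
        have h1 : Measurable fun q : (Fin n → Fin n → ℝ) × ℝ =>
            ∫⁻ v : Fin n → ℂ, K (bord q.2 v (hermitian q.1)) := by
          refine Measurable.lintegral_prod_right' (f := fun q : ((Fin n → Fin n → ℝ) × ℝ) ×
            (Fin n → ℂ) => K (bord q.1.2 q.2 (hermitian q.1.1))) ?_
          exact hmb.comp (((measurable_snd.comp measurable_fst).prodMk measurable_snd).prodMk
            (measurable_fst.comp measurable_fst))
        exact Measurable.lintegral_prod_right' (h1.mul (hGm.comp measurable_snd))
      -- the source term of the first row is `b₀ y`, with `y` the corner entry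
      have hlhs : ∫⁻ x, K (hermitian x) * ENNReal.ofReal (Real.exp (∑ i, b i * x i i))
          = ∫⁻ x, K' (hermitian x) * ENNReal.ofReal (Real.exp (∑ i, Fin.tail b i * x i i)) := by
        have hm : Measurable fun x : Fin (n + 1) → Fin (n + 1) → ℝ =>
            K (hermitian x) * ENNReal.ofReal (Real.exp (∑ i, b i * x i i)) :=
          hK.mul (by fun_prop)
        rw [lintegral_bordCoord hm]
        refine lintegral_congr fun x => ?_
        rw [hK', ← lintegral_mul_const' _ _ ENNReal.ofReal_ne_top]
        refine lintegral_congr fun y => ?_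
        rw [mul_assoc, ← lintegral_mul_const' _ _
          (ENNReal.mul_ne_top ENNReal.ofReal_ne_top ENNReal.ofReal_ne_top)]
        refine lintegral_congr fun v => ?_
        rw [hermitian_bordCoord, Fin.sum_univ_succ, Real.exp_add,
          ENNReal.ofReal_mul (Real.exp_pos _).le]
        simp [bordCoord, Fin.tail]
      rw [hlhs, hint K' hK'm (hs.lintegral_bord hK G)]
      -- the integrand on interlacing pairs of spectra: `μ` of the corner, `l` of the full matrix
      let F : (Fin n → ℝ) × (Fin (n + 1) → ℝ) → ENNReal :=
        {p : (Fin n → ℝ) × (Fin (n + 1) → ℝ) | Interlace p.1 p.2}.indicator fun p =>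
          K (Matrix.diagonal fun i => (p.2 i : ℂ)) *
            ENNReal.ofReal (Matrix.vandermonde p.2).det *
            (ENNReal.ofReal (Real.pi ^ n) * (G (∑ j, p.2 j - ∑ i, p.1 i) *
              ENNReal.ofReal (Matrix.of fun i j => φ i (p.1 j)).det))
      have hF : Measurable F := by
        refine Measurable.indicator ?_ measurableSet_interlace
        refine Measurable.mul (Measurable.mul ((measurable_comp_diagonal hK).comp measurable_snd)
          (ENNReal.measurable_ofReal.comp (continuous_det_vandermonde.measurable.comp
            measurable_snd))) (measurable_const.mul (Measurable.mul (hGm.comp (by fun_prop))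
          (ENNReal.measurable_ofReal.comp ((continuous_det_of hφ).measurable.comp
            measurable_fst))))
      -- the eigenvalues `l` of the bordered matrix become the coordinates of the border
      have h1 : ∫⁻ μ in {μ : Fin n → ℝ | StrictMono μ}, K' (Matrix.diagonal fun i => (μ i : ℂ)) *
          ENNReal.ofReal ((Matrix.vandermonde μ).det * (Matrix.of fun i j => φ i (μ j)).det)
          = ∫⁻ μ, ∫⁻ l, F (μ, l) := by
        rw [← lintegral_indicator measurableSet_strictMono]
        refine lintegral_congr fun μ => ?_
        by_cases hμ : StrictMono μ
        · rw [Set.indicator_of_mem (show μ ∈ {μ | StrictMono μ} from hμ)]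
          simp only [hK']
          rw [lintegral_bord_diagonal hK hs hGm hμ,
            ← lintegral_mul_const' _ _ ENNReal.ofReal_ne_top,
            ← lintegral_indicator (measurableSet_interlace_right μ)]
          refine lintegral_congr fun l => ?_
          by_cases hl : Interlace μ l
          · simp only [F]
            rw [Set.indicator_of_mem (show l ∈ {l | Interlace μ l} from hl),
              Set.indicator_of_mem (show (μ, l) ∈ {p : (Fin n → ℝ) × (Fin (n + 1) → ℝ) |
                Interlace p.1 p.2} from hl)]
            -- the Vandermonde determinant of `μ` cancels against the Jacobian
            have h2 : ENNReal.ofReal |(radialJac μ l).det| * ENNReal.ofReal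
                (Matrix.vandermonde μ).det = ENNReal.ofReal (Real.pi ^ n) *
                  ENNReal.ofReal (Matrix.vandermonde l).det := by
              rw [← ENNReal.ofReal_mul (abs_nonneg _), ← ENNReal.ofReal_mul hπ.le,
                abs_det_radialJac hμ hl.strictMono_right]
            rw [ENNReal.ofReal_mul (det_vandermonde_pos hμ).le]
            calc _ = (ENNReal.ofReal |(radialJac μ l).det| * ENNReal.ofReal
                (Matrix.vandermonde μ).det) * (K (Matrix.diagonal fun i => (l i : ℂ)) *
                  (G (∑ j, l j - ∑ i, μ i) *
                    ENNReal.ofReal (Matrix.of fun i j => φ i (μ j)).det)) := by ring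
              _ = _ := by rw [h2]; ring
          · simp only [F]
            rw [Set.indicator_of_notMem (show l ∉ {l | Interlace μ l} from hl),
              Set.indicator_of_notMem (show (μ, l) ∉ {p : (Fin n → ℝ) × (Fin (n + 1) → ℝ) |
                Interlace p.1 p.2} from hl)]
        · rw [Set.indicator_of_notMem (show μ ∉ {μ | StrictMono μ} from hμ)]
          have : ∀ l, F (μ, l) = 0 := fun l =>
            Set.indicator_of_notMem (fun h => hμ (Interlace.strictMono_left h)) _
          simp [this]
      -- for fixed `l`, the eigenvalues `μ` of the corner run between consecutive `l j`
      rw [h1, lintegral_lintegral_swap (f := fun μ l => F (μ, l)) hF.aemeasurable,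
        ← lintegral_indicator measurableSet_strictMono]
      refine lintegral_congr fun l => ?_
      by_cases hl : StrictMono l
      · rw [Set.indicator_of_mem (show l ∈ {l | StrictMono l} from hl),
          ENNReal.ofReal_mul (det_vandermonde_pos hl).le, ← (hkey l hl).2, ← mul_assoc]
        have hms : MeasurableSet {μ : Fin n → ℝ | Interlace μ l} := by
          rw [interlace_eq_pi]
          exact MeasurableSet.univ_pi fun _ => measurableSet_Ioo
        have hm : Measurable fun μ : Fin n → ℝ => ENNReal.ofReal (Real.pi ^ n) *
            (ENNReal.ofReal (Real.exp (b 0 * (∑ j, l j - ∑ i, μ i))) *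
              ENNReal.ofReal (Matrix.of fun i j => φ i (μ j)).det) :=
          measurable_const.mul (Measurable.mul (by fun_prop)
            (ENNReal.measurable_ofReal.comp (continuous_det_of hφ).measurable))
        rw [← lintegral_const_mul _ hm, ← lintegral_indicator hms]
        refine lintegral_congr fun μ => ?_
        by_cases hi : Interlace μ l
        · rw [Set.indicator_of_mem (show μ ∈ {μ | Interlace μ l} from hi)]
          exact Set.indicator_of_mem (show (μ, l) ∈ {p : (Fin n → ℝ) × (Fin (n + 1) → ℝ) |
                Interlace p.1 p.2} from hi) _
        · rw [Set.indicator_of_notMem (show μ ∉ {μ | Interlace μ l} from hi)]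
          exact Set.indicator_of_notMem (show (μ, l) ∉ {p : (Fin n → ℝ) × (Fin (n + 1) → ℝ) |
                Interlace p.1 p.2} from hi) _
      · rw [Set.indicator_of_notMem (show l ∉ {l | StrictMono l} from hl)]
        have : ∀ μ, F (μ, l) = 0 := fun μ =>
          Set.indicator_of_notMem (fun h => hl (Interlace.strictMono_right h)) _
        simp [this]

end

/-! ### The average characteristic polynomial -/

section

variable {n : ℕ}

/-- The coefficients of a polynomial of bounded degree are fixed linear combinations of its
values. -/
theorem exists_coeff_eq_sum_eval (K : Type*) [Field K] [CharZero K] (n i : ℕ) :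
    ∃ c : Fin (n + 1) → K, ∀ p : K[X], p.natDegree ≤ n →
      p.coeff i = ∑ j, c j * p.eval ((j : ℕ) : K) := by
  have hinj : Set.InjOn (fun j : Fin (n + 1) => ((j : ℕ) : K))
      (Finset.univ : Finset (Fin (n + 1))) :=
    fun i _ j _ h => Fin.ext (Nat.cast_injective h)
  refine ⟨fun j => (Lagrange.basis Finset.univ (fun j : Fin (n + 1) => ((j : ℕ) : K)) j).coeff i,
    fun p hp => ?_⟩
  have h := Lagrange.eq_interpolate (f := p) hinj (by
    rw [Finset.card_univ, Fintype.card_fin]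
    exact degree_le_natDegree.trans_lt (by exact_mod_cast Nat.lt_succ_of_le hp))
  conv_lhs => rw [h, Lagrange.interpolate_apply, finsetSum_coeff]
  exact Finset.sum_congr rfl fun j _ => by rw [coeff_C_mul, mul_comm]

theorem continuous_hermitian : Continuous (hermitian : (Fin n → Fin n → ℝ) → _) := by
  refine continuous_matrix fun i j => ?_
  simp only [hermitian, Matrix.of_apply]
  split_ifs <;> fun_prop

theorem continuous_charpoly_coeff (i : ℕ) :
    Continuous fun M : Matrix (Fin n) (Fin n) ℂ => M.charpoly.coeff i := by
  obtain ⟨c, hc⟩ := exists_coeff_eq_sum_eval ℂ n i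
  have h : (fun M : Matrix (Fin n) (Fin n) ℂ => M.charpoly.coeff i)
      = fun M => ∑ j : Fin (n + 1), c j *
        (Matrix.scalar (Fin n) (((j : ℕ) : ℂ)) - M).det := funext fun M => by
    rw [hc _ (by rw [Matrix.charpoly_natDegree_eq_dim, Fintype.card_fin])]
    simp only [Matrix.eval_charpoly]
  rw [h]
  exact continuous_finsetSum _ fun j _ => continuous_const.mul
    (Continuous.matrix_det (continuous_const.sub continuous_id))

theorem trace_aeval_hermitian {M : Matrix (Fin n) (Fin n) ℂ} (hM : M.IsHermitian) (V : ℝ[X]) :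
    (aeval M V).trace = ((∑ i, V.eval (hM.eigenvalues i) : ℝ) : ℂ) := by
  have hpow : ∀ k : ℕ, (M ^ k).trace = ((∑ i, hM.eigenvalues i ^ k : ℝ) : ℂ) := by
    intro k
    conv_lhs => rw [hM.spectral_theorem]
    rw [← map_pow, Unitary.conjStarAlgAut_apply, Matrix.trace_mul_comm, ← mul_assoc,
      Unitary.coe_star_mul_self, one_mul, Matrix.diagonal_pow, Matrix.trace_diagonal]
    push_cast
    rfl
  rw [aeval_eq_sum_range, Matrix.trace_sum]
  simp only [Matrix.trace_smul, hpow, eval_eq_sum_range]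
  rw [Finset.sum_comm]
  push_cast
  simp only [Finset.mul_sum, Complex.real_smul]

theorem trace_aeval_diagonal (l : Fin n → ℝ) (V : ℝ[X]) :
    (aeval (Matrix.diagonal fun i => (l i : ℂ)) V).trace = ((∑ i, V.eval (l i) : ℝ) : ℂ) := by
  rw [aeval_eq_sum_range, Matrix.trace_sum]
  simp only [Matrix.trace_smul, Matrix.diagonal_pow, Matrix.trace_diagonal, eval_eq_sum_range,
    Pi.pow_apply]
  rw [Finset.sum_comm]
  push_cast
  simp only [Finset.mul_sum, Complex.real_smul]

theorem charpoly_hermitian_real {M : Matrix (Fin n) (Fin n) ℂ} (hM : M.IsHermitian) (i : ℕ) :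
    ((M.charpoly.coeff i).re : ℂ) = M.charpoly.coeff i := by
  rw [hM.charpoly_eq]
  have : (∏ i, (X - C ((hM.eigenvalues i : ℝ) : ℂ)) : ℂ[X])
      = (∏ i, (X - C (hM.eigenvalues i)) : ℝ[X]).map (algebraMap ℝ ℂ) := by
    simp [Polynomial.map_prod]
  erw [this]
  rw [coeff_map]
  simp

/-- Integrals of determinants of functions of one variable each. -/
theorem integral_det {g : Fin n → Fin n → ℝ → ℝ} (hg : ∀ i j, Integrable (g i j)) :
    Integrable (fun l : Fin n → ℝ => (Matrix.of fun i j => g i j (l i)).det) ∧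
    ∫ l : Fin n → ℝ, (Matrix.of fun i j => g i j (l i)).det
      = (Matrix.of fun i j => ∫ s, g i j s).det := by
  have hprod : ∀ σ : Equiv.Perm (Fin n), Integrable (fun l : Fin n → ℝ => ∏ i, g i (σ i) (l i)) :=
    fun σ => Integrable.fintype_prod fun i => hg i (σ i)
  have hdet : ∀ A : Matrix (Fin n) (Fin n) ℝ,
      A.det = ∑ σ : Equiv.Perm (Fin n),
        ((Equiv.Perm.sign σ : ℤ) : ℝ) * ∏ i, A i (σ i) := fun A => by
    rw [← Matrix.det_transpose, Matrix.det_apply']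
    rfl
  simp only [hdet, Matrix.of_apply]
  refine ⟨integrable_finsetSum _ fun σ _ => (hprod σ).const_mul _, ?_⟩
  rw [integral_finsetSum _ fun σ _ => (hprod σ).const_mul _]
  refine Finset.sum_congr rfl fun σ _ => ?_
  rw [integral_const_mul, volume_pi, integral_fintype_prod_eq_prod (fun i => g i (σ i))]

/-- Integration over `ℝⁿ` and over the chamber of increasing vectors. -/
theorem integral_strictMono {G : (Fin n → ℝ) → ℝ} (hG : Integrable G)
    (h0 : ∀ l, ¬ Function.Injective l → G l = 0) :
    IntegrableOn (fun l => ∑ σ : Equiv.Perm (Fin n), G (l ∘ σ)) {l | StrictMono l} ∧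
    ∫ l in {l | StrictMono l}, ∑ σ : Equiv.Perm (Fin n), G (l ∘ σ) = ∫ l, G l := by
  have hmp : ∀ σ : Equiv.Perm (Fin n),
      MeasurePreserving (fun l : Fin n → ℝ => l ∘ σ) volume volume := fun σ => by
    have h := volume_measurePreserving_piCongrLeft (fun _ : Fin n => ℝ) σ.symm
    have heq : (fun l : Fin n → ℝ => l ∘ σ)
        = MeasurableEquiv.piCongrLeft (fun _ : Fin n => ℝ) σ.symm := by
      ext l i
      have := MeasurableEquiv.piCongrLeft_apply_apply (β := fun _ : Fin n => ℝ) σ.symm l (σ i)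
      rw [Equiv.symm_apply_apply] at this
      exact this.symm
    rw [heq]
    exact h
  have hme : ∀ σ : Equiv.Perm (Fin n), MeasurableEmbedding (fun l : Fin n → ℝ => l ∘ σ) :=
    fun σ => by
    have heq : (fun l : Fin n → ℝ => l ∘ σ)
        = MeasurableEquiv.piCongrLeft (fun _ : Fin n => ℝ) σ.symm := by
      ext l i
      have := MeasurableEquiv.piCongrLeft_apply_apply (β := fun _ : Fin n => ℝ) σ.symm l (σ i)
      rw [Equiv.symm_apply_apply] at this
      exact this.symm
    rw [heq]
    exact MeasurableEquiv.measurableEmbedding _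
  have hGσ : ∀ σ : Equiv.Perm (Fin n), Integrable fun l => G (l ∘ σ) := fun σ =>
    (hmp σ).integrable_comp_of_integrable hG
  refine ⟨(integrable_finsetSum _ fun σ _ => hGσ σ).integrableOn, ?_⟩
  rw [integral_finsetSum _ fun σ _ => (hGσ σ).integrableOn]
  let S : Set (Fin n → ℝ) := {l | StrictMono l}
  have hS : MeasurableSet S := measurableSet_strictMono
  have h1 : ∀ σ : Equiv.Perm (Fin n), ∫ l in S, G (l ∘ σ)
      = ∫ l, S.indicator (fun _ => G l) (l ∘ σ.symm) := fun σ => by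
    rw [← integral_indicator hS,
      ← (hmp σ).integral_comp (hme σ) fun l => S.indicator (fun _ => G l) (l ∘ σ.symm)]
    refine integral_congr_ae (Eventually.of_forall fun l => ?_)
    simp only [Function.comp_assoc, Equiv.self_comp_symm, Function.comp_id, Set.indicator]
  have hint : ∀ σ : Equiv.Perm (Fin n),
      Integrable fun l => S.indicator (fun _ => G l) (l ∘ σ.symm) := fun σ =>
    (hG.indicator ((hmp σ.symm).measurable hS)).congr (Eventually.of_forall fun l => rfl)
  rw [Finset.sum_congr rfl fun σ _ => h1 σ, ← integral_finsetSum _ fun σ _ => hint σ]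
  refine integral_congr_ae (Eventually.of_forall fun l => ?_)
  show ∑ σ : Equiv.Perm (Fin n), S.indicator (fun _ => G l) (l ∘ σ.symm) = G l
  by_cases hl : Function.Injective l
  · have hs : StrictMono (l ∘ Tuple.sort l) :=
      (Tuple.monotone_sort l).strictMono_of_injective (hl.comp (Tuple.sort l).injective)
    rw [Finset.sum_eq_single_of_mem (Tuple.sort l).symm (Finset.mem_univ _)]
    · exact Set.indicator_of_mem (show l ∘ _ ∈ S from hs) _
    · intro σ _ hσ
      refine Set.indicator_of_notMem (fun h => hσ ?_) _
      have h' : StrictMono (l ∘ σ.symm) := h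
      have := (h'.range_inj hs).1 (by
        rw [Set.range_comp, Set.range_comp, σ.symm.surjective.range_eq,
          (Tuple.sort l).surjective.range_eq])
      rw [← Equiv.symm_symm σ]
      congr 1
      exact Equiv.ext fun i => hl (congrFun this i)
  · rw [h0 l hl]
    exact Finset.sum_eq_zero fun σ _ => by simp [Set.indicator]

end

section

variable {n : ℕ}

/-- The multiplicity of `c` among the `b i` bounds the degree of the polynomial factors of
`exp (c x)` which the equation admits. -/
theorem eval_mul_exp_mem_sol : ∀ (n : ℕ) (b : Fin n → ℝ) (c : ℝ) (q : ℝ[X]),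
    q.degree < (Finset.univ.filter fun i => b i = c).card →
    (fun x => q.eval x * Real.exp (c * x)) ∈ Sol n b := by
  intro n
  induction n with
  | zero =>
    intro b c q hq
    have : q = 0 := by
      by_contra h
      exact absurd hq (not_lt.2 (by simpa using zero_le_degree_iff.2 h))
    subst this
    ext x
    simp
  | succ n ih =>
    intro b c q hq
    refine ⟨fun x => (derivative q + C c * q).eval x * Real.exp (c * x), fun x => ?_, ?_⟩
    · have h2 : HasDerivAt (fun x : ℝ => Real.exp (c * x)) (Real.exp (c * x) * c) x := by
        simpa using ((hasDerivAt_id x).const_mul c).exp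
      refine ((q.hasDerivAt x).mul h2).congr_deriv ?_
      simp only [eval_add, eval_mul, eval_C]
      ring
    · have heq : (fun x => (derivative q + C c * q).eval x * Real.exp (c * x)
          - b 0 * (q.eval x * Real.exp (c * x)))
          = fun x => (derivative q + C (c - b 0) * q).eval x * Real.exp (c * x) := by
        ext x
        simp only [eval_add, eval_mul, eval_C]
        ring
      rw [heq]
      refine ih _ c _ ?_
      rw [Fin.card_filter_univ_succ] at hq
      by_cases hq0 : q = 0
      · subst hq0
        simp
      by_cases hb : b 0 = c
      · rw [if_pos hb, degree_eq_natDegree hq0] at hq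
        have hq' : q.natDegree < (Finset.univ.filter fun i : Fin n => b i.succ = c).card + 1 := by
          exact_mod_cast hq
        rw [hb, sub_self, C_0, zero_mul, add_zero]
        refine (degree_derivative_lt hq0).trans_le ?_
        rw [degree_eq_natDegree hq0]
        exact_mod_cast Nat.lt_succ_iff.1 hq'
      · rw [if_neg hb] at hq
        refine lt_of_le_of_lt ((degree_add_le _ _).trans (max_le degree_derivative_le ?_)) hq
        rw [← smul_eq_C_mul]
        exact degree_smul_le _ _

section MomentPolynomial

variable (ψ : Fin n → ℝ → ℝ)

/-- The polynomial `± det (x ^ j ; ∫ s ^ j ψ_i(s) ds)`, orthogonal to all `ψ_i`. -/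
def momentPoly : ℝ[X] :=
  (-1) ^ n * (Matrix.of (Fin.cons (fun j : Fin (n + 1) => (X ^ (j : ℕ) : ℝ[X]))
    fun i j => C (∫ s, s ^ (j : ℕ) * ψ i s)) : Matrix (Fin (n + 1)) (Fin (n + 1)) ℝ[X]).det

/-- The minors of the moment matrix. -/
def momentMinor (j : Fin (n + 1)) : ℝ :=
  (Matrix.of fun i (j' : Fin n) => ∫ s, s ^ ((j.succAbove j' : Fin (n + 1)) : ℕ) * ψ i s).det

theorem momentPoly_eq : momentPoly ψ
    = (-1) ^ n * ∑ j : Fin (n + 1), (-1) ^ (j : ℕ) * X ^ (j : ℕ) * C (momentMinor ψ j) := by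
  rw [momentPoly, Matrix.det_succ_row_zero]
  refine congrArg _ (Finset.sum_congr rfl fun j _ => ?_)
  have h : C (momentMinor ψ j) = (Matrix.submatrix (Matrix.of (Fin.cons
      (fun j : Fin (n + 1) => (X ^ (j : ℕ) : ℝ[X])) fun i j => C (∫ s, s ^ (j : ℕ) * ψ i s)) :
      Matrix (Fin (n + 1)) (Fin (n + 1)) ℝ[X]) Fin.succ j.succAbove).det := by
    rw [momentMinor, RingHom.map_det]
    congr 1
  rw [h]
  simp only [Matrix.of_apply, Fin.cons_zero]

theorem natDegree_momentPoly_le : (momentPoly ψ).natDegree ≤ n := by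
  rw [momentPoly_eq]
  have h : ((-1) ^ n : ℝ[X]) = C ((-1) ^ n) := by simp
  rw [h]
  refine (natDegree_C_mul_le _ _).trans (natDegree_sum_le_of_forall_le _ _ fun j _ => ?_)
  have h' : ((-1) ^ (j : ℕ) : ℝ[X]) = C ((-1) ^ (j : ℕ)) := by simp
  rw [h', mul_assoc]
  refine (natDegree_C_mul_le _ _).trans ((natDegree_mul_C_le _ _).trans ?_)
  rw [natDegree_X_pow]
  omega

theorem eval_momentPoly (x : ℝ) : (momentPoly ψ).eval x
    = (-1) ^ n * ∑ j : Fin (n + 1), (-1) ^ (j : ℕ) * x ^ (j : ℕ) * momentMinor ψ j := by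
  rw [momentPoly_eq]
  simp only [eval_mul, eval_finsetSum, eval_pow, eval_neg, eval_one, eval_X, eval_C]

variable {ψ} (hψ : ∀ i (j : ℕ), Integrable fun s => s ^ j * ψ i s)
include hψ

/-- Pairing with `ψ i` produces a determinant with two equal rows. -/
theorem integral_momentPoly_mul (i : Fin n) : ∫ x, (momentPoly ψ).eval x * ψ i x = 0 := by
  have h1 : ∀ x, (momentPoly ψ).eval x * ψ i x = (-1) ^ n * ∑ j : Fin (n + 1),
      ((-1) ^ (j : ℕ) * momentMinor ψ j) * (x ^ (j : ℕ) * ψ i x) := fun x => by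
    rw [eval_momentPoly, mul_assoc, Finset.sum_mul]
    congr 1
    exact Finset.sum_congr rfl fun j _ => by ring
  simp only [h1]
  rw [integral_const_mul,
    integral_finsetSum _ fun (j : Fin (n + 1)) _ => (hψ i (j : ℕ)).const_mul _]
  simp only [integral_const_mul]
  have h2 : (Matrix.of (Fin.cons (fun j : Fin (n + 1) => ∫ s, s ^ (j : ℕ) * ψ i s)
      fun i' j => ∫ s, s ^ (j : ℕ) * ψ i' s) : Matrix (Fin (n + 1)) (Fin (n + 1)) ℝ).det = 0 :=
    Matrix.det_zero_of_row_eq (Fin.succ_ne_zero i).symm (by ext j; simp)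
  rw [Matrix.det_succ_row_zero] at h2
  rw [← mul_zero ((-1 : ℝ) ^ n), ← h2]
  congr 1
  refine Finset.sum_congr rfl fun j _ => ?_
  have h3 : momentMinor ψ j = (Matrix.submatrix (Matrix.of (Fin.cons
      (fun j : Fin (n + 1) => ∫ s, s ^ (j : ℕ) * ψ i s)
      fun i' j => ∫ s, s ^ (j : ℕ) * ψ i' s) : Matrix (Fin (n + 1)) (Fin (n + 1)) ℝ)
      Fin.succ j.succAbove).det := rfl
  rw [h3]
  simp only [Matrix.of_apply, Fin.cons_zero]
  ring

/-- Heine's formula for the polynomial orthogonal to all `ψ_i`. -/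
theorem integral_prod_sub_mul_vandermonde (x : ℝ) :
    Integrable (fun l : Fin n → ℝ =>
      (∏ j, (x - l j)) * ((Matrix.vandermonde l).det * ∏ j, ψ j (l j))) ∧
    ∫ l : Fin n → ℝ, (∏ j, (x - l j)) * ((Matrix.vandermonde l).det * ∏ j, ψ j (l j))
      = (momentPoly ψ).eval x := by
  have h1 : ∀ l : Fin n → ℝ, (∏ j, (x - l j)) * ((Matrix.vandermonde l).det * ∏ j, ψ j (l j))
      = (-1) ^ n * ∑ j : Fin (n + 1), (-1) ^ (j : ℕ) * x ^ (j : ℕ) *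
        (Matrix.of fun i (j' : Fin n) =>
          l i ^ ((j.succAbove j' : Fin (n + 1)) : ℕ) * ψ i (l i)).det := fun l => by
    have h2 : (Matrix.of (Fin.cons (fun j : Fin (n + 1) => x ^ (j : ℕ))
        fun i j => l i ^ (j : ℕ) * ψ i (l i)) : Matrix (Fin (n + 1)) (Fin (n + 1)) ℝ).det
        = (∏ j, ψ j (l j)) * (Matrix.vandermonde (Fin.cons x l : Fin (n + 1) → ℝ)).det := by
      have := Matrix.det_mul_column (Fin.cons 1 fun i => ψ i (l i) : Fin (n + 1) → ℝ)
        (Matrix.vandermonde (Fin.cons x l : Fin (n + 1) → ℝ))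
      rw [Fin.prod_univ_succ] at this
      simp only [Fin.cons_zero, Fin.cons_succ, one_mul] at this
      rw [← this]
      congr 1
      ext i j
      refine Fin.cases ?_ (fun i => ?_) i
      · simp [Matrix.vandermonde]
      · simp [Matrix.vandermonde, mul_comm]
    have h3 : (Matrix.vandermonde (Fin.cons x l : Fin (n + 1) → ℝ)).det
        = (-1) ^ n * (∏ j, (x - l j)) * (Matrix.vandermonde l).det := by
      rw [Matrix.det_vandermonde, Matrix.det_vandermonde, Fin.prod_univ_succ]
      congr 1
      · have h4 : ∏ j ∈ Finset.Ioi (0 : Fin (n + 1)),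
            ((Fin.cons x l : Fin (n + 1) → ℝ) j - (Fin.cons x l : Fin (n + 1) → ℝ) 0)
            = ∏ j : Fin n, (l j - x) := by
          rw [Fin.prod_Ioi_zero]
          simp
        rw [h4]
        have h5 : ∀ j : Fin n, l j - x = (-1) * (x - l j) := fun j => by ring
        simp only [h5, Finset.prod_mul_distrib, Finset.prod_const, Finset.card_univ,
          Fintype.card_fin]
      · refine Finset.prod_congr rfl fun i _ => ?_
        rw [Fin.prod_Ioi_succ]
        simp
    have h6 := h2
    rw [Matrix.det_succ_row_zero, h3] at h6
    have h7 : (∑ j : Fin (n + 1), (-1) ^ (j : ℕ) * x ^ (j : ℕ) *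
        (Matrix.of fun i (j' : Fin n) =>
          l i ^ ((j.succAbove j' : Fin (n + 1)) : ℕ) * ψ i (l i)).det)
        = (∏ j, ψ j (l j)) * ((-1) ^ n * (∏ j, (x - l j)) * (Matrix.vandermonde l).det) := by
      rw [← h6]
      rfl
    rw [h7]
    have h8 : ((-1 : ℝ) ^ n) * (-1) ^ n = 1 := by rw [← mul_pow]; simp
    linear_combination (-(∏ j, (x - l j)) * ((Matrix.vandermonde l).det * ∏ j, ψ j (l j))) * h8
  have h2 : ∀ j : Fin (n + 1), _ := fun j => integral_det
    (g := fun i (j' : Fin n) s => s ^ ((j.succAbove j' : Fin (n + 1)) : ℕ) * ψ i s)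
    fun i j' => hψ i _
  simp only [h1]
  refine ⟨(integrable_finsetSum _ fun j _ => ((h2 j).1.const_mul _)).const_mul _, ?_⟩
  rw [integral_const_mul, integral_finsetSum _ fun j _ => (h2 j).1.const_mul _, eval_momentPoly]
  simp only [integral_const_mul, (h2 _).2]
  rfl

/-- The integral of `∏ (X - l_j)` against the eigenvalue density, coefficient by coefficient. -/
theorem integral_coeff_mul_det (i : ℕ) :
    IntegrableOn (fun l : Fin n → ℝ => (∏ j, (X - C (l j)) : ℝ[X]).coeff i *
      ((Matrix.vandermonde l).det * (Matrix.of fun i j => ψ i (l j)).det)) {l | StrictMono l} ∧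
    ∫ l in {l : Fin n → ℝ | StrictMono l}, (∏ j, (X - C (l j)) : ℝ[X]).coeff i *
      ((Matrix.vandermonde l).det * (Matrix.of fun i j => ψ i (l j)).det)
      = (momentPoly ψ).coeff i := by
  have hx : ∀ x : ℝ, IntegrableOn (fun l : Fin n → ℝ => (∏ j, (X - C (l j)) : ℝ[X]).eval x *
      ((Matrix.vandermonde l).det * (Matrix.of fun i j => ψ i (l j)).det)) {l | StrictMono l} ∧
      ∫ l in {l : Fin n → ℝ | StrictMono l}, (∏ j, (X - C (l j)) : ℝ[X]).eval x *
        ((Matrix.vandermonde l).det * (Matrix.of fun i j => ψ i (l j)).det)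
        = (momentPoly ψ).eval x := by
    intro x
    obtain ⟨h1, h2⟩ := integral_prod_sub_mul_vandermonde hψ x
    obtain ⟨h3, h4⟩ := integral_strictMono h1 fun l hl => by
      rw [show (Matrix.vandermonde l).det = 0 by
        by_contra h
        exact hl (Matrix.det_vandermonde_ne_zero_iff.1 h)]
      ring
    have h5 : ∀ l : Fin n → ℝ, (∑ σ : Equiv.Perm (Fin n), (∏ j, (x - (l ∘ σ) j)) *
        ((Matrix.vandermonde (l ∘ σ)).det * ∏ j, ψ j ((l ∘ σ) j)))
        = (∏ j, (X - C (l j)) : ℝ[X]).eval x *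
        ((Matrix.vandermonde l).det * (Matrix.of fun i j => ψ i (l j)).det) := fun l => by
      have h6 : ∀ σ : Equiv.Perm (Fin n), (Matrix.vandermonde (l ∘ σ)).det
          = ((Equiv.Perm.sign σ : ℤ) : ℝ) * (Matrix.vandermonde l).det := fun σ => by
        rw [← Matrix.det_permute]
        rfl
      have h7 : ∀ σ : Equiv.Perm (Fin n), ∏ j, (x - (l ∘ σ) j) = ∏ j, (x - l j) := fun σ =>
        Equiv.prod_comp σ fun j => x - l j
      have h8 : (Matrix.of fun i j => ψ i (l j)).det
          = ∑ σ : Equiv.Perm (Fin n), ((Equiv.Perm.sign σ : ℤ) : ℝ) * ∏ j, ψ j ((l ∘ σ) j) := by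
        rw [← Matrix.det_transpose, Matrix.det_apply']
        rfl
      rw [eval_prod, h8, Finset.mul_sum, Finset.mul_sum]
      refine Finset.sum_congr rfl fun σ _ => ?_
      rw [h6, h7]
      simp only [eval_sub, eval_X, eval_C]
      ring
    simp only [h5] at h3 h4
    exact ⟨h3, h4.trans h2⟩
  obtain ⟨c, hc⟩ := exists_coeff_eq_sum_eval ℝ n i
  have h1 : ∀ l : Fin n → ℝ, (∏ j, (X - C (l j)) : ℝ[X]).coeff i *
      ((Matrix.vandermonde l).det * (Matrix.of fun i j => ψ i (l j)).det)
      = ∑ k : Fin (n + 1), c k * ((∏ j, (X - C (l j)) : ℝ[X]).eval ((k : ℕ) : ℝ) *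
      ((Matrix.vandermonde l).det * (Matrix.of fun i j => ψ i (l j)).det)) := fun l => by
    rw [hc _ (natDegree_prod_fin l).le, Finset.sum_mul]
    exact Finset.sum_congr rfl fun k _ => by ring
  simp only [h1]
  refine ⟨integrable_finsetSum _ fun k _ => (hx _).1.const_mul _, ?_⟩
  rw [integral_finsetSum _ fun k _ => (hx _).1.const_mul _, hc _ (natDegree_momentPoly_le ψ)]
  simp only [integral_const_mul, (hx _).2]

end MomentPolynomial

end

section

variable {n : ℕ}

/-- The distribution of a coefficient of the characteristic polynomial under a spectral density
times `exp (∑ b_i M_ii)`, in terms of the eigenvalues. -/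
theorem integral_spectral {D : (Fin n → ℝ) → ℝ} {b : Fin n → ℝ} (hD : Measurable D)
    (hD0 : ∀ l, StrictMono l → 0 ≤ D l)
    (hint : ∀ K : Matrix (Fin n) (Fin n) ℂ → ENNReal, (Measurable fun x => K (hermitian x)) →
      IsSpectral K →
      ∫⁻ x, K (hermitian x) * ENNReal.ofReal (Real.exp (∑ i, b i * x i i))
        = ∫⁻ l in {l : Fin n → ℝ | StrictMono l}, K (Matrix.diagonal fun i => (l i : ℂ)) *
          ENNReal.ofReal (D l))
    {W e : Matrix (Fin n) (Fin n) ℂ → ℝ} (hW : Measurable fun x => W (hermitian x))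
    (hW0 : ∀ M, 0 ≤ W M)
    (he : Measurable fun x => e (hermitian x))
    (hspec : ∀ A B, A.IsHermitian → B.IsHermitian → A.charpoly = B.charpoly →
      W A = W B ∧ e A = e B) :
    ∫ x, e (hermitian x) * (W (hermitian x) * Real.exp (∑ i, b i * x i i))
      = ∫ l in {l : Fin n → ℝ | StrictMono l}, e (Matrix.diagonal fun i => (l i : ℂ)) *
        (W (Matrix.diagonal fun i => (l i : ℂ)) * D l) := by
  have hdm : Measurable fun l : Fin n → ℝ => diagCoord l :=
    measurable_pi_lambda _ fun i => measurable_pi_lambda _ fun j => by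
      by_cases hij : i = j
      · simpa [diagCoord, hij] using measurable_pi_apply j
      · simp [diagCoord, hij]
  have hWd : Measurable fun l : Fin n → ℝ => W (Matrix.diagonal fun i => (l i : ℂ)) := by
    simpa only [Function.comp_def, hermitian_diagCoord] using hW.comp hdm
  have hed : Measurable fun l : Fin n → ℝ => e (Matrix.diagonal fun i => (l i : ℂ)) := by
    simpa only [Function.comp_def, hermitian_diagCoord] using he.comp hdm
  let f₁ : (Fin n → Fin n → ℝ) → ℝ := fun x => W (hermitian x) * Real.exp (∑ i, b i * x i i)
  let f₂ : (Fin n → ℝ) → ℝ := fun l => W (Matrix.diagonal fun i => (l i : ℂ)) * D l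
  have hf₁ : Measurable f₁ := hW.mul (by fun_prop)
  have hf₂ : Measurable f₂ := hWd.mul hD
  -- under `e`, the spectral formula identifies the two image measures
  have hmap : (volume.withDensity fun x => ENNReal.ofReal (f₁ x)).map (fun x => e (hermitian x))
      = ((volume.restrict {l : Fin n → ℝ | StrictMono l}).withDensity
          fun l => ENNReal.ofReal (f₂ l)).map fun l => e (Matrix.diagonal fun i => (l i : ℂ)) := by
    ext S hS
    rw [Measure.map_apply he hS, Measure.map_apply hed hS, withDensity_apply _ (he hS),
      withDensity_apply _ (hed hS), ← lintegral_indicator (he hS), ← lintegral_indicator (hed hS)]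
    have := hint (fun M => S.indicator (fun _ => ENNReal.ofReal (W M)) (e M))
      (by
        have : (fun x => S.indicator (fun _ => ENNReal.ofReal (W (hermitian x))) (e (hermitian x)))
            = ((fun x => e (hermitian (M := n) x)) ⁻¹' S).indicator
              fun x => ENNReal.ofReal (W (hermitian x)) := by
          rfl
        rw [this]
        exact hW.ennreal_ofReal.indicator (he hS))
      (fun A B hA hB h => by simp only [(hspec A B hA hB h).1, (hspec A B hA hB h).2])
    refine Eq.trans (lintegral_congr fun x => ?_) (this.trans (lintegral_congr fun l => ?_))
    · by_cases h : e (hermitian x) ∈ S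
      · rw [Set.indicator_of_mem h,
          Set.indicator_of_mem (show x ∈ (fun x => e (hermitian x)) ⁻¹' S from h),
          ENNReal.ofReal_mul (hW0 _)]
      · rw [Set.indicator_of_notMem h,
          Set.indicator_of_notMem (show x ∉ (fun x => e (hermitian x)) ⁻¹' S from h), zero_mul]
    · by_cases h : e (Matrix.diagonal fun i => (l i : ℂ)) ∈ S
      · rw [Set.indicator_of_mem h, Set.indicator_of_mem (show l ∈ (fun l : Fin n → ℝ =>
          e (Matrix.diagonal fun i => (l i : ℂ))) ⁻¹' S from h), ENNReal.ofReal_mul (hW0 _)]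
      · rw [Set.indicator_of_notMem h, Set.indicator_of_notMem (show l ∉ (fun l : Fin n → ℝ =>
          e (Matrix.diagonal fun i => (l i : ℂ))) ⁻¹' S from h), zero_mul]
  have h1 : ∫ x, e (hermitian x) * f₁ x
      = ∫ y, y ∂((volume.withDensity fun x => ENNReal.ofReal (f₁ x)).map
          fun x => e (hermitian x)) := by
    rw [integral_map (f := fun y : ℝ => y) he.aemeasurable measurable_id.aestronglyMeasurable,
      integral_withDensity_eq_integral_toReal_smul hf₁.ennreal_ofReal
        (Eventually.of_forall fun _ => ENNReal.ofReal_lt_top)]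
    refine integral_congr_ae (Eventually.of_forall fun x => ?_)
    simp only
    rw [ENNReal.toReal_ofReal (mul_nonneg (hW0 _) (Real.exp_pos _).le), smul_eq_mul, mul_comm]
  have h2 : ∫ l in {l : Fin n → ℝ | StrictMono l}, e (Matrix.diagonal fun i => (l i : ℂ)) * f₂ l
      = ∫ y, y ∂(((volume.restrict {l : Fin n → ℝ | StrictMono l}).withDensity
          fun l => ENNReal.ofReal (f₂ l)).map fun l => e (Matrix.diagonal fun i => (l i : ℂ))) := by
    rw [integral_map (f := fun y : ℝ => y) hed.aemeasurable measurable_id.aestronglyMeasurable,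
      integral_withDensity_eq_integral_toReal_smul hf₂.ennreal_ofReal
        (Eventually.of_forall fun _ => ENNReal.ofReal_lt_top)]
    refine setIntegral_congr_fun measurableSet_strictMono fun l hl => ?_
    rw [ENNReal.toReal_ofReal (mul_nonneg (hW0 _) (hD0 l hl)), smul_eq_mul, mul_comm]
  rw [h1, h2, hmap]

end

section

variable {V : ℝ[X]} (hV : IsConfining V) {a t : ℝ} (ht : 0 < t) (k : ℕ × ℕ)

theorem density_eq (x : Fin (k.1 + k.2) → Fin (k.1 + k.2) → ℝ) : density V a k t x
    = Real.exp (-t * (aeval (hermitian x) V).trace.re) *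
      Real.exp (∑ i : Fin (k.1 + k.2), (t * if (i : ℕ) < k.1 then a else -a) * x i i) := by
  rw [density, ← Real.exp_add]
  congr 1
  have h : (source a k * hermitian x).trace.re
      = ∑ i : Fin (k.1 + k.2), (if (i : ℕ) < k.1 then a else -a) * x i i := by
    simp only [source, Matrix.trace, Matrix.diag_apply, Matrix.diagonal_mul, Complex.re_sum]
    refine Finset.sum_congr rfl fun i _ => ?_
    split_ifs <;> simp [hermitian]
  rw [Matrix.trace_sub, Complex.sub_re, h]
  simp only [mul_assoc, ← Finset.mul_sum]
  ring

theorem measurable_trace_re {n : ℕ} (V : ℝ[X]) :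
    Measurable fun x : Fin n → Fin n → ℝ => (aeval (hermitian x) V).trace.re := by
  have h1 : Continuous fun M : Matrix (Fin n) (Fin n) ℂ => aeval M V := V.continuous_aeval
  exact (Complex.continuous_re.comp ((h1.comp continuous_hermitian).matrix_trace)).measurable

include hV ht in
theorem integrable_pow_mul_of_exp_bound {φ : ℝ → ℝ} (hφ : Continuous φ) {C : ℝ}
    (hC : ∀ x, |φ x| ≤ C * Real.exp (C * |x|)) (j : ℕ) :
    Integrable fun s => s ^ j * (Real.exp (-t * V.eval s) * φ s) := by
  have hC0 : 0 ≤ C := by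
    have := hC 0
    simp at this
    exact (abs_nonneg _).trans this
  have h1 := (integrable_eval_mul_pow_mul_weight hV ht (C / t) (Polynomial.C C) j).norm
  have h2 := (integrable_eval_mul_pow_mul_weight hV ht (-(C / t)) (Polynomial.C C) j).norm
  refine (h1.add h2).mono' (Continuous.aestronglyMeasurable
    ((continuous_pow j).mul ((by fun_prop : Continuous fun s => Real.exp (-t * V.eval s)).mul hφ)))
    (Eventually.of_forall fun s => ?_)
  have hw : ∀ b, weight V b t s = Real.exp (-t * V.eval s) * Real.exp (t * b * s) := fun b => by
    rw [weight, ← Real.exp_add]; congr 1; ring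
  simp only [eval_C, Pi.add_apply, norm_mul, Real.norm_eq_abs, hw, abs_mul, Real.abs_exp,
    abs_of_nonneg hC0]
  have h3 : t * (C / t) = C := by field_simp
  have h4 : t * -(C / t) = -C := by field_simp
  rw [h3, h4]
  have h5 : Real.exp (C * |s|) ≤ Real.exp (C * s) + Real.exp (-C * s) := by
    rcases abs_cases s with ⟨h, _⟩ | ⟨h, _⟩
    · rw [h]; linarith [Real.exp_pos (-C * s)]
    · rw [h, mul_neg, ← neg_mul]; linarith [Real.exp_pos (C * s)]
  calc |s ^ j| * (Real.exp (-t * V.eval s) * |φ s|)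
      ≤ |s ^ j| * (Real.exp (-t * V.eval s) * (C * (Real.exp (C * s) + Real.exp (-C * s)))) := by
        gcongr
        exact (hC s).trans (mul_le_mul_of_nonneg_left h5 hC0)
    _ = _ := by ring

include hV ht in
/-- The average characteristic polynomial of the Hermitian matrix model with external source is
the type II multiple orthogonal polynomial. -/
theorem avgCharPoly_eq (ha : a ≠ 0) {P : ℝ[X]} (hP : IsMOP V a t k P) :
    avgCharPoly V a k t = P.map (algebraMap ℝ ℂ) := by
  set n := k.1 + k.2 with hn
  set b : Fin n → ℝ := fun i => t * if (i : ℕ) < k.1 then a else -a with hb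
  obtain ⟨φ, hφ, ⟨B, hB⟩, hsol, hpos, hint⟩ := exists_radial_system n b
  set ψ : Fin n → ℝ → ℝ := fun i s => Real.exp (-t * V.eval s) * φ i s with hψdef
  have hψ : ∀ i (j : ℕ), Integrable fun s => s ^ j * ψ i s := fun i j =>
    integrable_pow_mul_of_exp_bound hV ht (hφ i) (hB i) j
  set Z : ℝ := ∫ x, density V a k t x with hZ
  -- the unitarily invariant factor of the density
  let W : Matrix (Fin n) (Fin n) ℂ → ℝ := fun M => Real.exp (-t * (aeval M V).trace.re)
  have hWm : Measurable fun x => W (hermitian x) := by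
    have := measurable_trace_re (n := n) V
    exact Real.measurable_exp.comp (this.const_mul _)
  have hWd : ∀ l : Fin n → ℝ, W (Matrix.diagonal fun i => (l i : ℂ)) *
      ((Matrix.vandermonde l).det * (Matrix.of fun i j => φ i (l j)).det)
      = (Matrix.vandermonde l).det * (Matrix.of fun i j => ψ i (l j)).det := fun l => by
    have h := Matrix.det_mul_row (fun j => Real.exp (-t * V.eval (l j)))
      (Matrix.of fun i j => φ i (l j))
    rw [← Real.exp_sum, ← Finset.mul_sum] at h
    have h1 : W (Matrix.diagonal fun i => (l i : ℂ)) = Real.exp (-t * ∑ i, V.eval (l i)) := by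
      simp only [W, trace_aeval_diagonal, Complex.ofReal_re]
    have h2 : (Matrix.of fun i j => ψ i (l j)) = Matrix.of fun i j =>
        Real.exp (-t * V.eval (l j)) * (Matrix.of fun i j => φ i (l j)) i j := rfl
    rw [h1, h2, h]
    ring
  have hWspec : ∀ A B : Matrix (Fin n) (Fin n) ℂ, A.IsHermitian → B.IsHermitian →
      A.charpoly = B.charpoly → W A = W B := fun A B hA hB h => by
    simp only [W, trace_aeval_hermitian hA, trace_aeval_hermitian hB,
      (hA.eigenvalues_eq_eigenvalues_iff hB).2 h]
  have hDm : Measurable fun l : Fin n → ℝ =>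
      (Matrix.vandermonde l).det * (Matrix.of fun i j => φ i (l j)).det :=
    (continuous_det_vandermonde.mul (continuous_det_of hφ)).measurable
  have hD0 : ∀ l : Fin n → ℝ, StrictMono l →
      0 ≤ (Matrix.vandermonde l).det * (Matrix.of fun i j => φ i (l j)).det := fun l hl =>
    mul_nonneg (det_vandermonde_pos hl).le (hpos l hl)
  -- the moments of the coefficients
  have hcoef : ∀ i, ∫ x, ((hermitian x).charpoly.coeff i).re * density V a k t x
      = (momentPoly ψ).coeff i := fun i => by
    rw [← (integral_coeff_mul_det hψ i).2]
    simp only [density_eq]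
    rw [integral_spectral (W := W) (e := fun M => (M.charpoly.coeff i).re) hDm hD0 hint hWm
      (fun _ => (Real.exp_pos _).le)
      (Complex.continuous_re.comp ((continuous_charpoly_coeff i).comp
        continuous_hermitian)).measurable
      (fun A B hA hB h => ⟨hWspec A B hA hB h, by rw [h]⟩)]
    refine setIntegral_congr_fun measurableSet_strictMono fun l _ => ?_
    simp only [hWd]
    congr 1
    rw [charpoly_diagonal_ofReal]
    have : (∏ j, (X - C (l j : ℂ)) : ℂ[X]) = (∏ j, (X - C (l j)) : ℝ[X]).map (algebraMap ℝ ℂ) := by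
      simp [Polynomial.map_prod]
    rw [this, coeff_map]
    simp
  have hcoefn : ∀ x : Fin n → Fin n → ℝ, (hermitian x).charpoly.coeff n = 1 := fun x => by
    have h := Matrix.charpoly_monic (hermitian x)
    rw [Monic, leadingCoeff, Matrix.charpoly_natDegree_eq_dim, Fintype.card_fin] at h
    exact h
  have hZn : Z = (momentPoly ψ).coeff n := by
    rw [← hcoef n, hZ]
    simp only [hcoefn, Complex.one_re, one_mul]
  have hdm : Measurable fun x => density V a k t x := by
    simp only [density_eq]
    exact hWm.mul (by fun_prop)
  have hdint : Integrable fun x => density V a k t x := by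
    refine ⟨hdm.aestronglyMeasurable, ?_⟩
    rw [hasFiniteIntegral_iff_ofReal (show 0 ≤ᵐ[volume] fun x => density V a k t x from
      Eventually.of_forall fun x => (Real.exp_pos _).le)]
    have h1 := hint (fun M => ENNReal.ofReal (W M)) hWm.ennreal_ofReal
      fun A B hA hB h => by simp only [hWspec A B hA hB h]
    have h2 : ∫⁻ x, ENNReal.ofReal (density V a k t x) = ∫⁻ l in {l : Fin n → ℝ | StrictMono l},
        ENNReal.ofReal ((Matrix.vandermonde l).det * (Matrix.of fun i j => ψ i (l j)).det) := by
      have h3 : ∀ l : Fin n → ℝ, ENNReal.ofReal (W (Matrix.diagonal fun i => (l i : ℂ))) *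
          ENNReal.ofReal ((Matrix.vandermonde l).det * (Matrix.of fun i j => φ i (l j)).det)
          = ENNReal.ofReal ((Matrix.vandermonde l).det * (Matrix.of fun i j => ψ i (l j)).det) :=
        fun l => by rw [← ENNReal.ofReal_mul (Real.exp_pos _).le, hWd]
      simp only [h3] at h1
      rw [← h1]
      refine lintegral_congr fun x => ?_
      rw [density_eq, ENNReal.ofReal_mul (Real.exp_pos _).le]
    rw [h2]
    have h4 := (integral_coeff_mul_det hψ n).1
    have h5 : ∀ l : Fin n → ℝ, (∏ j, (X - C (l j)) : ℝ[X]).coeff n = 1 := fun l => by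
      have h := monic_prod_fin l
      rwa [Monic, leadingCoeff, natDegree_prod_fin] at h
    simp only [h5, one_mul] at h4
    refine lt_of_le_of_lt (lintegral_mono fun l => ?_) h4.2
    rw [← ofReal_norm]
    exact ENNReal.ofReal_le_ofReal (le_abs_self _)
  have hZ0 : 0 < Z := by
    rw [hZ, integral_pos_iff_support_of_nonneg (show 0 ≤ fun x => density V a k t x from
      fun x => (Real.exp_pos _).le) hdint]
    have : Function.support (fun x => density V a k t x) = Set.univ :=
      Set.eq_univ_of_forall fun x => (Real.exp_pos _).ne'
    rw [this]
    exact Measure.measure_univ_pos.2 (NeZero.ne _)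
  -- orthogonality to the span of the radial system
  have horth : ∀ f ∈ Sol n b, ∫ x, (momentPoly ψ).eval x * (Real.exp (-t * V.eval x) * f x)
      = 0 := by
    intro f hf
    obtain ⟨c, hc⟩ := hsol f hf
    have h1 : ∀ x, (momentPoly ψ).eval x * (Real.exp (-t * V.eval x) * f x)
        = ∑ i, c i * ((momentPoly ψ).eval x * ψ i x) := fun x => by
      rw [hc, Finset.mul_sum, Finset.mul_sum]
      exact Finset.sum_congr rfl fun i _ => by simp only [hψdef]; ring
    have h2 : ∀ i, Integrable fun x => (momentPoly ψ).eval x * ψ i x := fun i => by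
      simp only [eval_eq_sum_range, Finset.sum_mul]
      refine integrable_finsetSum _ fun j _ => ?_
      simp only [mul_assoc]
      exact (hψ i j).const_mul _
    simp only [h1]
    rw [integral_finsetSum _ fun i _ => (h2 i).const_mul _]
    simp only [integral_const_mul, integral_momentPoly_mul hψ, mul_zero, Finset.sum_const_zero]
  -- the multiplicities of `± t a` among the `b i` give both families of orthogonality conditions
  have hcard₁ : k.1 ≤ (Finset.univ.filter fun i => b i = t * a).card := by
    have h : Finset.univ.map (Fin.castAddEmb k.2) ⊆ Finset.univ.filter fun i => b i = t * a := by
      intro i hi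
      obtain ⟨j, _, rfl⟩ := Finset.mem_map.1 hi
      simp [hb]
    simpa using Finset.card_le_card h
  have hcard₂ : k.2 ≤ (Finset.univ.filter fun i => b i = t * -a).card := by
    have h : Finset.univ.map (Fin.natAddEmb k.1) ⊆ Finset.univ.filter fun i => b i = t * -a := by
      intro i hi
      obtain ⟨j, _, rfl⟩ := Finset.mem_map.1 hi
      simp [hb]
    simpa using Finset.card_le_card h
  have horth' : ∀ (β : ℝ) (l : ℕ), l < (Finset.univ.filter fun i => b i = t * β).card →
      ∫ x, (C Z⁻¹ * momentPoly ψ).eval x * x ^ l * weight V β t x = 0 := by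
    intro β l hl
    have h1 := horth _ (eval_mul_exp_mem_sol n b (t * β) (X ^ l) (by
      rw [degree_X_pow]; exact_mod_cast hl))
    rw [← mul_zero Z⁻¹, ← h1, ← integral_const_mul]
    refine integral_congr_ae (Eventually.of_forall fun x => ?_)
    have hw : weight V β t x = Real.exp (-t * V.eval x) * Real.exp (t * β * x) := by
      rw [weight, ← Real.exp_add]; congr 1; ring
    simp only [eval_mul, eval_C, eval_pow, eval_X, hw]
    ring
  have hmonic : (C Z⁻¹ * momentPoly ψ).Monic ∧ (C Z⁻¹ * momentPoly ψ).natDegree = n := by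
    have h1 : (C Z⁻¹ * momentPoly ψ).coeff n = 1 := by
      rw [coeff_C_mul, ← hZn, inv_mul_cancel₀ hZ0.ne']
    have h2 : (C Z⁻¹ * momentPoly ψ).natDegree ≤ n :=
      (natDegree_C_mul_le _ _).trans (natDegree_momentPoly_le ψ)
    exact ⟨monic_of_natDegree_le_of_coeff_eq_one n h2 h1,
      le_antisymm h2 (le_natDegree_of_ne_zero (by rw [h1]; exact one_ne_zero))⟩
  have hM : IsMOP V a t k (C Z⁻¹ * momentPoly ψ) :=
    ⟨hmonic.1, hmonic.2, fun l hl => horth' a l (hl.trans_le hcard₁),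
      fun l hl => horth' (-a) l (hl.trans_le hcard₂)⟩
  rw [hP.unique hV ht ha hM]
  have hexp : ∀ i, expectation V a k t (fun M => M.charpoly.coeff i)
      = (((C Z⁻¹ * momentPoly ψ).coeff i : ℝ) : ℂ) := fun i => by
    rw [expectation, coeff_C_mul, ← hcoef i]
    have h1 : ∀ x, (hermitian x).charpoly.coeff i * (density V a k t x : ℂ)
        = ((((hermitian x).charpoly.coeff i).re * density V a k t x : ℝ) : ℂ) := fun x => by
      rw [Complex.ofReal_mul, charpoly_hermitian_real (isHermitian_hermitian x)]
    simp only [h1]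
    rw [integral_complex_ofReal]
    push_cast
    rw [div_eq_inv_mul]
  ext i
  rw [coeff_map, avgCharPoly, finsetSum_coeff]
  simp only [coeff_monomial, hexp]
  rw [Finset.sum_ite_eq']
  split_ifs with hi
  · rfl
  · rw [coeff_eq_zero_of_natDegree_lt (by rw [hmonic.2]; simpa using hi)]
    simp

end

/-! ### Wave functions and functions of the second kind -/

/-- The row of the wave matrix that belongs to the polynomial `P`. -/
def waveRow (V : ℝ[X]) (a t : ℝ) (P : ℝ[X]) (z : ℂ) : Fin 3 → ℂ :=
  ![aeval z P * Complex.exp (-(t : ℂ) * aeval z V),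
    weightedCauchy V a t P z * Complex.exp (-(t : ℂ) * (a : ℂ) * z),
    weightedCauchy V (-a) t P z * Complex.exp ((t : ℂ) * (a : ℂ) * z)]

theorem waveMatrix_apply (V : ℝ[X]) (a t : ℝ) (P : Fin 3 → ℝ[X]) (z : ℂ) (i j : Fin 3) :
    waveMatrix V a t P z i j = waveRow V a t (P i) z j := rfl

theorem abs_im_le_norm_ofReal_sub (z : ℂ) (x : ℝ) : |z.im| ≤ ‖(x : ℂ) - z‖ := by
  have := Complex.abs_im_le_norm ((x : ℂ) - z)
  simpa using this

theorem ofReal_sub_ne_zero {z : ℂ} (hz : z.im ≠ 0) (x : ℝ) : (x : ℂ) - z ≠ 0 := by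
  intro h
  have := abs_im_le_norm_ofReal_sub z x
  rw [h, norm_zero] at this
  exact hz (abs_nonpos_iff.1 this)

theorem continuous_ofReal_sub_inv {z : ℂ} (hz : z.im ≠ 0) :
    Continuous fun x : ℝ => ((x : ℂ) - z)⁻¹ :=
  (Complex.continuous_ofReal.sub continuous_const).inv₀ (ofReal_sub_ne_zero hz)

section

variable {V : ℝ[X]} (hV : IsConfining V) {t : ℝ} (ht : 0 < t) (b : ℝ)

include hV ht in
theorem integrable_ofReal_weight (P : ℝ[X]) :
    Integrable fun x : ℝ => ((P.eval x * weight V b t x : ℝ) : ℂ) :=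
  (integrable_eval_mul_weight hV ht b P).ofReal

include hV ht in
theorem integrable_mul_inv_pow (P : ℝ[X]) {z : ℂ} (hz : z.im ≠ 0) (j : ℕ) :
    Integrable fun x : ℝ => ((P.eval x * weight V b t x : ℝ) : ℂ) * (((x : ℂ) - z)⁻¹) ^ j := by
  refine (integrable_ofReal_weight hV ht b P).mul_bdd (c := (|z.im|⁻¹) ^ j)
    (((continuous_ofReal_sub_inv hz).pow j).aestronglyMeasurable) (Eventually.of_forall fun x => ?_)
  rw [norm_pow, norm_inv]
  have := abs_im_le_norm_ofReal_sub z x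
  have h0 : 0 < |z.im| := abs_pos.2 hz
  gcongr

include hV ht in
theorem norm_integral_mul_inv_pow_le (P : ℝ[X]) {z : ℂ} (hz : z.im ≠ 0) (j : ℕ) :
    ‖∫ x : ℝ, ((P.eval x * weight V b t x : ℝ) : ℂ) * (((x : ℂ) - z)⁻¹) ^ j‖
      ≤ (∫ x : ℝ, |P.eval x * weight V b t x|) * (|z.im|⁻¹) ^ j := by
  rw [← integral_mul_const]
  refine norm_integral_le_of_norm_le
    ((integrable_eval_mul_weight hV ht b P).abs.mul_const _) (Eventually.of_forall fun x => ?_)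
  rw [norm_mul, Complex.norm_real, norm_pow, norm_inv, Real.norm_eq_abs]
  have := abs_im_le_norm_ofReal_sub z x
  have h0 : 0 < |z.im| := abs_pos.2 hz
  gcongr

theorem weightedCauchy_eq (V : ℝ[X]) (b t : ℝ) (P : ℝ[X]) (z : ℂ) : weightedCauchy V b t P z
    = ∫ x : ℝ, ((P.eval x * weight V b t x : ℝ) : ℂ) * (((x : ℂ) - z)⁻¹) ^ 1 := by
  simp only [weightedCauchy, div_eq_mul_inv, pow_one]

include hV ht in
theorem norm_weightedCauchy_le (P : ℝ[X]) {z : ℂ} (hz : z.im ≠ 0) :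
    ‖weightedCauchy V b t P z‖ ≤ (∫ x : ℝ, |P.eval x * weight V b t x|) * |z.im|⁻¹ := by
  rw [weightedCauchy_eq]
  simpa using norm_integral_mul_inv_pow_le hV ht b P hz 1

include hV ht in
theorem weightedCauchy_add (P Q : ℝ[X]) {z : ℂ} (hz : z.im ≠ 0) :
    weightedCauchy V b t (P + Q) z = weightedCauchy V b t P z + weightedCauchy V b t Q z := by
  simp only [weightedCauchy_eq]
  rw [← integral_add (integrable_mul_inv_pow hV ht b P hz 1)
    (integrable_mul_inv_pow hV ht b Q hz 1)]
  refine integral_congr_ae (Eventually.of_forall fun x => ?_)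
  simp only [eval_add]
  push_cast
  ring

theorem weightedCauchy_C_mul (c : ℝ) (P : ℝ[X]) (z : ℂ) :
    weightedCauchy V b t (C c * P) z = c * weightedCauchy V b t P z := by
  simp only [weightedCauchy]
  rw [← integral_const_mul]
  refine integral_congr_ae (Eventually.of_forall fun x => ?_)
  simp only [eval_mul, eval_C]
  push_cast
  ring

include hV ht in
theorem mul_weightedCauchy (P : ℝ[X]) {z : ℂ} (hz : z.im ≠ 0) : z * weightedCauchy V b t P z
    = weightedCauchy V b t (X * P) z - ((∫ x : ℝ, P.eval x * weight V b t x : ℝ) : ℂ) := by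
  rw [eq_sub_iff_add_eq, ← integral_complex_ofReal, weightedCauchy_eq, weightedCauchy_eq,
    ← integral_const_mul,
    ← integral_add ((integrable_mul_inv_pow hV ht b P hz 1).const_mul z)
      (integrable_ofReal_weight hV ht b P)]
  refine integral_congr_ae (Eventually.of_forall fun x => ?_)
  have := ofReal_sub_ne_zero hz x
  simp only [eval_mul, eval_X, pow_one]
  push_cast
  field_simp
  ring

include hV ht in
/-- Orthogonality turns into decay of the function of the second kind. -/
theorem pow_mul_weightedCauchy {P : ℝ[X]} {j : ℕ}
    (h : ∀ l < j, ∫ x : ℝ, P.eval x * x ^ l * weight V b t x = 0) {z : ℂ} (hz : z.im ≠ 0) :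
    z ^ j * weightedCauchy V b t P z = weightedCauchy V b t (X ^ j * P) z := by
  induction j with
  | zero => simp
  | succ j ih =>
    rw [pow_succ', mul_assoc, ih fun l hl => h l (hl.trans j.lt_succ_self),
      mul_weightedCauchy hV ht b _ hz, pow_succ', mul_assoc]
    have : ∫ x : ℝ, (X ^ j * P).eval x * weight V b t x = 0 := by
      rw [← h j j.lt_succ_self]
      refine integral_congr_ae (Eventually.of_forall fun x => ?_)
      simp only [eval_mul, eval_pow, eval_X]
      ring
    rw [this]
    simp

include hV ht in
theorem hasDerivAt_weightedCauchy (P : ℝ[X]) {z : ℂ} (hz : z.im ≠ 0) :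
    HasDerivAt (weightedCauchy V b t P)
      (∫ x : ℝ, ((P.eval x * weight V b t x : ℝ) : ℂ) * (((x : ℂ) - z)⁻¹) ^ 2) z := by
  have h0 : 0 < |z.im| := abs_pos.2 hz
  have him : ∀ w ∈ Metric.ball z (|z.im| / 2), |z.im| / 2 ≤ |w.im| := fun w hw => by
    have h1 : |z.im - w.im| ≤ ‖w - z‖ := by
      have := Complex.abs_im_le_norm (w - z)
      rwa [Complex.sub_im, abs_sub_comm] at this
    have h2 : ‖w - z‖ < |z.im| / 2 := by simpa [dist_eq_norm] using hw
    have h3 := abs_sub_abs_le_abs_sub z.im w.im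
    linarith
  have hne : ∀ w ∈ Metric.ball z (|z.im| / 2), w.im ≠ 0 := fun w hw h => by
    have := him w hw
    rw [h, abs_zero] at this
    linarith
  have hfun : weightedCauchy V b t P = fun w =>
      ∫ x : ℝ, ((P.eval x * weight V b t x : ℝ) : ℂ) * (((x : ℂ) - w)⁻¹) ^ 1 :=
    funext fun w => weightedCauchy_eq V b t P w
  rw [hfun]
  have hmem : z ∈ Metric.ball z (|z.im| / 2) := Metric.mem_ball_self (by linarith)
  refine (hasDerivAt_integral_of_dominated_loc_of_deriv_le (μ := volume)
    (F := fun (w : ℂ) (x : ℝ) => ((P.eval x * weight V b t x : ℝ) : ℂ) * (((x : ℂ) - w)⁻¹) ^ 1)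
    (F' := fun (w : ℂ) (x : ℝ) => ((P.eval x * weight V b t x : ℝ) : ℂ) * (((x : ℂ) - w)⁻¹) ^ 2)
    (bound := fun x => |P.eval x * weight V b t x| * ((|z.im| / 2)⁻¹) ^ 2)
    (Metric.ball_mem_nhds z (show 0 < |z.im| / 2 by linarith)) ?_
    (integrable_mul_inv_pow hV ht b P hz 1)
    (integrable_mul_inv_pow hV ht b P hz 2).aestronglyMeasurable ?_
    ((integrable_eval_mul_weight hV ht b P).abs.mul_const _) ?_).2
  · filter_upwards [Metric.ball_mem_nhds z (show 0 < |z.im| / 2 by linarith)] with w hw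
    exact (integrable_mul_inv_pow hV ht b P (hne w hw) 1).aestronglyMeasurable
  · refine Eventually.of_forall fun x w hw => ?_
    rw [norm_mul, Complex.norm_real, norm_pow, norm_inv, Real.norm_eq_abs]
    have h1 := (him w hw).trans (abs_im_le_norm_ofReal_sub w x)
    have h2 : 0 < |z.im| / 2 := by linarith
    gcongr
  · refine Eventually.of_forall fun x w hw => ?_
    have h1 : HasDerivAt (fun w : ℂ => (x : ℂ) - w) (-1) w := by
      simpa using (hasDerivAt_id w).const_sub (x : ℂ)
    have h2 := (h1.inv (ofReal_sub_ne_zero (hne w hw) x)).const_mul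
      ((P.eval x * weight V b t x : ℝ) : ℂ)
    simp only [pow_one]
    refine h2.congr_deriv ?_
    rw [inv_pow, neg_neg, one_div]

theorem hasDerivAt_eval_mul_weight (P : ℝ[X]) (x : ℝ) :
    HasDerivAt (fun x => P.eval x * weight V b t x)
      ((derivative P - C t * derivative V * P + C (t * b) * P).eval x * weight V b t x) x := by
  have h1 : HasDerivAt (fun x => -t * (V.eval x - b * x))
      (-t * ((derivative V).eval x - b)) x := by
    simpa using ((V.hasDerivAt x).sub ((hasDerivAt_id x).const_mul b)).const_mul (-t)
  have h2 : HasDerivAt (weight V b t) (weight V b t x * (-t * ((derivative V).eval x - b))) x :=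
    h1.exp
  refine ((P.hasDerivAt x).mul h2).congr_deriv ?_
  simp only [eval_add, eval_sub, eval_mul, eval_C]
  ring

include hV ht in
/-- Integration by parts: the derivative of the kernel is moved to the polynomial and the weight. -/
theorem integral_mul_inv_sq (P : ℝ[X]) {z : ℂ} (hz : z.im ≠ 0) :
    ∫ x : ℝ, ((P.eval x * weight V b t x : ℝ) : ℂ) * (((x : ℂ) - z)⁻¹) ^ 2
      = weightedCauchy V b t (derivative P - C t * derivative V * P + C (t * b) * P) z := by
  rw [weightedCauchy_eq]
  have hu : ∀ x : ℝ, HasDerivAt (fun x : ℝ => ((P.eval x * weight V b t x : ℝ) : ℂ))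
      (((derivative P - C t * derivative V * P + C (t * b) * P).eval x * weight V b t x : ℝ) : ℂ)
      x := fun x => (hasDerivAt_eval_mul_weight b P x).ofReal_comp
  have hv : ∀ x : ℝ, HasDerivAt (fun x : ℝ => -((x : ℂ) - z)⁻¹) ((((x : ℂ) - z)⁻¹) ^ 2) x :=
    fun x => by
    have h1 : HasDerivAt (fun x : ℝ => (x : ℂ) - z) 1 x :=
      (Complex.ofRealCLM.hasDerivAt (x := x)).sub_const z
    refine (h1.inv (ofReal_sub_ne_zero hz x)).neg.congr_deriv ?_
    rw [inv_pow, neg_div, neg_neg, one_div]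
  have h := integral_mul_deriv_eq_deriv_mul_of_integrable (u := fun x : ℝ =>
    ((P.eval x * weight V b t x : ℝ) : ℂ)) (v := fun x : ℝ => -((x : ℂ) - z)⁻¹) (fun x _ => hu x)
    (fun x _ => hv x)
    (integrable_mul_inv_pow hV ht b P hz 2)
    (by
      refine (integrable_mul_inv_pow hV ht b
        (derivative P - C t * derivative V * P + C (t * b) * P) hz 1).neg.congr
        (Eventually.of_forall fun x => ?_)
      simp)
    (by
      refine (integrable_mul_inv_pow hV ht b P hz 1).neg.congr (Eventually.of_forall fun x => ?_)
      simp)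
  rw [h, ← integral_neg]
  refine integral_congr_ae (Eventually.of_forall fun x => ?_)
  simp only [pow_one]
  ring

end

section

variable {V : ℝ[X]} (hV : IsConfining V) {a t : ℝ} (ht : 0 < t)

/-- The operator `P ↦ P' / t - V' P`, which expresses differentiation of wave functions. -/
def waveDeriv (V : ℝ[X]) (t : ℝ) (P : ℝ[X]) : ℝ[X] := C t⁻¹ * derivative P - derivative V * P

include hV ht in
theorem waveRow_add (P Q : ℝ[X]) {z : ℂ} (hz : z.im ≠ 0) :
    waveRow V a t (P + Q) z = waveRow V a t P z + waveRow V a t Q z := by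
  ext j
  fin_cases j <;> simp [waveRow, weightedCauchy_add hV ht _ P Q hz, add_mul]

theorem waveRow_C_mul (c : ℝ) (P : ℝ[X]) (z : ℂ) :
    waveRow V a t (C c * P) z = (c : ℂ) • waveRow V a t P z := by
  ext j
  fin_cases j <;> simp [waveRow, weightedCauchy_C_mul, mul_assoc]

include hV ht in
theorem waveRow_sub (P Q : ℝ[X]) {z : ℂ} (hz : z.im ≠ 0) :
    waveRow V a t (P - Q) z = waveRow V a t P z - waveRow V a t Q z := by
  have h : P - Q = P + C (-1) * Q := by simp [sub_eq_add_neg]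
  rw [h, waveRow_add hV ht _ _ hz, waveRow_C_mul]
  simp [sub_eq_add_neg]

include hV ht in
/-- Multiplication by `X` commutes with the Cauchy transforms because the orthogonality to constants
kills the correction terms. -/
theorem waveRow_X_mul {P : ℝ[X]} {k : ℕ × ℕ} (h : IsOrth V a t k P) (h1 : 1 ≤ k.1) (h2 : 1 ≤ k.2)
    {z : ℂ} (hz : z.im ≠ 0) : waveRow V a t (X * P) z = z • waveRow V a t P z := by
  have e1 : ∫ x : ℝ, P.eval x * weight V a t x = 0 := by simpa using h.1 0 h1
  have e2 : ∫ x : ℝ, P.eval x * weight V (-a) t x = 0 := by simpa using h.2 0 h2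
  have f1 := mul_weightedCauchy hV ht a P hz
  have f2 := mul_weightedCauchy hV ht (-a) P hz
  rw [e1, Complex.ofReal_zero, sub_zero] at f1
  rw [e2, Complex.ofReal_zero, sub_zero] at f2
  ext j
  fin_cases j <;> simp [waveRow, ← f1, ← f2, mul_assoc]

include hV ht in
theorem hasDerivAt_weightedCauchy_mul_exp (b : ℝ) (P : ℝ[X]) {z : ℂ} (hz : z.im ≠ 0) :
    HasDerivAt (fun w => weightedCauchy V b t P w * Complex.exp (-(t : ℂ) * b * w))
      (t * (weightedCauchy V b t (waveDeriv V t P) z * Complex.exp (-(t : ℂ) * b * z))) z := by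
  have h1 := hasDerivAt_weightedCauchy hV ht b P hz
  have h2 : HasDerivAt (fun w : ℂ => Complex.exp (-(t : ℂ) * b * w))
      (Complex.exp (-(t : ℂ) * b * z) * (-(t : ℂ) * b)) z := by
    simpa using ((hasDerivAt_id z).const_mul (-(t : ℂ) * b)).cexp
  refine (h1.mul h2).congr_deriv ?_
  have h3 : (derivative P - C t * derivative V * P + C (t * b) * P)
      = C t * waveDeriv V t P + C (t * b) * P := by
    rw [waveDeriv, mul_sub, ← mul_assoc, ← C_mul, mul_inv_cancel₀ ht.ne', C_1, one_mul, mul_assoc]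
  rw [integral_mul_inv_sq hV ht b P hz, h3, weightedCauchy_add hV ht b _ _ hz,
    weightedCauchy_C_mul, weightedCauchy_C_mul]
  push_cast
  ring

include hV ht in
/-- Differentiation of the wave function of `P` acts on the polynomial as `waveDeriv`. -/
theorem hasDerivAt_waveRow (P : ℝ[X]) {z : ℂ} (hz : z.im ≠ 0) (j : Fin 3) :
    HasDerivAt (fun w => waveRow V a t P w j)
      (t * waveRow V a t (waveDeriv V t P) z j) z := by
  fin_cases j
  · have h1 := Polynomial.hasDerivAt_aeval P z
    have h2 := ((Polynomial.hasDerivAt_aeval V z).const_mul (-(t : ℂ))).cexp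
    refine (h1.mul h2).congr_deriv ?_
    have ht' : (t : ℂ) ≠ 0 := by exact_mod_cast ht.ne'
    simp only [waveRow, waveDeriv, Fin.zero_eta, Matrix.cons_val_zero, map_sub, map_mul, aeval_C,
      Complex.coe_algebraMap, Complex.ofReal_inv]
    field_simp
    ring
  · exact hasDerivAt_weightedCauchy_mul_exp hV ht a P hz
  · have := hasDerivAt_weightedCauchy_mul_exp hV ht (-a) P hz
    simpa [waveRow] using this

theorem isOrth_waveDeriv_aux (b : ℝ) (hV : IsConfining V) (ht : 0 < t) {P : ℝ[X]} {j : ℕ}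
    (h : ∀ l < j, ∫ x : ℝ, P.eval x * x ^ l * weight V b t x = 0) {l : ℕ} (hl : l < j) :
    ∫ x : ℝ, (waveDeriv V t P).eval x * x ^ l * weight V b t x = 0 := by
  -- the derivative of `P x ^ l w` integrates to zero
  have h1 := integral_eq_zero_of_hasDerivAt_of_integrable
    (fun x => hasDerivAt_eval_mul_weight (V := V) (t := t) b (P * X ^ l) x)
    (integrable_eval_mul_weight hV ht b _) (integrable_eval_mul_weight hV ht b _)
  have h2 : ∀ x, (derivative (P * X ^ l) - C t * derivative V * (P * X ^ l)
        + C (t * b) * (P * X ^ l)).eval x * weight V b t x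
      = t * ((waveDeriv V t P).eval x * x ^ l * weight V b t x)
        + l * (P.eval x * x ^ (l - 1) * weight V b t x)
        + (t * b) * (P.eval x * x ^ l * weight V b t x) := fun x => by
    simp only [waveDeriv, derivative_mul, derivative_X_pow, eval_add, eval_sub, eval_mul, eval_C,
      eval_pow, eval_X]
    field_simp
    ring
  have i1 := integrable_eval_mul_pow_mul_weight hV ht b (waveDeriv V t P) l
  have i2 := integrable_eval_mul_pow_mul_weight hV ht b P (l - 1)
  have i3 := integrable_eval_mul_pow_mul_weight hV ht b P l
  simp only [h2] at h1
  have i12 : Integrable fun x => t * ((waveDeriv V t P).eval x * x ^ l * weight V b t x)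
      + l * (P.eval x * x ^ (l - 1) * weight V b t x) := (i1.const_mul _).add (i2.const_mul _)
  rw [integral_add i12 (i3.const_mul _),
    integral_add (i1.const_mul _) (i2.const_mul _), integral_const_mul, integral_const_mul,
    integral_const_mul, h l hl, h (l - 1) (by omega), mul_zero, mul_zero, add_zero, add_zero] at h1
  exact (mul_eq_zero.1 h1).resolve_left ht.ne'

include hV ht in
theorem IsOrth.waveDeriv {P : ℝ[X]} {k : ℕ × ℕ} (h : IsOrth V a t k P) :
    IsOrth V a t k (waveDeriv V t P) :=
  ⟨fun _ hl => isOrth_waveDeriv_aux a hV ht h.1 hl,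
    fun _ hl => isOrth_waveDeriv_aux (-a) hV ht h.2 hl⟩

end

/-! ### Behaviour at infinity along the imaginary axis -/

theorem tendsto_inv_imag : Tendsto (fun y : ℝ => ((y : ℂ) * Complex.I)⁻¹) atTop (𝓝 0) := by
  rw [tendsto_zero_iff_norm_tendsto_zero]
  simp only [norm_inv, norm_mul, Complex.norm_I, mul_one, Complex.norm_real]
  exact tendsto_inv_atTop_zero.comp (tendsto_norm_atTop_atTop)

theorem imag_ne_zero {y : ℝ} (hy : 0 < y) : (y : ℂ) * Complex.I ≠ 0 :=
  mul_ne_zero (by exact_mod_cast hy.ne') Complex.I_ne_zero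

theorem im_imag (y : ℝ) : ((y : ℂ) * Complex.I).im = y := by simp

theorem tendsto_eval_div_pow {p : ℂ[X]} {e : ℕ} (h : p.natDegree ≤ e) :
    Tendsto (fun y : ℝ => p.eval ((y : ℂ) * Complex.I) / ((y : ℂ) * Complex.I) ^ e) atTop
      (𝓝 (p.coeff e)) := by
  have h1 : Tendsto (fun y : ℝ => ∑ i ∈ Finset.range (e + 1),
      p.coeff i * (((y : ℂ) * Complex.I)⁻¹) ^ (e - i)) atTop
      (𝓝 (∑ i ∈ Finset.range (e + 1), p.coeff i * (0 : ℂ) ^ (e - i))) :=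
    tendsto_finsetSum _ fun i _ => (tendsto_inv_imag.pow _).const_mul _
  have h2 : ∑ i ∈ Finset.range (e + 1), p.coeff i * (0 : ℂ) ^ (e - i) = p.coeff e := by
    rw [Finset.sum_eq_single_of_mem e (Finset.self_mem_range_succ e)]
    · simp
    · intro i hi hne
      have : i < e := lt_of_le_of_ne (Nat.lt_succ_iff.1 (Finset.mem_range.1 hi)) hne
      rw [zero_pow (by omega), mul_zero]
  rw [h2] at h1
  refine h1.congr' ?_
  filter_upwards [eventually_gt_atTop 0] with y hy
  have hz := imag_ne_zero hy
  rw [eval_eq_sum_range' (Nat.lt_succ_of_le h), Finset.sum_div]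
  refine Finset.sum_congr rfl fun i hi => ?_
  have : i ≤ e := Nat.lt_succ_iff.1 (Finset.mem_range.1 hi)
  rw [mul_div_assoc, inv_pow]
  congr 1
  rw [eq_div_iff (pow_ne_zero _ hz), inv_mul_eq_iff_eq_mul₀ (pow_ne_zero _ hz), ← pow_add]
  congr 1
  omega

/-- The growth of a polynomial along the imaginary axis determines its degree and leading
coefficient. -/
theorem natDegree_le_of_tendsto {p : ℂ[X]} {d : ℕ} {L : ℂ}
    (h : Tendsto (fun y : ℝ => p.eval ((y : ℂ) * Complex.I) / ((y : ℂ) * Complex.I) ^ d) atTop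
      (𝓝 L)) : p.natDegree ≤ d ∧ p.coeff d = L := by
  have h1 : p.natDegree ≤ d := by
    by_contra! hd
    have h2 := tendsto_eval_div_pow (le_refl p.natDegree)
    have h3 := h.mul (tendsto_inv_imag.pow (p.natDegree - d))
    rw [zero_pow (by omega), mul_zero] at h3
    have h4 := tendsto_nhds_unique_of_eventuallyEq h2 h3 (by
      filter_upwards [eventually_gt_atTop 0] with y hy
      have hz := imag_ne_zero hy
      rw [inv_pow, div_mul_eq_mul_div, div_eq_div_iff (pow_ne_zero _ hz) (pow_ne_zero _ hz),
        mul_assoc]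
      congr 1
      rw [eq_inv_mul_iff_mul_eq₀ (pow_ne_zero _ hz), ← pow_add]
      congr 1
      omega)
    rw [coeff_natDegree, leadingCoeff_eq_zero] at h4
    rw [h4] at hd
    simp at hd
  exact ⟨h1, tendsto_nhds_unique (tendsto_eval_div_pow h1) h⟩

theorem eq_zero_of_eventually_eval_imag_eq_zero {p : ℂ[X]}
    (h : ∀ᶠ y : ℝ in atTop, p.eval ((y : ℂ) * Complex.I) = 0) : p = 0 := by
  obtain ⟨h1, h2⟩ := natDegree_le_of_tendsto (p := p) (d := 0) (L := 0)
    (tendsto_const_nhds.congr' (by filter_upwards [h] with y hy; simp [hy]))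
  rw [eq_C_of_natDegree_le_zero h1, h2, C_0]

/-! ### The coefficients of the characteristic polynomial of a `3 × 3` matrix -/

/-- The sum of the principal `2 × 2` minors. -/
def minorSum {A : Type*} [CommRing A] (M : Matrix (Fin 3) (Fin 3) A) : A :=
  M 0 0 * M 1 1 - M 0 1 * M 1 0 + (M 0 0 * M 2 2 - M 0 2 * M 2 0)
    + (M 1 1 * M 2 2 - M 1 2 * M 2 1)

theorem two_mul_minorSum {A : Type*} [CommRing A] (M : Matrix (Fin 3) (Fin 3) A) :
    2 * minorSum M = M.trace ^ 2 - (M * M).trace := by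
  simp only [minorSum, Matrix.trace_fin_three, Matrix.mul_apply, Fin.sum_univ_three]
  ring

theorem det_smul_one_add {A : Type*} [CommRing A] (M : Matrix (Fin 3) (Fin 3) A) (ξ : A) :
    (ξ • (1 : Matrix (Fin 3) (Fin 3) A) + M).det
      = ξ ^ 3 + M.trace * ξ ^ 2 + minorSum M * ξ + M.det := by
  simp [minorSum, Matrix.trace_fin_three, Matrix.det_fin_three]
  ring

theorem minorSum_map {A B : Type*} [CommRing A] [CommRing B] (f : A →+* B)
    (M : Matrix (Fin 3) (Fin 3) A) : minorSum (M.map f) = f (minorSum M) := by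
  simp [minorSum]

theorem trace_map_three {A B : Type*} [CommRing A] [CommRing B] (f : A →+* B)
    (M : Matrix (Fin 3) (Fin 3) A) : (M.map f).trace = f M.trace := by
  simp [Matrix.trace_fin_three]

theorem det_map_three {A B : Type*} [CommRing A] [CommRing B] (f : A →+* B)
    (M : Matrix (Fin 3) (Fin 3) A) : (M.map f).det = f M.det := by
  simp [Matrix.det_fin_three]

/-- The coefficients of the characteristic polynomial are invariant under conjugation. -/
theorem invariants_of_conj {K : Type*} [CommRing K] [IsDomain K] [CharZero K]
    {R M Y : Matrix (Fin 3) (Fin 3) K} (hu : IsUnit Y.det) (h : R * Y = Y * M) :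
    R.trace = M.trace ∧ minorSum R = minorSum M ∧ R.det = M.det := by
  have hR : R = Y * M * Y⁻¹ := by
    rw [← h, mul_assoc, Matrix.mul_nonsing_inv _ hu, mul_one]
  have h1 : ∀ X : Matrix (Fin 3) (Fin 3) K, (Y * X * Y⁻¹).trace = X.trace := fun X => by
    rw [Matrix.trace_mul_comm, ← mul_assoc, Matrix.nonsing_inv_mul _ hu, one_mul]
  have h2 : R * R = Y * (M * M) * Y⁻¹ := by
    calc R * R = Y * M * (Y⁻¹ * Y) * (M * Y⁻¹) := by rw [hR]; simp only [mul_assoc]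
      _ = Y * (M * M) * Y⁻¹ := by rw [Matrix.nonsing_inv_mul _ hu]; simp only [mul_assoc, one_mul]
  have ht : R.trace = M.trace := by rw [hR, h1]
  refine ⟨ht, ?_, ?_⟩
  · have h3 := two_mul_minorSum R
    rw [ht, h2, h1, ← two_mul_minorSum M] at h3
    exact mul_left_cancel₀ two_ne_zero h3
  · have h4 := congrArg Matrix.det h
    rw [Matrix.det_mul, Matrix.det_mul, mul_comm] at h4
    exact mul_left_cancel₀ hu.ne_zero h4

/-! ### Normalized wave functions -/

section

variable {V : ℝ[X]} (hV : IsConfining V) {a t : ℝ} (ht : 0 < t) (n : ℕ × ℕ)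

/-- The wave functions and functions of the second kind without their growth at infinity. -/
def normWave (V : ℝ[X]) (a t : ℝ) (n : ℕ × ℕ) (P : ℝ[X]) (z : ℂ) : Fin 3 → ℂ :=
  ![aeval z P / z ^ (n.1 + n.2), z ^ n.1 * weightedCauchy V a t P z,
    z ^ n.2 * weightedCauchy V (-a) t P z]

/-- The growth at infinity of the columns of the wave matrix. -/
def growth (V : ℝ[X]) (a t : ℝ) (n : ℕ × ℕ) (z : ℂ) : Fin 3 → ℂ :=
  ![z ^ (n.1 + n.2) * Complex.exp (-(t : ℂ) * aeval z V),
    (z ^ n.1)⁻¹ * Complex.exp (-(t : ℂ) * (a : ℂ) * z),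
    (z ^ n.2)⁻¹ * Complex.exp ((t : ℂ) * (a : ℂ) * z)]

/-- The logarithmic derivative of `growth`, divided by `t`. -/
def growthRate (V : ℝ[X]) (a t : ℝ) (n : ℕ × ℕ) (z : ℂ) : Fin 3 → ℂ :=
  ![((n.1 + n.2 : ℕ) : ℂ) / t * z⁻¹ - aeval z (derivative V), -((n.1 : ℂ) / t * z⁻¹) - a,
    -((n.2 : ℂ) / t * z⁻¹) + a]

theorem waveRow_eq_mul {z : ℂ} (hz : z ≠ 0) (P : ℝ[X]) (j : Fin 3) :
    waveRow V a t P z j = normWave V a t n P z j * growth V a t n z j := by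
  fin_cases j
  · simp [waveRow, normWave, growth]
    field_simp
  · simp [waveRow, normWave, growth]
    field_simp
  · simp [waveRow, normWave, growth]
    field_simp

theorem growth_ne_zero {z : ℂ} (hz : z ≠ 0) (j : Fin 3) : growth V a t n z j ≠ 0 := by
  fin_cases j <;> simp [growth, hz, Complex.exp_ne_zero]

include ht in
theorem hasDerivAt_growth {z : ℂ} (hz : z ≠ 0) (j : Fin 3) :
    HasDerivAt (fun w => growth V a t n w j)
      (growth V a t n z j * (t * growthRate V a t n z j)) z := by
  have ht' : (t : ℂ) ≠ 0 := by exact_mod_cast ht.ne'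
  have hpow : ∀ k : ℕ, HasDerivAt (fun w : ℂ => w ^ k) (z ^ k * (k * z⁻¹)) z := fun k => by
    refine (hasDerivAt_pow k z).congr_deriv ?_
    rcases k with _ | k
    · simp
    · rw [Nat.add_sub_cancel, pow_succ]
      field_simp
  have hinv : ∀ k : ℕ, HasDerivAt (fun w : ℂ => (w ^ k)⁻¹) ((z ^ k)⁻¹ * (-(k * z⁻¹))) z :=
    fun k => by
    refine ((hpow k).inv (pow_ne_zero k hz)).congr_deriv ?_
    field_simp
  fin_cases j
  · have h2 := ((Polynomial.hasDerivAt_aeval V z).const_mul (-(t : ℂ))).cexp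
    refine ((hpow (n.1 + n.2)).mul h2).congr_deriv ?_
    simp only [growth, growthRate, Fin.zero_eta, Matrix.cons_val_zero]
    field_simp
    ring
  · have h2 : HasDerivAt (fun w : ℂ => Complex.exp (-(t : ℂ) * a * w))
        (Complex.exp (-(t : ℂ) * a * z) * (-(t : ℂ) * a)) z := by
      simpa using ((hasDerivAt_id z).const_mul (-(t : ℂ) * a)).cexp
    refine ((hinv n.1).mul h2).congr_deriv ?_
    simp only [growth, growthRate, Fin.mk_one, Matrix.cons_val_one, Matrix.cons_val_zero]
    field_simp
    ring
  · have h2 : HasDerivAt (fun w : ℂ => Complex.exp ((t : ℂ) * a * w))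
        (Complex.exp ((t : ℂ) * a * z) * ((t : ℂ) * a)) z := by
      simpa using ((hasDerivAt_id z).const_mul ((t : ℂ) * a)).cexp
    refine ((hinv n.2).mul h2).congr_deriv ?_
    simp only [growth, growthRate, Fin.reduceFinMk, Matrix.cons_val]
    field_simp

include hV ht in
/-- The Cauchy transform of a polynomial whose first `j - 1` moments vanish is of order `z ^ (-j)`
along the imaginary axis, with leading coefficient minus the next moment. -/
theorem pow_mul_weightedCauchy_asymp (b : ℝ) {P : ℝ[X]} {j : ℕ} (hj : 1 ≤ j)
    (h : ∀ l < j - 1, ∫ x : ℝ, P.eval x * x ^ l * weight V b t x = 0) :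
    ∃ D : ℂ → ℂ, (∀ z : ℂ, z.im ≠ 0 →
        HasDerivAt (fun w => w ^ j * weightedCauchy V b t P w) (D z) z) ∧
      Tendsto (fun y : ℝ => ((y : ℂ) * Complex.I) ^ j *
        weightedCauchy V b t P ((y : ℂ) * Complex.I)) atTop
        (𝓝 (-((∫ x : ℝ, P.eval x * x ^ (j - 1) * weight V b t x : ℝ) : ℂ))) ∧
      Tendsto (fun y : ℝ => ((y : ℂ) * Complex.I) * D ((y : ℂ) * Complex.I)) atTop (𝓝 0) := by
  set c : ℝ := ∫ x : ℝ, P.eval x * x ^ (j - 1) * weight V b t x with hc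
  have heq : ∀ z : ℂ, z.im ≠ 0 → z ^ j * weightedCauchy V b t P z
      = weightedCauchy V b t (X ^ j * P) z - c := fun z hz => by
    obtain ⟨i, rfl⟩ : ∃ i, j = i + 1 := ⟨j - 1, by omega⟩
    rw [Nat.add_sub_cancel] at h hc
    have hI : ∫ x : ℝ, (X ^ i * P).eval x * weight V b t x = c := by
      refine integral_congr_ae (Eventually.of_forall fun x => ?_)
      simp only [eval_mul, eval_pow, eval_X, Nat.add_sub_cancel]
      ring
    rw [pow_succ', mul_assoc, pow_mul_weightedCauchy hV ht b h hz, mul_weightedCauchy hV ht b _ hz,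
      hI, pow_succ', mul_assoc]
  refine ⟨fun z => ∫ x : ℝ, (((X ^ j * P).eval x * weight V b t x : ℝ) : ℂ) *
    (((x : ℂ) - z)⁻¹) ^ 2, fun z hz => ?_, ?_, ?_⟩
  · refine HasDerivAt.congr_of_eventuallyEq
      ((hasDerivAt_weightedCauchy hV ht b (X ^ j * P) hz).sub_const (c : ℂ)) ?_
    filter_upwards [(isOpen_ne.preimage Complex.continuous_im).mem_nhds hz] with w hw
    exact heq w hw
  · have h1 : Tendsto (fun y : ℝ => weightedCauchy V b t (X ^ j * P) ((y : ℂ) * Complex.I)) atTop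
        (𝓝 0) := by
      refine squeeze_zero_norm' (a := fun y : ℝ =>
        (∫ x : ℝ, |(X ^ j * P).eval x * weight V b t x|) * |y|⁻¹) ?_ ?_
      · filter_upwards [eventually_gt_atTop 0] with y hy
        have := norm_weightedCauchy_le hV ht b (X ^ j * P) (z := (y : ℂ) * Complex.I)
          (by rw [im_imag]; exact hy.ne')
        rwa [im_imag] at this
      · have := (tendsto_inv_atTop_zero.comp (tendsto_abs_atTop_atTop (G := ℝ))).const_mul
          (∫ x : ℝ, |(X ^ j * P).eval x * weight V b t x|)
        simpa using this
    have h2 := h1.sub_const (c : ℂ)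
    rw [zero_sub] at h2
    refine h2.congr' ?_
    filter_upwards [eventually_gt_atTop 0] with y hy
    rw [heq _ (by rw [im_imag]; exact hy.ne')]
  · refine squeeze_zero_norm' (a := fun y : ℝ =>
      (∫ x : ℝ, |(X ^ j * P).eval x * weight V b t x|) * |y|⁻¹) ?_ ?_
    · filter_upwards [eventually_gt_atTop 0] with y hy
      have := norm_integral_mul_inv_pow_le hV ht b (X ^ j * P) (z := (y : ℂ) * Complex.I)
          (by rw [im_imag]; exact hy.ne') 2
      rw [im_imag] at this
      rw [norm_mul, norm_mul, Complex.norm_I, mul_one, Complex.norm_real, Real.norm_eq_abs]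
      refine (mul_le_mul_of_nonneg_left this (abs_nonneg y)).trans_eq ?_
      have : |y| ≠ 0 := (abs_pos.2 hy.ne').ne'
      field_simp
    · have := (tendsto_inv_atTop_zero.comp (tendsto_abs_atTop_atTop (G := ℝ))).const_mul
          (∫ x : ℝ, |(X ^ j * P).eval x * weight V b t x|)
      simpa using this

theorem aeval_eq_eval_map (P : ℝ[X]) (z : ℂ) : aeval z P = (P.map (algebraMap ℝ ℂ)).eval z := by
  rw [eval_map_algebraMap]

theorem eval_div_pow_asymp {P : ℝ[X]} {e : ℕ} (hP : P.natDegree ≤ e) :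
    ∃ D : ℂ → ℂ, (∀ z : ℂ, z.im ≠ 0 → HasDerivAt (fun w => aeval w P / w ^ e) (D z) z) ∧
      Tendsto (fun y : ℝ => aeval ((y : ℂ) * Complex.I) P / ((y : ℂ) * Complex.I) ^ e) atTop
        (𝓝 ((P.coeff e : ℝ) : ℂ)) ∧
      Tendsto (fun y : ℝ => ((y : ℂ) * Complex.I) * D ((y : ℂ) * Complex.I)) atTop (𝓝 0) := by
  refine ⟨fun z => (aeval z (X * derivative P - C (e : ℝ) * P) / z ^ e) * z⁻¹, fun z hz => ?_,
    ?_, ?_⟩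
  · have hz0 : z ≠ 0 := fun h => hz (by rw [h]; rfl)
    refine ((Polynomial.hasDerivAt_aeval P z).div (hasDerivAt_pow e z)
      (pow_ne_zero e hz0)).congr_deriv ?_
    rcases e with _ | e
    · simp
      field_simp
    · simp only [map_sub, map_mul, aeval_X, aeval_C, Nat.add_sub_cancel, Complex.coe_algebraMap]
      push_cast
      field_simp
      ring
  · simp only [aeval_eq_eval_map]
    have := tendsto_eval_div_pow (p := P.map (algebraMap ℝ ℂ)) (natDegree_map_le.trans hP)
    rwa [coeff_map] at this
  · have h1 : (X * derivative P - C (e : ℝ) * P).natDegree ≤ e := by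
      refine (natDegree_sub_le _ _).trans (max_le ?_ ((natDegree_C_mul_le _ _).trans hP))
      rcases Nat.eq_zero_or_pos P.natDegree with h0 | h0
      · rw [eq_C_of_natDegree_eq_zero h0]; simp
      · refine natDegree_mul_le.trans ?_
        have := natDegree_derivative_lt h0.ne'
        rw [natDegree_X]
        omega
    have h2 : (X * derivative P - C (e : ℝ) * P).coeff e = 0 := by
      rcases e with _ | e
      · simp
      · rw [coeff_sub, coeff_X_mul, coeff_derivative, coeff_C_mul]
        push_cast
        ring
    have h3 := tendsto_eval_div_pow (p := (X * derivative P - C (e : ℝ) * P).map (algebraMap ℝ ℂ))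
      (natDegree_map_le.trans h1)
    rw [coeff_map, h2, map_zero] at h3
    refine h3.congr' ?_
    filter_upwards [eventually_gt_atTop 0] with y hy
    have := imag_ne_zero hy
    simp only [aeval_eq_eval_map]
    have key : ∀ A w : ℂ, w ≠ 0 → A = w * (A * w⁻¹) := fun A w hw => by field_simp
    exact key _ _ this

include hV ht in
theorem normWave_asymp {P : ℝ[X]} (h1 : 1 ≤ n.1) (h2 : 1 ≤ n.2) (hd : P.natDegree ≤ n.1 + n.2)
    (ho : IsOrth V a t (n.1 - 1, n.2 - 1) P) :
    ∃ D : ℂ → Fin 3 → ℂ, (∀ z : ℂ, z.im ≠ 0 → ∀ j,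
        HasDerivAt (fun w => normWave V a t n P w j) (D z j) z) ∧
      (∀ j, Tendsto (fun y : ℝ => normWave V a t n P ((y : ℂ) * Complex.I) j) atTop
        (𝓝 ((![P.coeff (n.1 + n.2), -∫ x : ℝ, P.eval x * x ^ (n.1 - 1) * weight V a t x,
          -∫ x : ℝ, P.eval x * x ^ (n.2 - 1) * weight V (-a) t x] j : ℝ) : ℂ))) ∧
      ∀ j, Tendsto (fun y : ℝ => ((y : ℂ) * Complex.I) * D ((y : ℂ) * Complex.I) j) atTop
        (𝓝 0) := by
  obtain ⟨D0, a0, b0, c0⟩ := eval_div_pow_asymp hd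
  obtain ⟨D1, a1, b1, c1⟩ := pow_mul_weightedCauchy_asymp hV ht a h1 ho.1
  obtain ⟨D2, a2, b2, c2⟩ := pow_mul_weightedCauchy_asymp hV ht (-a) h2 ho.2
  refine ⟨fun z => ![D0 z, D1 z, D2 z], fun z hz j => ?_, fun j => ?_, fun j => ?_⟩
  · fin_cases j
    exacts [a0 z hz, a1 z hz, a2 z hz]
  · fin_cases j
    · exact b0
    · simpa [normWave] using b1
    · simpa [normWave] using b2
  · fin_cases j
    exacts [c0, c1, c2]

end

/-! ### The coefficients of the finite spectral curve -/

theorem tendsto_inv_pow_ite (m : ℕ) : Tendsto (fun y : ℝ => (((y : ℂ) * Complex.I)⁻¹) ^ m) atTop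
    (𝓝 (if m = 0 then 1 else 0)) := by
  have := tendsto_inv_imag.pow m
  rwa [zero_pow_eq] at this

/-- Small perturbations of a diagonal matrix one of whose entries is large: the second and third
coefficients of the characteristic polynomial. -/
theorem tendsto_invariants {m : ℕ} (hm : 2 ≤ m) {Λ : ℝ → Fin 3 → ℂ}
    {G : ℝ → Matrix (Fin 3) (Fin 3) ℂ} {v a s q : ℂ}
    (hG : ∀ i j, Tendsto (fun y : ℝ => ((y : ℂ) * Complex.I) * G y i j) atTop (𝓝 0))
    (h0 : Tendsto (fun y : ℝ => Λ y 0 / ((y : ℂ) * Complex.I) ^ (m - 1)) atTop (𝓝 (-v)))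
    (h1 : Tendsto (fun y : ℝ => Λ y 1) atTop (𝓝 (-a)))
    (h2 : Tendsto (fun y : ℝ => Λ y 2) atTop (𝓝 a))
    (hs : Tendsto (fun y : ℝ => ((y : ℂ) * Complex.I) * (Λ y 1 + Λ y 2)) atTop (𝓝 s))
    (hq : Tendsto (fun y : ℝ => ((y : ℂ) * Complex.I) * (Λ y 1 * Λ y 2 + a ^ 2)) atTop (𝓝 q)) :
    Tendsto (fun y : ℝ => minorSum (Matrix.diagonal (Λ y) + G y) / ((y : ℂ) * Complex.I) ^ (m - 2))
      atTop (𝓝 (-(v * s) - if m = 2 then a ^ 2 else 0)) ∧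
    Tendsto (fun y : ℝ => ((Matrix.diagonal (Λ y) + G y).det + a ^ 2 * Λ y 0) /
      ((y : ℂ) * Complex.I) ^ (m - 2)) atTop (𝓝 (-(v * q))) := by
  have hε := tendsto_inv_imag
  have hτ := tendsto_inv_pow_ite (m - 2)
  have hm2 : (m - 2 = 0) ↔ m = 2 := by omega
  have hif : (if m - 2 = 0 then (1 : ℂ) else 0) = if m = 2 then 1 else 0 := by simp only [hm2]
  rw [hif] at hτ
  have hm1 : m - 1 = m - 2 + 1 := by omega
  have e1 := h1.add (hε.mul (hG 1 1))
  have e2 := h2.add (hε.mul (hG 2 2))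
  constructor
  · have key := (h0.mul (hs.add ((hG 1 1).add (hG 2 2)))).add (hτ.mul
      ((((hε.mul (hG 0 0)).mul (e1.add e2)).sub ((hε.pow 2).mul
        (((hG 0 1).mul (hG 1 0)).add ((hG 0 2).mul (hG 2 0))))).add
        ((e1.mul e2).sub ((hε.pow 2).mul ((hG 1 2).mul (hG 2 1))))))
    have hlim : -v * (s + (0 + 0)) + (if m = 2 then (1 : ℂ) else 0) * (0 * 0 * (-a + 0 * 0 +
        (a + 0 * 0)) - 0 ^ 2 * (0 * 0 + 0 * 0) + ((-a + 0 * 0) * (a + 0 * 0) - 0 ^ 2 * (0 * 0)))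
        = -(v * s) - if m = 2 then a ^ 2 else 0 := by
      split_ifs <;> ring
    rw [hlim] at key
    refine key.congr' ?_
    filter_upwards [eventually_gt_atTop 0] with y hy
    have hz := imag_ne_zero hy
    set z := (y : ℂ) * Complex.I
    simp only [minorSum, Matrix.add_apply, Matrix.diagonal_apply_eq, ne_eq, Fin.reduceEq,
      not_false_eq_true, Matrix.diagonal_apply_ne, zero_add]
    rw [hm1, pow_succ, inv_pow]
    field_simp
    ring
  · have key := (h0.mul (hq.add ((((hG 1 1).mul h2).add ((hG 2 2).mul h1)).add
        (hε.mul (((hG 1 1).mul (hG 2 2)).sub ((hG 1 2).mul (hG 2 1))))))).add (hτ.mul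
        (((((hε.mul (hG 0 0)).mul ((e1.mul e2).sub ((hε.pow 2).mul ((hG 1 2).mul (hG 2 1)))))).sub
        ((hε.mul (hG 0 1)).mul (((hε.mul (hG 1 0)).mul e2).sub
          ((hε.pow 2).mul ((hG 1 2).mul (hG 2 0)))))).add
        ((hε.mul (hG 0 2)).mul (((hε.pow 2).mul ((hG 1 0).mul (hG 2 1))).sub
          ((hε.mul (hG 2 0)).mul e1)))))
    simp only [zero_mul, mul_zero, add_zero, sub_zero, neg_mul] at key
    refine key.congr' ?_
    filter_upwards [eventually_gt_atTop 0] with y hy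
    have hz := imag_ne_zero hy
    set z := (y : ℂ) * Complex.I
    simp only [Matrix.det_fin_three, Matrix.add_apply, Matrix.diagonal_apply_eq, ne_eq,
      Fin.reduceEq,
      not_false_eq_true, Matrix.diagonal_apply_ne, zero_add]
    rw [hm1, pow_succ, inv_pow]
    field_simp
    ring

section

variable {V : ℝ[X]} (hV : IsConfining V) {a : ℝ} (ha : a ≠ 0) {n : ℕ × ℕ} (h1 : 1 ≤ n.1)
  (h2 : 1 ≤ n.2)

include hV ha in
/-- The first moment which the orthogonality conditions leave free does not vanish: otherwise the
polynomial would be orthogonal with index `n`, but of smaller degree. -/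
theorem IsMOP.integral_ne_zero {t : ℝ} (ht : 0 < t) {P : ℝ[X]} :
    (IsMOP V a t (n.1 - 1, n.2) P → 1 ≤ n.1 →
      ∫ x : ℝ, P.eval x * x ^ (n.1 - 1) * weight V a t x ≠ 0) ∧
    (IsMOP V a t (n.1, n.2 - 1) P → 1 ≤ n.2 →
      ∫ x : ℝ, P.eval x * x ^ (n.2 - 1) * weight V (-a) t x ≠ 0) := by
  constructor
  · intro hP h1 h
    refine hP.monic.ne_zero (IsOrth.eq_zero_of_degree_lt hV ht ha (k := n) ⟨fun l hl => ?_,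
      hP.orth_snd⟩ ?_)
    · rcases Nat.lt_or_ge l (n.1 - 1) with h' | h'
      · exact hP.orth_fst l h'
      · rw [show l = n.1 - 1 by omega]; exact h
    · rw [degree_eq_natDegree hP.monic.ne_zero, hP.degree]
      exact_mod_cast (by omega : n.1 - 1 + n.2 < n.1 + n.2)
  · intro hP h2 h
    refine hP.monic.ne_zero (IsOrth.eq_zero_of_degree_lt hV ht ha (k := n) ⟨hP.orth_fst,
      fun l hl => ?_⟩ ?_)
    · rcases Nat.lt_or_ge l (n.2 - 1) with h' | h'
      · exact hP.orth_snd l h'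
      · rw [show l = n.2 - 1 by omega]; exact h
    · rw [degree_eq_natDegree hP.monic.ne_zero, hP.degree]
      exact_mod_cast (by omega : n.1 + (n.2 - 1) < n.1 + n.2)

include hV ha h1 h2 in
/-- The matrix of normalized wave functions has an invertible limit along the imaginary axis. -/
theorem exists_normWave_matrix {t : ℝ} (ht : 0 < t) {P : Fin 3 → ℝ[X]} (hP0 : IsMOP V a t n (P 0))
    (hP1 : IsMOP V a t (n.1 - 1, n.2) (P 1)) (hP2 : IsMOP V a t (n.1, n.2 - 1) (P 2)) :
    ∃ (D : ℂ → Matrix (Fin 3) (Fin 3) ℂ) (L : Matrix (Fin 3) (Fin 3) ℂ), L.det ≠ 0 ∧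
      (∀ z : ℂ, z.im ≠ 0 → ∀ i j, HasDerivAt (fun w => normWave V a t n (P i) w j) (D z i j) z) ∧
      (Tendsto (fun y : ℝ => Matrix.of fun i j => normWave V a t n (P i) ((y : ℂ) * Complex.I) j)
        atTop (𝓝 L)) ∧
      Tendsto (fun y : ℝ => ((y : ℂ) * Complex.I) • D ((y : ℂ) * Complex.I)) atTop (𝓝 0) := by
  have hd : ∀ i, (P i).natDegree ≤ n.1 + n.2 := fun i => by
    fin_cases i
    · exact hP0.degree.le
    · exact hP1.degree.le.trans (by simp)
    · exact hP2.degree.le.trans (by simp)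
  have ho : ∀ i, IsOrth V a t (n.1 - 1, n.2 - 1) (P i) := fun i => by
    fin_cases i
    · exact hP0.isOrth.mono (by simp) (by simp)
    · exact hP1.isOrth.mono (by simp) (by simp)
    · exact hP2.isOrth.mono (by simp) (by simp)
  choose D hD hL hz using fun i => normWave_asymp hV ht n h1 h2 (hd i) (ho i)
  refine ⟨fun z => Matrix.of fun i j => D i z j, Matrix.of fun i j =>
    ((![(P i).coeff (n.1 + n.2), -∫ x : ℝ, (P i).eval x * x ^ (n.1 - 1) * weight V a t x,
      -∫ x : ℝ, (P i).eval x * x ^ (n.2 - 1) * weight V (-a) t x] j : ℝ) : ℂ), ?_,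
    fun z hz i j => hD i z hz j, ?_, ?_⟩
  · have e00 : (P 0).coeff (n.1 + n.2) = 1 := by rw [← hP0.degree]; exact hP0.monic
    have e10 : (P 1).coeff (n.1 + n.2) = 0 :=
      coeff_eq_zero_of_natDegree_lt (by rw [hP1.degree]; simp only; omega)
    have e20 : (P 2).coeff (n.1 + n.2) = 0 :=
      coeff_eq_zero_of_natDegree_lt (by rw [hP2.degree]; simp only; omega)
    have e12 := hP1.orth_snd (n.2 - 1) (by simp only; omega)
    have f1 := (IsMOP.integral_ne_zero hV ha (n := n) ht).1 hP1 h1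
    have f2 := (IsMOP.integral_ne_zero hV ha (n := n) ht).2 hP2 h2
    rw [Matrix.det_fin_three]
    simp only [Matrix.of_apply, Matrix.cons_val, e00, e10, e20, e12]
    simp only [neg_zero, Complex.ofReal_zero, mul_zero, sub_zero, zero_mul, add_zero,
      Complex.ofReal_one, one_mul, ne_eq, mul_eq_zero, Complex.ofReal_eq_zero, neg_eq_zero]
    exact not_or.2 ⟨f1, f2⟩
  · exact tendsto_pi_nhds.2 fun i => tendsto_pi_nhds.2 fun j => hL i j
  · refine tendsto_pi_nhds.2 fun i => tendsto_pi_nhds.2 fun j => ?_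
    simpa using hz i j

include h1 h2 in
/-- The differential equation in terms of the normalized wave functions. -/
theorem coeffMatrix_mul_normWave {P : Fin 3 → ℝ[X]} {R : Matrix (Fin 3) (Fin 3) ℂ[X]}
    (hR : ∀ z : ℂ, z.im ≠ 0 → ∀ i j,
      HasDerivAt (fun w => waveMatrix V a ((n.1 + n.2 : ℕ) : ℝ) P w i j)
        (((n.1 + n.2 : ℕ) : ℂ) *
          (matEval R z * waveMatrix V a ((n.1 + n.2 : ℕ) : ℝ) P z) i j) z)
    {D : ℂ → Matrix (Fin 3) (Fin 3) ℂ} (hD : ∀ z : ℂ, z.im ≠ 0 → ∀ i j,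
      HasDerivAt (fun w => normWave V a ((n.1 + n.2 : ℕ) : ℝ) n (P i) w j) (D z i j) z)
    {z : ℂ} (hz : z.im ≠ 0) :
    matEval R z * (Matrix.of fun i j => normWave V a ((n.1 + n.2 : ℕ) : ℝ) n (P i) z j)
      = (Matrix.of fun i j => normWave V a ((n.1 + n.2 : ℕ) : ℝ) n (P i) z j) *
          Matrix.diagonal (growthRate V a ((n.1 + n.2 : ℕ) : ℝ) n z)
        + ((n.1 + n.2 : ℕ) : ℂ)⁻¹ • D z := by
  set t : ℝ := ((n.1 + n.2 : ℕ) : ℝ) with ht'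
  have ht : 0 < t := by rw [ht']; exact_mod_cast (by omega)
  have htc : ((n.1 + n.2 : ℕ) : ℂ) = (t : ℂ) := by rw [ht']; push_cast; rfl
  have ht0 : (t : ℂ) ≠ 0 := by exact_mod_cast ht.ne'
  have hz0 : z ≠ 0 := fun h => hz (by rw [h]; rfl)
  ext i j
  have e1 := hR z hz i j
  have e2 : HasDerivAt (fun w => waveMatrix V a t P w i j)
      (D z i j * growth V a t n z j + normWave V a t n (P i) z j *
        (growth V a t n z j * (t * growthRate V a t n z j))) z := by
    refine ((hD z hz i j).mul (hasDerivAt_growth ht n hz0 j)).congr_of_eventuallyEq ?_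
    filter_upwards [isOpen_ne.mem_nhds hz0] with w hw
    exact waveRow_eq_mul n hw (P i) j
  have e3 := e1.unique e2
  have e4 : (matEval R z * waveMatrix V a t P z) i j = (matEval R z *
      (Matrix.of fun i j => normWave V a t n (P i) z j)) i j * growth V a t n z j := by
    simp only [Matrix.mul_apply, Finset.sum_mul, waveMatrix_apply, waveRow_eq_mul n hz0,
      Matrix.of_apply, mul_assoc]
  have hg := growth_ne_zero (V := V) (a := a) (t := t) n hz0 j
  rw [e4, htc] at e3
  rw [Matrix.add_apply, Matrix.mul_diagonal, Matrix.smul_apply, Matrix.of_apply, smul_eq_mul, htc]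
  rw [← mul_right_inj' ht0, ← mul_left_inj' hg]
  rw [← mul_assoc] at e3
  rw [e3]
  field_simp
  ring

include hV ha h1 h2 in
/-- The coefficient matrix is determined by the differential equation. -/
theorem coeffMatrix_unique {R R' : Matrix (Fin 3) (Fin 3) ℂ[X]} (hR : IsCoeffMatrix V a n R)
    (hR' : IsCoeffMatrix V a n R') : R = R' := by
  have ht : 0 < ((n.1 + n.2 : ℕ) : ℝ) := by exact_mod_cast (by omega)
  obtain ⟨P, hP0, hP1, hP2, hP⟩ := hR
  obtain ⟨P', hP0', hP1', hP2', hP'⟩ := hR'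
  have hPP : P' = P := by
    ext1 i
    fin_cases i
    · exact hP0'.unique hV ht ha hP0
    · exact hP1'.unique hV ht ha hP1
    · exact hP2'.unique hV ht ha hP2
  subst hPP
  obtain ⟨D, L, hL, hD, hY, -⟩ := exists_normWave_matrix hV ha h1 h2 ht hP0 hP1 hP2
  have hdet : ∀ᶠ y : ℝ in atTop, (Matrix.of fun i j => normWave V a ((n.1 + n.2 : ℕ) : ℝ) n (P' i)
      ((y : ℂ) * Complex.I) j).det ≠ 0 :=
    ((Continuous.matrix_det continuous_id).continuousAt.tendsto.comp hY).eventually_ne hL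
  have heq : ∀ᶠ y : ℝ in atTop, matEval R ((y : ℂ) * Complex.I) =
      matEval R' ((y : ℂ) * Complex.I) := by
    filter_upwards [hdet, eventually_gt_atTop 0] with y hy hy0
    have hz : ((y : ℂ) * Complex.I).im ≠ 0 := by rw [im_imag]; exact hy0.ne'
    have := (coeffMatrix_mul_normWave h1 h2 hP hD hz).trans
      (coeffMatrix_mul_normWave h1 h2 hP' hD hz).symm
    have hu := Matrix.mul_nonsing_inv _ hy.isUnit
    have h3 := congrArg (· * (Matrix.of fun i j => normWave V a ((n.1 + n.2 : ℕ) : ℝ) n (P' i)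
      ((y : ℂ) * Complex.I) j)⁻¹) this
    simpa only [mul_assoc, hu, mul_one] using h3
  ext1 i j
  rw [← sub_eq_zero]
  refine eq_zero_of_eventually_eval_imag_eq_zero ?_
  filter_upwards [heq] with y hy
  rw [eval_sub, sub_eq_zero]
  exact congrFun (congrFun hy i) j

theorem tendsto_growthRate {t : ℝ} (ht : 0 < t) (htn : t = ((n.1 + n.2 : ℕ) : ℝ))
    (hm : 2 ≤ V.natDegree) :
    Tendsto (fun y : ℝ => growthRate V a t n ((y : ℂ) * Complex.I) 0 /
      ((y : ℂ) * Complex.I) ^ (V.natDegree - 1)) atTop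
      (𝓝 (-(((derivative V).coeff (V.natDegree - 1) : ℝ) : ℂ))) ∧
    Tendsto (fun y : ℝ => growthRate V a t n ((y : ℂ) * Complex.I) 1) atTop (𝓝 (-(a : ℂ))) ∧
    Tendsto (fun y : ℝ => growthRate V a t n ((y : ℂ) * Complex.I) 2) atTop (𝓝 (a : ℂ)) ∧
    Tendsto (fun y : ℝ => ((y : ℂ) * Complex.I) * (growthRate V a t n ((y : ℂ) * Complex.I) 1 +
      growthRate V a t n ((y : ℂ) * Complex.I) 2)) atTop (𝓝 (-1)) ∧
    Tendsto (fun y : ℝ => ((y : ℂ) * Complex.I) * (growthRate V a t n ((y : ℂ) * Complex.I) 1 *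
      growthRate V a t n ((y : ℂ) * Complex.I) 2 + (a : ℂ) ^ 2)) atTop
      (𝓝 (((n.2 : ℂ) - n.1) / t * a)) := by
  have ht0 : (t : ℂ) ≠ 0 := by exact_mod_cast ht.ne'
  have htc : (t : ℂ) = (n.1 : ℂ) + n.2 := by rw [htn]; push_cast; rfl
  have hε := tendsto_inv_imag
  refine ⟨?_, ?_, ?_, ?_, ?_⟩
  · have e1 := tendsto_eval_div_pow (p := (derivative V).map (algebraMap ℝ ℂ))
      (e := V.natDegree - 1) (natDegree_map_le.trans (natDegree_derivative_le V))
    have e2 := (((hε.pow V.natDegree).const_mul (((n.1 + n.2 : ℕ) : ℂ) / t))).sub e1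
    rw [coeff_map, zero_pow (by omega), mul_zero, zero_sub] at e2
    refine e2.congr' ?_
    filter_upwards [eventually_gt_atTop 0] with y hy
    have hz := imag_ne_zero hy
    simp only [growthRate, Matrix.cons_val_zero, aeval_eq_eval_map]
    rw [sub_div]
    congr 1
    rw [mul_div_assoc]
    congr 1
    obtain ⟨m, hm'⟩ : ∃ m, V.natDegree = m + 1 := ⟨V.natDegree - 1, by omega⟩
    rw [hm', Nat.add_sub_cancel, pow_succ, inv_pow]
    field_simp
  · have := ((hε.const_mul ((n.1 : ℂ) / t)).neg).sub_const (a : ℂ)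
    simpa [growthRate] using this
  · have := ((hε.const_mul ((n.2 : ℂ) / t)).neg).add_const (a : ℂ)
    simpa [growthRate] using this
  · refine tendsto_const_nhds.congr' ?_
    filter_upwards [eventually_gt_atTop 0] with y hy
    have hz := imag_ne_zero hy
    set z := (y : ℂ) * Complex.I
    simp only [growthRate, Matrix.cons_val]
    field_simp
    rw [htc]
    ring
  · have := (hε.const_mul ((n.1 : ℂ) / t * (n.2 / t))).add_const (((n.2 : ℂ) - n.1) / t * a)
    rw [mul_zero, zero_add] at this
    refine this.congr' ?_
    filter_upwards [eventually_gt_atTop 0] with y hy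
    have hz := imag_ne_zero hy
    set z := (y : ℂ) * Complex.I
    simp only [growthRate, Matrix.cons_val]
    field_simp
    ring

include hV ha h1 h2 in
/-- Degrees and leading coefficients of the coefficients of the finite spectral curve. -/
theorem coeffMatrix_invariants {R : Matrix (Fin 3) (Fin 3) ℂ[X]} (hR : IsCoeffMatrix V a n R) :
    R.trace = -(derivative V).map (algebraMap ℝ ℂ) ∧
    ((minorSum R).natDegree ≤ V.natDegree - 2 ∧
      (minorSum R).coeff (V.natDegree - 2) = (derivative V).coeff (V.natDegree - 1) -
        if V.natDegree = 2 then (a : ℂ) ^ 2 else 0) ∧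
    (R.det - C ((a : ℂ) ^ 2) * (derivative V).map (algebraMap ℝ ℂ)).natDegree ≤ V.natDegree - 2 ∧
    (R.det - C ((a : ℂ) ^ 2) * (derivative V).map (algebraMap ℝ ℂ)).coeff (V.natDegree - 2)
      = (derivative V).coeff (V.natDegree - 1) * a *
        (((n.1 : ℂ) - n.2) / ((n.1 + n.2 : ℕ) : ℂ)) := by
  have ht : 0 < ((n.1 + n.2 : ℕ) : ℝ) := by exact_mod_cast (by omega)
  have htc : ((n.1 + n.2 : ℕ) : ℂ) = (((n.1 + n.2 : ℕ) : ℝ) : ℂ) := by push_cast; rfl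
  obtain ⟨P, hP0, hP1, hP2, hP⟩ := hR
  obtain ⟨D, L, hL, hD, hY, hzD⟩ := exists_normWave_matrix hV ha h1 h2 ht hP0 hP1 hP2
  set Y : ℝ → Matrix (Fin 3) (Fin 3) ℂ := fun y =>
    Matrix.of fun i j => normWave V a ((n.1 + n.2 : ℕ) : ℝ) n (P i) ((y : ℂ) * Complex.I) j
    with hYdef
  -- conjugation with `Y` turns `R` into the diagonal matrix of growth rates plus `G = o(1 / z)`
  set G : ℝ → Matrix (Fin 3) (Fin 3) ℂ := fun y =>
    (Y y)⁻¹ * (((n.1 + n.2 : ℕ) : ℂ)⁻¹ • D ((y : ℂ) * Complex.I)) with hGdef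
  set Λ : ℝ → Fin 3 → ℂ := fun y =>
    growthRate V a ((n.1 + n.2 : ℕ) : ℝ) n ((y : ℂ) * Complex.I) with hΛdef
  have hdetY : Tendsto (fun y => (Y y).det) atTop (𝓝 L.det) :=
    (Continuous.matrix_det continuous_id).continuousAt.tendsto.comp hY
  have hdet : ∀ᶠ y : ℝ in atTop, (Y y).det ≠ 0 := hdetY.eventually_ne hL
  have hG : ∀ i j, Tendsto (fun y : ℝ => ((y : ℂ) * Complex.I) * G y i j) atTop (𝓝 0) := by
    have hadj : Tendsto (fun y => (Y y).adjugate) atTop (𝓝 L.adjugate) :=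
      (Continuous.matrix_adjugate continuous_id).continuousAt.tendsto.comp hY
    have e1 : Tendsto (fun y => (((Y y).det)⁻¹ • (Y y).adjugate) * (((n.1 + n.2 : ℕ) : ℂ)⁻¹ •
        (((y : ℂ) * Complex.I) • D ((y : ℂ) * Complex.I)))) atTop
        (𝓝 (((L.det)⁻¹ • L.adjugate) * (((n.1 + n.2 : ℕ) : ℂ)⁻¹ • 0))) :=
      ((hdetY.inv₀ hL).smul hadj).mul (hzD.const_smul _)
    rw [smul_zero, mul_zero] at e1
    intro i j
    refine (tendsto_pi_nhds.1 (tendsto_pi_nhds.1 e1 i) j).congr fun y => ?_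
    rw [hGdef]
    simp only [Matrix.inv_def, Ring.inverse_eq_inv']
    rw [smul_comm _ ((y : ℂ) * Complex.I), mul_smul_comm, Matrix.smul_apply, smul_eq_mul]
  obtain ⟨t0, t1, t2, t3, t4⟩ := tendsto_growthRate (V := V) (a := a) ht rfl hV.two_le
  obtain ⟨i1, i2⟩ := tendsto_invariants hV.two_le hG t0 t1 t2 t3 t4
  have hinv : ∀ᶠ y : ℝ in atTop,
      R.trace.eval ((y : ℂ) * Complex.I) = (Matrix.diagonal (Λ y) + G y).trace ∧
      (minorSum R).eval ((y : ℂ) * Complex.I) = minorSum (Matrix.diagonal (Λ y) + G y) ∧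
      R.det.eval ((y : ℂ) * Complex.I) = (Matrix.diagonal (Λ y) + G y).det := by
    filter_upwards [hdet, eventually_gt_atTop 0] with y hy hy0
    have hz : ((y : ℂ) * Complex.I).im ≠ 0 := by rw [im_imag]; exact hy0.ne'
    have e1 := coeffMatrix_mul_normWave h1 h2 hP hD hz
    have e2 : matEval R ((y : ℂ) * Complex.I) * Y y = Y y * (Matrix.diagonal (Λ y) + G y) := by
      rw [mul_add, hGdef]
      simp only
      rw [← mul_assoc, Matrix.mul_nonsing_inv _ hy.isUnit, one_mul]
      exact e1
    have e3 := invariants_of_conj hy.isUnit e2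
    have e4 : matEval R ((y : ℂ) * Complex.I) = R.map (evalRingHom ((y : ℂ) * Complex.I)) := rfl
    rw [e4, trace_map_three, minorSum_map, det_map_three] at e3
    exact e3
  refine ⟨?_, ?_, ?_⟩
  · rw [eq_neg_iff_add_eq_zero]
    have hlim : Tendsto (fun y : ℝ => (R.trace + (derivative V).map (algebraMap ℝ ℂ)).eval
        ((y : ℂ) * Complex.I) / ((y : ℂ) * Complex.I) ^ 0) atTop (𝓝 0) := by
      have e1 := ((tendsto_inv_imag.mul (hG 0 0)).add (tendsto_inv_imag.mul (hG 1 1))).add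
        (tendsto_inv_imag.mul (hG 2 2))
      simp only [mul_zero, add_zero] at e1
      refine e1.congr' ?_
      filter_upwards [hinv, eventually_gt_atTop 0] with y hy hy0
      have hz := imag_ne_zero hy0
      have hn0 : (((n.1 + n.2 : ℕ) : ℝ) : ℂ) ≠ 0 := by exact_mod_cast ht.ne'
      have hn1 : (((n.1 + n.2 : ℕ) : ℝ) : ℂ) = n.1 + n.2 := by push_cast; rfl
      have e4 : Λ y 0 + Λ y 1 + Λ y 2 = -aeval ((y : ℂ) * Complex.I) (derivative V) := by
        simp only [hΛdef, growthRate, Matrix.cons_val]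
        rw [htc, div_self hn0, div_eq_mul_inv, div_eq_mul_inv]
        linear_combination (((y : ℂ) * Complex.I)⁻¹ * (((n.1 + n.2 : ℕ) : ℝ) : ℂ)⁻¹) * hn1
          - ((y : ℂ) * Complex.I)⁻¹ * mul_inv_cancel₀ hn0
      rw [eval_add, hy.1, pow_zero, div_one, Matrix.trace_fin_three]
      simp only [Matrix.add_apply, Matrix.diagonal_apply_eq, inv_mul_cancel_left₀ hz]
      rw [aeval_eq_eval_map] at e4
      linear_combination -e4
    obtain ⟨d1, d2⟩ := natDegree_le_of_tendsto hlim
    rw [eq_C_of_natDegree_le_zero d1, d2, C_0]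
  · refine natDegree_le_of_tendsto ?_
    have e1 : -((((derivative V).coeff (V.natDegree - 1) : ℝ) : ℂ) * -1) -
        (if V.natDegree = 2 then (a : ℂ) ^ 2 else 0) = (derivative V).coeff (V.natDegree - 1) -
        if V.natDegree = 2 then (a : ℂ) ^ 2 else 0 := by ring
    rw [e1] at i1
    refine i1.congr' ?_
    filter_upwards [hinv] with y hy
    rw [hy.2.1]
  · refine natDegree_le_of_tendsto ?_
    have e0 := (tendsto_inv_imag.pow (V.natDegree - 2 + 1)).const_mul ((a : ℂ) ^ 2)
    rw [zero_pow (by omega), mul_zero] at e0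
    have e1 := i2.sub e0
    have e2 : -((((derivative V).coeff (V.natDegree - 1) : ℝ) : ℂ) *
        (((n.2 : ℂ) - n.1) / ((n.1 + n.2 : ℕ) : ℝ) * a)) - 0
        = (derivative V).coeff (V.natDegree - 1) * a *
          (((n.1 : ℂ) - n.2) / ((n.1 + n.2 : ℕ) : ℂ)) := by
      rw [htc]; ring
    rw [e2] at e1
    refine e1.congr' ?_
    filter_upwards [hinv, eventually_gt_atTop 0] with y hy hy0
    have hz := imag_ne_zero hy0
    have hn0 : (((n.1 + n.2 : ℕ) : ℝ) : ℂ) ≠ 0 := by exact_mod_cast ht.ne'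
    rw [eval_sub, eval_mul, eval_C, hy.2.2, ← aeval_eq_eval_map]
    have e3 : Λ y 0 = ((y : ℂ) * Complex.I)⁻¹ - aeval ((y : ℂ) * Complex.I) (derivative V) := by
      simp only [hΛdef, growthRate, Matrix.cons_val_zero]
      rw [htc, div_self hn0, one_mul]
    have e4 : ((Matrix.diagonal (Λ y) + G y).det + (a : ℂ) ^ 2 * Λ y 0) /
        ((y : ℂ) * Complex.I) ^ (V.natDegree - 2) -
        (a : ℂ) ^ 2 * ((y : ℂ) * Complex.I)⁻¹ ^ (V.natDegree - 2 + 1) =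
        ((Matrix.diagonal (Λ y) + G y).det - (a : ℂ) ^ 2 *
          aeval ((y : ℂ) * Complex.I) (derivative V)) /
        ((y : ℂ) * Complex.I) ^ (V.natDegree - 2) := by
      rw [e3]
      generalize (y : ℂ) * Complex.I = z at hz
      rw [pow_succ, inv_pow]
      field_simp
      ring
    exact e4

end

/-! ### Expansions with bounded coefficients -/

theorem reflect_mul_pow {Q : ℝ[X]} {D : ℕ} (hD : Q.natDegree ≤ D) {u : ℂ} (hu : u ≠ 0) :
    aeval u (reflect D Q) = u ^ D * aeval u⁻¹ Q := by
  let _ : Invertible u⁻¹ := invertibleOfNonzero (inv_ne_zero hu)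
  have := eval₂_reflect_mul_pow (algebraMap ℝ ℂ) u⁻¹ D Q hD
  rw [invOf_eq_inv, inv_inv, inv_pow] at this
  rw [aeval_def, aeval_def, ← this]
  field_simp

theorem aeval_zero_reflect (Q : ℝ[X]) (D : ℕ) : aeval (0 : ℂ) (reflect D Q) = (Q.coeff D : ℂ) := by
  rw [aeval_def, eval₂_at_zero, coeff_reflect, revAt_le (Nat.zero_le D), Nat.sub_zero]
  rfl

/-- A polynomial dominated by a monic polynomial `P` on a circle around the zeros of `P` is
dominated at infinity as well, by the maximum principle. -/
theorem abs_coeff_le_of_norm_le {P Q : ℝ[X]} {D : ℕ} (hP : P.Monic) (hPD : P.natDegree = D)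
    (hQD : Q.natDegree ≤ D) {ρ : ℝ} (hρ : 0 < ρ) (hP0 : ∀ z : ℂ, ρ ≤ ‖z‖ → aeval z P ≠ 0) {B : ℝ}
    (h : ∀ z : ℂ, ‖z‖ = ρ → ‖aeval z Q‖ ≤ B * ‖aeval z P‖) : |Q.coeff D| ≤ B := by
  have hne : ∀ u : ℂ, ‖u‖ ≤ ρ⁻¹ → aeval u (reflect D P) ≠ 0 := fun u hu => by
    rcases eq_or_ne u 0 with rfl | hu0
    · rw [aeval_zero_reflect, ← hPD, coeff_natDegree, hP]
      simp
    · rw [reflect_mul_pow hPD.le hu0]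
      refine mul_ne_zero (pow_ne_zero _ hu0) (hP0 _ ?_)
      rw [norm_inv]
      exact (le_inv_comm₀ (norm_pos_iff.2 hu0) hρ).1 hu
  have hρ' : ρ⁻¹ ≠ 0 := inv_ne_zero hρ.ne'
  have hd : DiffContOnCl ℂ (fun u : ℂ => aeval u (reflect D Q) / aeval u (reflect D P))
      (Metric.ball 0 ρ⁻¹) := by
    refine DifferentiableOn.diffContOnCl fun u hu => ?_
    rw [closure_ball _ hρ', mem_closedBall_zero_iff] at hu
    have h1 : ∀ F : ℝ[X], DifferentiableAt ℂ (fun w : ℂ => aeval w F) u := fun F =>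
      (Polynomial.hasDerivAt_aeval F u).differentiableAt
    exact ((h1 _).div (h1 _) (hne u hu)).differentiableWithinAt
  have key := Complex.norm_le_of_forall_mem_frontier_norm_le Metric.isBounded_ball hd (C := B)
    (fun u hu => ?_) (z := 0) (subset_closure (Metric.mem_ball_self (inv_pos.2 hρ)))
  · rw [aeval_zero_reflect, aeval_zero_reflect, ← hPD, coeff_natDegree, hP.leadingCoeff] at key
    rw [← hPD]
    simpa using key
  · rw [frontier_ball _ hρ', mem_sphere_zero_iff_norm] at hu
    have hu0 : u ≠ 0 := by
      rintro rfl
      rw [norm_zero] at hu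
      exact hρ' hu.symm
    have hn : ‖u⁻¹‖ = ρ := by rw [norm_inv, hu, inv_inv]
    have h1 := h _ hn
    rw [reflect_mul_pow hPD.le hu0, reflect_mul_pow hQD hu0,
      mul_div_mul_left _ _ (pow_ne_zero _ hu0), norm_div]
    exact div_le_of_le_mul₀ (norm_nonneg _) (by
      by_contra! hB
      exact absurd (h1.trans (mul_nonpos_of_nonpos_of_nonneg hB.le (norm_nonneg _)))
        (by
          intro h2
          have h3 : aeval u⁻¹ Q = 0 := norm_le_zero_iff.1 h2
          rw [h3, norm_zero] at h1
          exact absurd h1 (not_le.2 (mul_neg_of_neg_of_pos hB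
            (norm_pos_iff.2 (hP0 _ hn.ge)))))) h1

theorem chain_le {k : ℕ → ℕ × ℕ} {L : ℕ} (hk : ∀ i < L, IsStep (k i) (k (i + 1))) (i : ℕ)
    (hi : i ≤ L) : (k 0).1 ≤ (k i).1 ∧ (k 0).2 ≤ (k i).2 := by
  induction i with
  | zero => simp
  | succ i ih =>
    exact ⟨(ih (by omega)).1.trans (hk i hi).le_fst, (ih (by omega)).2.trans (hk i hi).le_snd⟩

/-- The monic multiple orthogonal polynomial with multi-index `k`. -/
def mop (V : ℝ[X]) (a t : ℝ) (k : ℕ × ℕ) : ℝ[X] := Classical.epsilon (IsMOP V a t k)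

section

variable {V : ℝ[X]} (hV : IsConfining V) {a t : ℝ} (ha : a ≠ 0) (ht : 0 < t) {k k' : ℕ × ℕ}

include hV ha ht in
theorem isMOP_mop (k : ℕ × ℕ) : IsMOP V a t k (mop V a t k) :=
  Classical.epsilon_spec (exists_isMOP hV ht ha k)

include hV ha ht in
/-- Interval bounds for the zeros pass to all smaller multi-indices with the same parameter `t`. -/
theorem rootsIn_mop_of_le {r : ℝ} (hr : RootsIn r (mop V a t k')) (h1 : k.1 ≤ k'.1)
    (h2 : k.2 ≤ k'.2) : RootsIn r (mop V a t k) := by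
  obtain ⟨i, hi⟩ := Nat.exists_eq_add_of_le h1
  obtain ⟨j, hj⟩ := Nat.exists_eq_add_of_le h2
  have key : ∀ i j, RootsIn r (mop V a t (k.1 + i, k.2 + j)) → RootsIn r (mop V a t k) := by
    intro i
    induction i with
    | zero =>
      intro j
      induction j with
      | zero => exact fun h => h
      | succ j ih =>
        exact fun h => ih (h.of_step hV ht ha (isMOP_mop hV ha ht _) (isMOP_mop hV ha ht _)
          (Or.inr (by simp [Prod.ext_iff]; omega)))
    | succ i ih =>
      exact fun j h => ih j (h.of_step hV ht ha (isMOP_mop hV ha ht _) (isMOP_mop hV ha ht _)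
        (Or.inl (by simp [Prod.ext_iff]; omega)))
  refine key i j ?_
  rwa [← hi, ← hj]

include hV ha ht in
theorem rootsIn_mop_chain {r : ℝ} {q : ℕ → ℕ × ℕ} {L : ℕ} (hq : ∀ i < L, IsStep (q i) (q (i + 1)))
    (hL : RootsIn r (mop V a t (q L))) {l : ℕ} (hl : l ≤ L) : RootsIn r (mop V a t (q l)) := by
  have := chain_le (k := fun i => q (l + i)) (L := L - l) (fun i hi => hq (l + i) (by omega))
    (L - l) le_rfl
  simp only [Nat.add_sub_of_le hl, add_zero] at this
  exact rootsIn_mop_of_le hV ha ht hL this.1 this.2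

end

section

variable {V : ℝ[X]} (hV : IsConfining V) {a : ℝ} (ha : a ≠ 0) {r : ℝ} (hr : 1 ≤ r)

include hV ha hr in
/-- On the circle of radius `3 r`, the polynomials of a chain have comparable size. -/
theorem norm_mop_chain {t : ℝ} (ht : 0 < t) {k : ℕ → ℕ × ℕ} {L : ℕ}
    (hk : ∀ i < L, IsStep (k i) (k (i + 1))) (hL : RootsIn r (mop V a t (k L))) {z : ℂ}
    (hz : ‖z‖ = 3 * r) :
    ‖aeval z (mop V a t (k 0))‖ ≤ ‖aeval z (mop V a t (k L))‖ ∧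
    ‖aeval z (mop V a t (k L))‖ ≤ (6 * r) ^ L * ‖aeval z (mop V a t (k 0))‖ := by
  induction L with
  | zero => simp
  | succ L ih =>
    have hs := hk L L.lt_succ_self
    have hL' := rootsIn_mop_of_le hV ha ht hL hs.le_fst hs.le_snd
    obtain ⟨i1, i2⟩ := ih (fun i hi => hk i (hi.trans L.lt_succ_self)) hL'
    obtain ⟨b1, b2⟩ := norm_aeval_step_bounds hV ht ha (isMOP_mop hV ha ht (k L))
      (isMOP_mop hV ha ht (k (L + 1))) hs (by linarith) hL hz.ge
    rw [hz] at b1 b2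
    have h0 := norm_nonneg (aeval z (mop V a t (k L)))
    constructor
    · nlinarith
    · rw [pow_succ]
      nlinarith

include hV ha hr in
/-- A polynomial with the orthogonality conditions of the first index of a chain, and degree at
most the size of the last one, is a combination of the polynomials of the chain; the coefficients
are controlled by the size of the polynomial on a circle. -/
theorem exists_expansion (L : ℕ) : ∃ K : ℝ, 0 ≤ K ∧ ∀ (t : ℝ) (_ : 0 < t) (k : ℕ → ℕ × ℕ)
    (_ : ∀ i < L, IsStep (k i) (k (i + 1))) (_ : RootsIn r (mop V a t (k L))) (Q : ℝ[X]) (B : ℝ)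
    (_ : 0 ≤ B) (_ : IsOrth V a t (k 0) Q) (_ : Q.natDegree ≤ (k L).1 + (k L).2)
    (_ : ∀ z : ℂ, ‖z‖ = 3 * r → ‖aeval z Q‖ ≤ B * ‖aeval z (mop V a t (k 0))‖),
    ∃ c : ℕ → ℝ, (∀ i, |c i| ≤ K * B) ∧
      Q = ∑ i ∈ Finset.range (L + 1), C (c i) * mop V a t (k i) := by
  -- the leading coefficient is the value at infinity of `Q / P`, bounded by the maximum principle
  have hcoeff : ∀ (L : ℕ) (t : ℝ) (_ : 0 < t) (k : ℕ → ℕ × ℕ)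
      (_ : ∀ i < L, IsStep (k i) (k (i + 1))) (_ : RootsIn r (mop V a t (k L))) (Q : ℝ[X]) (B : ℝ)
      (_ : 0 ≤ B) (_ : Q.natDegree ≤ (k L).1 + (k L).2)
      (_ : ∀ z : ℂ, ‖z‖ = 3 * r → ‖aeval z Q‖ ≤ B * ‖aeval z (mop V a t (k 0))‖),
      |Q.coeff ((k L).1 + (k L).2)| ≤ B := by
    intro L t ht k hk hL Q B hB hQ hQB
    have hP := isMOP_mop hV ha ht (k L)
    refine abs_coeff_le_of_norm_le hP.monic hP.degree hQ (ρ := 3 * r) (by linarith)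
      (fun z hz => hP.aeval_ne_zero hV ht ha hL (Or.inl (by linarith))) fun z hz => ?_
    exact (hQB z hz).trans (mul_le_mul_of_nonneg_left (norm_mop_chain hV ha hr ht hk hL hz).1 hB)
  have hdeg : ∀ (t : ℝ) (_ : 0 < t) (k : ℕ × ℕ) (Q : ℝ[X]), Q.natDegree ≤ k.1 + k.2 →
      (Q - C (Q.coeff (k.1 + k.2)) * mop V a t k).degree < (k.1 + k.2 : ℕ) := by
    intro t ht k Q hQ
    have hP := isMOP_mop hV ha ht k
    rw [degree_lt_iff_coeff_zero]
    intro m hm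
    rw [coeff_sub, coeff_C_mul]
    rcases eq_or_lt_of_le hm with rfl | hm
    · have : (mop V a t k).coeff (k.1 + k.2) = 1 := by
        rw [← hP.degree]; exact hP.monic
      rw [this, mul_one, sub_self]
    · rw [coeff_eq_zero_of_natDegree_lt (hQ.trans_lt hm),
        coeff_eq_zero_of_natDegree_lt (hP.degree.trans_lt hm), mul_zero, sub_zero]
  induction L with
  | zero =>
    refine ⟨1, zero_le_one, fun t ht k hk hL Q B hB hQ hQd hQB => ?_⟩
    refine ⟨fun _ => Q.coeff ((k 0).1 + (k 0).2), fun _ => ?_, ?_⟩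
    · rw [one_mul]
      exact hcoeff 0 t ht k hk hL Q B hB hQd hQB
    · have hP := isMOP_mop hV ha ht (k 0)
      have := (hQ.sub hV ht (hP.isOrth.C_mul (Q.coeff ((k 0).1 + (k 0).2)))).eq_zero_of_degree_lt
        hV ht ha (hdeg t ht _ Q hQd)
      simpa using sub_eq_zero.1 this
  | succ L ih =>
    obtain ⟨K, hK, h⟩ := ih
    have h6 : 0 ≤ (6 * r) ^ (L + 1) := by positivity
    refine ⟨1 + K * (1 + (6 * r) ^ (L + 1)), by positivity,
      fun t ht k hk hL Q B hB hQ hQd hQB => ?_⟩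
    set γ := Q.coeff ((k (L + 1)).1 + (k (L + 1)).2) with hγ
    have hγB : |γ| ≤ B := hcoeff (L + 1) t ht k hk hL Q B hB hQd hQB
    have hs := hk L L.lt_succ_self
    have hle := chain_le hk (L + 1) le_rfl
    -- without its leading term, `Q` expands along the chain without the last index
    obtain ⟨c, hc, hQc⟩ := h t ht k (fun i hi => hk i (hi.trans L.lt_succ_self))
      (rootsIn_mop_of_le hV ha ht hL hs.le_fst hs.le_snd) (Q - C γ * mop V a t (k (L + 1)))
      (B * (1 + (6 * r) ^ (L + 1))) (by positivity)
      (hQ.sub hV ht (((isMOP_mop hV ha ht _).isOrth.mono hle.1 hle.2).C_mul γ))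
      (by
        have := hdeg t ht _ Q hQd
        have hsz := hs.size
        exact natDegree_le_iff_coeff_eq_zero.2 fun m hm =>
          (degree_lt_iff_coeff_zero _ _).1 this m (by omega))
      (fun z hz => by
        rw [map_sub, map_mul, aeval_C]
        refine (norm_sub_le _ _).trans ?_
        rw [norm_mul, Complex.coe_algebraMap, Complex.norm_real, Real.norm_eq_abs]
        have e1 := hQB z hz
        have e2 := (norm_mop_chain hV ha hr ht hk hL hz).2
        have e3 := mul_le_mul hγB e2 (norm_nonneg _) hB
        linarith)
    refine ⟨fun i => if i = L + 1 then γ else c i, fun i => ?_, ?_⟩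
    · simp only
      split_ifs with hi
      · have : 0 ≤ K * (1 + (6 * r) ^ (L + 1)) * B := by positivity
        linarith
      · have := hc i
        linarith
    · simp only
      rw [Finset.sum_range_succ, if_pos rfl, ← sub_eq_iff_eq_add, hQc]
      refine Finset.sum_congr rfl fun i hi => ?_
      rw [if_neg (Finset.mem_range.1 hi).ne]

end

/-! ### Recurrence relations with bounded coefficients -/

/-- The chain of indices `q 0 - (1, 1)`, `q 0 - (1, 0)`, `q 0`, `q 1`, … -/
def descend (q : ℕ → ℕ × ℕ) : ℕ → ℕ × ℕ
  | 0 => ((q 0).1 - 1, (q 0).2 - 1)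
  | 1 => ((q 0).1 - 1, (q 0).2)
  | l + 2 => q l

theorem isStep_descend {q : ℕ → ℕ × ℕ} {L : ℕ} (hq : ∀ l < L, IsStep (q l) (q (l + 1)))
    (h1 : 1 ≤ (q 0).1) (h2 : 1 ≤ (q 0).2) (l : ℕ) (hl : l < L + 2) :
    IsStep (descend q l) (descend q (l + 1)) := by
  match l with
  | 0 => exact Or.inr (by simp [descend, Prod.ext_iff]; omega)
  | 1 => exact Or.inl (by simp [descend, Prod.ext_iff]; omega)
  | l + 2 => exact hq l (by omega)

section

variable {V : ℝ[X]} (hV : IsConfining V) {a : ℝ} (ha : a ≠ 0) {r : ℝ} (hr : 1 ≤ r)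

include hV ha hr in
/-- The two lower neighbours of `k` differ by a bounded multiple of the polynomial of index
`k - (1, 1)`. -/
theorem exists_neighbor : ∃ K : ℝ, ∀ (t : ℝ) (_ : 0 < t) (k : ℕ × ℕ) (_ : 1 ≤ k.1) (_ : 1 ≤ k.2)
    (_ : RootsIn r (mop V a t k)), ∃ h : ℝ, |h| ≤ K ∧
      mop V a t (k.1, k.2 - 1) = mop V a t (k.1 - 1, k.2) - C h * mop V a t (k.1 - 1, k.2 - 1) := by
  obtain ⟨K, hK, h⟩ := exists_expansion hV ha hr 0
  refine ⟨K * (12 * r), fun t ht k h1 h2 hk => ?_⟩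
  have hP := isMOP_mop hV ha ht
  have hr1 := rootsIn_mop_of_le hV ha ht hk (k := (k.1 - 1, k.2)) (by simp) (by simp)
  have hr2 := rootsIn_mop_of_le hV ha ht hk (k := (k.1, k.2 - 1)) (by simp) (by simp)
  have hr3 := rootsIn_mop_of_le hV ha ht hr1 (k := (k.1 - 1, k.2 - 1)) (by simp) (by simp)
  have hlt : (mop V a t (k.1 - 1, k.2) - mop V a t (k.1, k.2 - 1)).degree < (k.1 + k.2 - 1 : ℕ) :=
    degree_sub_lt_of_monic (hP _).monic (hP _).monic (by rw [(hP _).degree]; simp only; omega)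
      (by rw [(hP _).degree]; simp only; omega)
  obtain ⟨c, hc, hQ⟩ := h t ht (fun _ => (k.1 - 1, k.2 - 1)) (fun i hi => absurd hi (by omega)) hr3
    (mop V a t (k.1 - 1, k.2) - mop V a t (k.1, k.2 - 1)) (12 * r) (by linarith)
    (((hP _).isOrth.mono (by simp) (by simp)).sub hV ht ((hP _).isOrth.mono (by simp) (by simp)))
    (natDegree_le_iff_coeff_eq_zero.2 fun m hm =>
      (degree_lt_iff_coeff_zero _ _).1 hlt m (by simp only at hm; omega))
    (fun z hz => by
      have b1 := (norm_aeval_step_bounds hV ht ha (hP (k.1 - 1, k.2 - 1)) (hP (k.1 - 1, k.2))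
        (Or.inr (by simp [Prod.ext_iff]; omega)) (by linarith) hr1 hz.ge).1
      have b2 := (norm_aeval_step_bounds hV ht ha (hP (k.1 - 1, k.2 - 1)) (hP (k.1, k.2 - 1))
        (Or.inl (by simp [Prod.ext_iff]; omega)) (by linarith) hr2 hz.ge).1
      rw [hz] at b1 b2
      rw [map_sub]
      refine (norm_sub_le _ _).trans ?_
      linarith)
  refine ⟨c 0, hc 0, ?_⟩
  rw [zero_add, Finset.sum_range_one] at hQ
  rw [← hQ]
  ring

include hV ha hr in
/-- Four-term recurrence with bounded coefficients for a step of the multi-index. -/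
theorem exists_recurrence : ∃ K : ℝ, ∀ (t : ℝ) (_ : 0 < t) (k k' : ℕ × ℕ) (_ : 1 ≤ k.1)
    (_ : 1 ≤ k.2) (_ : IsStep k k') (_ : RootsIn r (mop V a t k')), ∃ c : ℕ → ℝ, (∀ i, |c i| ≤ K) ∧
      mop V a t k' = X * mop V a t k - (C (c 0) * mop V a t (k.1 - 1, k.2 - 1) +
        C (c 1) * mop V a t (k.1 - 1, k.2) + C (c 2) * mop V a t k) := by
  obtain ⟨K, hK, h⟩ := exists_expansion hV ha hr 2
  refine ⟨K * (9 * r * (6 * r) ^ 2), fun t ht k k' h1 h2 hs hk => ?_⟩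
  have hP := isMOP_mop hV ha ht
  have hr1 := rootsIn_mop_of_le hV ha ht hk hs.le_fst hs.le_snd
  have hch := isStep_descend (q := fun _ => k) (L := 0) (fun l hl => absurd hl (by omega)) h1 h2
  obtain ⟨c, hc, hQ⟩ := h t ht (descend fun _ => k) hch hr1
    (X * mop V a t k - mop V a t k') (9 * r * (6 * r) ^ 2) (by positivity)
    ((hP k).isOrth.X_mul.sub hV ht ((hP k').isOrth.mono
      ((Nat.sub_le _ _).trans hs.le_fst) ((Nat.sub_le _ _).trans hs.le_snd)))
    (natDegree_le_iff_coeff_eq_zero.2 fun m hm => by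
      have hlt : (X * mop V a t k - mop V a t k').degree < ((k.1 + k.2 + 1 : ℕ) : WithBot ℕ) :=
        degree_sub_lt_of_monic (monic_X.mul (hP _).monic) (hP _).monic
          (by rw [natDegree_X_mul (hP _).monic.ne_zero, (hP _).degree])
          (by rw [(hP _).degree, hs.size])
      exact (degree_lt_iff_coeff_zero _ _).1 hlt m hm)
    (fun z hz => by
      have b1 := (norm_aeval_step_bounds hV ht ha (hP k) (hP k') hs (by linarith) hk hz.ge).1
      have b2 := (norm_mop_chain hV ha hr ht hch hr1 hz).2
      rw [hz] at b1
      rw [map_sub, map_mul, aeval_X]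
      refine (norm_sub_le _ _).trans ?_
      rw [norm_mul, hz]
      have e1 : descend (fun _ => k) (0 + 2) = k := rfl
      rw [e1, zero_add] at b2
      have := mul_le_mul_of_nonneg_left b2 (show 0 ≤ 9 * r by linarith)
      linarith)
  refine ⟨c, hc, ?_⟩
  rw [Finset.sum_range_succ, Finset.sum_range_succ, Finset.sum_range_one] at hQ
  simp only [descend] at hQ
  rw [← hQ]
  ring

end

/-! ### Families of polynomials with bounded coefficients -/

section

variable {ι : Type*}

/-- Families of polynomials of bounded degree with uniformly bounded coefficients. -/
def BddPoly (f : ι → ℝ[X]) : Prop :=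
  ∃ (D : ℕ) (B : ℝ), 0 ≤ B ∧ ∀ i, (f i).natDegree ≤ D ∧ ∀ l, |(f i).coeff l| ≤ B

theorem bddPoly_C {c : ι → ℝ} {K : ℝ} (h : ∀ i, |c i| ≤ K) : BddPoly fun i => C (c i) := by
  refine ⟨0, |K|, abs_nonneg _, fun i => ⟨(natDegree_C _).le, fun l => ?_⟩⟩
  rw [coeff_C]
  split_ifs
  · exact (h i).trans (le_abs_self K)
  · simp

theorem bddPoly_const (p : ℝ[X]) : BddPoly fun _ : ι => p := by
  refine ⟨p.natDegree, ∑ l ∈ p.support, |p.coeff l|, Finset.sum_nonneg fun _ _ => abs_nonneg _,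
    fun i => ⟨le_rfl, fun l => ?_⟩⟩
  by_cases hl : l ∈ p.support
  · exact Finset.single_le_sum (f := fun l => |p.coeff l|) (fun _ _ => abs_nonneg _) hl
  · rw [notMem_support_iff.1 hl, abs_zero]
    exact Finset.sum_nonneg fun _ _ => abs_nonneg _

theorem BddPoly.add {f g : ι → ℝ[X]} (hf : BddPoly f) (hg : BddPoly g) :
    BddPoly fun i => f i + g i := by
  obtain ⟨D, B, hB, h⟩ := hf
  obtain ⟨D', B', hB', h'⟩ := hg
  refine ⟨max D D', B + B', by linarith, fun i =>
    ⟨(natDegree_add_le _ _).trans (max_le_max (h i).1 (h' i).1), fun l => ?_⟩⟩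
  rw [coeff_add]
  exact (abs_add_le _ _).trans (add_le_add ((h i).2 l) ((h' i).2 l))

theorem BddPoly.mul {f g : ι → ℝ[X]} (hf : BddPoly f) (hg : BddPoly g) :
    BddPoly fun i => f i * g i := by
  obtain ⟨D, B, hB, h⟩ := hf
  obtain ⟨D', B', hB', h'⟩ := hg
  have hd : ∀ i, (f i * g i).natDegree ≤ D + D' := fun i =>
    natDegree_mul_le.trans (add_le_add (h i).1 (h' i).1)
  refine ⟨D + D', ((D + D' : ℕ) + 1) * (B * B'), by positivity, fun i => ⟨hd i, fun l => ?_⟩⟩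
  rcases Nat.lt_or_ge (D + D') l with hl | hl
  · rw [coeff_eq_zero_of_natDegree_lt ((hd i).trans_lt hl), abs_zero]
    positivity
  · rw [coeff_mul]
    refine (Finset.abs_sum_le_sum_abs _ _).trans ?_
    refine (Finset.sum_le_card_nsmul _ _ (B * B') fun p _ => ?_).trans ?_
    · rw [abs_mul]
      exact mul_le_mul ((h i).2 _) ((h' i).2 _) (abs_nonneg _) hB
    · rw [Finset.Nat.card_antidiagonal, nsmul_eq_mul]
      refine mul_le_mul_of_nonneg_right ?_ (mul_nonneg hB hB')
      exact_mod_cast Nat.succ_le_succ hl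

/-- The wave functions of the family `f` are combinations, with polynomial coefficients that are
bounded along the family, of the wave functions of the families `B · 0`, `B · 1`, `B · 2`. -/
def BddSpan (V : ℝ[X]) (a : ℝ) (t : ι → ℝ) (B : ι → Fin 3 → ℝ[X]) (f : ι → ℝ[X]) : Prop :=
  ∃ r : Fin 3 → ι → ℝ[X], (∀ j, BddPoly (r j)) ∧ ∀ i, ∀ z : ℂ, z.im ≠ 0 →
    waveRow V a (t i) (f i) z = ∑ j, aeval z (r j i) • waveRow V a (t i) (B i j) z

variable {V : ℝ[X]} (hV : IsConfining V) {a : ℝ} {t : ι → ℝ} (ht : ∀ i, 0 < t i)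
  {B : ι → Fin 3 → ℝ[X]} {f g : ι → ℝ[X]}

theorem bddSpan_apply (j : Fin 3) : BddSpan V a t B fun i => B i j := by
  refine ⟨fun l _ => if l = j then 1 else 0, fun l => bddPoly_const _, fun i z hz => ?_⟩
  rw [Finset.sum_eq_single j]
  · simp
  · intro l _ hl
    simp [hl]
  · simp

include hV ht in
theorem BddSpan.add (hf : BddSpan V a t B f) (hg : BddSpan V a t B g) :
    BddSpan V a t B fun i => f i + g i := by
  obtain ⟨r, hr, h⟩ := hf
  obtain ⟨r', hr', h'⟩ := hg
  refine ⟨fun j i => r j i + r' j i, fun j => (hr j).add (hr' j), fun i z hz => ?_⟩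
  rw [waveRow_add hV (ht i) _ _ hz, h i z hz, h' i z hz, ← Finset.sum_add_distrib]
  simp only [map_add, add_smul]

theorem BddSpan.C_mul (hf : BddSpan V a t B f) {c : ι → ℝ} {K : ℝ} (hc : ∀ i, |c i| ≤ K) :
    BddSpan V a t B fun i => C (c i) * f i := by
  obtain ⟨r, hr, h⟩ := hf
  refine ⟨fun j i => C (c i) * r j i, fun j => (bddPoly_C hc).mul (hr j), fun i z hz => ?_⟩
  rw [waveRow_C_mul, h i z hz, Finset.smul_sum]
  simp only [map_mul, aeval_C, mul_smul]
  rfl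

include hV ht in
theorem BddSpan.sub (hf : BddSpan V a t B f) (hg : BddSpan V a t B g) :
    BddSpan V a t B fun i => f i - g i := by
  have := hf.add hV ht (hg.C_mul (c := fun _ => -1) (K := 1) (by simp))
  simpa [sub_eq_add_neg] using this

include hV ht in
theorem BddSpan.X_mul (hf : BddSpan V a t B f) {k : ι → ℕ × ℕ}
    (hk : ∀ i, IsOrth V a (t i) (k i) (f i)) (h1 : ∀ i, 1 ≤ (k i).1) (h2 : ∀ i, 1 ≤ (k i).2) :
    BddSpan V a t B fun i => X * f i := by
  obtain ⟨r, hr, h⟩ := hf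
  refine ⟨fun j i => X * r j i, fun j => (bddPoly_const X).mul (hr j), fun i z hz => ?_⟩
  rw [waveRow_X_mul hV (ht i) (hk i) (h1 i) (h2 i) hz, h i z hz, Finset.smul_sum]
  simp only [map_mul, aeval_X, mul_smul]

include hV ht in
theorem BddSpan.sum (s : Finset ℕ) {F : ℕ → ι → ℝ[X]} (h : ∀ l ∈ s, BddSpan V a t B (F l)) :
    BddSpan V a t B fun i => ∑ l ∈ s, F l i := by
  induction s using Finset.induction_on with
  | empty =>
    have := (bddSpan_apply (V := V) (a := a) (t := t) (B := B) 0).C_mul (c := fun _ => 0) (K := 0)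
      (by simp)
    simpa using this
  | insert l s hl ih =>
    simp only [Finset.sum_insert hl]
    exact (h l (Finset.mem_insert_self l s)).add hV ht
      (ih fun l hl => h l (Finset.mem_insert_of_mem hl))

/-- The polynomials with indices `k`, `k - (1, 0)`, `k - (1, 1)`. -/
def triple (V : ℝ[X]) (a t : ℝ) (k : ℕ × ℕ) : Fin 3 → ℝ[X] :=
  ![mop V a t k, mop V a t (k.1 - 1, k.2), mop V a t (k.1 - 1, k.2 - 1)]

include hV ht in
/-- One step of the path does not leave the bounded span. -/
theorem bddSpan_triple_step (ha : a ≠ 0) {r : ℝ} (hr : 1 ≤ r) {k k' : ι → ℕ × ℕ}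
    (h1 : ∀ i, 1 ≤ (k i).1) (h2 : ∀ i, 1 ≤ (k i).2) (hs : ∀ i, IsStep (k i) (k' i))
    (hk : ∀ i, RootsIn r (mop V a (t i) (k' i)))
    (h : ∀ j, BddSpan V a t B fun i => triple V a (t i) (k i) j) (j : Fin 3) :
    BddSpan V a t B fun i => triple V a (t i) (k' i) j := by
  obtain ⟨K, hK⟩ := exists_neighbor hV ha hr
  obtain ⟨K', hK'⟩ := exists_recurrence hV ha hr
  have hr1 : ∀ i, RootsIn r (mop V a (t i) (k i)) := fun i =>
    rootsIn_mop_of_le hV ha (ht i) (hk i) (hs i).le_fst (hs i).le_snd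
  have H0 : BddSpan V a t B fun i => mop V a (t i) (k i) := h 0
  have H1 : BddSpan V a t B fun i => mop V a (t i) ((k i).1 - 1, (k i).2) := h 1
  have H2 : BddSpan V a t B fun i => mop V a (t i) ((k i).1 - 1, (k i).2 - 1) := h 2
  have hcomb : ∀ F : ι → ℝ[X], (∃ M : ℝ, ∀ i, ∃ c : Fin 3 → ℝ, (∀ j, |c j| ≤ M) ∧
      F i = C (c 0) * mop V a (t i) (k i) + C (c 1) * mop V a (t i) ((k i).1 - 1, (k i).2) +
        C (c 2) * mop V a (t i) ((k i).1 - 1, (k i).2 - 1)) → BddSpan V a t B F := by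
    rintro F ⟨M, hM⟩
    choose c hc hF using hM
    rw [funext hF]
    exact ((H0.C_mul fun i => hc i 0).add hV ht (H1.C_mul fun i => hc i 1)).add hV ht
      (H2.C_mul fun i => hc i 2)
  -- the recurrence gives the new polynomial, the neighbour relations the other two
  fin_cases j
  · choose c hc hF using fun i => hK' (t i) (ht i) (k i) (k' i) (h1 i) (h2 i) (hs i) (hk i)
    change BddSpan V a t B fun i => mop V a (t i) (k' i)
    rw [funext hF]
    exact (H0.X_mul hV ht (fun i => (isMOP_mop hV ha (ht i) (k i)).isOrth) h1 h2).sub hV ht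
      (((H2.C_mul fun i => hc i 0).add hV ht (H1.C_mul fun i => hc i 1)).add hV ht
        (H0.C_mul fun i => hc i 2))
  · refine hcomb _ ⟨|K| + 1, fun i => ?_⟩
    rcases hs i with h' | h'
    · refine ⟨![1, 0, 0], fun j => ?_, ?_⟩
      · fin_cases j <;> simp [abs_nonneg, add_nonneg]
      · simp [triple, h']
    · obtain ⟨η, hη, e⟩ := hK (t i) (ht i) (k' i) (by rw [h']; exact h1 i)
        (by rw [h']; simp) (hk i)
      rw [h'] at e
      refine ⟨![1, η, 0], fun j => ?_, ?_⟩
      · fin_cases j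
        · simp
        · have := le_abs_self K
          simp only [Fin.mk_one, Matrix.cons_val_one, Matrix.cons_val_zero]
          linarith
        · simp [add_nonneg]
      · simp [triple, h'] at e ⊢
        rw [e]
        ring
  · refine hcomb _ ⟨|K| + 1, fun i => ?_⟩
    rcases hs i with h' | h'
    · obtain ⟨η, hη, e⟩ := hK (t i) (ht i) (k i) (h1 i) (h2 i) (hr1 i)
      refine ⟨![0, 1, -η], fun j => ?_, ?_⟩
      · fin_cases j
        · simp [add_nonneg]
        · simp
        · have := le_abs_self K
          simp only [Fin.reduceFinMk, Matrix.cons_val, abs_neg]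
          linarith
      · simp [triple, h']
        rw [e]
        ring
    · refine ⟨![0, 1, 0], fun j => ?_, ?_⟩
      · fin_cases j <;> simp [add_nonneg]
      · simp [triple, h']

end

/-! ### The differential equation with bounded coefficients -/

theorem aeval_derivative_prod {s : Finset ℝ} {z : ℂ}
    (hz : aeval z (∏ y ∈ s, (X - C y : ℝ[X])) ≠ 0) :
    aeval z (derivative (∏ y ∈ s, (X - C y : ℝ[X]))) =
      aeval z (∏ y ∈ s, (X - C y : ℝ[X])) * ∑ y ∈ s, (z - (y : ℂ))⁻¹ := by
  rw [derivative_prod_finset, map_sum, Finset.mul_sum]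
  refine Finset.sum_congr rfl fun y hy => ?_
  rw [derivative_X_sub_C, mul_one, aeval_prod_X_sub_C, aeval_prod_X_sub_C,
    ← Finset.mul_prod_erase s _ hy]
  rw [aeval_prod_X_sub_C, Finset.prod_ne_zero_iff] at hz
  have := hz y hy
  field_simp

section

variable {V : ℝ[X]} (hV : IsConfining V) {a : ℝ} (ha : a ≠ 0) {r : ℝ} (hr : 1 ≤ r)

include hV ha hr in
theorem norm_derivative_mop_le {t : ℝ} (ht : 0 < t) {k : ℕ × ℕ} (hk : RootsIn r (mop V a t k))
    {z : ℂ} (hz : ‖z‖ = 3 * r) : ‖aeval z (derivative (mop V a t k))‖ ≤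
      ((k.1 + k.2 : ℕ) : ℝ) * ‖aeval z (mop V a t k)‖ := by
  have hne := (isMOP_mop hV ha ht k).aeval_ne_zero hV ht ha hk (z := z) (Or.inl (by linarith))
  obtain ⟨s, hs, hP⟩ := (isMOP_mop hV ha ht k).exists_eq_prod hV ht ha
  rw [hP] at hne hk ⊢
  rw [aeval_derivative_prod hne, norm_mul, mul_comm]
  refine mul_le_mul_of_nonneg_right ?_ (norm_nonneg _)
  refine (norm_sum_le _ _).trans ?_
  rw [← hs, ← nsmul_one]
  refine Finset.sum_le_card_nsmul _ _ _ fun y hy => ?_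
  rw [norm_inv]
  refine inv_le_one_of_one_le₀ ?_
  have h1 := norm_sub_norm_le z (y : ℂ)
  rw [Complex.norm_real, Real.norm_eq_abs] at h1
  have h2 := rootsIn_prod.1 hk y hy
  linarith

include hV ha hr in
theorem exists_norm_waveDeriv_le : ∃ M : ℝ, 0 ≤ M ∧ ∀ (t : ℝ) (_ : 0 < t) (k : ℕ × ℕ)
    (_ : ((k.1 + k.2 : ℕ) : ℝ) ≤ t) (_ : RootsIn r (mop V a t k)) (z : ℂ) (_ : ‖z‖ = 3 * r),
    ‖aeval z (waveDeriv V t (mop V a t k))‖ ≤ M * ‖aeval z (mop V a t k)‖ := by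
  obtain ⟨M, hM⟩ := (isCompact_sphere (0 : ℂ) (3 * r)).exists_bound_of_continuousOn
    (f := fun z : ℂ => aeval z (derivative V)) (Polynomial.continuous_aeval _).continuousOn
  refine ⟨1 + |M|, by positivity, fun t ht k hkt hk z hz => ?_⟩
  have h1 := norm_derivative_mop_le hV ha hr ht hk hz
  have h2 := (hM z (by simpa using hz)).trans (le_abs_self M)
  rw [waveDeriv, map_sub, map_mul, map_mul, aeval_C]
  refine (norm_sub_le _ _).trans ?_
  rw [norm_mul, norm_mul, Complex.coe_algebraMap, Complex.norm_real, Real.norm_eq_abs,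
    abs_of_pos (inv_pos.2 ht), add_mul, one_mul]
  refine add_le_add ?_ (mul_le_mul_of_nonneg_right h2 (norm_nonneg _))
  rw [inv_mul_le_iff₀ ht]
  exact h1.trans (mul_le_mul_of_nonneg_right hkt (norm_nonneg _))

theorem natDegree_waveDeriv_le {t : ℝ} {P : ℝ[X]} (hm : 2 ≤ V.natDegree) :
    (waveDeriv V t P).natDegree ≤ P.natDegree + (V.natDegree - 1) := by
  refine (natDegree_sub_le _ _).trans (max_le ?_ ?_)
  · exact (natDegree_C_mul_le _ _).trans ((natDegree_derivative_le P).trans (by omega))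
  · exact natDegree_mul_le.trans (by have := natDegree_derivative_le V; omega)

theorem coeff_waveDeriv {t : ℝ} {P : ℝ[X]} (hm : 2 ≤ V.natDegree) (hP : P.Monic) :
    (waveDeriv V t P).coeff (P.natDegree + (V.natDegree - 1)) =
      -(derivative V).coeff (V.natDegree - 1) := by
  rw [waveDeriv, coeff_sub, coeff_C_mul, coeff_eq_zero_of_natDegree_lt
    (lt_of_le_of_lt (natDegree_derivative_le P) (by omega)), mul_zero, zero_sub, add_comm,
    coeff_mul_add_eq_of_natDegree_le (natDegree_derivative_le V) le_rfl,
    hP.coeff_natDegree, mul_one]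

variable {ι : Type*} {t : ι → ℝ} (ht : ∀ i, 0 < t i) {q : ι → ℕ → ℕ × ℕ}
  (hq : ∀ i, ∀ l < V.natDegree - 2, IsStep (q i l) (q i (l + 1))) (h1 : ∀ i, 1 ≤ (q i 0).1)
  (h2 : ∀ i, 1 ≤ (q i 0).2) (hqt : ∀ i, (((q i 0).1 + (q i 0).2 : ℕ) : ℝ) ≤ t i)
  (hroots : ∀ i, RootsIn r (mop V a (t i) (q i (V.natDegree - 2))))

include hV ha hr ht hq h1 h2 hroots in
/-- Along the path, all polynomials and their lower neighbours stay in the bounded span of the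
triple at its start. -/
theorem bddSpan_path {l : ℕ} (hl : l ≤ V.natDegree - 2) (j : Fin 3) :
    BddSpan V a t (fun i => triple V a (t i) (q i 0)) fun i => triple V a (t i) (q i l) j := by
  induction l generalizing j with
  | zero => exact bddSpan_apply j
  | succ l ih =>
    refine bddSpan_triple_step hV ht ha hr (k := fun i => q i l)
      (fun i => (h1 i).trans (chain_le (hq i) l (by omega)).1)
      (fun i => (h2 i).trans (chain_le (hq i) l (by omega)).2) (fun i => hq i l hl) (fun i => ?_)
      (fun j => ih (by omega) j) j
    exact rootsIn_mop_chain hV ha (ht i) (hq i) (hroots i) hl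

include hV ha hr ht hq h1 h2 hqt hroots in
/-- The operator `P ↦ P' / t - V' P` acts on the three polynomials near the end of the path by a
matrix with bounded polynomial entries. -/
theorem exists_bddPoly_matrix : ∃ R : ι → Matrix (Fin 3) (Fin 3) ℝ[X],
    (∀ b j, BddPoly fun i => R i b j) ∧ ∀ i, ∀ z : ℂ, z.im ≠ 0 → ∀ b,
      waveRow V a (t i) (waveDeriv V (t i) (triple V a (t i) (q i 0) b)) z =
        ∑ j, aeval z (R i b j) • waveRow V a (t i) (triple V a (t i) (q i 0) j) z := by
  suffices H : ∀ b, BddSpan V a t (fun i => triple V a (t i) (q i 0)) fun i =>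
      waveDeriv V (t i) (triple V a (t i) (q i 0) b) by
    choose R hR h using H
    exact ⟨fun i => Matrix.of fun b j => R b j i, hR, fun i z hz b => h b i z hz⟩
  set L := V.natDegree - 2 with hL
  have hm := hV.two_le
  have hch := fun i => isStep_descend (hq i) (h1 i) (h2 i)
  have hP := fun i => isMOP_mop hV ha (ht i)
  have hsize : ∀ i l, l ≤ L + 2 →
      (descend (q i) l).1 + (descend (q i) l).2 + 2 = (q i 0).1 + (q i 0).2 + l := by
    intro i l
    induction l with
    | zero =>
      intro _
      have := h1 i
      have := h2 i
      simp only [descend]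
      omega
    | succ l ih =>
      intro hl
      have := (hch i l hl).size
      have := ih (by omega)
      omega
  have hrts : ∀ i l, l ≤ L + 2 → RootsIn r (mop V a (t i) (descend (q i) l)) := fun i l hl =>
    rootsIn_mop_chain hV ha (ht i) (hch i) (hroots i) hl
  have hnorm : ∀ i l, l ≤ L + 2 → ∀ z : ℂ, ‖z‖ = 3 * r → ‖aeval z (mop V a (t i) (descend (q i) l))‖
      ≤ (6 * r) ^ l * ‖aeval z (mop V a (t i) (descend (q i) 0))‖ := fun i l hl z hz =>
    (norm_mop_chain hV ha hr (ht i) (fun l' hl' => hch i l' (by omega)) (hrts i l hl) hz).2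
  have hspan : ∀ l ≤ L + 2, BddSpan V a t (fun i => triple V a (t i) (q i 0)) fun i =>
      mop V a (t i) (descend (q i) l) := by
    intro l hl
    match l with
    | 0 => exact bddSpan_apply 2
    | 1 => exact bddSpan_apply 1
    | l + 2 => exact bddSpan_path hV ha hr ht hq h1 h2 hroots (by omega) 0
  -- bounded polynomials of small degree belong to the bounded span
  have hexp : ∀ (Q : ι → ℝ[X]) (B : ℝ), 0 ≤ B → (∀ i, IsOrth V a (t i) (descend (q i) 0) (Q i)) →
      (∀ i, (Q i).natDegree + 2 ≤ (q i 0).1 + (q i 0).2 + (L + 2)) →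
      (∀ i, ∀ z : ℂ, ‖z‖ = 3 * r →
        ‖aeval z (Q i)‖ ≤ B * ‖aeval z (mop V a (t i) (descend (q i) 0))‖) →
      BddSpan V a t (fun i => triple V a (t i) (q i 0)) Q := by
    intro Q B hB hQ hQd hQB
    obtain ⟨K, hK, hex⟩ := exists_expansion hV ha hr (L + 2)
    choose c hc hQc using fun i => hex (t i) (ht i) (descend (q i)) (hch i) (hroots i) (Q i) B hB
      (hQ i) (by have := hsize i (L + 2) le_rfl; have := hQd i; omega) (hQB i)
    rw [funext hQc]
    exact BddSpan.sum hV ht _ fun l hl =>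
      (hspan l (by have := Finset.mem_range.1 hl; omega)).C_mul fun i => hc i l
  obtain ⟨M, hM0, hM⟩ := exists_norm_waveDeriv_le hV ha hr
  have hwave : ∀ i l, l ≤ 2 → ∀ z : ℂ, ‖z‖ = 3 * r →
      ‖aeval z (waveDeriv V (t i) (mop V a (t i) (descend (q i) l)))‖
        ≤ M * (6 * r) ^ l * ‖aeval z (mop V a (t i) (descend (q i) 0))‖ := by
    intro i l hl z hz
    refine (hM (t i) (ht i) _ (le_trans (Nat.cast_le.2 ?_) (hqt i))
      (hrts i l (by omega)) z hz).trans ?_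
    · have := hsize i l (by omega)
      omega
    · rw [mul_assoc]
      exact mul_le_mul_of_nonneg_left (hnorm i l (by omega) z hz) hM0
  have horth : ∀ i l, l ≤ L + 2 → IsOrth V a (t i) (descend (q i) 0)
      (mop V a (t i) (descend (q i) l)) := by
    intro i l hl
    have := chain_le (hch i) l hl
    exact (hP i _).isOrth.mono this.1 this.2
  -- for the two lower polynomials the degree is small enough without correction
  have hlow : ∀ l < 2, BddSpan V a t (fun i => triple V a (t i) (q i 0)) fun i =>
      waveDeriv V (t i) (mop V a (t i) (descend (q i) l)) := by
    intro l hl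
    refine hexp _ (M * (6 * r) ^ l) (by positivity)
      (fun i => (horth i l (by omega)).waveDeriv hV (ht i)) (fun i => ?_)
      (fun i z hz => hwave i l (by omega) z hz)
    have e1 := natDegree_waveDeriv_le (t := t i) (P := mop V a (t i) (descend (q i) l)) hm
    rw [(hP i _).degree] at e1
    have := hsize i l (by omega)
    omega
  intro b
  fin_cases b
  · -- the leading term is removed with a multiple of `X` times the last polynomial of the path
    set v := (derivative V).coeff (V.natDegree - 1) with hv
    have hX : BddSpan V a t (fun i => triple V a (t i) (q i 0)) fun i =>
        X * mop V a (t i) (descend (q i) (L + 2)) := by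
      refine (hspan (L + 2) le_rfl).X_mul hV ht (k := fun i => q i 0) (fun i => ?_) h1 h2
      have := chain_le (hq i) L le_rfl
      exact (hP i _).isOrth.mono this.1 this.2
    have hrest : BddSpan V a t (fun i => triple V a (t i) (q i 0)) fun i =>
        waveDeriv V (t i) (mop V a (t i) (descend (q i) 2)) +
          C v * (X * mop V a (t i) (descend (q i) (L + 2))) := by
      refine hexp _ (M * (6 * r) ^ 2 + |v| * (3 * r * (6 * r) ^ (L + 2))) (by positivity)
        (fun i => ?_) (fun i => ?_) (fun i z hz => ?_)
      · refine ((horth i 2 (by omega)).waveDeriv hV (ht i)).add hV (ht i) (IsOrth.C_mul ?_ v)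
        refine ((hP i _).isOrth (k := q i L)).X_mul.mono ?_ ?_
        all_goals
          have := chain_le (hq i) L le_rfl
          simp only [descend]
          omega
      · have e1 := natDegree_waveDeriv_le (t := t i) (P := mop V a (t i) (descend (q i) 2)) hm
        have e2 := coeff_waveDeriv (t := t i) hm (hP i (descend (q i) 2)).monic
        rw [(hP i _).degree] at e1 e2
        have e3 := (hP i (descend (q i) (L + 2))).degree
        have s2 := hsize i 2 (by omega)
        have sL := hsize i (L + 2) le_rfl
        refine Nat.add_le_add_right (m := (q i 0).1 + (q i 0).2 + L)
          (natDegree_le_iff_coeff_eq_zero.2 fun l hl => ?_) 2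
        rw [coeff_add, coeff_C_mul]
        obtain ⟨l, rfl⟩ : ∃ l', l = l' + 1 := ⟨l - 1, by omega⟩
        rw [coeff_X_mul]
        rcases eq_or_lt_of_le (show (q i 0).1 + (q i 0).2 + L ≤ l by omega) with h | h
        · have e4 : l = (mop V a (t i) (descend (q i) (L + 2))).natDegree := by omega
          have e5 : l + 1 = (descend (q i) 2).1 + (descend (q i) 2).2 + (V.natDegree - 1) := by
            omega
          rw [e5, e2, e4, (hP i _).monic.coeff_natDegree]
          ring
        · rw [coeff_eq_zero_of_natDegree_lt (by omega), coeff_eq_zero_of_natDegree_lt (by omega)]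
          simp
      · rw [map_add, map_mul, map_mul, aeval_C, aeval_X, add_mul]
        refine (norm_add_le _ _).trans (add_le_add (hwave i 2 le_rfl z hz) ?_)
        rw [norm_mul, norm_mul, hz, Complex.coe_algebraMap, Complex.norm_real, Real.norm_eq_abs]
        have := mul_le_mul_of_nonneg_left (mul_le_mul_of_nonneg_left (hnorm i (L + 2) le_rfl z hz)
          (show 0 ≤ 3 * r by linarith)) (abs_nonneg v)
        linarith
    have := hrest.sub hV ht (hX.C_mul (c := fun _ => v) (K := |v|) fun _ => le_rfl)
    simpa using! this
  · exact hlow 1 (by omega)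
  · exact hlow 0 (by omega)

end

/-! ### Existence of the coefficient matrix -/

section

variable {V : ℝ[X]} (hV : IsConfining V) {a : ℝ} (ha : a ≠ 0) {n : ℕ × ℕ} (h1 : 1 ≤ n.1)
  (h2 : 1 ≤ n.2)

include hV ha h1 h2 in
/-- The coefficient matrix is conjugate, by a constant matrix, to the matrix which represents
`P ↦ P' / t - V' P` in terms of the polynomials with indices `n`, `n - (1, 0)`, `n - (1, 1)`. -/
theorem exists_isCoeffMatrix {r : ℝ} (hr : 1 ≤ r)
    (hroots : RootsIn r (mop V a ((n.1 + n.2 : ℕ) : ℝ) n)) {S : Matrix (Fin 3) (Fin 3) ℝ[X]}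
    (hS : ∀ z : ℂ, z.im ≠ 0 → ∀ b, waveRow V a ((n.1 + n.2 : ℕ) : ℝ)
        (waveDeriv V ((n.1 + n.2 : ℕ) : ℝ) (triple V a ((n.1 + n.2 : ℕ) : ℝ) n b)) z =
      ∑ j, aeval z (S b j) • waveRow V a ((n.1 + n.2 : ℕ) : ℝ)
        (triple V a ((n.1 + n.2 : ℕ) : ℝ) n j) z) :
    ∃ R, IsCoeffMatrix V a n R ∧ R.trace = S.trace.map (algebraMap ℝ ℂ) ∧
      minorSum R = (minorSum S).map (algebraMap ℝ ℂ) ∧ R.det = S.det.map (algebraMap ℝ ℂ) := by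
  have htc : ((n.1 + n.2 : ℕ) : ℂ) = (((n.1 + n.2 : ℕ) : ℝ) : ℂ) := by push_cast; rfl
  have ht : 0 < ((n.1 + n.2 : ℕ) : ℝ) := by exact_mod_cast (by omega)
  obtain ⟨K, hK⟩ := exists_neighbor hV ha hr
  obtain ⟨h, -, hh⟩ := hK _ ht n h1 h2 hroots
  have hP := isMOP_mop hV ha ht
  -- for `h = 0` the neighbour would satisfy all conditions of index `n`, with smaller degree
  have hh0 : h ≠ 0 := by
    rintro rfl
    rw [C_0, zero_mul, sub_zero] at hh
    have h3 : IsOrth V a ((n.1 + n.2 : ℕ) : ℝ) n (mop V a ((n.1 + n.2 : ℕ) : ℝ) (n.1, n.2 - 1)) :=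
      ⟨(hP (n.1, n.2 - 1)).orth_fst, by rw [hh]; exact (hP (n.1 - 1, n.2)).orth_snd⟩
    refine (hP _).monic.ne_zero (h3.eq_zero_of_degree_lt hV ht ha ?_)
    rw [degree_eq_natDegree (hP _).monic.ne_zero, (hP _).degree]
    exact_mod_cast (by omega : n.1 + (n.2 - 1) < n.1 + n.2)
  set t : ℝ := ((n.1 + n.2 : ℕ) : ℝ) with ht'
  -- the change of basis from `n - (1, 1)` to `n - (0, 1)`
  set G : Matrix (Fin 3) (Fin 3) ℂ[X] := !![1, 0, 0; 0, 1, 0; 0, 1, -C (h : ℂ)] with hG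
  set Sc : Matrix (Fin 3) (Fin 3) ℂ[X] := S.map (mapRingHom (algebraMap ℝ ℂ)) with hSc
  have hdet : IsUnit G.det := by
    have : G.det = C (-(h : ℂ)) := by simp [hG, Matrix.det_fin_three]
    rw [this, isUnit_C]
    exact (neg_ne_zero.2 (by exact_mod_cast hh0)).isUnit
  have hconj : (G * Sc * G⁻¹) * G = G * Sc := by
    rw [mul_assoc, Matrix.nonsing_inv_mul _ hdet, mul_one]
  obtain ⟨i1, i2, i3⟩ := invariants_of_conj hdet hconj
  refine ⟨G * Sc * G⁻¹, ?_, i1.trans (trace_map_three _ _), i2.trans (minorSum_map _ _),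
    i3.trans (det_map_three _ _)⟩
  refine ⟨![mop V a t n, mop V a t (n.1 - 1, n.2), mop V a t (n.1, n.2 - 1)], hP _, hP _, hP _,
    fun z hz i j => ?_⟩
  set W : Matrix (Fin 3) (Fin 3) ℂ := Matrix.of fun b j => waveRow V a t (triple V a t n b) z j
    with hW
  have hrow : ∀ j, waveRow V a t (mop V a t (n.1, n.2 - 1)) z j = W 1 j - h * W 2 j := fun j => by
    rw [hh, waveRow_sub hV ht _ _ hz, waveRow_C_mul]
    rfl
  have hwave : waveMatrix V a t ![mop V a t n, mop V a t (n.1 - 1, n.2), mop V a t (n.1, n.2 - 1)] z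
      = matEval G z * W := by
    ext i j
    fin_cases i
    · simp [waveMatrix_apply, Matrix.mul_apply, Fin.sum_univ_three, matEval, hG, hW, triple]
    · simp [waveMatrix_apply, Matrix.mul_apply, Fin.sum_univ_three, matEval, hG, hW, triple]
    · simp [waveMatrix_apply, Matrix.mul_apply, Fin.sum_univ_three, matEval, hG]
      rw [hrow]
      ring
  have heval : ∀ A B : Matrix (Fin 3) (Fin 3) ℂ[X], matEval (A * B) z = matEval A z * matEval B z :=
    fun A B => Matrix.map_mul (f := evalRingHom z)
  have hD : ∀ b j, waveRow V a t (waveDeriv V t (triple V a t n b)) z j =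
      (matEval Sc z * W) b j := by
    intro b j
    rw [hS z hz b, Finset.sum_apply, Matrix.mul_apply]
    refine Finset.sum_congr rfl fun l _ => ?_
    simp [hSc, matEval, hW, aeval_def, eval_map]
  have hD2 : waveDeriv V t (mop V a t (n.1, n.2 - 1)) = waveDeriv V t (triple V a t n 1) -
      C h * waveDeriv V t (triple V a t n 2) := by
    have e1 : triple V a t n 1 = mop V a t (n.1 - 1, n.2) := rfl
    have e2 : triple V a t n 2 = mop V a t (n.1 - 1, n.2 - 1) := rfl
    rw [hh, e1, e2]
    simp only [waveDeriv, derivative_sub, derivative_mul, derivative_C]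
    ring
  rw [hwave, ← mul_assoc, ← heval, hconj, heval, mul_assoc, htc]
  refine (hasDerivAt_waveRow hV ht _ hz j).congr_deriv ?_
  congr 1
  rw [Matrix.mul_apply, Fin.sum_univ_three, ← hD, ← hD, ← hD]
  fin_cases i
  · simp [matEval, hG, triple]
  · simp [matEval, hG, triple]
  · simp only [Fin.reduceFinMk, Matrix.cons_val]
    rw [hD2, waveRow_sub hV ht _ _ hz, waveRow_C_mul]
    simp [matEval, hG]
    ring

end

/-! ### Weak limits of zero counting measures -/

theorem zeroMeasure_prod (s : Finset ℝ) :
    zeroMeasure ((∏ y ∈ s, (X - C y : ℝ[X])).map (algebraMap ℝ ℂ)) =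
      (s.card : ENNReal)⁻¹ • ∑ y ∈ s, Measure.dirac (y : ℂ) := by
  have h1 : (∏ y ∈ s, (X - C y : ℝ[X])).map (algebraMap ℝ ℂ) =
      ((s.val.map fun y : ℝ => (y : ℂ)).map fun w => X - C w).prod := by
    rw [Polynomial.map_prod, Multiset.map_map]
    simp only [Polynomial.map_sub, map_X, map_C, Function.comp_def]
    rfl
  have h2 : ((∏ y ∈ s, (X - C y : ℝ[X])).map (algebraMap ℝ ℂ)).roots =
      s.val.map fun y : ℝ => (y : ℂ) := by
    rw [h1, roots_multiset_prod_X_sub_C]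
  rw [zeroMeasure, h2, natDegree_map, natDegree_prod_X_sub_C_finset, Multiset.map_map]
  rfl

theorem integral_zeroMeasure {E : Type*} [NormedAddCommGroup E] [NormedSpace ℝ E] [CompleteSpace E]
    (s : Finset ℝ) (F : ℂ → E) :
    ∫ w, F w ∂(zeroMeasure ((∏ y ∈ s, (X - C y : ℝ[X])).map (algebraMap ℝ ℂ))) =
      (s.card : ℝ)⁻¹ • ∑ y ∈ s, F y := by
  rw [zeroMeasure_prod, integral_smul_measure,
    integral_finsetSum_measure fun y _ => integrable_dirac (by simp)]
  simp [integral_dirac]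

/-- The interval `[-r, r]` in the complex plane. -/
def realSegment (r : ℝ) : Set ℂ := (fun y : ℝ => (y : ℂ)) '' Set.Icc (-r) r

theorem isCompact_realSegment (r : ℝ) : IsCompact (realSegment r) :=
  isCompact_Icc.image Complex.continuous_ofReal

theorem im_eq_zero_of_mem_realSegment {r : ℝ} {w : ℂ} (hw : w ∈ realSegment r) : w.im = 0 := by
  obtain ⟨y, -, rfl⟩ := hw
  simp

theorem norm_le_of_mem_realSegment {r : ℝ} {w : ℂ} (hw : w ∈ realSegment r) : ‖w‖ ≤ r := by
  obtain ⟨y, hy, rfl⟩ := hw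
  rw [Complex.norm_real]
  exact abs_le.2 hy

section

variable {r : ℝ} (hr : 0 ≤ r) {s : ℕ → Finset ℝ} (hs : ∀ k, (s k).Nonempty)
  (hsr : ∀ k, ∀ y ∈ s k, |y| ≤ r) {lam : Measure ℂ} [IsFiniteMeasureOnCompacts lam]
  (hlam : WeakStarTendsto
    (fun k => zeroMeasure ((∏ y ∈ s k, (X - C y : ℝ[X])).map (algebraMap ℝ ℂ))) lam)

theorem hasCompactSupport_cutoff {f : ℂ → ℝ} {R : ℝ} (hf : ∀ w, R ≤ ‖w‖ → f w = 0) :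
    HasCompactSupport f :=
  HasCompactSupport.intro (isCompact_closedBall (0 : ℂ) R) fun w hw => hf w (by
    rw [mem_closedBall_zero_iff, not_le] at hw
    exact hw.le)

include hr hsr hlam in
/-- A weak-* limit of measures on a segment is carried by it: test with a cutoff times the distance
to the segment. -/
theorem ae_mem_realSegment : ∀ᵐ w ∂lam, w ∈ realSegment r := by
  have hne : (realSegment r).Nonempty := ⟨(0 : ℝ), 0, by simpa using hr, rfl⟩
  have key : ∀ R : ℕ, ∀ᵐ w ∂lam,
      max 0 ((R : ℝ) - ‖w‖) * Metric.infDist w (realSegment r) = 0 := by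
    intro R
    have hc : Continuous fun w : ℂ =>
        max 0 ((R : ℝ) - ‖w‖) * Metric.infDist w (realSegment r) :=
      (continuous_const.max (continuous_const.sub continuous_norm)).mul
        (Metric.continuous_infDist_pt _)
    have hcs : HasCompactSupport fun w : ℂ =>
        max 0 ((R : ℝ) - ‖w‖) * Metric.infDist w (realSegment r) :=
      hasCompactSupport_cutoff (R := R) fun w hw => by
        rw [max_eq_left (by linarith), zero_mul]
    have h1 := hlam _ hc hcs
    simp only [integral_zeroMeasure] at h1
    have h2 : ∀ k, ((s k).card : ℝ)⁻¹ • ∑ y ∈ s k, max 0 ((R : ℝ) - ‖(y : ℂ)‖) *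
        Metric.infDist (y : ℂ) (realSegment r) = 0 := fun k => by
      rw [Finset.sum_eq_zero, smul_zero]
      intro y hy
      have hmem : (y : ℂ) ∈ realSegment r := ⟨y, abs_le.1 (hsr k y hy), rfl⟩
      rw [Metric.infDist_zero_of_mem hmem, mul_zero]
    simp only [h2] at h1
    have h3 := tendsto_nhds_unique h1 tendsto_const_nhds
    exact (integral_eq_zero_iff_of_nonneg
      (fun w => mul_nonneg (le_max_left _ _) Metric.infDist_nonneg)
      (hc.integrable_of_hasCompactSupport hcs)).1 h3
  filter_upwards [ae_all_iff.2 key] with w hw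
  obtain ⟨R, hR⟩ := exists_nat_gt ‖w‖
  have h1 := (mul_eq_zero.1 (hw R)).resolve_left (by
    rw [max_eq_right (by linarith)]
    linarith)
  exact ((isCompact_realSegment r).isClosed.mem_iff_infDist_zero hne).2 h1

include hr hsr hlam in
/-- Convergence against continuous functions without compact support. -/
theorem tendsto_integral_zeroMeasure {f : ℂ → ℝ} (hf : Continuous f) : Integrable f lam ∧
    Tendsto (fun k => ((s k).card : ℝ)⁻¹ • ∑ y ∈ s k, f y) atTop (𝓝 (∫ w, f w ∂lam)) := by
  have hχc : Continuous fun w : ℂ => max 0 (min 1 (r + 2 - ‖w‖)) * f w :=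
    (continuous_const.max (continuous_const.min (continuous_const.sub continuous_norm))).mul hf
  have hχs : HasCompactSupport fun w : ℂ => max 0 (min 1 (r + 2 - ‖w‖)) * f w :=
    hasCompactSupport_cutoff (R := r + 2) fun w hw => by
      rw [max_eq_left ((min_le_right _ _).trans (by linarith)), zero_mul]
  have hχ : ∀ w ∈ realSegment r, max 0 (min 1 (r + 2 - ‖w‖)) * f w = f w := fun w hw => by
    have := norm_le_of_mem_realSegment hw
    rw [min_eq_left (by linarith), max_eq_right zero_le_one, one_mul]
  have hae : (fun w : ℂ => max 0 (min 1 (r + 2 - ‖w‖)) * f w) =ᵐ[lam] f := by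
    filter_upwards [ae_mem_realSegment hr hsr hlam] with w hw using hχ w hw
  refine ⟨(hχc.integrable_of_hasCompactSupport hχs).congr hae, ?_⟩
  have h1 := hlam _ hχc hχs
  rw [integral_congr_ae hae] at h1
  refine h1.congr fun k => ?_
  rw [integral_zeroMeasure]
  congr 1
  exact Finset.sum_congr rfl fun y hy => hχ _ ⟨y, abs_le.1 (hsr k y hy), rfl⟩

include hr hs hsr hlam in
theorem isProbabilityMeasure_of_weakStarTendsto : IsProbabilityMeasure lam := by
  obtain ⟨h1, h2⟩ := tendsto_integral_zeroMeasure hr hsr hlam (f := fun _ => 1) continuous_const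
  have h3 : ∀ k, ((s k).card : ℝ)⁻¹ • ∑ y ∈ s k, (1 : ℝ) = 1 := fun k => by
    have : ((s k).card : ℝ) ≠ 0 := by exact_mod_cast (hs k).card_pos.ne'
    rw [Finset.sum_const, nsmul_one, smul_eq_mul, inv_mul_cancel₀ this]
  simp only [h3] at h2
  have h4 := tendsto_nhds_unique h2 tendsto_const_nhds
  rw [integral_const, smul_eq_mul, mul_one] at h4
  have h5 := (ENNReal.toReal_eq_one_iff _).1 h4
  exact ⟨h5⟩

include hr hsr hlam in
theorem tendsto_integral_zeroMeasure_complex {F : ℂ → ℂ} (hF : Continuous F) :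
    Tendsto (fun k => ((s k).card : ℂ)⁻¹ * ∑ y ∈ s k, F y) atTop (𝓝 (∫ w, F w ∂lam)) := by
  obtain ⟨h1, h2⟩ := tendsto_integral_zeroMeasure hr hsr hlam (Complex.continuous_re.comp hF)
  obtain ⟨h3, h4⟩ := tendsto_integral_zeroMeasure hr hsr hlam (Complex.continuous_im.comp hF)
  have hint : Integrable F lam := Integrable.re_im_iff.1 ⟨h1, h3⟩
  have h5 := ((Complex.continuous_ofReal.tendsto _).comp h2).add
    (((Complex.continuous_ofReal.tendsto _).comp h4).mul_const Complex.I)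
  rw [← integral_re_add_im hint]
  refine h5.congr fun k => ?_
  apply Complex.ext <;> simp

/-- The Cauchy kernel, truncated near its pole so as to be continuous. -/
theorem exists_continuous_eq_inv {K : Set ℂ} {z : ℂ} (hK : IsClosed K) (hz : z ∉ K) :
    ∃ F : ℂ → ℂ, Continuous F ∧ ∀ w ∈ K, F w = (w - z)⁻¹ := by
  obtain ⟨δ, hδ, hb⟩ := Metric.isOpen_iff.1 hK.isOpen_compl z hz
  have hm : ∀ w : ℂ, 0 < max δ ‖w - z‖ := fun w => lt_max_of_lt_left hδ
  refine ⟨fun w => (starRingEnd ℂ) (w - z) * (((max δ ‖w - z‖ : ℝ) : ℂ) ^ 2)⁻¹, ?_, fun w hw => ?_⟩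
  · refine Continuous.mul (Complex.continuous_conj.comp (continuous_id.sub continuous_const)) ?_
    refine Continuous.inv₀ ((Complex.continuous_ofReal.comp (continuous_const.max
      (continuous_id.sub continuous_const).norm)).pow 2) fun w => ?_
    exact pow_ne_zero _ (by exact_mod_cast (hm w).ne')
  · have h1 : δ ≤ ‖w - z‖ := by
      by_contra! h
      exact hb (by rwa [Metric.mem_ball, dist_eq_norm]) hw
    simp only
    rw [max_eq_right h1, Complex.inv_def (w - z), Complex.normSq_eq_norm_sq, Complex.ofReal_inv,
      Complex.ofReal_pow]

include hr hsr hlam in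
theorem tendsto_cauchy_zeroMeasure {z : ℂ} (hz : z ∉ realSegment r) :
    Tendsto (fun k => ((s k).card : ℂ)⁻¹ * ∑ y ∈ s k, ((y : ℂ) - z)⁻¹) atTop
      (𝓝 (∫ w, (w - z)⁻¹ ∂lam)) := by
  obtain ⟨F, hF, hFz⟩ := exists_continuous_eq_inv (isCompact_realSegment r).isClosed hz
  have h1 := tendsto_integral_zeroMeasure_complex hr hsr hlam hF
  have h2 : ∫ w, F w ∂lam = ∫ w, (w - z)⁻¹ ∂lam := integral_congr_ae (by
    filter_upwards [ae_mem_realSegment hr hsr hlam] with w hw using hFz w hw)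
  rw [h2] at h1
  refine h1.congr fun k => ?_
  congr 1
  exact Finset.sum_congr rfl fun y hy => hFz _ ⟨y, abs_le.1 (hsr k y hy), rfl⟩

end

/-! ### The Cauchy transform off the support -/

theorem exists_ae_le_norm_sub {lam : Measure ℂ} {z : ℂ} (hz : z ∉ lam.support) :
    ∃ ε > 0, ∀ᵐ w ∂lam, ε ≤ ‖w - z‖ := by
  obtain ⟨ε, hε, hb⟩ := Metric.isOpen_iff.1 Measure.isClosed_support.isOpen_compl z hz
  refine ⟨ε, hε, ?_⟩
  filter_upwards [Measure.support_mem_ae (μ := lam)] with w hw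
  by_contra! h
  exact hb (by rwa [Metric.mem_ball, dist_eq_norm]) hw

/-- Off the support, truncation near `z` removes nothing once `ε` is small. -/
theorem cauchyTransform_eq {lam : Measure ℂ} {z : ℂ} (hz : z ∉ lam.support) :
    cauchyTransform lam z = ∫ w, (w - z)⁻¹ ∂lam := by
  obtain ⟨ε, hε, h⟩ := exists_ae_le_norm_sub hz
  refine Tendsto.limUnder_eq (tendsto_const_nhds.congr' ?_)
  filter_upwards [Ioo_mem_nhdsGT hε] with δ hδ
  rw [setIntegral_eq_integral_of_ae_compl_eq_zero]
  filter_upwards [h] with w hw hw'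
  exfalso
  apply hw'
  rw [norm_sub_rev]
  exact hδ.2.trans_le hw

theorem continuousAt_xi {lam : Measure ℂ} [IsFiniteMeasure lam] {V : ℝ[X]} {z : ℂ}
    (hz : z ∉ lam.support) : ContinuousAt (xi V lam) z := by
  obtain ⟨ε, hε, h⟩ := exists_ae_le_norm_sub hz
  have h1 : ContinuousAt (fun u => ∫ w, (w - u)⁻¹ ∂lam) z := by
    have hball : Metric.ball z (ε / 2) ∈ 𝓝 z := Metric.ball_mem_nhds z (by linarith)
    have hsub : ∀ u ∈ Metric.ball z (ε / 2), ∀ w : ℂ, ε ≤ ‖w - z‖ → ε / 2 ≤ ‖w - u‖ := by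
      intro u hu w hw
      rw [Metric.mem_ball, dist_eq_norm] at hu
      have := norm_sub_le_norm_sub_add_norm_sub w u z
      linarith
    refine continuousAt_of_dominated (bound := fun _ => (ε / 2)⁻¹) ?_ ?_ (integrable_const _) ?_
    · exact Eventually.of_forall fun u =>
        ((measurable_id.sub measurable_const).inv).aestronglyMeasurable
    · filter_upwards [hball] with u hu
      filter_upwards [h] with w hw
      rw [norm_inv]
      exact inv_anti₀ (by linarith) (hsub u hu w hw)
    · filter_upwards [h] with w hw
      refine (continuousAt_const.sub continuousAt_id).inv₀ ?_
      intro h0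
      replace h0 : w = z := sub_eq_zero.1 h0
      rw [h0, sub_self, norm_zero] at hw
      linarith
  refine (h1.congr ?_).add (Polynomial.continuous_aeval _).continuousAt
  filter_upwards [Measure.isClosed_support.isOpen_compl.mem_nhds hz] with u hu
  exact (cauchyTransform_eq hu).symm

/-! ### Coefficientwise convergence of polynomials -/

/-- Coefficientwise convergence of a sequence of polynomials of bounded degree. -/
def PolyTendsto (f : ℕ → ℝ[X]) (p : ℝ[X]) : Prop :=
  (∃ D : ℕ, ∀ k, (f k).natDegree ≤ D) ∧ ∀ l, Tendsto (fun k => (f k).coeff l) atTop (𝓝 (p.coeff l))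

section

variable {f g : ℕ → ℝ[X]} {p q : ℝ[X]}

theorem PolyTendsto.add (hf : PolyTendsto f p) (hg : PolyTendsto g q) :
    PolyTendsto (fun k => f k + g k) (p + q) := by
  obtain ⟨⟨D, hD⟩, hf⟩ := hf
  obtain ⟨⟨E, hE⟩, hg⟩ := hg
  refine ⟨⟨max D E, fun k => (natDegree_add_le _ _).trans (max_le_max (hD k) (hE k))⟩, fun l => ?_⟩
  simp only [coeff_add]
  exact (hf l).add (hg l)

theorem PolyTendsto.sub (hf : PolyTendsto f p) (hg : PolyTendsto g q) :
    PolyTendsto (fun k => f k - g k) (p - q) := by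
  obtain ⟨⟨D, hD⟩, hf⟩ := hf
  obtain ⟨⟨E, hE⟩, hg⟩ := hg
  refine ⟨⟨max D E, fun k => (natDegree_sub_le _ _).trans (max_le_max (hD k) (hE k))⟩, fun l => ?_⟩
  simp only [coeff_sub]
  exact (hf l).sub (hg l)

theorem PolyTendsto.mul (hf : PolyTendsto f p) (hg : PolyTendsto g q) :
    PolyTendsto (fun k => f k * g k) (p * q) := by
  obtain ⟨⟨D, hD⟩, hf⟩ := hf
  obtain ⟨⟨E, hE⟩, hg⟩ := hg
  refine ⟨⟨D + E, fun k => natDegree_mul_le.trans (add_le_add (hD k) (hE k))⟩, fun l => ?_⟩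
  simp only [coeff_mul]
  exact tendsto_finsetSum _ fun x _ => (hf x.1).mul (hg x.2)

theorem PolyTendsto.tendsto_aeval (hf : PolyTendsto f p) (z : ℂ) :
    Tendsto (fun y : ℕ × ℂ => aeval y.2 (f y.1)) (atTop ×ˢ 𝓝 z) (𝓝 (aeval z p)) := by
  obtain ⟨⟨D, hD⟩, hf⟩ := hf
  have hp : p.natDegree ≤ D := natDegree_le_iff_coeff_eq_zero.2 fun l hl =>
    tendsto_nhds_unique (hf l) (tendsto_const_nhds.congr fun k =>
      (coeff_eq_zero_of_natDegree_lt ((hD k).trans_lt hl)).symm)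
  rw [aeval_eq_sum_range' (Nat.lt_succ_of_le hp)]
  have : ∀ y : ℕ × ℂ, aeval y.2 (f y.1) =
      ∑ l ∈ Finset.range (D + 1), (f y.1).coeff l • y.2 ^ l := fun y =>
    aeval_eq_sum_range' (Nat.lt_succ_of_le (hD y.1)) _
  simp only [this]
  exact tendsto_finsetSum _ fun l _ =>
    ((hf l).comp tendsto_fst).smul (tendsto_snd.pow l)

theorem PolyTendsto.tendsto_aeval_const (hf : PolyTendsto f p) (z : ℂ) :
    Tendsto (fun k => aeval z (f k)) atTop (𝓝 (aeval z p)) :=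
  (hf.tendsto_aeval z).comp (tendsto_id.prodMk tendsto_const_nhds)

end

/-- Compactness of bounded families of polynomials. -/
theorem exists_polyTendsto {κ : Type*} [Fintype κ] {f : κ → ℕ → ℝ[X]} (hf : ∀ c, BddPoly (f c)) :
    ∃ ψ : ℕ → ℕ, StrictMono ψ ∧ ∃ p : κ → ℝ[X], ∀ c, PolyTendsto (fun k => f c (ψ k)) (p c) := by
  choose D B hB h using hf
  set E := ∑ c, D c with hE
  have hDE : ∀ c, D c ≤ E := fun c =>
    Finset.single_le_sum (f := D) (fun _ _ => Nat.zero_le _) (Finset.mem_univ c)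
  have hBs : ∀ c, B c ≤ ∑ c, B c := fun c =>
    Finset.single_le_sum (f := B) (fun c _ => hB c) (Finset.mem_univ c)
  obtain ⟨x, -, ψ, hψ, hx⟩ := tendsto_subseq_of_bounded
    (Metric.isBounded_closedBall (x := (0 : κ → Fin (E + 1) → ℝ)) (r := ∑ c, B c))
    (x := fun k c l => (f c k).coeff l) (fun k => by
      rw [mem_closedBall_zero_iff]
      have h0 : 0 ≤ ∑ c, B c := Finset.sum_nonneg fun c _ => hB c
      refine (pi_norm_le_iff_of_nonneg h0).2 fun c => (pi_norm_le_iff_of_nonneg h0).2 fun l => ?_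
      exact ((h c k).2 l).trans (hBs c))
  refine ⟨ψ, hψ, fun c => ∑ l : Fin (E + 1), monomial (l : ℕ) (x c l), fun c =>
    ⟨⟨D c, fun k => (h c _).1⟩, fun l => ?_⟩⟩
  simp only [finsetSum_coeff, coeff_monomial]
  rcases Nat.lt_or_ge l (E + 1) with hl | hl
  · rw [Finset.sum_eq_single (⟨l, hl⟩ : Fin (E + 1))]
    · rw [if_pos rfl]
      exact tendsto_pi_nhds.1 (tendsto_pi_nhds.1 hx c) ⟨l, hl⟩
    · intro b _ hb
      exact if_neg fun h => hb (Fin.ext h)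
    · simp
  · rw [Finset.sum_eq_zero fun b _ => if_neg (by omega)]
    refine tendsto_const_nhds.congr fun k => ?_
    exact (coeff_eq_zero_of_natDegree_lt ((h c _).1.trans_lt (by have := hDE c; omega))).symm

theorem tendstoLocallyUniformly_of_tendsto_prod {F : ℕ → ℂ × ℂ → ℂ} {f : ℂ × ℂ → ℂ}
    (hf : Continuous f)
    (h : ∀ x, Tendsto (fun y : ℕ × (ℂ × ℂ) => F y.1 y.2) (atTop ×ˢ 𝓝 x) (𝓝 (f x))) :
    TendstoLocallyUniformly F f atTop := by
  rw [tendstoLocallyUniformly_iff_forall_tendsto]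
  intro x
  have h1 := ((hf.tendsto x).comp (tendsto_snd (f := (atTop : Filter ℕ)))).prodMk (h x)
  refine h1.mono_right ?_
  rw [← nhds_prod_eq]
  exact nhds_le_uniformity _

theorem continuous_curveEval (p₂ p₁ p₀ : ℝ[X]) :
    Continuous fun q : ℂ × ℂ => curveEval p₂ p₁ p₀ q.1 q.2 := by
  have h : ∀ p : ℝ[X], Continuous fun q : ℂ × ℂ => aeval q.2 p := fun p =>
    (Polynomial.continuous_aeval p).comp continuous_snd
  exact (((continuous_fst.pow 3).add ((h p₂).mul (continuous_fst.pow 2))).add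
    ((h p₁).mul continuous_fst)).add (h p₀)

theorem tendstoLocallyUniformly_curveEval {f₂ f₁ f₀ : ℕ → ℝ[X]} {p₂ p₁ p₀ : ℝ[X]}
    (h₂ : PolyTendsto f₂ p₂) (h₁ : PolyTendsto f₁ p₁) (h₀ : PolyTendsto f₀ p₀) :
    TendstoLocallyUniformly (fun (k : ℕ) (q : ℂ × ℂ) => curveEval (f₂ k) (f₁ k) (f₀ k) q.1 q.2)
      (fun q => curveEval p₂ p₁ p₀ q.1 q.2) atTop := by
  refine tendstoLocallyUniformly_of_tendsto_prod (continuous_curveEval _ _ _) fun x => ?_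
  have hξ : Tendsto (fun y : ℕ × (ℂ × ℂ) => y.2.1) (atTop ×ˢ 𝓝 x) (𝓝 x.1) :=
    (continuous_fst.tendsto x).comp tendsto_snd
  have hz : Tendsto (fun y : ℕ × (ℂ × ℂ) => (y.1, y.2.2)) (atTop ×ˢ 𝓝 x) (atTop ×ˢ 𝓝 x.2) :=
    tendsto_fst.prodMk ((continuous_snd.tendsto x).comp tendsto_snd)
  have h : ∀ {f : ℕ → ℝ[X]} {p : ℝ[X]}, PolyTendsto f p →
      Tendsto (fun y : ℕ × (ℂ × ℂ) => aeval y.2.2 (f y.1)) (atTop ×ˢ 𝓝 x) (𝓝 (aeval x.2 p)) :=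
    fun hf => (hf.tendsto_aeval x.2).comp hz
  exact (((hξ.pow 3).add ((h h₂).mul (hξ.pow 2))).add ((h h₁).mul hξ)).add (h h₀)

/-! ### The spectral curve at a single index -/

section

variable {V : ℝ[X]} (hV : IsConfining V) {a t : ℝ} (ha : a ≠ 0) (ht : 0 < t)

include hV ha ht in
/-- The quotient `g` of neighbouring polynomials and its derivative `g'` are bounded away from the
real line, uniformly in the index. -/
theorem exists_quotient_bound {k k' : ℕ × ℕ} {P Q : ℝ[X]} (hP : IsMOP V a t k P)
    (hQ : IsMOP V a t k' Q) (hk : IsStep k k') {z : ℂ} (hz : z.im ≠ 0) :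
    ∃ g g' : ℂ, ‖g‖ ≤ |z.im|⁻¹ ∧ ‖g'‖ ≤ |z.im|⁻¹ ^ 2 ∧ aeval z P = aeval z Q * g ∧
      aeval z (derivative P) = aeval z (derivative Q) * g + aeval z Q * g' := by
  obtain ⟨s, c, hQs, hpos, hsum, h⟩ := exists_stieltjes hV ht ha hP hQ hk
  have hQ0 : ∀ w : ℂ, w.im ≠ 0 → aeval w Q ≠ 0 := fun w hw => by
    rw [hQs, aeval_prod_X_sub_C, Finset.prod_ne_zero_iff]
    intro y _ h0
    exact hw (by rw [sub_eq_zero.1 h0]; simp)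
  have him : 0 < |z.im| := abs_pos.2 hz
  have hle : ∀ x : ℝ, |z.im| ≤ ‖z - x‖ := fun x => by
    have := Complex.abs_im_le_norm (z - x)
    simpa using this
  have hne : ∀ x : ℝ, z - x ≠ 0 := fun x h0 => by
    have := hle x
    rw [h0, norm_zero] at this
    linarith
  have hbd : ∀ j : ℕ, ‖∑ x ∈ s, (c x : ℂ) * ((z - x)⁻¹) ^ j‖ ≤ |z.im|⁻¹ ^ j := fun j => by
    refine (norm_sum_le _ _).trans ?_
    rw [← one_mul (|z.im|⁻¹ ^ j), ← hsum, Finset.sum_mul]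
    refine Finset.sum_le_sum fun x hx => ?_
    rw [norm_mul, norm_pow, norm_inv, Complex.norm_real, Real.norm_eq_abs, abs_of_pos (hpos x hx)]
    have := hle x
    have := (hpos x hx).le
    gcongr
  refine ⟨∑ x ∈ s, (c x : ℂ) / (z - x), -∑ x ∈ s, (c x : ℂ) * ((z - x)⁻¹) ^ 2, ?_, ?_,
    h z (hQ0 z hz), ?_⟩
  · simpa [div_eq_mul_inv] using hbd 1
  · rw [norm_neg]
    exact hbd 2
  · have hd : HasDerivAt (fun w : ℂ => ∑ x ∈ s, (c x : ℂ) / (w - x))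
        (-∑ x ∈ s, (c x : ℂ) * ((z - x)⁻¹) ^ 2) z := by
      rw [← Finset.sum_neg_distrib]
      refine HasDerivAt.fun_sum fun x _ => ?_
      have := (((hasDerivAt_id z).sub_const (x : ℂ)).inv (hne x)).const_mul (c x : ℂ)
      refine (this.congr_deriv ?_)
      have := hne x
      simp only [id]
      field_simp
    have h1 := (Polynomial.hasDerivAt_aeval Q z).mul hd
    refine (Polynomial.hasDerivAt_aeval P z).unique (h1.congr_of_eventuallyEq ?_)
    filter_upwards [(isOpen_ne_fun Complex.continuous_im continuous_const).mem_nhds hz] with w hw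
    exact h w (hQ0 w hw)

include hV ha ht in
/-- The logarithmic derivative of the polynomial with index `n` satisfies the equation of the
finite spectral curve up to an error of order `1 / t`. -/
theorem det_eq_of_wave {n : ℕ × ℕ} (h1 : 1 ≤ n.1) (h2 : 1 ≤ n.2) {S : Matrix (Fin 3) (Fin 3) ℝ[X]}
    {z : ℂ} (hz : z.im ≠ 0)
    (hS : ∀ b, waveRow V a t (waveDeriv V t (triple V a t n b)) z =
      ∑ j, aeval z (S b j) • waveRow V a t (triple V a t n j) z) :
    ∃ w' : Fin 3 → ℂ, (∀ b, ‖w' b‖ ≤ |z.im|⁻¹ ^ 2 + 2 * |z.im|⁻¹ ^ 3) ∧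
      ((aeval z (derivative V) - (t : ℂ)⁻¹ * (aeval z (derivative (mop V a t n)) /
        aeval z (mop V a t n))) • (1 : Matrix (Fin 3) (Fin 3) ℂ) + S.map (aeval z)).det =
      (t : ℂ)⁻¹ * ((((aeval z (derivative V) - (t : ℂ)⁻¹ * (aeval z (derivative (mop V a t n)) /
        aeval z (mop V a t n))) • (1 : Matrix (Fin 3) (Fin 3) ℂ) +
        S.map (aeval z)).adjugate).mulVec w') 0 := by
  have hP := isMOP_mop hV ha ht
  obtain ⟨g1, g1', b1, b1', e1, e1'⟩ := exists_quotient_bound hV ha ht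
    (hP (n.1 - 1, n.2)) (hP n) (Or.inl (by simp [Prod.ext_iff]; omega)) hz
  obtain ⟨g2, g2', b2, b2', e2, e2'⟩ := exists_quotient_bound hV ha ht
    (hP (n.1 - 1, n.2 - 1)) (hP (n.1 - 1, n.2)) (Or.inr (by simp [Prod.ext_iff]; omega)) hz
  set T0 := aeval z (mop V a t n) with hT0
  set T0' := aeval z (derivative (mop V a t n)) with hT0'
  have hT0ne : T0 ≠ 0 := by
    obtain ⟨s, -, hs⟩ := (hP n).exists_eq_prod hV ht ha
    rw [hT0, hs, aeval_prod_X_sub_C, Finset.prod_ne_zero_iff]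
    intro y _ h0
    exact hz (by rw [sub_eq_zero.1 h0]; simp)
  set ξ := aeval z (derivative V) - (t : ℂ)⁻¹ * (T0' / T0) with hξ
  set M := ξ • (1 : Matrix (Fin 3) (Fin 3) ℂ) + S.map (aeval z) with hM
  set w : Fin 3 → ℂ := ![1, g1, g1 * g2] with hw
  set w' : Fin 3 → ℂ := ![0, g1', g1' * g2 + g1 * g2'] with hw'
  have hTw : ∀ b, aeval z (triple V a t n b) = T0 * w b := fun b => by
    fin_cases b
    · simp [triple, hw, hT0]
    · simpa [triple, hw] using e1
    · simp [triple, hw, e2, e1, mul_assoc]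
  have hTw' : ∀ b, aeval z (derivative (triple V a t n b)) = T0' * w b + T0 * w' b := fun b => by
    fin_cases b
    · simp [triple, hw, hw', hT0']
    · simpa [triple, hw, hw'] using e1'
    · simp only [triple, hw, hw', Fin.reduceFinMk, Matrix.cons_val]
      rw [e2', e1', e1]
      ring
  have hMw : M.mulVec w = (t : ℂ)⁻¹ • w' := by
    ext b
    have h3 := congrFun (hS b) 0
    rw [Finset.sum_apply] at h3
    have h4 : ∀ Q, waveRow V a t Q z 0 = aeval z Q * Complex.exp (-(t : ℂ) * aeval z V) :=
      fun Q => rfl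
    simp only [Pi.smul_apply, h4, smul_eq_mul, ← mul_assoc, ← Finset.sum_mul] at h3
    have h5 := mul_right_cancel₀ (Complex.exp_ne_zero _) h3
    have hderiv : aeval z (waveDeriv V t (triple V a t n b)) =
        (t : ℂ)⁻¹ * (T0' * w b + T0 * w' b) - aeval z (derivative V) * (T0 * w b) := by
      rw [waveDeriv, map_sub, map_mul, map_mul, aeval_C, hTw, hTw']
      simp
    rw [hderiv] at h5
    simp only [hTw] at h5
    have h6 : (M.mulVec w) b = ξ * w b + ∑ j, aeval z (S b j) * w j := by
      rw [hM, Matrix.add_mulVec, Matrix.smul_mulVec, Matrix.one_mulVec]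
      rfl
    have h7 : ∑ j, aeval z (S b j) * (T0 * w j) = T0 * ∑ j, aeval z (S b j) * w j := by
      rw [Finset.mul_sum]
      exact Finset.sum_congr rfl fun j _ => by ring
    rw [h7] at h5
    rw [h6, Pi.smul_apply, smul_eq_mul]
    apply mul_left_cancel₀ hT0ne
    rw [mul_add, ← h5, hξ]
    field_simp
    ring
  refine ⟨w', fun b => ?_, ?_⟩
  · have hδ : 0 ≤ |z.im|⁻¹ := by positivity
    fin_cases b
    · simp only [hw', Fin.zero_eta, Matrix.cons_val_zero, norm_zero]
      positivity
    · have : 0 ≤ |z.im|⁻¹ ^ 3 := by positivity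
      simp only [hw', Fin.mk_one, Matrix.cons_val_one, Matrix.cons_val_zero]
      linarith
    · simp only [hw', Fin.reduceFinMk, Matrix.cons_val]
      refine (norm_add_le _ _).trans ?_
      rw [norm_mul, norm_mul]
      have c1 := mul_le_mul b1' b2 (norm_nonneg _) (by positivity)
      have c2 := mul_le_mul b1 b2' (norm_nonneg _) (by positivity)
      have : 0 ≤ |z.im|⁻¹ ^ 2 := by positivity
      calc _ ≤ |z.im|⁻¹ ^ 2 * |z.im|⁻¹ + |z.im|⁻¹ * |z.im|⁻¹ ^ 2 := add_le_add c1 c2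
        _ = 2 * |z.im|⁻¹ ^ 3 := by ring
        _ ≤ _ := by linarith
  · have h8 : M.adjugate.mulVec (M.mulVec w) = M.det • w := by
      rw [Matrix.mulVec_mulVec, Matrix.adjugate_mul, Matrix.smul_mulVec, Matrix.one_mulVec]
    have h9 := congrFun h8 0
    rw [hMw, Matrix.mulVec_smul] at h9
    simp only [Pi.smul_apply, smul_eq_mul, hw, Matrix.cons_val_zero, mul_one] at h9
    exact h9.symm

end

/-! ### Irreducibility of the limit curve -/

/-- Comparison of degrees in `q (q² - W q + p₁) = - p₀` excludes all roots `q` except for constants,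
and these only occur for slopes `0` and `1`. -/
theorem curve_no_root {W p₁ p₀ : ℂ[X]} {m : ℕ} (hm : 2 ≤ m) {v a α : ℂ} (hv : v ≠ 0) (ha : a ≠ 0)
    (hα₀ : α ≠ 0) (hα₁ : α ≠ 1) (hW : W.natDegree ≤ m - 1) (hWv : W.coeff (m - 1) = v)
    (hp₁ : p₁.natDegree ≤ m - 2) (hp₁v : p₁.coeff (m - 2) = v - if m = 2 then a ^ 2 else 0)
    (hp₀ : p₀.natDegree ≤ m - 1) (hp₀v : p₀.coeff (m - 1) = v * a ^ 2)
    (hp₀n : p₀.coeff (m - 2) = W.coeff (m - 2) * a ^ 2 + v * a * (2 * α - 1)) (q : ℂ[X]) :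
    q ^ 3 - W * q ^ 2 + p₁ * q + p₀ ≠ 0 := by
  intro h
  have hp₀0 : p₀ ≠ 0 := fun h0 => by
    rw [h0, coeff_zero] at hp₀v
    exact mul_ne_zero hv (pow_ne_zero 2 ha) hp₀v.symm
  have hp₀d : p₀.natDegree = m - 1 :=
    natDegree_eq_of_le_of_coeff_ne_zero hp₀ (by rw [hp₀v]; exact mul_ne_zero hv (pow_ne_zero 2 ha))
  have hWd : W.natDegree = m - 1 :=
    natDegree_eq_of_le_of_coeff_ne_zero hW (by rw [hWv]; exact hv)
  have hW0 : W ≠ 0 := fun h0 => hv (by rw [← hWv, h0, coeff_zero])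
  set u := q ^ 2 - W * q + p₁ with hu
  have hqu : q * u = -p₀ := by rw [hu]; linear_combination h
  have hq0 : q ≠ 0 := fun h0 => hp₀0 (by rw [h0, zero_mul] at hqu; exact neg_eq_zero.1 hqu.symm)
  have hu0 : u ≠ 0 := fun h0 => hp₀0 (by rw [h0, mul_zero] at hqu; exact neg_eq_zero.1 hqu.symm)
  have hdeg : q.natDegree + u.natDegree = m - 1 := by
    rw [← natDegree_mul hq0 hu0, hqu, natDegree_neg, hp₀d]
  have hu' : u = q * (q - W) + p₁ := by rw [hu]; ring
  rcases eq_or_ne q.natDegree (m - 1) with he | he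
  · -- degree `m - 1`: the root is `W`
    have hud : u.natDegree = 0 := by omega
    have hqW : q = W := by
      by_contra hne
      have h1 : q * (q - W) = u - p₁ := by rw [hu']; ring
      have h2 : (q * (q - W)).natDegree ≤ m - 2 := by
        rw [h1]
        exact (natDegree_sub_le _ _).trans (max_le (by omega) hp₁)
      rw [natDegree_mul hq0 (sub_ne_zero.2 hne)] at h2
      omega
    rw [hqW, sub_self, mul_zero, zero_add] at hu'
    obtain ⟨c, hc⟩ := natDegree_eq_zero.1 hud
    have h3 := congrArg (fun p : ℂ[X] => p.coeff (m - 1)) hqu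
    rw [hqW, ← hc, coeff_mul_C, coeff_neg, hWv, hp₀v] at h3
    have h4 : c = -a ^ 2 := mul_left_cancel₀ hv (by rw [h3]; ring)
    rw [← hu', ← hc, coeff_C, h4] at hp₁v
    apply hv
    by_cases h2 : m = 2
    · rw [if_pos (by omega), if_pos h2] at hp₁v
      linear_combination -hp₁v
    · rw [if_neg (by omega), if_neg h2] at hp₁v
      linear_combination -hp₁v
  · have hlt : q.natDegree < m - 1 := by omega
    have hqWd : (q - W).natDegree = m - 1 := by
      rw [natDegree_sub_eq_right_of_natDegree_lt (by omega), hWd]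
    have hne : q - W ≠ 0 := fun h0 => by rw [h0, natDegree_zero] at hqWd; omega
    have h1 : (q * (q - W)).natDegree = q.natDegree + (m - 1) := by
      rw [natDegree_mul hq0 hne, hqWd]
    have h2 : u.natDegree = q.natDegree + (m - 1) := by
      rw [hu', natDegree_add_eq_left_of_natDegree_lt (by omega), h1]
    obtain ⟨c, hc⟩ := natDegree_eq_zero.1 (show q.natDegree = 0 by omega)
    rw [← hc] at h
    have h3 := congrArg (fun p : ℂ[X] => p.coeff (m - 1)) h
    have h4 := congrArg (fun p : ℂ[X] => p.coeff (m - 2)) h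
    simp only [← C_pow, coeff_add, coeff_sub, coeff_mul_C, coeff_C, coeff_zero, hWv, hp₀v, hp₀n,
      hp₁v, if_neg (show m - 1 ≠ 0 by omega),
      coeff_eq_zero_of_natDegree_lt (lt_of_le_of_lt hp₁ (show m - 2 < m - 1 by omega))] at h3 h4
    have h5 : c ^ 2 = a ^ 2 := mul_left_cancel₀ hv (by linear_combination -h3)
    have h6 : c = -a * (2 * α - 1) := by
      apply mul_left_cancel₀ hv
      by_cases h2 : m = 2
      · rw [if_pos (by omega), if_pos h2] at h4
        linear_combination h4 + (W.coeff (m - 2) - c) * h5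
      · rw [if_neg (by omega), if_neg h2] at h4
        linear_combination h4 + W.coeff (m - 2) * h5
    have h7 : a ^ 2 * (4 * (α * (α - 1))) = 0 := by
      rw [h6] at h5
      linear_combination h5
    rcases mul_eq_zero.1 h7 with h8 | h8
    · exact pow_ne_zero 2 ha h8
    · rcases mul_eq_zero.1 ((mul_eq_zero.1 h8).resolve_left (by norm_num)) with h9 | h9
      · exact hα₀ h9
      · exact hα₁ (sub_eq_zero.1 h9)

/-- A reducible cubic which is monic in `ξ` has, by the lemma of Gauss, a root which is
polynomial in `z`; comparison of degrees excludes it. -/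
theorem irreducible_curvePoly {W p₁ p₀ : ℝ[X]} {m : ℕ} (hm : 2 ≤ m) {a α : ℝ} (ha : a ≠ 0)
    (hα₀ : α ≠ 0) (hα₁ : α ≠ 1) (hW : W.natDegree ≤ m - 1) (hv : W.coeff (m - 1) ≠ 0)
    (hp₁ : p₁.natDegree ≤ m - 2)
    (hp₁v : p₁.coeff (m - 2) = W.coeff (m - 1) - if m = 2 then a ^ 2 else 0)
    (hp₀ : p₀.natDegree ≤ m - 1) (hp₀v : p₀.coeff (m - 1) = W.coeff (m - 1) * a ^ 2)
    (hp₀n : p₀.coeff (m - 2) = W.coeff (m - 2) * a ^ 2 + W.coeff (m - 1) * a * (2 * α - 1)) :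
    Irreducible (curvePoly (-W) p₁ p₀) := by
  set F := curvePoly (-W) p₁ p₀ with hF
  have hlow : (C ((-W).map (algebraMap ℝ ℂ)) * X ^ 2 + C (p₁.map (algebraMap ℝ ℂ)) * X
      + C (p₀.map (algebraMap ℝ ℂ)) : ℂ[X][X]).degree < ((3 : ℕ) : WithBot ℕ) :=
    degree_quadratic_lt
  have hFe : F = X ^ 3 + (C ((-W).map (algebraMap ℝ ℂ)) * X ^ 2 + C (p₁.map (algebraMap ℝ ℂ)) * X
      + C (p₀.map (algebraMap ℝ ℂ))) := by
    rw [hF, curvePoly]; ring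
  have hmonic : F.Monic := by
    rw [hFe]
    exact monic_X_pow_add (by exact_mod_cast hlow)
  have hdeg : F.natDegree = 3 := by
    rw [hFe]
    exact natDegree_eq_of_degree_eq_some (by
      rw [degree_add_eq_left_of_degree_lt (by rw [degree_X_pow]; exact hlow), degree_X_pow])
  rw [hmonic.irreducible_iff_roots_eq_zero_of_degree_le_three (by omega) (by omega)]
  refine Multiset.eq_zero_of_forall_notMem fun q hq => ?_
  have hroot := (mem_roots hmonic.ne_zero).1 hq
  rw [IsRoot, hF, curvePoly] at hroot
  simp only [eval_add, eval_mul, eval_pow, eval_X, eval_C, Polynomial.map_neg, neg_mul] at hroot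
  refine curve_no_root (W := W.map (algebraMap ℝ ℂ)) (p₁ := p₁.map (algebraMap ℝ ℂ))
    (p₀ := p₀.map (algebraMap ℝ ℂ)) hm (v := (W.coeff (m - 1) : ℂ)) (a := a) (α := α)
    (by exact_mod_cast hv) (by exact_mod_cast ha) (by exact_mod_cast hα₀) (by exact_mod_cast hα₁)
    (natDegree_map_le.trans hW) (coeff_map _ _) (natDegree_map_le.trans hp₁) ?_
    (natDegree_map_le.trans hp₀) ?_ ?_ q (by rw [← hroot]; ring)
  · rw [coeff_map, hp₁v]
    split_ifs <;> simp
  · rw [coeff_map, hp₀v]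
    simp
  · rw [coeff_map, hp₀n, coeff_map]
    simp

/-! ### The limit of the finite spectral curves -/

theorem PolyTendsto.minorSum {S : ℕ → Matrix (Fin 3) (Fin 3) ℝ[X]} {T : Matrix (Fin 3) (Fin 3) ℝ[X]}
    (h : ∀ b j, PolyTendsto (fun k => S k b j) (T b j)) :
    PolyTendsto (fun k => minorSum (S k)) (minorSum T) :=
  ((((h 0 0).mul (h 1 1)).sub ((h 0 1).mul (h 1 0))).add
    (((h 0 0).mul (h 2 2)).sub ((h 0 2).mul (h 2 0)))).add
    (((h 1 1).mul (h 2 2)).sub ((h 1 2).mul (h 2 1)))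

theorem PolyTendsto.trace {S : ℕ → Matrix (Fin 3) (Fin 3) ℝ[X]} {T : Matrix (Fin 3) (Fin 3) ℝ[X]}
    (h : ∀ b j, PolyTendsto (fun k => S k b j) (T b j)) :
    PolyTendsto (fun k => (S k).trace) T.trace := by
  simp only [Matrix.trace_fin_three]
  exact ((h 0 0).add (h 1 1)).add (h 2 2)

theorem PolyTendsto.det {S : ℕ → Matrix (Fin 3) (Fin 3) ℝ[X]} {T : Matrix (Fin 3) (Fin 3) ℝ[X]}
    (h : ∀ b j, PolyTendsto (fun k => S k b j) (T b j)) :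
    PolyTendsto (fun k => (S k).det) T.det := by
  simp only [Matrix.det_fin_three]
  exact (((((((h 0 0).mul (h 1 1)).mul (h 2 2)).sub (((h 0 0).mul (h 1 2)).mul (h 2 1))).sub
    (((h 0 1).mul (h 1 0)).mul (h 2 2))).add (((h 0 1).mul (h 1 2)).mul (h 2 0))).add
    (((h 0 2).mul (h 1 0)).mul (h 2 1))).sub (((h 0 2).mul (h 1 1)).mul (h 2 0))

theorem PolyTendsto.natDegree_le {f : ℕ → ℝ[X]} {p : ℝ[X]} (h : PolyTendsto f p) {D : ℕ}
    (hD : ∀ k, (f k).natDegree ≤ D) : p.natDegree ≤ D :=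
  natDegree_le_iff_coeff_eq_zero.2 fun l hl => tendsto_nhds_unique (h.2 l)
    (tendsto_const_nhds.congr fun k => (coeff_eq_zero_of_natDegree_lt ((hD k).trans_lt hl)).symm)

theorem det_smul_one_add_map_aeval (S : Matrix (Fin 3) (Fin 3) ℝ[X]) (ξ z : ℂ) :
    (ξ • (1 : Matrix (Fin 3) (Fin 3) ℂ) + S.map (aeval z)).det =
      curveEval S.trace (minorSum S) S.det ξ z := by
  have h : S.map (aeval z) = S.map (aeval z : ℝ[X] →ₐ[ℝ] ℂ).toRingHom := rfl
  rw [det_smul_one_add, h, trace_map_three, minorSum_map, det_map_three]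
  rfl

section

variable {V : ℝ[X]} (hV : IsConfining V) {a : ℝ} (ha : a ≠ 0)

include hV ha in
/-- The finite spectral curve in terms of the matrix which represents `P ↦ P' / t - V' P`, and the
degrees and leading coefficients of its coefficients. -/
theorem finiteCurve_eq {n : ℕ × ℕ} (h1 : 1 ≤ n.1) (h2 : 1 ≤ n.2) {r : ℝ} (hr : 1 ≤ r)
    (hroots : RootsIn r (mop V a ((n.1 + n.2 : ℕ) : ℝ) n)) {S : Matrix (Fin 3) (Fin 3) ℝ[X]}
    (hS : ∀ z : ℂ, z.im ≠ 0 → ∀ b, waveRow V a ((n.1 + n.2 : ℕ) : ℝ)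
        (waveDeriv V ((n.1 + n.2 : ℕ) : ℝ) (triple V a ((n.1 + n.2 : ℕ) : ℝ) n b)) z =
      ∑ j, aeval z (S b j) • waveRow V a ((n.1 + n.2 : ℕ) : ℝ)
        (triple V a ((n.1 + n.2 : ℕ) : ℝ) n j) z)
    {R : Matrix (Fin 3) (Fin 3) ℂ[X]} (hR : IsCoeffMatrix V a n R) :
    (∀ ξ z, finiteCurve R ξ z = curveEval (-derivative V) (minorSum S) S.det ξ z) ∧
    S.trace = -derivative V ∧
    ((minorSum S).natDegree ≤ V.natDegree - 2 ∧ (minorSum S).coeff (V.natDegree - 2) =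
      (derivative V).coeff (V.natDegree - 1) - if V.natDegree = 2 then a ^ 2 else 0) ∧
    (S.det - C (a ^ 2) * derivative V).natDegree ≤ V.natDegree - 2 ∧
    (S.det - C (a ^ 2) * derivative V).coeff (V.natDegree - 2) =
      (derivative V).coeff (V.natDegree - 1) * a * (((n.1 : ℝ) - n.2) / ((n.1 + n.2 : ℕ) : ℝ)) := by
  obtain ⟨R', hR', e1, e2, e3⟩ := exists_isCoeffMatrix hV ha h1 h2 hr hroots hS
  obtain rfl := coeffMatrix_unique hV ha h1 h2 hR hR'
  obtain ⟨f1, ⟨f2, f3⟩, f4, f5⟩ := coeffMatrix_invariants hV ha h1 h2 hR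
  have hinj : Function.Injective (algebraMap ℝ ℂ) := (algebraMap ℝ ℂ).injective
  have htr : S.trace = -derivative V := by
    apply map_injective _ hinj
    rw [← e1, f1, Polynomial.map_neg]
  have hdet : R.det - C ((a : ℂ) ^ 2) * (derivative V).map (algebraMap ℝ ℂ) =
      (S.det - C (a ^ 2) * derivative V).map (algebraMap ℝ ℂ) := by
    rw [e3, Polynomial.map_sub, Polynomial.map_mul, map_C]
    simp
  rw [hdet] at f4 f5
  rw [e2] at f2 f3
  rw [natDegree_map] at f2 f4
  rw [coeff_map] at f3 f5
  refine ⟨fun ξ z => ?_, htr, ⟨f2, ?_⟩, f4, ?_⟩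
  · have h : matEval R z = R.map (evalRingHom z) := rfl
    rw [finiteCurve, det_smul_one_add, h, trace_map_three, minorSum_map, det_map_three, e1, e2, e3,
      htr]
    simp only [coe_evalRingHom, curveEval, aeval_eq_eval_map]
  · apply hinj
    rw [f3]
    split_ifs <;> simp
  · apply hinj
    rw [f5]
    simp

theorem support_subset_realSegment {lam : Measure ℂ} {r : ℝ} (h : ∀ᵐ w ∂lam, w ∈ realSegment r) :
    lam.support ⊆ realSegment r := by
  intro z hz
  by_contra hzK
  have := (Measure.mem_support_iff_forall z).1 hz _
    ((isCompact_realSegment r).isClosed.isOpen_compl.mem_nhds hzK)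
  exact this.ne' h

variable (ha₀ : 0 < a) {α : ℝ} (hα₀ : 0 < α) (hα₁ : α < 1) {ν : ℕ → ℕ × ℕ}
  (h1 : ∀ k, 1 ≤ (ν k).1) (h2 : ∀ k, 1 ≤ (ν k).2)
  (hsize : Tendsto (fun k => (((ν k).1 + (ν k).2 : ℕ) : ℝ)) atTop atTop)
  (hslope : Tendsto (fun k => ((ν k).1 : ℝ) / (((ν k).1 + (ν k).2 : ℕ) : ℝ)) atTop (𝓝 α))
  {r : ℝ} (hr : 1 ≤ r)
  (hroots : ∀ k, RootsIn r (mop V a (((ν k).1 + (ν k).2 : ℕ) : ℝ) (ν k)))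
  {S : ℕ → Matrix (Fin 3) (Fin 3) ℝ[X]} (hSb : ∀ b j, BddPoly fun k => S k b j)
  (hS : ∀ k, ∀ z : ℂ, z.im ≠ 0 → ∀ b, waveRow V a (((ν k).1 + (ν k).2 : ℕ) : ℝ)
      (waveDeriv V (((ν k).1 + (ν k).2 : ℕ) : ℝ)
        (triple V a (((ν k).1 + (ν k).2 : ℕ) : ℝ) (ν k) b)) z =
    ∑ j, aeval z (S k b j) • waveRow V a (((ν k).1 + (ν k).2 : ℕ) : ℝ)
      (triple V a (((ν k).1 + (ν k).2 : ℕ) : ℝ) (ν k) j) z)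
  {R : ℕ → Matrix (Fin 3) (Fin 3) ℂ[X]} (hR : ∀ k, IsCoeffMatrix V a (ν k) (R k))
  {lam : Measure ℂ} [IsFiniteMeasureOnCompacts lam]
  (hlam : WeakStarTendsto (fun k => zeroMeasure
    ((mop V a (((ν k).1 + (ν k).2 : ℕ) : ℝ) (ν k)).map (algebraMap ℝ ℂ))) lam)

include hV ha h1 hr hroots hlam in
/-- Weak limits of zero counting measures are probability measures on a segment, and the
logarithmic derivatives converge to the Cauchy transform. -/
theorem limit_zeroMeasure : IsProbabilityMeasure lam ∧ (∀ᵐ w ∂lam, w ∈ realSegment r) ∧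
    ∀ z : ℂ, z.im ≠ 0 → Tendsto (fun k => aeval z (derivative V) -
      ((((ν k).1 + (ν k).2 : ℕ) : ℝ) : ℂ)⁻¹ *
        (aeval z (derivative (mop V a (((ν k).1 + (ν k).2 : ℕ) : ℝ) (ν k))) /
          aeval z (mop V a (((ν k).1 + (ν k).2 : ℕ) : ℝ) (ν k)))) atTop (𝓝 (xi V lam z)) := by
  have ht : ∀ k, (0 : ℝ) < (((ν k).1 + (ν k).2 : ℕ) : ℝ) := fun k => by
    have := h1 k
    exact_mod_cast (by omega)
  choose s hcard hs using fun k => (isMOP_mop hV ha (ht k) (ν k)).exists_eq_prod hV (ht k) ha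
  have hr0 : 0 ≤ r := by linarith
  have hne : ∀ k, (s k).Nonempty := fun k => Finset.card_pos.1 (by
    have := h1 k
    have := hcard k
    omega)
  have hsr : ∀ k, ∀ y ∈ s k, |y| ≤ r := fun k => rootsIn_prod.1 (hs k ▸ hroots k)
  simp only [hs] at hlam
  have hae := ae_mem_realSegment hr0 hsr hlam
  refine ⟨isProbabilityMeasure_of_weakStarTendsto hr0 hne hsr hlam, hae, fun z hz => ?_⟩
  have hzK : z ∉ realSegment r := fun h => hz (im_eq_zero_of_mem_realSegment h)
  have h3 := tendsto_cauchy_zeroMeasure hr0 hsr hlam hzK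
  rw [← cauchyTransform_eq fun h => hzK (support_subset_realSegment hae h)] at h3
  have h4 := h3.const_add (aeval z (derivative V))
  rw [xi, add_comm]
  refine h4.congr fun k => ?_
  have hne0 : aeval z (∏ y ∈ s k, (X - C y : ℝ[X])) ≠ 0 :=
    RootsIn.aeval_ne_zero (hs k ▸ hroots k) (Or.inr hz)
  rw [hs k, aeval_derivative_prod hne0, mul_div_cancel_left₀ _ hne0, hcard k, sub_eq_add_neg,
    ← mul_neg, ← Finset.sum_neg_distrib, Complex.ofReal_natCast]
  congr 2
  refine Finset.sum_congr rfl fun y _ => ?_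
  rw [← neg_sub z, inv_neg]

include hV ha₀ hα₀ hα₁ h1 h2 hsize hslope hr hroots hSb hS hR hlam in
/-- The limit curve: compactness of the bounded polynomial matrices gives a limit matrix, whose
characteristic polynomial inherits the coefficients from the finite curves and vanishes on the
limit of the logarithmic derivatives. -/
theorem exists_limit_curve : IsProbabilityMeasure lam ∧ lam {s : ℂ | s.im ≠ 0} = 0 ∧
    ∃ p₂ p₁ p₀ : ℝ[X], IsAdmissibleCurve V a α p₂ p₁ p₀ ∧
      (∀ z : ℂ, z ∉ lam.support → curveEval p₂ p₁ p₀ (xi V lam z) z = 0) ∧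
      ∃ ψ : ℕ → ℕ, StrictMono ψ ∧ TendstoLocallyUniformly
        (fun (k : ℕ) (q : ℂ × ℂ) => finiteCurve (R (ψ k)) q.1 q.2)
        (fun q => curveEval p₂ p₁ p₀ q.1 q.2) atTop := by
  have ha : a ≠ 0 := ha₀.ne'
  have ht : ∀ k, (0 : ℝ) < (((ν k).1 + (ν k).2 : ℕ) : ℝ) := fun k => by
    have := h1 k
    exact_mod_cast (by omega)
  obtain ⟨hprob, hae, hξ⟩ := limit_zeroMeasure hV ha h1 hr hroots hlam
  have him : lam {s : ℂ | s.im ≠ 0} = 0 := by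
    rw [← compl_mem_ae_iff]
    filter_upwards [hae] with w hw h
    exact h (im_eq_zero_of_mem_realSegment hw)
  refine ⟨hprob, him, ?_⟩
  obtain ⟨ψ, hψ, p, hp⟩ := exists_polyTendsto
    (f := fun (c : Fin 3 × Fin 3) k => S k c.1 c.2) fun c => hSb c.1 c.2
  set T : Matrix (Fin 3) (Fin 3) ℝ[X] := Matrix.of fun b j => p (b, j) with hT
  have hST : ∀ b j, PolyTendsto (fun k => S (ψ k) b j) (T b j) := fun b j => hp (b, j)
  have hinv := fun k => finiteCurve_eq hV ha (h1 k) (h2 k) hr (hroots k) (hS k) (hR k)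
  have hm := hV.two_le
  have hv : (derivative V).coeff (V.natDegree - 1) ≠ 0 := by
    rw [coeff_derivative, Nat.sub_add_cancel (by omega)]
    have h3 : V.coeff V.natDegree ≠ 0 := hV.pos.ne'
    have : ((V.natDegree - 1 : ℕ) : ℝ) + 1 ≠ 0 := by positivity
    exact mul_ne_zero h3 this
  have htr : T.trace = -derivative V := by
    ext l
    refine tendsto_nhds_unique ((PolyTendsto.trace hST).2 l) ?_
    simp only [(hinv _).2.1]
    exact tendsto_const_nhds
  have hM := PolyTendsto.minorSum hST
  have hD := PolyTendsto.det hST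
  have hconst : ∀ p : ℝ[X], PolyTendsto (fun _ => p) p := fun p =>
    ⟨⟨_, fun _ => le_rfl⟩, fun _ => tendsto_const_nhds⟩
  have hp₁ : (minorSum T).natDegree ≤ V.natDegree - 2 :=
    hM.natDegree_le fun k => (hinv (ψ k)).2.2.1.1
  have hp₁v : (minorSum T).coeff (V.natDegree - 2) =
      (derivative V).coeff (V.natDegree - 1) - if V.natDegree = 2 then a ^ 2 else 0 := by
    refine tendsto_nhds_unique (hM.2 _) ?_
    simp only [(hinv _).2.2.1.2]
    exact tendsto_const_nhds
  have hD' := hD.sub ((hconst (C (a ^ 2))).mul (hconst (derivative V)))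
  have hd₁ : (T.det - C (a ^ 2) * derivative V).natDegree ≤ V.natDegree - 2 :=
    hD'.natDegree_le fun k => (hinv (ψ k)).2.2.2.1
  have hd₂ : (T.det - C (a ^ 2) * derivative V).coeff (V.natDegree - 2) =
      (derivative V).coeff (V.natDegree - 1) * a * (2 * α - 1) := by
    refine tendsto_nhds_unique (hD'.2 _) ?_
    simp only [(hinv _).2.2.2.2]
    have h3 := (((hslope.comp hψ.tendsto_atTop).const_mul 2).sub_const 1).const_mul
      ((derivative V).coeff (V.natDegree - 1) * a)
    refine h3.congr fun k => ?_
    have h4 := (ht (ψ k)).ne'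
    simp only [Function.comp]
    congr 1
    field_simp
    push_cast
    ring
  have hdet : T.det = C (a ^ 2) * derivative V + (T.det - C (a ^ 2) * derivative V) := by ring
  have hp₀ : T.det.natDegree ≤ V.natDegree - 1 := by
    rw [hdet]
    exact (natDegree_add_le _ _).trans (max_le ((natDegree_C_mul_le _ _).trans
      (natDegree_derivative_le V)) (hd₁.trans (by omega)))
  have hp₀v : T.det.coeff (V.natDegree - 1) = (derivative V).coeff (V.natDegree - 1) * a ^ 2 := by
    rw [hdet, coeff_add, coeff_C_mul, coeff_eq_zero_of_natDegree_lt (lt_of_le_of_lt hd₁ (by omega)),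
      add_zero, mul_comm]
  have hp₀n : T.det.coeff (V.natDegree - 2) = (derivative V).coeff (V.natDegree - 2) * a ^ 2
      + (derivative V).coeff (V.natDegree - 1) * a * (2 * α - 1) := by
    rw [hdet, coeff_add, coeff_C_mul, hd₂, mul_comm (a ^ 2)]
  -- off the real line, the determinant of the approximate kernel equation tends to zero
  have hcurve : ∀ z : ℂ, z.im ≠ 0 →
      curveEval (-derivative V) (minorSum T) T.det (xi V lam z) z = 0 := by
    intro z hz
    choose w' hw' hdetw using fun k => det_eq_of_wave hV ha (ht k) (h1 k) (h2 k) hz (hS k z hz)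
    set Mk : ℕ → Matrix (Fin 3) (Fin 3) ℂ := fun k => (aeval z (derivative V) -
      ((((ν k).1 + (ν k).2 : ℕ) : ℝ) : ℂ)⁻¹ *
        (aeval z (derivative (mop V a (((ν k).1 + (ν k).2 : ℕ) : ℝ) (ν k))) /
          aeval z (mop V a (((ν k).1 + (ν k).2 : ℕ) : ℝ) (ν k)))) •
      (1 : Matrix (Fin 3) (Fin 3) ℂ) + (S k).map (aeval z) with hMk
    have hMlim : Tendsto (fun k => Mk (ψ k)) atTop
        (𝓝 (xi V lam z • (1 : Matrix (Fin 3) (Fin 3) ℂ) + T.map (aeval z))) := by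
      refine (((hξ z hz).comp hψ.tendsto_atTop).smul_const _).add ?_
      exact tendsto_pi_nhds.2 fun b => tendsto_pi_nhds.2 fun j => (hST b j).tendsto_aeval_const z
    have hdlim : Tendsto (fun k => (Mk (ψ k)).det) atTop (𝓝 (curveEval (-derivative V) (minorSum T)
        T.det (xi V lam z) z)) := by
      rw [← htr, ← det_smul_one_add_map_aeval]
      exact (Continuous.matrix_det continuous_id).continuousAt.tendsto.comp hMlim
    have hadj : Tendsto (fun k => (Mk (ψ k)).adjugate) atTop
        (𝓝 (xi V lam z • (1 : Matrix (Fin 3) (Fin 3) ℂ) + T.map (aeval z)).adjugate) :=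
      (Continuous.matrix_adjugate continuous_id).continuousAt.tendsto.comp hMlim
    have hzero : Tendsto (fun k => (Mk (ψ k)).det) atTop (𝓝 0) := by
      set δ : ℝ := |z.im|⁻¹ ^ 2 + 2 * |z.im|⁻¹ ^ 3 with hδ
      have hinvt : Tendsto (fun k => ((((ν (ψ k)).1 + (ν (ψ k)).2 : ℕ) : ℝ))⁻¹) atTop (𝓝 0) :=
        (tendsto_inv_atTop_zero.comp hsize).comp hψ.tendsto_atTop
      have hnorm : ∀ j : Fin 3, Tendsto (fun k => ‖(Mk (ψ k)).adjugate 0 j‖ * δ) atTop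
          (𝓝 (‖(xi V lam z • (1 : Matrix (Fin 3) (Fin 3) ℂ) +
            T.map (aeval z)).adjugate 0 j‖ * δ)) :=
        fun j => ((tendsto_pi_nhds.1 (tendsto_pi_nhds.1 hadj 0) j).norm).mul_const δ
      have hsum := hinvt.mul (tendsto_finsetSum Finset.univ fun j _ => hnorm j)
      rw [zero_mul] at hsum
      refine squeeze_zero_norm (fun k => ?_) hsum
      rw [hdetw (ψ k), norm_mul, norm_inv, Complex.norm_real, Real.norm_eq_abs,
        abs_of_pos (ht (ψ k))]
      refine mul_le_mul_of_nonneg_left ?_ (inv_nonneg.2 (ht (ψ k)).le)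
      rw [Matrix.mulVec, dotProduct]
      refine (norm_sum_le _ _).trans (Finset.sum_le_sum fun j _ => ?_)
      rw [norm_mul]
      exact mul_le_mul_of_nonneg_left (hw' (ψ k) j) (norm_nonneg _)
    exact tendsto_nhds_unique hdlim hzero
  refine ⟨-derivative V, minorSum T, T.det,
    ⟨irreducible_curvePoly hm ha hα₀.ne' hα₁.ne (natDegree_derivative_le V) hv hp₁ hp₁v
      hp₀ hp₀v hp₀n,
      rfl, hp₁, hp₀, hp₀v, hp₀n, lam, hprob, him, hcurve⟩, fun z hz => ?_, ψ, hψ, ?_⟩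
  · -- real points off the support are reached by continuity
    by_cases hzi : z.im = 0
    · have hcont : ContinuousAt (fun u => curveEval (-derivative V) (minorSum T) T.det
          (xi V lam u) u) z :=
        ContinuousAt.comp (f := fun u => (xi V lam u, u))
          (g := fun q : ℂ × ℂ => curveEval (-derivative V) (minorSum T) T.det q.1 q.2)
          (continuous_curveEval _ _ _).continuousAt ((continuousAt_xi hz).prodMk continuousAt_id)
      have hseq : Tendsto (fun k : ℕ => z + ((1 / ((k : ℝ) + 1) : ℝ) : ℂ) * Complex.I) atTop
          (𝓝 z) := by
        have h3 := ((Complex.continuous_ofReal.tendsto 0).comp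
          (tendsto_one_div_add_atTop_nhds_zero_nat (𝕜 := ℝ))).mul_const Complex.I
        have h4 := h3.const_add z
        rw [Complex.ofReal_zero, zero_mul, add_zero] at h4
        exact h4
      refine tendsto_nhds_unique (hcont.tendsto.comp hseq) (tendsto_const_nhds.congr fun k => ?_)
      refine (hcurve _ ?_).symm
      rw [Complex.add_im, hzi, zero_add, im_imag]
      positivity
    · exact hcurve z hzi
  · have h3 := tendstoLocallyUniformly_curveEval (hconst (-derivative V)) hM hD
    have h4 : (fun (k : ℕ) (q : ℂ × ℂ) => finiteCurve (R (ψ k)) q.1 q.2) = fun k q =>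
        curveEval (-derivative V) (minorSum (S (ψ k))) (S (ψ k)).det q.1 q.2 := by
      ext k q
      exact (hinv (ψ k)).1 q.1 q.2
    rw [h4]
    exact h3

end

/-! ### Up-right paths and their zeros -/

theorem IsUpRightPath.le {n : ℕ → ℕ × ℕ} {α : ℝ} {d : ℕ} (hn : IsUpRightPath n α d) (N L : ℕ) :
    (n N).1 ≤ (n (N + L)).1 ∧ (n N).2 ≤ (n (N + L)).2 :=
  chain_le (k := fun i => n (N + i)) (L := L) (fun i _ => hn.step (N + i)) L le_rfl

theorem IsUpRightPath.one_le {n : ℕ → ℕ × ℕ} {α : ℝ} {d : ℕ} (hn : IsUpRightPath n α d) {N : ℕ}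
    (hN : d ≤ N) : 1 ≤ (n N).1 ∧ 1 ≤ (n N).2 := by
  have h1 := hn.fst_advance 0
  have h2 := hn.snd_advance 0
  have h3 := hn.le d (N - d)
  rw [Nat.add_sub_of_le hN] at h3
  rw [zero_add] at h1 h2
  omega

theorem natDegree_avgCharPoly_le (V : ℝ[X]) (a : ℝ) (k : ℕ × ℕ) (t : ℝ) :
    (avgCharPoly V a k t).natDegree ≤ k.1 + k.2 :=
  natDegree_sum_le_of_forall_le _ _ fun _ hi =>
    (natDegree_monomial_le _).trans (Nat.lt_succ_iff.1 (Finset.mem_range.1 hi))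

section

variable {V : ℝ[X]} (hV : IsConfining V) {a : ℝ} (ha : a ≠ 0)

include hV ha in
theorem avgCharPoly_eq_mop {t : ℝ} (ht : 0 < t) (k : ℕ × ℕ) :
    avgCharPoly V a k t = (mop V a t k).map (algebraMap ℝ ℂ) :=
  avgCharPoly_eq hV ht k ha (isMOP_mop hV ha ht k)

include hV ha in
theorem mem_realSegment_of_mem_roots {t : ℝ} (ht : 0 < t) {k : ℕ × ℕ} {r : ℝ}
    (hr : RootsIn r (mop V a t k)) {w : ℂ} (hw : w ∈ (avgCharPoly V a k t).roots) :
    w ∈ realSegment r := by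
  rw [avgCharPoly_eq_mop hV ha ht] at hw
  have h1 := isRoot_of_mem_roots hw
  rw [IsRoot, ← aeval_eq_eval_map] at h1
  obtain ⟨s, -, hs⟩ := (isMOP_mop hV ha ht k).exists_eq_prod hV ht ha
  rw [hs] at hr
  rw [hs, aeval_prod_X_sub_C, Finset.prod_eq_zero_iff] at h1
  obtain ⟨y, hy, h2⟩ := h1
  exact ⟨y, abs_le.1 (rootsIn_prod.1 hr y hy), (sub_eq_zero.1 h2).symm⟩

include hV ha in
theorem rootsIn_of_roots_avgCharPoly {t : ℝ} (ht : 0 < t) {k : ℕ × ℕ} {r : ℝ}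
    (h : ∀ w ∈ (avgCharPoly V a k t).roots, ‖w‖ ≤ r) : RootsIn r (mop V a t k) := by
  intro x hx
  have h1 : (x : ℂ) ∈ (avgCharPoly V a k t).roots := by
    rw [avgCharPoly_eq_mop hV ha ht, mem_roots ((isMOP_mop hV ha ht k).monic.map _).ne_zero, IsRoot,
      ← aeval_eq_eval_map, aeval_ofReal, hx, Complex.ofReal_zero]
  have h2 := h _ h1
  rwa [Complex.norm_real, Real.norm_eq_abs] at h2

variable {n : ℕ → ℕ × ℕ} {α : ℝ} {d : ℕ} (hn : IsUpRightPath n α d) {r : ℝ} (hr : 1 ≤ r)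
  {κ : ℕ} (hκ : V.natDegree - 2 ≤ κ) (hroots : ∀ N, 1 ≤ N →
    RootsIn r (mop V a (((n N).1 + (n N).2 : ℕ) : ℝ) (n (N + κ))))

include hn hV ha hr hκ hroots in
/-- Bounded coefficient matrices along the path: the indices needed above `n_N` precede `n_{N+κ}`,
whose zeros are controlled. -/
theorem exists_bddPoly_matrix_path {ι : Type*} (N : ι → ℕ) (h1 : ∀ i, 1 ≤ (n (N i)).1)
    (h2 : ∀ i, 1 ≤ (n (N i)).2) : ∃ S : ι → Matrix (Fin 3) (Fin 3) ℝ[X],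
    (∀ b j, BddPoly fun i => S i b j) ∧ ∀ i, ∀ z : ℂ, z.im ≠ 0 → ∀ b,
      waveRow V a (((n (N i)).1 + (n (N i)).2 : ℕ) : ℝ)
        (waveDeriv V (((n (N i)).1 + (n (N i)).2 : ℕ) : ℝ)
          (triple V a (((n (N i)).1 + (n (N i)).2 : ℕ) : ℝ) (n (N i)) b)) z =
      ∑ j, aeval z (S i b j) • waveRow V a (((n (N i)).1 + (n (N i)).2 : ℕ) : ℝ)
        (triple V a (((n (N i)).1 + (n (N i)).2 : ℕ) : ℝ) (n (N i)) j) z := by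
  have ht : ∀ i, (0 : ℝ) < (((n (N i)).1 + (n (N i)).2 : ℕ) : ℝ) := fun i => by
    have := h1 i
    exact_mod_cast (by omega)
  refine exists_bddPoly_matrix hV ha hr ht (q := fun i l => n (N i + l))
    (fun i l _ => hn.step (N i + l)) h1 h2 (fun i => le_rfl) fun i => ?_
  have h3 := hn.le (N i + (V.natDegree - 2)) (κ - (V.natDegree - 2))
  rw [add_assoc, Nat.add_sub_of_le hκ] at h3
  refine rootsIn_mop_of_le hV ha (ht i) (hroots (N i) ?_) h3.1 h3.2
  have := hn.size (N i)
  have := h1 i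
  omega

end

end ExternalSource

end

open ExternalSource in
theorem theoremE (V : ℝ[X]) (hm : 2 ≤ V.natDegree) (heven : Even V.natDegree)
    (hlead : 0 < V.leadingCoeff) (a α : ℝ) (ha : 0 < a) (hα₀ : 0 < α) (hα₁ : α < 1)
    (d : ℕ) (n : ℕ → ℕ × ℕ) (hn : IsUpRightPath n α d)
    (hK : ∃ K : Set ℂ, IsCompact K ∧ ∀ N : ℕ, max (V.natDegree - 2) d < N →
      ∀ w ∈ (avgCharPoly V a (n N) ((N : ℝ) - (max (V.natDegree - 2) d : ℕ))).roots, w ∈ K) :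
    (∃ K' : Set ℂ, IsCompact K' ∧ ∀ N : ℕ, ∀ w ∈ (avgCharPoly V a (n N) (N : ℝ)).roots, w ∈ K') ∧
    (∀ N : ℕ, 1 ≤ (n N).1 → 1 ≤ (n N).2 →
      ∃! R : Matrix (Fin 3) (Fin 3) ℂ[X], IsCoeffMatrix V a (n N) R) ∧
    ∀ R : ℕ → Matrix (Fin 3) (Fin 3) ℂ[X],
      (∀ N : ℕ, 1 ≤ (n N).1 → 1 ≤ (n N).2 → IsCoeffMatrix V a (n N) (R N)) →
      ∀ (φ : ℕ → ℕ) (lam : Measure ℂ) [IsFiniteMeasureOnCompacts lam], StrictMono φ →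
        WeakStarTendsto (fun k => zeroMeasure (avgCharPoly V a (n (φ k)) (φ k : ℝ))) lam →
        IsProbabilityMeasure lam ∧ lam {s : ℂ | s.im ≠ 0} = 0 ∧
        ∃ p₂ p₁ p₀ : ℝ[X], IsAdmissibleCurve V a α p₂ p₁ p₀ ∧
          (∀ z : ℂ, z ∉ lam.support → curveEval p₂ p₁ p₀ (xi V lam z) z = 0) ∧
          ∃ ψ : ℕ → ℕ, StrictMono ψ ∧
            TendstoLocallyUniformly
              (fun (k : ℕ) (q : ℂ × ℂ) => finiteCurve (R (φ (ψ k))) q.1 q.2)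
              (fun q => curveEval p₂ p₁ p₀ q.1 q.2) atTop := by
  have hV : IsConfining V := ⟨hm, heven, hlead⟩
  have ha' : a ≠ 0 := ha.ne'
  obtain ⟨K, hKc, hK⟩ := hK
  obtain ⟨r₀, hr₀⟩ := hKc.isBounded.exists_norm_le
  set κ := max (V.natDegree - 2) d with hκ
  set r := max 1 r₀ with hr
  have hr1 : 1 ≤ r := le_max_left _ _
  -- the hypothesis at the index `n_{N+κ}` concerns the parameter `t = N`
  have hroots : ∀ N, 1 ≤ N → RootsIn r (mop V a (((n N).1 + (n N).2 : ℕ) : ℝ) (n (N + κ))) := by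
    intro N hN
    have h := hK (N + κ) (by omega)
    rw [Nat.cast_add, add_sub_cancel_right] at h
    rw [hn.size N]
    exact rootsIn_of_roots_avgCharPoly hV ha' (by exact_mod_cast hN) fun w hw =>
      (hr₀ w (h w hw)).trans (le_max_right _ _)
  have hrootsN : ∀ N, 1 ≤ N → RootsIn r (mop V a (((n N).1 + (n N).2 : ℕ) : ℝ) (n N)) := by
    intro N hN
    refine rootsIn_mop_of_le hV ha' ?_ (hroots N hN) (hn.le N κ).1 (hn.le N κ).2
    rw [hn.size N]
    exact_mod_cast hN
  have hpos : ∀ N, 1 ≤ (n N).1 → 1 ≤ N := fun N h => by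
    have := hn.size N
    omega
  refine ⟨⟨realSegment r, isCompact_realSegment r, fun N w hw => ?_⟩, fun N h1 h2 => ?_,
    fun R hR φ lam _ hφ hlam => ?_⟩
  · -- at `N = 0` the polynomial is constant
    rcases Nat.eq_zero_or_pos N with rfl | hN
    · have h1 := natDegree_avgCharPoly_le V a (n 0) ((0 : ℕ) : ℝ)
      rw [hn.size 0] at h1
      have h2 := (card_roots' _).trans h1
      rw [Nat.le_zero, Multiset.card_eq_zero] at h2
      rw [h2] at hw
      exact absurd hw (Multiset.notMem_zero w)
    · have h1 := hrootsN N hN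
      rw [hn.size N] at h1
      exact mem_realSegment_of_mem_roots hV ha' (by exact_mod_cast hN) h1 hw
  · obtain ⟨S, -, hS⟩ := exists_bddPoly_matrix_path hV ha' hn hr1 (le_max_left _ _) hroots
      (fun _ : Unit => N) (fun _ => h1) fun _ => h2
    obtain ⟨R, hR, -⟩ := exists_isCoeffMatrix hV ha' h1 h2 hr1 (hrootsN N (hpos N h1)) (hS ())
    exact ⟨R, hR, fun R' hR' => coeffMatrix_unique hV ha' h1 h2 hR' hR⟩
  · -- from the index `d` on, both components of the multi-index are positive
    have hd : ∀ k, d ≤ φ (k + d) := fun k => by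
      have := hφ.le_apply (x := k + d)
      omega
    have h1 := fun k => (hn.one_le (hd k)).1
    have h2 := fun k => (hn.one_le (hd k)).2
    have hφd : Tendsto (fun k => φ (k + d)) atTop atTop :=
      hφ.tendsto_atTop.comp (tendsto_add_atTop_nat d)
    obtain ⟨S, hSb, hS⟩ := exists_bddPoly_matrix_path hV ha' hn hr1 (le_max_left _ _) hroots
      (fun k => φ (k + d)) h1 h2
    have hlam' : WeakStarTendsto (fun k => zeroMeasure ((mop V a
        (((n (φ (k + d))).1 + (n (φ (k + d))).2 : ℕ) : ℝ) (n (φ (k + d)))).map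
          (algebraMap ℝ ℂ))) lam := by
      intro f hf hfs
      refine ((hlam f hf hfs).comp (tendsto_add_atTop_nat d)).congr fun k => ?_
      have hp : (0 : ℝ) < (φ (k + d) : ℝ) := by exact_mod_cast hpos _ (h1 k)
      simp only [Function.comp, hn.size]
      rw [avgCharPoly_eq_mop hV ha' hp]
    obtain ⟨hprob, him, p₂, p₁, p₀, hadm, hsupp, ψ, hψ, hlim⟩ := exists_limit_curve hV ha hα₀ hα₁
      h1 h2
      (by simp only [hn.size]; exact tendsto_natCast_atTop_atTop.comp hφd)
      (by simp only [hn.size]; exact hn.slope.comp hφd) hr1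
      (fun k => hrootsN _ (hpos _ (h1 k))) hSb hS (fun k => hR (φ (k + d)) (h1 k) (h2 k)) hlam'
    exact ⟨hprob, him, p₂, p₁, p₀, hadm, hsupp, fun k => ψ k + d, hψ.add_const d, hlim⟩
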